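/- **Notation.** For $w\in\mathbb C$ and $k\in\mathbb Z$ let $(w)_k=\Gamma(w+k)/\Gamma(w)$ be the Pochhammer symbol (for $k>0$, $(w)_{-k}=1/\big((w-k)\cdots(w-1)\big)$). Horn's function is $$H_5(a,b,c,x,y)=\sum_{m,n\ge0}\frac{(a)_{2m+n}(b)_{n-m}}{(c)_n}\frac{x^my^n}{m!\,n!}.$$ The region of convergence of a double series is the interior of the set of points $(x,y)\in\mathbb C^2$ at which it converges absolutely. Powers are principal powers unless stated otherwise. Let $a,b,c\in\mathbb C$ be generic: $a,c,c-b\notin\{0,-1,-2,\dots\}$ and $b,\ c-a,\ a+b-c,\ a+2b-c,\ a+2b-2c\notin\mathbb Z$. Put $$S_1=\frac{\Gamma(c)\Gamma(c-a-b)}{\Gamma(c-a)\Gamma(c-b)}\sum_{m,n\ge0}\frac{(a-c+1)_{2m}(a)_{2m+n}(b)_{n-m}}{(c-b)_m(a+b-c+1)_{m+n}}\frac{(-x)^m(1-y)^n}{m!\,n!},$$ $$S_2=(1-y)^{c-a-b}\frac{\Gamma(c)\Gamma(a+b-c)}{\Gamma(a)\Gamma(b)}\sum_{m,n\ge0}\frac{(a-c+1)_{2m}(c-a)_{n-2m}(c-b)_{m+n}}{m!\,n!\,(c-b)_m(c-a-b+1)_{n-m}}\Big(-\frac{x}{1-y}\Big)^m(1-y)^n,$$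 $$S_2'=(1-y)^{c-a-b}\Big(\frac{x}{y-1}\Big)^{c-a-b}\frac{\Gamma(c)\Gamma(a+b-c)}{\Gamma(a)\Gamma(b)}\sum_{m,n\ge0}\frac{(a+2b-2c+1)_{m-n}(a+b-c)_{m-n}(a+2b-c)_{2m-n}}{m!\,n!\,(a+2b-2c+1)_{m-2n}(a+2b-c)_{2(m-n)}}\Big(\frac{1-y}{x}\Big)^m(-x)^n .$$ Let $D_2$ be the part of the region of convergence of the double series in $S_2$ where $1-y\notin(-\infty,0]$, and $D_1$ the intersection of $D_2$ with the region of convergence of the double series in $S_1$. With $r=\frac{1-y}{x}$ and $s=-x$, let $\Omega$ be the set of $(x,y)\in\mathbb C^2$ with $x\ne0$, $y\ne1$ and $$|r|<1,\qquad |s|<\tfrac1{16},\qquad \sqrt{|s|}<\min(z_1,z_2,z_3),$$ where $z_1,z_2,z_3$ are the second real roots (real roots listed in increasing order) of, respectively, $$27z^4|r|^2-2z^2(9|r|+8)-|r|-1,\quad 27z^4|r|^2+2z^2(9|r|-8)+|r|-1,\quad 27z^4|r|^2+2z^2(9|r|+8)-|r|-1 .$$ Let $\Omega^*$ be the set of points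 of $\Omega$ with $1-y\notin(-\infty,0]$ and $\frac{x}{y-1}\notin(-\infty,0]$. Say that $U\subseteq\mathbb C^2$ *contains tubes* if for every compact $K\subset\mathbb C\setminus[1,\infty)$ there is $\varepsilon>0$ such that $U$ contains all $(x,y)$ with $\frac{x}{1-y}\in K$, $|1-y|<\varepsilon$, $1-y\notin(-\infty,0]$. **Theorem.** 1. On $D_2$, $$S_2=(1-y)^{c-a-b}\frac{\Gamma(c)\Gamma(a+b-c)}{\Gamma(a)\Gamma(b)}\sum_{n\ge0}\frac{(1-y)^n(c-a)_n(c-b)_n}{n!\,(c-a-b+1)_n}\,\Phi_n\Big(\frac{x}{1-y}\Big),$$ $$\Phi_n(z)={}_4F_3\Big(\tfrac{a-c+1}2,\tfrac{a-c}2+1,a+b-c-n,c-b+n;\;c-b,\tfrac{a-c-n+1}2,\tfrac{a-c-n}2+1;\;z\Big).$$ 2. For each $n\ge 0$, $\Phi_n$ continues analytically from $|z|<1$ to $\mathbb C\setminus[1,\infty)$, and for $|z|>1$ only one term of the connection formula at infinity is present: writing $\Phi_n={}_4F_3(a_1,\dots,a_4;b_1,b_2,b_3;z)$ with the parameters in the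 above order, so that $a_3=a+b-c-n$, the continuation equals $$\prod_{j=1}^3\frac{\Gamma(b_j)}{\Gamma(b_j-a_3)}\prod_{i\in\{1,2,4\}}\frac{\Gamma(a_i-a_3)}{\Gamma(a_i)}\;(-z)^{-a_3}\;{}_4F_3\Big(a_3,1+a_3-b_1,1+a_3-b_2,1+a_3-b_3;\;1+a_3-a_1,1+a_3-a_2,1+a_3-a_4;\;\tfrac1z\Big).$$ 3. There are a connected open $W\subseteq\mathbb C^2$ that contains $D_2$, $\Omega^*$ and tubes, and a holomorphic function on $W$ that equals $S_2$ on $D_2$ and $S_2'$ on $\Omega^*$. 4. For $x\neq0$, $y\neq1$, the region of convergence of the double series in $S_2'$ is exactly $\Omega$, and $\Omega$ is contained in the region of convergence of the double series in $S_1$; so $\Omega$ is the region of convergence of $S_1+S_2'$. 5. The function $H_5$ has the analytic continuation $S_1+S_2'$: the region of convergence $D_0$ of $H_5$ contains $(0,0)$, and there are a connected open $U\subseteq\mathbb C^2$ that contains $D_0$, $D_1$, $\Omega^*$ and tubes, and a holomorphic function on $U$ that equals $H_5$ on $D_0$, $S_1+S_2$ on $D_1$ and $$S_1+S_2'\quad\text{on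 }\Omega^* .$$ 6. The representation holds on all of $\Omega$ for every determination of the powers: for $p\in\Omega$ and any logarithms $\ell_1$ of $1-y$ and $\ell_2$ of $\frac{x}{y-1}$ that are holomorphic near $p$, the germ of $H_5$ at $(0,0)$ continues analytically along some path to the germ at $p$ of $S_1+S_2'$, where in $S_2'$ the two powers are $e^{(c-a-b)\ell_1}$ and $e^{(c-a-b)\ell_2}$. 7. The point $(0,1)$ lies in the closure of $\Omega^*$, and $\Omega$ is disjoint from $D_1$; so the new representation covers points arbitrarily close to $(0,1)$ that $S_1+S_2$ does not cover. -/

import Mathlib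

open Set Filter Topology

noncomputable section

/-- The Pochhammer symbol `(w)_k = Γ(w + k) / Γ(w)` for an integer index `k`:
`(w)_k = w (w + 1) ⋯ (w + k - 1)` for `k ≥ 0`, and
`(w)_{-k} = 1 / ((w - k) (w - k + 1) ⋯ (w - 1))` for `k > 0`. -/
def poch (w : ℂ) : ℤ → ℂ
  | Int.ofNat k => (ascPochhammer ℂ k).eval w
  | Int.negSucc k => ((ascPochhammer ℂ (k + 1)).eval (w - ((k + 1 : ℕ) : ℂ)))⁻¹

/-- The generalized hypergeometric function `₄F₃(a₁, a₂, a₃, a₄; b₁, b₂, b₃; z)` (sum of the series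
on the unit disc). Mathlib's function is regularized, that is, divided by `Γ(b₁) Γ(b₂) Γ(b₃)`. -/
def hyp4F3 (a₁ a₂ a₃ a₄ b₁ b₂ b₃ z : ℂ) : ℂ :=
  Complex.Gamma b₁ * Complex.Gamma b₂ * Complex.Gamma b₃ *
    Complex.regularizedHGFun {a₁, a₂, a₃, a₄} {b₁, b₂, b₃} z

/-- The region of convergence of a double series of functions of two complex variables: the
interior of the set of points at which it converges absolutely. -/
def regionOfConvergence (t : ℂ × ℂ → ℕ × ℕ → ℂ) : Set (ℂ × ℂ) :=
  interior {p | Summable (t p)}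

/-- The terms of the double series that defines `H₅(a, b, c, x, y)`; here `p = (x, y)` and
`k = (m, n)`, as in all the series below. -/
def hornH5Term (a b c : ℂ) (p : ℂ × ℂ) (k : ℕ × ℕ) : ℂ :=
  poch a (2 * k.1 + k.2) * poch b (k.2 - k.1) / poch c k.2 *
    (p.1 ^ k.1 * p.2 ^ k.2 / (k.1.factorial * k.2.factorial))

/-- Horn's function `H₅(a, b, c, x, y)`, `p = (x, y)`. -/
def hornH5 (a b c : ℂ) (p : ℂ × ℂ) : ℂ :=
  ∑' k : ℕ × ℕ, hornH5Term a b c p k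

/-- The terms of the first double series, in `-x` and `1 - y`. -/
def firstTerm (a b c : ℂ) (p : ℂ × ℂ) (k : ℕ × ℕ) : ℂ :=
  poch (a - c + 1) (2 * k.1) * poch a (2 * k.1 + k.2) * poch b (k.2 - k.1) /
      (poch (c - b) k.1 * poch (a + b - c + 1) (k.1 + k.2)) *
    ((-p.1) ^ k.1 * (1 - p.2) ^ k.2 / (k.1.factorial * k.2.factorial))

/-- The first series, with its factor. -/
def firstSeries (a b c : ℂ) (p : ℂ × ℂ) : ℂ :=
  Complex.Gamma c * Complex.Gamma (c - a - b) / (Complex.Gamma (c - a) * Complex.Gamma (c - b)) *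
    ∑' k : ℕ × ℕ, firstTerm a b c p k

/-- The constant in front of the second series and of its continuation. -/
def secondConst (a b c : ℂ) : ℂ :=
  Complex.Gamma c * Complex.Gamma (a + b - c) / (Complex.Gamma a * Complex.Gamma b)

/-- The terms of the second double series of the first continuation around `(0, 1)`, in
`-x / (1 - y)` and `1 - y`. -/
def secondTerm (a b c : ℂ) (p : ℂ × ℂ) (k : ℕ × ℕ) : ℂ :=
  poch (a - c + 1) (2 * k.1) * poch (c - a) (k.2 - 2 * k.1) * poch (c - b) (k.1 + k.2) /
      (poch (c - b) k.1 * poch (c - a - b + 1) (k.2 - k.1)) *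
    ((-(p.1 / (1 - p.2))) ^ k.1 * (1 - p.2) ^ k.2 / (k.1.factorial * k.2.factorial))

/-- The second series `S₂` of the first continuation around `(0, 1)`, with its factors; the power
is the principal one. -/
def secondSeries (a b c : ℂ) (p : ℂ × ℂ) : ℂ :=
  (1 - p.2) ^ (c - a - b) * secondConst a b c * ∑' k : ℕ × ℕ, secondTerm a b c p k

/-- The `₄F₃` that is the coefficient of `(1 - y) ^ n` when `S₂` is summed over `m`, as a function
of `z = x / (1 - y)`. -/
def inner4F3 (a b c : ℂ) (n : ℕ) (z : ℂ) : ℂ :=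
  hyp4F3 ((a - c + 1) / 2) ((a - c) / 2 + 1) (a + b - c - n) (c - b + n)
    (c - b) ((a - c - n + 1) / 2) ((a - c - n) / 2 + 1) z

/-- The one term that remains in the connection formula of `inner4F3` at infinity: for
`₄F₃(a₁, a₂, a₃, a₄; b₁, b₂, b₃; z)` it is the term with the power `(-z) ^ (-a₃)`,
where `a₃ = a + b - c - n`. -/
def inner4F3AtInfinity (a b c : ℂ) (n : ℕ) (z : ℂ) : ℂ :=
  let a₁ := (a - c + 1) / 2
  let a₂ := (a - c) / 2 + 1
  let a₃ := a + b - c - n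
  let a₄ := c - b + n
  let b₁ := c - b
  let b₂ := (a - c - n + 1) / 2
  let b₃ := (a - c - n) / 2 + 1
  Complex.Gamma b₁ * Complex.Gamma b₂ * Complex.Gamma b₃ *
      Complex.Gamma (a₁ - a₃) * Complex.Gamma (a₂ - a₃) * Complex.Gamma (a₄ - a₃) /
      (Complex.Gamma a₁ * Complex.Gamma a₂ * Complex.Gamma a₄ *
        Complex.Gamma (b₁ - a₃) * Complex.Gamma (b₂ - a₃) * Complex.Gamma (b₃ - a₃)) *
    (-z) ^ (-a₃) *
    hyp4F3 a₃ (1 + a₃ - b₁) (1 + a₃ - b₂) (1 + a₃ - b₃)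
      (1 + a₃ - a₁) (1 + a₃ - a₂) (1 + a₃ - a₄) z⁻¹

/-- The terms of the new double series, in `(1 - y) / x` and `-x`. -/
def newTerm (a b c : ℂ) (p : ℂ × ℂ) (k : ℕ × ℕ) : ℂ :=
  poch (a + 2 * b - 2 * c + 1) (k.1 - k.2) * poch (a + b - c) (k.1 - k.2) *
      poch (a + 2 * b - c) (2 * k.1 - k.2) /
      (poch (a + 2 * b - 2 * c + 1) (k.1 - 2 * k.2) * poch (a + 2 * b - c) (2 * (k.1 - k.2))) *
    (((1 - p.2) / p.1) ^ k.1 * (-p.1) ^ k.2 / (k.1.factorial * k.2.factorial))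

/-- The new series `S₂'`, with its factors; the powers are the principal ones. -/
def newSeries (a b c : ℂ) (p : ℂ × ℂ) : ℂ :=
  (1 - p.2) ^ (c - a - b) * (p.1 / (p.2 - 1)) ^ (c - a - b) * secondConst a b c *
    ∑' k : ℕ × ℕ, newTerm a b c p k

/-- `S₂'` with the powers taken by means of `l₁` and `l₂`, a logarithm of `1 - y` and a logarithm
of `x / (y - 1)`. -/
def newSeriesBranch (a b c : ℂ) (l₁ l₂ : ℂ × ℂ → ℂ) (p : ℂ × ℂ) : ℂ :=
  Complex.exp ((c - a - b) * l₁ p) * Complex.exp ((c - a - b) * l₂ p) * secondConst a b c *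
    ∑' k : ℕ × ℕ, newTerm a b c p k

/-- `w` is the second real root of `P`, the real roots being listed in increasing order: `P w = 0`
and exactly one real root of `P` is smaller than `w`. -/
def IsSecondRoot (P : ℝ → ℝ) (w : ℝ) : Prop :=
  P w = 0 ∧ ∃! v : ℝ, v < w ∧ P v = 0

/-- The region `|r| < 1`, `√|s| < min (z₁, z₂, z₃)`, `|s| < 1 / 16`, where `r = (1 - y) / x` and
`s = -x`. -/
def newRegion : Set (ℂ × ℂ) :=
  {p | p.1 ≠ 0 ∧ p.2 ≠ 1 ∧
    let R : ℝ := ‖(1 - p.2) / p.1‖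
    let S : ℝ := ‖-p.1‖
    R < 1 ∧ S < 1 / 16 ∧
    ∃ z₁ z₂ z₃ : ℝ,
      IsSecondRoot (fun z => 27 * z ^ 4 * R ^ 2 - 2 * z ^ 2 * (9 * R + 8) - R - 1) z₁ ∧
      IsSecondRoot (fun z => 27 * z ^ 4 * R ^ 2 + 2 * z ^ 2 * (9 * R - 8) + R - 1) z₂ ∧
      IsSecondRoot (fun z => 27 * z ^ 4 * R ^ 2 + 2 * z ^ 2 * (9 * R + 8) - R - 1) z₃ ∧
      √S < min z₁ (min z₂ z₃)}

/-- The part of `newRegion` on which both principal powers in `newSeries` are holomorphic. -/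
def newRegionCut : Set (ℂ × ℂ) :=
  {p ∈ newRegion | 1 - p.2 ∈ Complex.slitPlane ∧ p.1 / (p.2 - 1) ∈ Complex.slitPlane}

/-- The region of convergence of the second series, cut along `1 - y ≤ 0`. -/
def secondRegion (a b c : ℂ) : Set (ℂ × ℂ) :=
  {p ∈ regionOfConvergence (secondTerm a b c) | 1 - p.2 ∈ Complex.slitPlane}

/-- The common region of convergence of the two series of the first continuation around `(0, 1)`,
cut along `1 - y ≤ 0`. -/
def firstContinuationRegion (a b c : ℂ) : Set (ℂ × ℂ) :=
  regionOfConvergence (firstTerm a b c) ∩ secondRegion a b c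

/-- The complex plane cut along the real half-line `[1, ∞)`. -/
def cutPlane : Set ℂ := {z | 1 - z ∈ Complex.slitPlane}

/-- `U` contains, for every compact set `K` in the plane cut along `[1, ∞)`, all points with
`x / (1 - y) ∈ K` and with `1 - y` small and off the half-line `(-∞, 0]`. -/
def ContainsTubes (U : Set (ℂ × ℂ)) : Prop :=
  ∀ K ⊆ cutPlane, IsCompact K → ∃ ε > 0, ∀ p : ℂ × ℂ,
    1 - p.2 ∈ Complex.slitPlane → ‖1 - p.2‖ < ε → p.1 / (1 - p.2) ∈ K → p ∈ U

/-- The germ of `g` at `p` can be continued analytically, along some path from `p` to `q`, to the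
germ of `h` at `q`. -/
def ContinuesTo (p q : ℂ × ℂ) (g h : ℂ × ℂ → ℂ) : Prop :=
  ∃ (γ : Path p q) (f : unitInterval → ℂ × ℂ → ℂ),
    f 0 =ᶠ[𝓝 p] g ∧ f 1 =ᶠ[𝓝 q] h ∧ (∀ t, AnalyticAt ℂ (f t) (γ t)) ∧
    ∀ t, ∀ᶠ s in 𝓝 t, f s =ᶠ[𝓝 (γ s)] f t

end

/-! Put u = 1 - y and z = x/(1 - y). The key fact concerns the functions Φ_n. Their upper and lower
parameters differ by integers in such a way that, apart from (β)_m/m! with β = a+b-c-n, the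
coefficient of z^m is a polynomial in m of degree 2n. Hence Φ_n is, up to a constant, a product ∏(θ
+ κ_i) of 2n factors, θ = z d/dz, applied to (1-z)^(-β), that is, a finite combination of the powers
(1-z)^(-(β+j)), 0 ≤ j ≤ 2n (`expFun`, `psi`). Such a function is holomorphic on the plane cut along
[1,∞). At infinity it involves only the exponents -β-K, K a natural number, and θ multiplies
(-z)^(-β) z^(-K) by -β-K. So a single term of the connection formula survives, and its coefficients
are the same polynomial evaluated at -β-K: these are the coefficients of S₂' (`secondCoef_eq`,
`newCoef_eq`, `hasSum_expFun_at_infinity`).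

The coefficients of the finite combination have sum of moduli at most (C(n+1))^(2n), while the
factor in front is of size (n!)^(-2) up to geometric and polynomial factors. So the n-th function
grows at most geometrically in n, locally uniformly on the cut plane (`psi_bound`), and ∑ u^n ψ_n(z)
converges for small u over every compact part of the cut plane. This is the bridge from |z| < 1,
where S₂ converges, to |z| > 1, where S₂' converges. On the two regions the sum is identified with
S₂ and S₂' by reordering an absolutely convergent double series. The sets glued to the tubes are
stable under (x, 1-y) ↦ τ(x, 1-y), 0 < τ ≤ 1, which fixes z; this makes the unions connected
(`isConnected_union_tubes`).

For H₅ itself, the sum over n at fixed m is a Gauss function of y, and Gauss's connection formula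
from 0 to 1 splits it into the corresponding rows of S₁ and S₂ (`row_connection`). That formula is
derived from the differential equation. A weighted Wronskian is constant, so connection coefficients
exist and are unique; the operator C + y d/dy carries the relation for C+1 to the one for C; the
regular coefficient tends to 1 as C is shifted to infinity, so it is a limit of Pochhammer
quotients, hence a quotient of Gamma values; Euler's transformation then exchanges the two
coefficients (`gauss_connection`). The identity theorem extends the equality from a neighbourhood of
a point of the axis x = 0.

For the region of convergence, the coefficients of S₂' are compared, up to polynomial factors, with
quotients of factorials, whose shape depends on which of four cones contains (m, n). In the two
middle cones |r| ≤ 1 and |s| ≤ 1/16 suffice. In the outer cones m ≥ 2n and n ≥ 2m the trinomial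
theorem with well chosen weights gives convergence (`newMaj_mul_le`), and Stirling's estimate along
rays of lattice points shows that the condition is necessary (`line_bound`). The weight p solves
12σp² + 2p = 1, and eliminating it yields the second and third biquadratic polynomials; the first
one imposes nothing new. The other series need rough estimates only.

For arbitrary determinations of the powers, Ω depends only on the moduli of its variables. So the
imaginary parts of both logarithms may be shrunk to 0 inside Ω, ending at a point where the powers
are principal (`continuesTo_of_logs`). -/

noncomputable section

/-! ### Pochhammer symbols and their size up to polynomial factors -/

/-- The rising factorial `(w)_n` for a natural index. -/
abbrev asc (w : ℂ) (n : ℕ) : ℂ := (ascPochhammer ℂ n).eval w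

lemma asc_zero (w : ℂ) : asc w 0 = 1 := by simp [asc]

lemma asc_succ (w : ℂ) (n : ℕ) : asc w (n + 1) = asc w n * (w + n) :=
  ascPochhammer_succ_eval n w

lemma asc_succ_left (w : ℂ) (n : ℕ) : asc w (n + 1) = w * asc (w + 1) n := by
  simp [asc, ascPochhammer_succ_left, Polynomial.eval_comp]

lemma asc_add (w : ℂ) (m n : ℕ) : asc w (m + n) = asc w m * asc (w + m) n := by
  induction n with
  | zero => simp [asc_zero]
  | succ n ih => rw [← add_assoc, asc_succ, ih, asc_succ]; push_cast; ring

lemma asc_ne_zero {w : ℂ} (hw : ∀ k : ℕ, w ≠ -(k : ℂ)) (n : ℕ) : asc w n ≠ 0 := by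
  induction n with
  | zero => simp [asc_zero]
  | succ n ih =>
    rw [asc_succ]
    refine mul_ne_zero ih fun h => hw n ?_
    linear_combination h

lemma asc_reflect (w : ℂ) (n : ℕ) : asc w n = (-1) ^ n * asc (1 - w - n) n := by
  induction n generalizing w with
  | zero => simp [asc_zero]
  | succ n ih =>
    rw [asc_succ_left, asc_succ, ih]
    push_cast
    rw [show (1 - (w + 1) - n : ℂ) = 1 - w - (n + 1) by ring]
    ring

lemma asc_mul_Gamma {w : ℂ} (hw : ∀ k : ℕ, w ≠ -(k : ℂ)) (n : ℕ) :
    asc w n * Complex.Gamma w = Complex.Gamma (w + n) := by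
  rw [asc, ← Complex.Gamma_add_nat_div_Gamma_eq w hw,
    div_mul_cancel₀ _ (Complex.Gamma_ne_zero hw)]

lemma poch_natCast (w : ℂ) (n : ℕ) : poch w (n : ℤ) = asc w n := rfl

lemma poch_neg_natCast (w : ℂ) (n : ℕ) : poch w (-(n : ℤ)) = (asc (w - n) n)⁻¹ := by
  cases n with
  | zero => simp [poch, asc]
  | succ n => rfl

lemma poch_neg_natCast' (w : ℂ) (n : ℕ) : poch w (-(n : ℤ)) = (-1) ^ n * (asc (1 - w) n)⁻¹ := by
  rw [poch_neg_natCast, asc_reflect, show (1 - (w - n) - n : ℂ) = 1 - w by ring, mul_inv]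
  congr 1
  rw [← inv_pow]; norm_num

/-- `w` is not an integer. -/
def NotInt (w : ℂ) : Prop := ∀ k : ℤ, w ≠ (k : ℂ)

lemma NotInt.ne_neg {w : ℂ} (hw : NotInt w) (k : ℕ) : w ≠ -(k : ℂ) := by
  simpa using hw (-(k : ℤ))

lemma NotInt.add_int {w : ℂ} (hw : NotInt w) (k : ℤ) : NotInt (w + k) := by
  intro j h
  apply hw (j - k)
  push_cast
  linear_combination h

lemma NotInt.neg {w : ℂ} (hw : NotInt w) : NotInt (-w) := by
  intro j h
  apply hw (-j)
  push_cast
  linear_combination -h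

lemma NotInt.of_eq_add {w v : ℂ} (hw : NotInt w) (k : ℤ) (h : v = w + k) : NotInt v :=
  h ▸ hw.add_int k

lemma NotInt.of_eq_sub {w v : ℂ} (hw : NotInt w) (k : ℤ) (h : v = k - w) : NotInt v :=
  hw.neg.of_eq_add k (by rw [h]; ring)

lemma poch_mul_Gamma {w : ℂ} (hw : NotInt w) (k : ℤ) :
    poch w k * Complex.Gamma w = Complex.Gamma (w + k) := by
  obtain ⟨n, rfl | rfl⟩ := Int.eq_nat_or_neg k
  · rw [poch_natCast, asc_mul_Gamma hw.ne_neg]; simp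
  · have h : NotInt (w - n) := hw.of_eq_add (-n) (by push_cast; ring)
    have := asc_mul_Gamma h.ne_neg n
    rw [sub_add_cancel] at this
    rw [poch_neg_natCast, ← this, inv_mul_cancel_left₀ (asc_ne_zero h.ne_neg n)]
    push_cast
    rw [sub_eq_add_neg]

lemma poch_eq_Gamma_div {w : ℂ} (hw : NotInt w) (k : ℤ) :
    poch w k = Complex.Gamma (w + k) / Complex.Gamma w := by
  rw [eq_div_iff (Complex.Gamma_ne_zero hw.ne_neg), poch_mul_Gamma hw]

lemma poch_add {w : ℂ} (hw : NotInt w) (k l : ℤ) :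
    poch w (k + l) = poch w k * poch (w + k) l := by
  rw [poch_eq_Gamma_div hw, poch_eq_Gamma_div hw, poch_eq_Gamma_div (hw.add_int k)]
  have := Complex.Gamma_ne_zero (hw.add_int k).ne_neg
  push_cast
  rw [← add_assoc]
  field_simp

lemma poch_ne_zero {w : ℂ} (hw : NotInt w) (k : ℤ) : poch w k ≠ 0 := by
  rw [poch_eq_Gamma_div hw]
  exact div_ne_zero (Complex.Gamma_ne_zero (hw.add_int k).ne_neg)
    (Complex.Gamma_ne_zero hw.ne_neg)

/-- Each new factor w + k is at most M + k in modulus, and by Bernoulli's inequality M + k ≤ (1 +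
1/(1+k))^M (k+1); the product of the M-th powers telescopes to (1+k)^M. -/
lemma asc_norm_le (w : ℂ) : ∃ C > 0, ∃ M : ℕ, ∀ k : ℕ,
    ‖asc w k‖ ≤ C * (1 + k : ℝ) ^ M * k.factorial := by
  obtain ⟨M, hM⟩ := exists_nat_ge ‖w‖
  refine ⟨1, one_pos, M, fun k => ?_⟩
  rw [one_mul]
  induction k with
  | zero => simp [asc_zero]
  | succ k ih =>
    have h1 : ‖w + k‖ ≤ M + k := (norm_add_le _ _).trans (by simpa using hM)
    have hb : 1 + (M : ℝ) * (1 / (1 + k)) ≤ (1 + 1 / (1 + k)) ^ M :=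
      one_add_mul_le_pow (by have : (0 : ℝ) ≤ 1 / (1 + k) := by positivity
                             linarith) M
    have h2 : (M + k : ℝ) ≤ (1 + 1 / (1 + k)) ^ M * (k + 1) := by
      calc (M + k : ℝ) ≤ (1 + (M : ℝ) * (1 / (1 + k))) * (k + 1) := by field_simp; linarith
        _ ≤ _ := by gcongr
    rw [asc_succ, norm_mul, Nat.factorial_succ]
    calc ‖asc w k‖ * ‖w + k‖ ≤ ((1 + k : ℝ) ^ M * k.factorial) *
          ((1 + 1 / (1 + k)) ^ M * (k + 1)) := by gcongr; exact h1.trans h2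
      _ = ((1 + k : ℝ) * (1 + 1 / (1 + k))) ^ M * ((k + 1) * k.factorial) := by rw [mul_pow]; ring
      _ = _ := by
        rw [show ((1 + k : ℝ) * (1 + 1 / (1 + k))) = 1 + ((k + 1 : ℕ) : ℝ) by
          push_cast; field_simp; ring]
        push_cast; ring

/-- From the index M + 1 > ‖w‖ on, the factors of (w)_k are at least 1, 2, 3, … in modulus, so (w)_k
falls short of k! by a polynomial factor only. The constant takes care of the finitely many smaller
k. -/
lemma factorial_le_asc_norm {w : ℂ} (hw : ∀ k : ℕ, w ≠ -(k : ℂ)) : ∃ C > 0, ∃ M : ℕ, ∀ k : ℕ,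
    (k.factorial : ℝ) ≤ C * (1 + k : ℝ) ^ M * ‖asc w k‖ := by
  obtain ⟨M, hM⟩ := exists_nat_ge (‖w‖ + 1)
  have hM' : ‖w‖ ≤ M := by linarith
  have key : ∀ k : ℕ, ‖asc w (M + 1)‖ * k.factorial ≤ ‖asc w (M + 1 + k)‖ := by
    intro k
    induction k with
    | zero => simp
    | succ k ih =>
      rw [← add_assoc, asc_succ w (M + 1 + k), norm_mul, Nat.factorial_succ]
      have h1 : ((k + 1 : ℕ) : ℝ) ≤ ‖w + ((M + 1 + k : ℕ) : ℂ)‖ := by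
        have := norm_sub_le (w + ((M + 1 + k : ℕ) : ℂ)) w
        rw [add_sub_cancel_left, Complex.norm_natCast] at this
        push_cast at this ⊢
        linarith
      calc _ = (‖asc w (M + 1)‖ * k.factorial) * ((k + 1 : ℕ) : ℝ) := by push_cast; ring
        _ ≤ _ := mul_le_mul ih h1 (by positivity) (norm_nonneg _)
  have h0 : ∀ k, 0 < ‖asc w k‖ := fun k => norm_pos_iff.2 (asc_ne_zero hw k)
  let C : ℝ := ∑ k ∈ Finset.range (M + 1), k.factorial / ‖asc w k‖ + 1 / ‖asc w (M + 1)‖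
  have hs : 0 ≤ ∑ k ∈ Finset.range (M + 1), (k.factorial : ℝ) / ‖asc w k‖ :=
    Finset.sum_nonneg fun k _ => by positivity
  refine ⟨C, by have := h0 (M + 1); positivity, M + 1, fun k => ?_⟩
  have hk1 : (1 : ℝ) ≤ (1 + k : ℝ) ^ (M + 1) := one_le_pow₀ (by simp)
  rcases lt_or_ge k (M + 1) with hk | hk
  · have h1 : (k.factorial : ℝ) / ‖asc w k‖ ≤ C := by
      have := Finset.single_le_sum (f := fun k : ℕ => (k.factorial : ℝ) / ‖asc w k‖)
        (fun i _ => by positivity) (Finset.mem_range.2 hk)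
      have h2 : 0 ≤ 1 / ‖asc w (M + 1)‖ := by positivity
      simp only [C]; linarith
    rw [div_le_iff₀ (h0 k)] at h1
    calc (k.factorial : ℝ) ≤ C * ‖asc w k‖ := h1
      _ ≤ (C * (1 + k : ℝ) ^ (M + 1)) * ‖asc w k‖ := by
        gcongr
        exact le_mul_of_one_le_right (by positivity) hk1
  · obtain ⟨j, rfl⟩ := Nat.exists_eq_add_of_le hk
    have h1 : ((M + 1 + j).factorial : ℝ) ≤ (1 + (M + 1 + j : ℕ) : ℝ) ^ (M + 1) * j.factorial := by
      have h3 : (M + 1 + j).factorial ≤ j.factorial * (j + (M + 1)) ^ (M + 1) := by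
        rw [add_comm (M + 1) j,
          ← Nat.factorial_mul_descFactorial (show M + 1 ≤ j + (M + 1) by omega)]
        simpa using Nat.mul_le_mul_left _ (Nat.descFactorial_le_pow (j + (M + 1)) (M + 1))
      have h4 : ((M + 1 + j).factorial : ℝ) ≤ j.factorial * (j + (M + 1) : ℝ) ^ (M + 1) := by
        exact_mod_cast h3
      refine h4.trans ?_
      rw [mul_comm]
      push_cast
      refine mul_le_mul_of_nonneg_right (pow_le_pow_left₀ (by positivity) (by linarith) _)
        (by positivity)
    have h2 : (1 / ‖asc w (M + 1)‖) ≤ C := by simp only [C]; linarith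
    calc ((M + 1 + j).factorial : ℝ) ≤ (1 + (M + 1 + j : ℕ) : ℝ) ^ (M + 1) * j.factorial := h1
      _ = 1 / ‖asc w (M + 1)‖ * (1 + (M + 1 + j : ℕ) : ℝ) ^ (M + 1) *
          (‖asc w (M + 1)‖ * j.factorial) := by field_simp [(h0 (M + 1)).ne']
      _ ≤ _ := by gcongr; exact key j

/-- The size of `(w)_k` for non-integral `w`, up to polynomial factors. -/
def zfact : ℤ → ℝ
  | Int.ofNat k => k.factorial
  | Int.negSucc k => ((k + 1).factorial : ℝ)⁻¹

lemma zfact_natCast (n : ℕ) : zfact (n : ℤ) = n.factorial := rfl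

lemma zfact_neg_natCast (n : ℕ) : zfact (-(n : ℤ)) = (n.factorial : ℝ)⁻¹ := by
  cases n with
  | zero => simp [zfact]
  | succ n => rfl

lemma zfact_pos (k : ℤ) : 0 < zfact k := by
  obtain ⟨n, rfl | rfl⟩ := Int.eq_nat_or_neg k
  · rw [zfact_natCast]; positivity
  · rw [zfact_neg_natCast]; positivity

lemma max_poly_bound {C D : ℝ} {M N : ℕ} (hC : 0 < C) (hD : 0 < D) (x : ℝ) (hx : 0 ≤ x) :
    C * (1 + x) ^ M ≤ (C + D) * (1 + x) ^ (M + N) ∧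
      D * (1 + x) ^ N ≤ (C + D) * (1 + x) ^ (M + N) := by
  have h1 : (1 : ℝ) ≤ 1 + x := by linarith
  have h0 : 0 ≤ 1 + x := by linarith
  exact ⟨mul_le_mul (by linarith) (pow_le_pow_right₀ h1 (by omega)) (by positivity) (by positivity),
    mul_le_mul (by linarith) (pow_le_pow_right₀ h1 (by omega)) (by positivity) (by positivity)⟩

lemma poch_norm_le {w : ℂ} (hw : NotInt w) : ∃ C > 0, ∃ M : ℕ, ∀ k : ℤ,
    ‖poch w k‖ ≤ C * (1 + k.natAbs : ℝ) ^ M * zfact k := by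
  obtain ⟨C, hC, M, h1⟩ := asc_norm_le w
  obtain ⟨D, hD, N, h2⟩ := factorial_le_asc_norm (w := 1 - w)
    (hw.of_eq_sub 1 (by push_cast; ring)).ne_neg
  refine ⟨C + D, by positivity, M + N, fun k => ?_⟩
  obtain ⟨n, rfl | rfl⟩ := Int.eq_nat_or_neg k
  · rw [poch_natCast, zfact_natCast, Int.natAbs_natCast]
    refine (h1 n).trans ?_
    exact mul_le_mul_of_nonneg_right (max_poly_bound hC hD n n.cast_nonneg).1 (by positivity)
  · rw [poch_neg_natCast', zfact_neg_natCast, Int.natAbs_neg, Int.natAbs_natCast]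
    have h3 := h2 n
    have h4 : 0 < ‖asc (1 - w) n‖ := norm_pos_iff.2
      (asc_ne_zero (hw.of_eq_sub 1 (by push_cast; ring)).ne_neg n)
    have h5 : ‖asc (1 - w) n‖⁻¹ ≤ D * (1 + n : ℝ) ^ N * (n.factorial : ℝ)⁻¹ := by
      have : (0 : ℝ) < n.factorial := by positivity
      rw [inv_le_iff_one_le_mul₀ h4, mul_assoc, mul_comm (_⁻¹), ← mul_assoc, ← div_eq_mul_inv,
        le_div_iff₀ this]
      linarith
    rw [norm_mul, norm_pow, norm_neg, norm_one, one_pow, one_mul, norm_inv]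
    refine h5.trans ?_
    exact mul_le_mul_of_nonneg_right (max_poly_bound hC hD n n.cast_nonneg).2 (by positivity)

lemma zfact_le_poch_norm {w : ℂ} (hw : NotInt w) : ∃ C > 0, ∃ M : ℕ, ∀ k : ℤ,
    zfact k ≤ C * (1 + k.natAbs : ℝ) ^ M * ‖poch w k‖ := by
  obtain ⟨C, hC, M, h1⟩ := factorial_le_asc_norm hw.ne_neg
  obtain ⟨D, hD, N, h2⟩ := asc_norm_le (1 - w)
  refine ⟨C + D, by positivity, M + N, fun k => ?_⟩
  obtain ⟨n, rfl | rfl⟩ := Int.eq_nat_or_neg k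
  · rw [poch_natCast, zfact_natCast, Int.natAbs_natCast]
    refine (h1 n).trans ?_
    exact mul_le_mul_of_nonneg_right (max_poly_bound hC hD n n.cast_nonneg).1 (by positivity)
  · rw [poch_neg_natCast', zfact_neg_natCast, Int.natAbs_neg, Int.natAbs_natCast]
    have h3 := h2 n
    have h4 : 0 < ‖asc (1 - w) n‖ := norm_pos_iff.2
      (asc_ne_zero (hw.of_eq_sub 1 (by push_cast; ring)).ne_neg n)
    have h5 : (n.factorial : ℝ)⁻¹ ≤ D * (1 + n : ℝ) ^ N * ‖asc (1 - w) n‖⁻¹ := by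
      have : (0 : ℝ) < n.factorial := by positivity
      rw [inv_le_iff_one_le_mul₀ this, mul_assoc, mul_comm (_⁻¹), ← mul_assoc, ← div_eq_mul_inv,
        le_div_iff₀ h4]
      linarith
    rw [norm_mul, norm_pow, norm_neg, norm_one, one_pow, one_mul, norm_inv]
    refine h5.trans ?_
    exact mul_le_mul_of_nonneg_right (max_poly_bound hC hD n n.cast_nonneg).2 (by positivity)

/-- `f ≤ g` up to a polynomial factor in the indices. -/
def PolyLE (f g : ℕ × ℕ → ℝ) : Prop :=
  ∃ C > 0, ∃ M : ℕ, ∀ k : ℕ × ℕ, f k ≤ C * (1 + k.1 + k.2 : ℝ) ^ M * g k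

lemma PolyLE.mul {f g f' g' : ℕ × ℕ → ℝ} (h : PolyLE f g) (h' : PolyLE f' g')
    (hf' : ∀ k, 0 ≤ f' k) (hg : ∀ k, 0 ≤ g k) :
    PolyLE (fun k => f k * f' k) (fun k => g k * g' k) := by
  obtain ⟨C, hC, M, h1⟩ := h
  obtain ⟨D, hD, N, h2⟩ := h'
  refine ⟨C * D, by positivity, M + N, fun k => ?_⟩
  calc f k * f' k ≤ (C * (1 + k.1 + k.2 : ℝ) ^ M * g k) * (D * (1 + k.1 + k.2 : ℝ) ^ N * g' k) :=
        mul_le_mul (h1 k) (h2 k) (hf' k) (mul_nonneg (by positivity) (hg k))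
    _ = _ := by ring

lemma PolyLE.trans {f g h : ℕ × ℕ → ℝ} (h1 : PolyLE f g) (h2 : PolyLE g h) : PolyLE f h := by
  obtain ⟨C, hC, M, h1⟩ := h1
  obtain ⟨D, hD, N, h2⟩ := h2
  refine ⟨C * D, by positivity, M + N, fun k => ?_⟩
  calc f k ≤ C * (1 + k.1 + k.2 : ℝ) ^ M * g k := h1 k
    _ ≤ C * (1 + k.1 + k.2 : ℝ) ^ M * (D * (1 + k.1 + k.2 : ℝ) ^ N * h k) := by gcongr; exact h2 k
    _ = _ := by ring

lemma PolyLE.of_le {f g : ℕ × ℕ → ℝ} (h : ∀ k, f k ≤ g k) : PolyLE f g :=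
  ⟨1, one_pos, 0, fun k => by simpa using h k⟩

lemma PolyLE.congr {f g f' g' : ℕ × ℕ → ℝ} (h : PolyLE f g) (hf : ∀ k, f' k = f k)
    (hg : ∀ k, g k = g' k) : PolyLE f' g' := by
  obtain ⟨C, hC, M, h⟩ := h
  exact ⟨C, hC, M, fun k => by rw [hf, ← hg]; exact h k⟩

lemma PolyLE.inv {f g : ℕ × ℕ → ℝ} (h : PolyLE f g) (hf : ∀ k, 0 < f k) (hg : ∀ k, 0 < g k) :
    PolyLE (fun k => (g k)⁻¹) (fun k => (f k)⁻¹) := by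
  obtain ⟨C, hC, M, h⟩ := h
  refine ⟨C, hC, M, fun k => ?_⟩
  rw [← div_eq_mul_inv, le_div_iff₀ (hf k), inv_mul_le_iff₀ (hg k)]
  linarith [h k]

/-- An index form `k ↦ ℓ k` of at most linear growth. -/
lemma natAbs_poly {C : ℝ} {M : ℕ} {j : ℤ} {k : ℕ × ℕ} (hC : 0 < C)
    (hj : j.natAbs ≤ 2 * (k.1 + k.2)) {g : ℝ} (hg : 0 ≤ g) :
    C * (1 + j.natAbs : ℝ) ^ M * g ≤ (C * 2 ^ M) * (1 + k.1 + k.2 : ℝ) ^ M * g := by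
  have : (1 + j.natAbs : ℝ) ≤ 2 * (1 + k.1 + k.2 : ℝ) := by
    have : (j.natAbs : ℝ) ≤ 2 * (k.1 + k.2) := by exact_mod_cast hj
    linarith
  calc C * (1 + j.natAbs : ℝ) ^ M * g ≤ C * (2 * (1 + k.1 + k.2 : ℝ)) ^ M * g := by gcongr
    _ = _ := by rw [mul_pow]; ring

lemma polyLE_poch {w : ℂ} (hw : NotInt w) (ℓ : ℕ × ℕ → ℤ)
    (hℓ : ∀ k, (ℓ k).natAbs ≤ 2 * (k.1 + k.2)) :
    PolyLE (fun k => ‖poch w (ℓ k)‖) (fun k => zfact (ℓ k)) := by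
  obtain ⟨C, hC, M, h⟩ := poch_norm_le hw
  exact ⟨C * 2 ^ M, by positivity, M, fun k =>
    (h _).trans (natAbs_poly hC (hℓ k) (zfact_pos _).le)⟩

lemma polyLE_zfact {w : ℂ} (hw : NotInt w) (ℓ : ℕ × ℕ → ℤ)
    (hℓ : ∀ k, (ℓ k).natAbs ≤ 2 * (k.1 + k.2)) :
    PolyLE (fun k => zfact (ℓ k)) (fun k => ‖poch w (ℓ k)‖) := by
  obtain ⟨C, hC, M, h⟩ := zfact_le_poch_norm hw
  exact ⟨C * 2 ^ M, by positivity, M, fun k =>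
    (h _).trans (natAbs_poly hC (hℓ k) (norm_nonneg _))⟩

lemma polyLE_asc (w : ℂ) (ℓ : ℕ × ℕ → ℕ) (hℓ : ∀ k, ℓ k ≤ 2 * (k.1 + k.2)) :
    PolyLE (fun k => ‖asc w (ℓ k)‖) (fun k => zfact (ℓ k)) := by
  obtain ⟨C, hC, M, h⟩ := asc_norm_le w
  refine ⟨C * 2 ^ M, by positivity, M, fun k => ?_⟩
  have := natAbs_poly (M := M) (j := ℓ k) hC (by simpa using hℓ k) (zfact_pos (ℓ k)).le
  exact (h _).trans (by simpa [zfact_natCast] using this)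

lemma polyLE_zfact_asc {w : ℂ} (hw : ∀ k : ℕ, w ≠ -(k : ℂ)) (ℓ : ℕ × ℕ → ℕ)
    (hℓ : ∀ k, ℓ k ≤ 2 * (k.1 + k.2)) :
    PolyLE (fun k => zfact (ℓ k)) (fun k => ‖asc w (ℓ k)‖) := by
  obtain ⟨C, hC, M, h⟩ := factorial_le_asc_norm hw
  refine ⟨C * 2 ^ M, by positivity, M, fun k => ?_⟩
  have := natAbs_poly (M := M) (j := ℓ k) hC (by simpa using hℓ k) (norm_nonneg (asc w (ℓ k)))
  exact (h _).trans (by simpa using this)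

lemma summable_poly_geom (M : ℕ) {x y : ℝ} (hx : 0 ≤ x) (hx1 : x < 1) (hy : 0 ≤ y) (hy1 : y < 1) :
    Summable fun k : ℕ × ℕ => (1 + k.1 + k.2 : ℝ) ^ M * (x ^ k.1 * y ^ k.2) := by
  have key : ∀ {x : ℝ}, 0 ≤ x → x < 1 → Summable fun n : ℕ => (1 + n : ℝ) ^ M * x ^ n := by
    intro x hx hx1
    rcases hx.eq_or_lt with rfl | hx0
    · exact summable_of_ne_finset_zero (s := {0}) fun n hn => by
        simp at hn; simp [hn]
    have h := (summable_nat_add_iff (f := fun n : ℕ => (n : ℝ) ^ M * x ^ n) 1).2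
      (summable_pow_mul_geometric_of_norm_lt_one M (by rwa [Real.norm_of_nonneg hx]))
    refine (h.mul_right x⁻¹).congr fun n => ?_
    push_cast
    field_simp
    ring
  refine Summable.of_nonneg_of_le (fun k => by positivity) (fun k => ?_)
    ((key hx hx1).mul_of_nonneg (key hy hy1) (fun n => by positivity) (fun n => by positivity))
  have : (1 + k.1 + k.2 : ℝ) ≤ (1 + k.1) * (1 + k.2) := by
    nlinarith [mul_nonneg (Nat.cast_nonneg (α := ℝ) k.1) (Nat.cast_nonneg (α := ℝ) k.2)]
  calc (1 + k.1 + k.2 : ℝ) ^ M * (x ^ k.1 * y ^ k.2)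
      ≤ ((1 + k.1) * (1 + k.2)) ^ M * (x ^ k.1 * y ^ k.2) := by gcongr
    _ = _ := by rw [mul_pow]; ring

/-- Boundedness of the majorant at (A, B) gives convergence at every strictly smaller (X, Y), since
the geometric decay beats the polynomial factor. -/
lemma PolyLE.summable {f g : ℕ × ℕ → ℝ} (h : PolyLE f g) (hf : ∀ k, 0 ≤ f k) {A B D X Y : ℝ}
    (hX : 0 ≤ X) (hXA : X < A) (hY : 0 ≤ Y) (hYB : Y < B)
    (hg : ∀ k, g k * (A ^ k.1 * B ^ k.2) ≤ D) :
    Summable fun k : ℕ × ℕ => f k * (X ^ k.1 * Y ^ k.2) := by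
  obtain ⟨C, hC, M, h⟩ := h
  have hA : 0 < A := hX.trans_lt hXA
  have hB : 0 < B := hY.trans_lt hYB
  refine Summable.of_nonneg_of_le (fun k => mul_nonneg (hf k) (by positivity)) (fun k => ?_)
    ((summable_poly_geom M (x := X / A) (y := Y / B) (by positivity) ((div_lt_one hA).2 hXA)
      (by positivity) ((div_lt_one hB).2 hYB)).mul_left (C * D))
  calc f k * (X ^ k.1 * Y ^ k.2)
      ≤ (C * (1 + k.1 + k.2 : ℝ) ^ M * g k) * (X ^ k.1 * Y ^ k.2) := by gcongr; exact h k
    _ = C * (1 + k.1 + k.2 : ℝ) ^ M * (g k * (A ^ k.1 * B ^ k.2)) *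
        ((X / A) ^ k.1 * (Y / B) ^ k.2) := by rw [div_pow, div_pow]; field_simp
    _ ≤ C * (1 + k.1 + k.2 : ℝ) ^ M * D * ((X / A) ^ k.1 * (Y / B) ^ k.2) := by gcongr; exact hg k
    _ = _ := by ring

end

/-! ### Analyticity of double power series -/

noncomputable section

/-- The multilinear form whose diagonal is the monomial `x ^ m * y ^ (N - m)`. -/
def monomialForm (N m : ℕ) : ContinuousMultilinearMap ℂ (fun _ : Fin N => ℂ × ℂ) ℂ :=
  (ContinuousMultilinearMap.mkPiAlgebraFin ℂ N ℂ).compContinuousLinearMap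
    fun i : Fin N => if (i : ℕ) < m then ContinuousLinearMap.fst ℂ ℂ ℂ
      else ContinuousLinearMap.snd ℂ ℂ ℂ

lemma norm_monomialForm_le (N m : ℕ) : ‖monomialForm N m‖ ≤ 1 := by
  refine (ContinuousMultilinearMap.norm_compContinuousLinearMap_le _ _).trans ?_
  rw [ContinuousMultilinearMap.norm_mkPiAlgebraFin, one_mul]
  refine Finset.prod_le_one (fun _ _ => norm_nonneg _) fun i _ => ?_
  split_ifs
  · exact ContinuousLinearMap.norm_fst_le ..
  · exact ContinuousLinearMap.norm_snd_le ..

lemma monomialForm_diag (m n : ℕ) (v : ℂ × ℂ) :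
    monomialForm (m + n) m (fun _ => v) = v.1 ^ m * v.2 ^ n := by
  simp only [monomialForm, ContinuousMultilinearMap.compContinuousLinearMap_apply,
    ContinuousMultilinearMap.mkPiAlgebraFin_apply, List.prod_ofFn]
  rw [Fin.prod_univ_add]
  simp

/-- The formal power series in two variables with given coefficients. -/
def doubleSeries (c : ℕ × ℕ → ℂ) : FormalMultilinearSeries ℂ (ℂ × ℂ) ℂ := fun N =>
  ∑ k ∈ Finset.HasAntidiagonal.antidiagonal N, c k • monomialForm N k.1

/-- The double series is grouped by total degree. In the sup norm of ℂ × ℂ every monomial form has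
norm at most 1, so each homogeneous part is bounded by the sum of all ‖c k‖ and the radius is at
least 1. -/
lemma doubleSeries_hasFPowerSeriesOnBall {c : ℕ × ℕ → ℂ} (hc : Summable fun k => ‖c k‖) :
    HasFPowerSeriesOnBall (fun p : ℂ × ℂ => ∑' k : ℕ × ℕ, c k * (p.1 ^ k.1 * p.2 ^ k.2))
      (doubleSeries c) 0 1 where
  r_le := by
    have h : ((1 : NNReal) : ENNReal) ≤ (doubleSeries c).radius := by
      refine FormalMultilinearSeries.le_radius_of_bound _ (∑' k, ‖c k‖) fun N => ?_
      rw [NNReal.coe_one, one_pow, mul_one]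
      calc ‖doubleSeries c N‖ ≤ ∑ k ∈ Finset.HasAntidiagonal.antidiagonal N, ‖c k • monomialForm N k.1‖ :=
            norm_sum_le _ _
        _ ≤ ∑ k ∈ Finset.HasAntidiagonal.antidiagonal N, ‖c k‖ := by
            refine Finset.sum_le_sum fun k _ => ?_
            rw [norm_smul]
            exact mul_le_of_le_one_right (norm_nonneg _) (norm_monomialForm_le _ _)
        _ ≤ _ := hc.sum_le_tsum _ fun _ _ => norm_nonneg _
    simpa using h
  r_pos := one_pos
  hasSum := by
    intro v hv
    have hv' : ‖v‖ < 1 := by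
      rwa [← ENNReal.ofReal_one, Metric.eball_ofReal, mem_ball_zero_iff] at hv
    have h1 : ‖v.1‖ ≤ 1 := (norm_fst_le v).trans hv'.le
    have h2 : ‖v.2‖ ≤ 1 := (norm_snd_le v).trans hv'.le
    have hs : Summable fun k : ℕ × ℕ => c k * (v.1 ^ k.1 * v.2 ^ k.2) := by
      refine Summable.of_norm_bounded hc fun k => ?_
      rw [norm_mul, norm_mul, norm_pow, norm_pow]
      exact mul_le_of_le_one_right (norm_nonneg _)
        (mul_le_one₀ (pow_le_one₀ (norm_nonneg _) h1) (by positivity)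
          (pow_le_one₀ (norm_nonneg _) h2))
    rw [zero_add]
    have h3 := (Finset.HasAntidiagonal.sigmaAntidiagonalEquivProd.hasSum_iff).2 hs.hasSum
    have h4 := h3.sigma fun N => hasSum_fintype _
    convert! h4 using 2 with N
    rw [doubleSeries, _root_.sum_apply, ← Finset.sum_coe_sort]
    refine Finset.sum_congr rfl fun k _ => ?_
    obtain ⟨⟨m, n⟩, hk⟩ := k
    obtain rfl : m + n = N := Finset.HasAntidiagonal.mem_antidiagonal.1 hk
    simp [monomialForm_diag]

/-- Rescaling the coordinates by A and B reduces a polydisc with two different radii to the unit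
ball of the sup norm. -/
lemma analyticAt_doubleSeries {c : ℕ × ℕ → ℂ} {A B : ℝ}
    (hc : Summable fun k => ‖c k‖ * (A ^ k.1 * B ^ k.2)) {p : ℂ × ℂ} (hA : ‖p.1‖ < A)
    (hB : ‖p.2‖ < B) :
    AnalyticAt ℂ (fun p : ℂ × ℂ => ∑' k : ℕ × ℕ, c k * (p.1 ^ k.1 * p.2 ^ k.2)) p := by
  have hA0 : 0 < A := (norm_nonneg _).trans_lt hA
  have hB0 : 0 < B := (norm_nonneg _).trans_lt hB
  have hA' : (A : ℂ) ≠ 0 := by exact_mod_cast hA0.ne'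
  have hB' : (B : ℂ) ≠ 0 := by exact_mod_cast hB0.ne'
  have h := doubleSeries_hasFPowerSeriesOnBall (c := fun k => c k * ((A : ℂ) ^ k.1 * (B : ℂ) ^ k.2))
    (hc.congr fun k => by simp [abs_of_pos hA0, abs_of_pos hB0])
  have h2 : AnalyticAt ℂ (fun p : ℂ × ℂ => ∑' k : ℕ × ℕ,
      c k * ((A : ℂ) ^ k.1 * (B : ℂ) ^ k.2) * (p.1 ^ k.1 * p.2 ^ k.2)) (p.1 / A, p.2 / B) := by
    refine h.analyticAt_of_mem ?_
    have : ‖((p.1 / A, p.2 / B) : ℂ × ℂ)‖ < 1 := by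
      rw [Prod.norm_def, max_lt_iff]
      simp only [norm_div, Complex.norm_real, Real.norm_eq_abs, abs_of_pos hA0, abs_of_pos hB0]
      exact ⟨(div_lt_one hA0).2 hA, (div_lt_one hB0).2 hB⟩
    rwa [← ENNReal.ofReal_one, Metric.eball_ofReal, mem_ball_zero_iff]
  have h3 : AnalyticAt ℂ (fun p : ℂ × ℂ => ((p.1 / A, p.2 / B) : ℂ × ℂ)) p :=
    (analyticAt_fst.div analyticAt_const hA').prod (analyticAt_snd.div analyticAt_const hB')
  refine (h2.comp_of_eq h3 rfl).congr (Eventually.of_forall fun q => ?_)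
  refine tsum_congr fun k => ?_
  simp only [div_pow]
  field_simp

/-- Cauchy's estimates turn the uniform geometric bound for ψ_n on a disc into bounds for its Taylor
coefficients at z₀, so the sum is an absolutely convergent double power series in u and z - z₀. -/
lemma analyticAt_tsum_pow_mul {ψ : ℕ → ℂ → ℂ} {z₀ : ℂ} {δ ρ M : ℝ} (hδ : 0 < δ)
    (hψ : ∀ n, DifferentiableOn ℂ (ψ n) (Metric.ball z₀ δ))
    (hM : ∀ n, ∀ z ∈ Metric.ball z₀ δ, ‖ψ n z‖ * ρ ^ n ≤ M) {u₀ : ℂ} (hu : ‖u₀‖ < ρ) :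
    AnalyticAt ℂ (fun q : ℂ × ℂ => ∑' n : ℕ, q.1 ^ n * ψ n q.2) (u₀, z₀) := by
  have hρ : 0 < ρ := (norm_nonneg _).trans_lt hu
  obtain ⟨A, hA1, hA2⟩ := exists_between hu
  have hA0 : 0 < A := (norm_nonneg _).trans_lt hA1
  let c : ℕ × ℕ → ℂ := fun k => (k.2.factorial : ℂ)⁻¹ * iteratedDeriv k.2 (ψ k.1) z₀
  have hM0 : 0 ≤ M := (by positivity : 0 ≤ ‖ψ 0 z₀‖ * ρ ^ 0).trans
    (hM 0 z₀ (Metric.mem_ball_self hδ))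
  have hcb : ∀ k, ‖c k‖ ≤ M / ρ ^ k.1 / (δ / 2) ^ k.2 := by
    intro k
    have h1 := Complex.norm_iteratedDeriv_le_of_forall_mem_sphere_norm_le (f := ψ k.1) (c := z₀)
      k.2 (C := M / ρ ^ k.1) (half_pos hδ)
      (((hψ k.1).mono (Metric.closedBall_subset_ball (by linarith))).diffContOnCl_ball subset_rfl)
      fun z hz => by
        rw [le_div_iff₀ (by positivity)]
        exact hM k.1 z (Metric.sphere_subset_closedBall.trans
          (Metric.closedBall_subset_ball (by linarith)) hz)
    simp only [c, norm_mul, norm_inv, Complex.norm_natCast]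
    rw [inv_mul_le_iff₀ (by positivity)]
    exact h1.trans_eq (by ring)
  -- A lies strictly between ‖u₀‖ and ρ, and δ/4 is half of the radius δ/2 used in Cauchy's
  -- estimates, so both geometric ratios are less than 1.
  have hsum : Summable fun k => ‖c k‖ * (A ^ k.1 * (δ / 4) ^ k.2) := by
    refine Summable.of_nonneg_of_le (fun k => by positivity) (fun k => ?_)
      ((summable_poly_geom 0 (x := A / ρ) (y := 1 / 2) (by positivity) ((div_lt_one hρ).2 hA2)
        (by norm_num) (by norm_num)).mul_left M)
    calc ‖c k‖ * (A ^ k.1 * (δ / 4) ^ k.2)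
        ≤ (M / ρ ^ k.1 / (δ / 2) ^ k.2) * (A ^ k.1 * (δ / 4) ^ k.2) := by gcongr; exact hcb k
      _ = _ := by
        rw [pow_zero, one_mul, div_pow A ρ, show (δ / 4 : ℝ) = δ / 2 * (1 / 2) by ring, mul_pow (δ / 2)]
        have : (δ / 2) ^ k.2 ≠ 0 := by positivity
        generalize (δ / 2) ^ k.2 = d at *
        field_simp
  have h := analyticAt_doubleSeries hsum (p := (u₀, 0)) hA1 (by simpa using hδ)
  have h2 : AnalyticAt ℂ (fun q : ℂ × ℂ => ((q.1, q.2 - z₀) : ℂ × ℂ)) (u₀, z₀) :=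
    analyticAt_fst.prod (analyticAt_snd.sub analyticAt_const)
  refine (h.comp_of_eq h2 (by simp)).congr ?_
  have ho : ∀ᶠ q : ℂ × ℂ in 𝓝 (u₀, z₀), ‖q.1‖ < A ∧ ‖q.2 - z₀‖ < δ / 4 := by
    refine ContinuousAt.eventually_lt (by fun_prop) (by fun_prop) hA1 |>.and
      (ContinuousAt.eventually_lt (by fun_prop) (by fun_prop) ?_)
    simpa using hδ
  filter_upwards [ho] with q hq
  have hs : Summable fun k : ℕ × ℕ => c k * (q.1 ^ k.1 * (q.2 - z₀) ^ k.2) := by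
    refine Summable.of_norm_bounded hsum fun k => ?_
    rw [norm_mul (c k), norm_mul (q.1 ^ k.1), norm_pow, norm_pow]
    gcongr
    · exact hq.1.le
    · exact hq.2.le
  simp only [Function.comp]
  rw [hs.tsum_prod]
  refine tsum_congr fun n => ?_
  have ht := Complex.hasSum_taylorSeries_on_ball (f := ψ n) (c := z₀) (r := δ) (hψ n) (z := q.2)
    (by rw [Metric.mem_ball, dist_eq_norm]; linarith [hq.2])
  rw [← ht.tsum_eq, ← tsum_mul_left]
  refine tsum_congr fun m => ?_
  simp only [c, smul_eq_mul]
  ring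

end

/-! ### Gauss's differential equation and the Wronskian -/

noncomputable section

/-- A sequence of at most polynomial growth. -/
def PolyBdd (f : ℕ → ℂ) : Prop := ∃ K > 0, ∃ M : ℕ, ∀ n, ‖f n‖ ≤ K * (1 + n : ℝ) ^ M

/-- The sum of the power series with coefficients `f`. -/
def pser (f : ℕ → ℂ) (y : ℂ) : ℂ := ∑' n, f n * y ^ n

/-- The coefficients of the derived power series. -/
def dcoef (f : ℕ → ℂ) (n : ℕ) : ℂ := (n + 1) * f (n + 1)

lemma summable_poly_geom_one (M : ℕ) {x : ℝ} (hx : 0 ≤ x) (hx1 : x < 1) :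
    Summable fun n : ℕ => (1 + n : ℝ) ^ M * x ^ n := by
  have h := (summable_poly_geom M hx hx1 le_rfl one_pos).comp_injective
    (i := fun n : ℕ => (n, 0)) (fun a b h => (Prod.ext_iff.1 h).1)
  refine h.congr fun n => ?_
  simp

lemma PolyBdd.summable_norm {f : ℕ → ℂ} (hf : PolyBdd f) {x : ℝ} (hx : 0 ≤ x) (hx1 : x < 1) :
    Summable fun n => ‖f n‖ * x ^ n := by
  obtain ⟨K, hK, M, h⟩ := hf
  refine Summable.of_nonneg_of_le (fun n => by positivity) (fun n => ?_)
    ((summable_poly_geom_one M hx hx1).mul_left K)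
  rw [← mul_assoc]
  exact mul_le_mul_of_nonneg_right (h n) (by positivity)

lemma PolyBdd.hasSum {f : ℕ → ℂ} (hf : PolyBdd f) {y : ℂ} (hy : ‖y‖ < 1) :
    HasSum (fun n => f n * y ^ n) (pser f y) := by
  refine (Summable.of_norm ?_).hasSum
  simpa using hf.summable_norm (norm_nonneg y) hy

lemma PolyBdd.dcoef {f : ℕ → ℂ} (hf : PolyBdd f) : PolyBdd (dcoef f) := by
  obtain ⟨K, hK, M, h⟩ := hf
  refine ⟨K * 2 ^ M, by positivity, M + 1, fun n => ?_⟩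
  have h1 : ‖(n + 1 : ℂ)‖ = 1 + n := by
    rw [add_comm]; exact_mod_cast Complex.norm_natCast (1 + n)
  rw [_root_.dcoef, norm_mul, h1]
  have h2 : (1 + ((n + 1 : ℕ) : ℝ)) ≤ 2 * (1 + n) := by push_cast; linarith [n.cast_nonneg (α := ℝ)]
  calc (1 + n : ℝ) * ‖f (n + 1)‖ ≤ (1 + n) * (K * (2 * (1 + n)) ^ M) := by
        gcongr; exact (h _).trans (by gcongr)
    _ = _ := by rw [mul_pow]; ring

lemma PolyBdd.hasDerivAt {f : ℕ → ℂ} (hf : PolyBdd f) {y : ℂ} (hy : ‖y‖ < 1) :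
    HasDerivAt (pser f) (pser (_root_.dcoef f) y) y := by
  obtain ⟨r, hr1, hr2⟩ := exists_between hy
  have hr0 : 0 ≤ r := (norm_nonneg _).trans hr1.le
  have hs := hf.summable_norm hr0 hr2
  have hd : ∀ n, DifferentiableOn ℂ (fun y : ℂ => f n * y ^ n) (Metric.ball 0 r) :=
    fun n => by fun_prop
  have hb : ∀ n, ∀ w ∈ Metric.ball (0 : ℂ) r, ‖f n * w ^ n‖ ≤ ‖f n‖ * r ^ n := by
    intro n w hw
    rw [norm_mul, norm_pow]
    have : ‖w‖ ≤ r := (mem_ball_zero_iff.1 hw).le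
    gcongr
  have hy' : y ∈ Metric.ball (0 : ℂ) r := mem_ball_zero_iff.2 hr1
  have h1 := Complex.differentiableOn_tsum_of_summable_norm hs hd Metric.isOpen_ball hb
  have h2 := Complex.hasSum_deriv_of_summable_norm hs hd Metric.isOpen_ball hb hy'
  have h3 := (h1.differentiableAt (Metric.isOpen_ball.mem_nhds hy')).hasDerivAt
  suffices deriv (fun y => ∑' n, f n * y ^ n) y = pser (_root_.dcoef f) y by rwa [this] at h3
  have h4 := (hasSum_nat_add_iff' 1).2 h2
  simp only [Finset.range_one, Finset.sum_singleton, pow_zero, deriv_const, sub_zero] at h4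
  refine h4.unique ((hf.dcoef.hasSum hy).congr_fun fun n => ?_)
  simp [_root_.dcoef]
  ring

lemma PolyBdd.hasSum_theta {f : ℕ → ℂ} (hf : PolyBdd f) {y : ℂ} (hy : ‖y‖ < 1) :
    HasSum (fun n : ℕ => n * f n * y ^ n) (y * pser (_root_.dcoef f) y) := by
  have h := (hf.dcoef.hasSum hy).mul_left y
  have h2 := (hasSum_nat_add_iff (f := fun n : ℕ => (n * f n * y ^ n : ℂ)) 1
    (g := y * pser (_root_.dcoef f) y)).1 (h.congr_fun fun n => by
      simp only [_root_.dcoef]; push_cast; ring)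
  simpa using h2

/-- The coefficients of Gauss's hypergeometric series. -/
def gcoef (A B C : ℂ) (n : ℕ) : ℂ := asc A n * asc B n / (asc C n * n.factorial)

/-- Gauss's hypergeometric function on the unit disc. -/
def gauss (A B C y : ℂ) : ℂ := pser (gcoef A B C) y

/-- The derivative of Gauss's hypergeometric function. -/
def gauss' (A B C y : ℂ) : ℂ := pser (dcoef (gcoef A B C)) y

lemma polyBdd_gcoef (A B : ℂ) {C : ℂ} (hC : ∀ k : ℕ, C ≠ -(k : ℂ)) : PolyBdd (gcoef A B C) := by
  obtain ⟨K1, h1, M1, H1⟩ := asc_norm_le A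
  obtain ⟨K2, h2, M2, H2⟩ := asc_norm_le B
  obtain ⟨K3, h3, M3, H3⟩ := factorial_le_asc_norm hC
  refine ⟨K1 * K2 * K3, by positivity, M1 + M2 + M3, fun n => ?_⟩
  have h0 : 0 < ‖asc C n‖ := norm_pos_iff.2 (asc_ne_zero hC n)
  rw [gcoef, norm_div, norm_mul, norm_mul, Complex.norm_natCast, div_le_iff₀ (by positivity)]
  calc ‖asc A n‖ * ‖asc B n‖
      ≤ (K1 * (1 + n : ℝ) ^ M1 * n.factorial) * (K2 * (1 + n : ℝ) ^ M2 * n.factorial) := by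
        gcongr; exacts [H1 n, H2 n]
    _ ≤ (K1 * (1 + n : ℝ) ^ M1 * n.factorial) * (K2 * (1 + n : ℝ) ^ M2 *
          (K3 * (1 + n : ℝ) ^ M3 * ‖asc C n‖)) := by gcongr; exact H3 n
    _ = _ := by ring

lemma gcoef_succ (A B : ℂ) {C : ℂ} (hC : ∀ k : ℕ, C ≠ -(k : ℂ)) (n : ℕ) :
    (n + 1) * (C + n) * gcoef A B C (n + 1) = (A + n) * (B + n) * gcoef A B C n := by
  have h1 := asc_ne_zero hC n
  have h2 : C + n ≠ 0 := fun h => hC n (by linear_combination h)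
  have h3 : (n.factorial : ℂ) ≠ 0 := by exact_mod_cast n.factorial_ne_zero
  have h4 : (n + 1 : ℂ) ≠ 0 := by exact_mod_cast n.succ_ne_zero
  rw [gcoef, gcoef, asc_succ, asc_succ, asc_succ, Nat.factorial_succ]
  push_cast
  field_simp

/-- `w`, with derivative `w'`, solves the hypergeometric differential equation on `S`. -/
def SolvesHG (A B C : ℂ) (S : Set ℂ) (w w' : ℂ → ℂ) : Prop :=
  ∀ y ∈ S, HasDerivAt w (w' y) y ∧ ∃ w'', HasDerivAt w' w'' y ∧
    y * (1 - y) * w'' + (C - (A + B + 1) * y) * w' y - A * B * w y = 0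

lemma SolvesHG.mono {A B C : ℂ} {S T : Set ℂ} {w w' : ℂ → ℂ} (h : SolvesHG A B C S w w')
    (hT : T ⊆ S) : SolvesHG A B C T w w' := fun y hy => h y (hT hy)

/-- The coefficient of y^n in the differential equation is exactly the two-term recurrence
`gcoef_succ`. -/
lemma solvesHG_gauss (A B : ℂ) {C : ℂ} (hC : ∀ k : ℕ, C ≠ -(k : ℂ)) :
    SolvesHG A B C (Metric.ball 0 1) (gauss A B C) (gauss' A B C) := by
  intro y hy
  replace hy : ‖y‖ < 1 := mem_ball_zero_iff.1 hy
  have hf := polyBdd_gcoef A B hC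
  refine ⟨hf.hasDerivAt hy, _, hf.dcoef.hasDerivAt hy, ?_⟩
  set f := gcoef A B C
  have h0 := hf.hasSum hy
  have h1 := hf.dcoef.hasSum hy
  have h2 := hf.hasSum_theta hy
  have h3 := hf.dcoef.hasSum_theta hy
  have h4 : HasSum (fun n : ℕ => ((n : ℂ) - 1) * n * f n * y ^ n)
      (y * (y * pser (dcoef (dcoef f)) y)) := by
    have h := (hasSum_nat_add_iff (f := fun n : ℕ => (((n : ℂ) - 1) * n * f n * y ^ n : ℂ)) 1
      (g := y * (y * pser (dcoef (dcoef f)) y))).1 ((h3.mul_left y).congr_fun fun n => by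
        simp only [_root_.dcoef]; push_cast; ring)
    simpa using h
  have h5 := (((h3.sub h4).add (h1.mul_left C)).sub (h2.mul_left (A + B + 1))).sub
    (h0.mul_left (A * B))
  have h6 := h5.unique (hasSum_zero.congr_fun fun n => ?_)
  · rw [gauss, gauss', ← h6]; ring
  · have := gcoef_succ A B hC n
    simp only [_root_.dcoef]
    linear_combination (y ^ n) * this

lemma SolvesHG.reflect {A B C : ℂ} {S : Set ℂ} {w w' : ℂ → ℂ} (h : SolvesHG A B C S w w') :
    SolvesHG A B (A + B + 1 - C) ((fun y => 1 - y) ⁻¹' S) (fun y => w (1 - y))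
      (fun y => -w' (1 - y)) := by
  intro y hy
  obtain ⟨h1, w'', h2, h3⟩ := h (1 - y) hy
  have hd : HasDerivAt (fun y : ℂ => 1 - y) (-1) y := by simpa using (hasDerivAt_id y).const_sub 1
  refine ⟨HasDerivAt.comp_const_sub 1 y h1, w'',
    by simpa using (HasDerivAt.comp_const_sub 1 y h2).fun_neg, ?_⟩
  linear_combination h3

/-- The factor (1-y)^(C-A-B) exchanges the two exponents 0 and C-A-B at y = 1. It produces the
singular solution at 1 and also the right-hand side of Euler's transformation. -/
lemma SolvesHG.cpow_mul {A B C : ℂ} {S : Set ℂ} {w w' : ℂ → ℂ}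
    (h : SolvesHG (C - A) (C - B) C S w w') (hS : ∀ y ∈ S, 1 - y ∈ Complex.slitPlane) :
    SolvesHG A B C S (fun y => (1 - y) ^ (C - A - B) * w y)
      (fun y => (1 - y) ^ (C - A - B) * (w' y - (C - A - B) * w y / (1 - y))) := by
  intro y hy
  obtain ⟨h1, w'', h2, h3⟩ := h y hy
  have hu : (1 - y) ≠ 0 := Complex.slitPlane_ne_zero (hS y hy)
  have hd : HasDerivAt (fun y : ℂ => 1 - y) (-1) y := by simpa using (hasDerivAt_id y).const_sub 1
  have hp : HasDerivAt (fun y : ℂ => (1 - y) ^ (C - A - B))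
      (-((C - A - B) / (1 - y) * (1 - y) ^ (C - A - B))) y := by
    convert! hd.cpow_const (c := C - A - B) (hS y hy) using 1
    rw [Complex.cpow_sub (C - A - B) 1 hu, Complex.cpow_one]
    ring
  refine ⟨?_, (1 - y) ^ (C - A - B) * (w'' - 2 * (C - A - B) * w' y / (1 - y) +
    (C - A - B) * (C - A - B - 1) * w y / (1 - y) ^ 2), ?_, ?_⟩
  · convert! hp.mul h1 using 1
    field_simp
    ring
  · have hq : HasDerivAt (fun y => w' y - (C - A - B) * w y / (1 - y))
        (w'' - ((C - A - B) * w' y * (1 - y) - (C - A - B) * w y * -1) / (1 - y) ^ 2) y :=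
      h2.sub ((h1.const_mul (C - A - B)).div hd hu)
    convert! hp.mul hq using 1
    field_simp
    ring
  · have : y * (1 - y) * w'' = -(C - (2 * C - A - B + 1) * y) * w' y + (C - A) * (C - B) * w y := by
      linear_combination h3
    have e : ∀ p : ℂ, y * (1 - y) * (p * (w'' - 2 * (C - A - B) * w' y / (1 - y) +
        (C - A - B) * (C - A - B - 1) * w y / (1 - y) ^ 2)) = p * (y * (1 - y) * w'' -
        2 * (C - A - B) * y * w' y + (C - A - B) * (C - A - B - 1) * y * w y / (1 - y)) := by
      intro p; field_simp
    simp only [e, this]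
    field_simp
    ring

/-- The Wronskian. -/
def wronsk (v v' w w' : ℂ → ℂ) (y : ℂ) : ℂ := v y * w' y - v' y * w y

/-- Abel's identity: in the derivative of the Wronskian the terms without second derivatives cancel.
-/
lemma SolvesHG.wronsk_deriv {A B C : ℂ} {S : Set ℂ} {v v' w w' : ℂ → ℂ}
    (hv : SolvesHG A B C S v v') (hw : SolvesHG A B C S w w') {y : ℂ} (hy : y ∈ S) :
    ∃ d, HasDerivAt (wronsk v v' w w') d y ∧
      y * (1 - y) * d = -(C - (A + B + 1) * y) * wronsk v v' w w' y := by
  obtain ⟨h1, v'', h2, h3⟩ := hv y hy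
  obtain ⟨h4, w'', h5, h6⟩ := hw y hy
  refine ⟨_, (h1.mul h5).sub (h2.mul h4), ?_⟩
  simp only [wronsk]
  linear_combination v y * h6 - w y * h3

/-- The intersection of the two unit discs centred at `0` and at `1`. -/
def lens : Set ℂ := Metric.ball 0 1 ∩ Metric.ball 1 1

lemma mem_lens {y : ℂ} : y ∈ lens ↔ ‖y‖ < 1 ∧ ‖1 - y‖ < 1 := by
  rw [lens, mem_inter_iff, mem_ball_zero_iff, Metric.mem_ball', dist_eq_norm]

lemma isOpen_lens : IsOpen lens := Metric.isOpen_ball.inter Metric.isOpen_ball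

lemma convex_lens : Convex ℝ lens := (convex_ball _ _).inter (convex_ball _ _)

lemma slit_of_norm_one_sub_lt {y : ℂ} (h : ‖1 - y‖ < 1) : y ∈ Complex.slitPlane := by
  left
  have := (Complex.re_le_norm (1 - y)).trans_lt h
  simp at this
  exact this

lemma one_sub_slit_of_norm_lt {y : ℂ} (h : ‖y‖ < 1) : 1 - y ∈ Complex.slitPlane :=
  slit_of_norm_one_sub_lt (by simpa using h)

/-- y^C (1-y)^(A+B-C+1) is the integrating factor of Abel's equation. On the lens both principal
powers are holomorphic, and the lens is convex, so a vanishing derivative means constancy. -/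
lemma SolvesHG.wronsk_const {A B C : ℂ} {v v' w w' : ℂ → ℂ}
    (hv : SolvesHG A B C lens v v') (hw : SolvesHG A B C lens w w') :
    ∃ k, ∀ y ∈ lens, y ^ C * (1 - y) ^ (A + B - C + 1) * wronsk v v' w w' y = k := by
  have hd : ∀ y ∈ lens, HasDerivAt
      (fun y => y ^ C * (1 - y) ^ (A + B - C + 1) * wronsk v v' w w' y) 0 y := by
    intro y hy
    have hy' := mem_lens.1 hy
    have hys := slit_of_norm_one_sub_lt hy'.2
    have hus := one_sub_slit_of_norm_lt hy'.1
    have hy0 := Complex.slitPlane_ne_zero hys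
    have hu0 := Complex.slitPlane_ne_zero hus
    obtain ⟨d, h1, h2⟩ := hv.wronsk_deriv hw hy
    have hd : HasDerivAt (fun y : ℂ => 1 - y) (-1) y := by
      simpa using (hasDerivAt_id y).const_sub 1
    have h3 := (hasDerivAt_id y).cpow_const (c := C) hys
    have h4 := hd.cpow_const (c := A + B - C + 1) hus
    convert! (h3.mul h4).mul h1 using 1
    have h5 : d = -(C - (A + B + 1) * y) * wronsk v v' w w' y / (y * (1 - y)) := by
      rw [eq_div_iff (mul_ne_zero hy0 hu0)]; linear_combination h2
    simp only [id, Pi.mul_apply]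
    rw [h5, Complex.cpow_sub _ _ hy0, Complex.cpow_sub _ _ hu0, Complex.cpow_one, Complex.cpow_one]
    field_simp
    ring
  have h := isOpen_lens.exists_is_const_of_deriv_eq_zero (𝕜 := ℂ) convex_lens.isPreconnected
    (fun y hy => (hd y hy).differentiableAt.differentiableWithinAt)
    (fun y hy => (hd y hy).deriv)
  exact h

end

/-! ### Contiguous relations and connection coefficients at 1 -/

noncomputable section

lemma gauss_zero (A B C : ℂ) : gauss A B C 0 = 1 := by
  rw [gauss, pser, tsum_eq_single 0 fun n hn => by simp [hn]]
  simp [gcoef, asc_zero]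

lemma gcoef_zero (A B C : ℂ) : gcoef A B C 0 = 1 := by simp [gcoef, asc_zero]

lemma PolyBdd.hasSum_succ {f : ℕ → ℂ} (hf : PolyBdd f) {y : ℂ} (hy : ‖y‖ < 1) :
    HasSum (fun n => f (n + 1) * y ^ (n + 1)) (pser f y - f 0) := by
  simpa using (hasSum_nat_add_iff' 1).2 (hf.hasSum hy)

/-- The operator C + y d/dy multiplies the n-th coefficient by C + n, which changes (C+1)_n in the
denominator into (C)_n. The next two lemmas describe the same operator on the two solutions at 1, in
the variable u = 1 - y, where y d/dy is -(1-u) d/du. -/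
lemma gauss_lower_contiguous (A B : ℂ) {C : ℂ} (hC : ∀ k : ℕ, C ≠ -(k : ℂ)) {y : ℂ}
    (hy : ‖y‖ < 1) :
    C * gauss A B C y = C * gauss A B (C + 1) y + y * gauss' A B (C + 1) y := by
  have hC1 : ∀ k : ℕ, C + 1 ≠ -(k : ℂ) := fun k h => hC (k + 1) (by push_cast; linear_combination h)
  have h1 := (polyBdd_gcoef A B hC).hasSum hy
  have h2 := (polyBdd_gcoef A B hC1).hasSum hy
  have h3 := (polyBdd_gcoef A B hC1).hasSum_theta hy
  refine (h1.mul_left C).unique (((h2.mul_left C).add h3).congr_fun fun n => ?_)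
  have e := asc_succ_left C n
  rw [asc_succ] at e
  have h4 := asc_ne_zero hC n
  have h5 := asc_ne_zero hC1 n
  have h6 : (n.factorial : ℂ) ≠ 0 := by exact_mod_cast n.factorial_ne_zero
  simp only [gcoef]
  field_simp
  linear_combination -asc A n * asc B n * y ^ n * e

/-- C + y d/dy on the regular solution at 1: lowering C raises the third parameter D of that
solution. -/
lemma gauss_raise_contiguous (A B C : ℂ) {D : ℂ} (hD : ∀ k : ℕ, D ≠ -(k : ℂ))
    (hCD : C + D = A + B) {u : ℂ} (hu : ‖u‖ < 1) :
    D * (C * gauss A B D u - (1 - u) * gauss' A B D u) =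
      (C * D - A * B) * gauss A B (D + 1) u := by
  have hD1 : ∀ k : ℕ, D + 1 ≠ -(k : ℂ) := fun k h => hD (k + 1) (by push_cast; linear_combination h)
  have h0 := polyBdd_gcoef A B hD
  have h1 := h0.hasSum hu
  have h2 := h0.dcoef.hasSum hu
  have h3 := h0.hasSum_theta hu
  have h4 := (polyBdd_gcoef A B hD1).hasSum hu
  have h5 := (((h1.mul_left C).sub h2).add h3).mul_left D
  have h6 := h5.unique ((h4.mul_left (C * D - A * B)).congr_fun fun n => ?_)
  · rw [gauss, gauss', gauss, ← h6]; ring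
  have e := asc_succ_left D n
  rw [asc_succ] at e
  have h7 := asc_ne_zero hD n
  have h8 := asc_ne_zero hD1 n
  have h9 : (n.factorial : ℂ) ≠ 0 := by exact_mod_cast n.factorial_ne_zero
  have hs := gcoef_succ A B hD n
  have hDn : D + n ≠ 0 := fun h => hD n (by linear_combination h)
  have hs' : dcoef (gcoef A B D) n = (A + n) * (B + n) * gcoef A B D n / (D + n) := by
    rw [eq_div_iff hDn, dcoef]; linear_combination hs
  rw [hs']
  have e2 : gcoef A B (D + 1) n = D * gcoef A B D n / (D + n) := by
    rw [eq_div_iff hDn]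
    simp only [gcoef]
    field_simp
    linear_combination asc A n * asc B n * e
  rw [e2]
  field_simp
  have : A = C + D - B := by linear_combination -hCD
  subst this
  ring

/-- C + y d/dy on the singular solution u^D F(A+1, B+1; D+1; u), after division by u^(D-1). -/
lemma gauss_singular_contiguous {A B C D : ℂ} (hD : ∀ k : ℕ, D ≠ -(k : ℂ))
    (hCD : A + B + 1 = C + D) {u : ℂ} (hu : ‖u‖ < 1) :
    C * (u * gauss (A + 1) (B + 1) (D + 1) u) - (1 - u) * (D * gauss (A + 1) (B + 1) (D + 1) u +
      u * gauss' (A + 1) (B + 1) (D + 1) u) = -D * gauss A B D u := by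
  have hD1 : ∀ k : ℕ, D + 1 ≠ -(k : ℂ) := fun k h => hD (k + 1) (by push_cast; linear_combination h)
  have hh := polyBdd_gcoef (A + 1) (B + 1) hD1
  have h1 := (hh.hasSum hu).mul_left u
  have h2 := (hh.hasSum_theta hu).mul_left u
  have h3 := hh.hasSum_succ hu
  have h4 := (hh.dcoef.hasSum hu).mul_left u
  have h5 := (polyBdd_gcoef A B hD).hasSum_succ hu
  rw [gcoef_zero] at h3 h5
  have h6 := (((h1.mul_left (C + D)).add h2).sub (h3.mul_left D)).sub h4
  have h7 := h6.unique ((h5.mul_left (-D)).congr_fun fun n => ?_)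
  · rw [gauss, gauss', gauss]; linear_combination h7
  have hDn : D + 1 + n ≠ 0 := fun h => hD1 n (by linear_combination h)
  have hD0 : D ≠ 0 := by simpa using hD 0
  have hn : (n + 1 : ℂ) ≠ 0 := by exact_mod_cast n.succ_ne_zero
  have hs := gcoef_succ (A + 1) (B + 1) hD1 n
  have hs' : gcoef (A + 1) (B + 1) (D + 1) (n + 1) = (A + 1 + n) * (B + 1 + n) *
      gcoef (A + 1) (B + 1) (D + 1) n / ((n + 1) * (D + 1 + n)) := by
    rw [eq_div_iff (mul_ne_zero hn hDn)]; linear_combination hs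
  have e2 : gcoef A B D (n + 1) = A * B * gcoef (A + 1) (B + 1) (D + 1) n / (D * (n + 1)) := by
    have h9 : (n.factorial : ℂ) ≠ 0 := by exact_mod_cast n.factorial_ne_zero
    have h8 := asc_ne_zero hD1 n
    simp only [gcoef, asc_succ_left, Nat.factorial_succ]
    push_cast
    field_simp
  simp only [dcoef]
  rw [hs', e2]
  obtain rfl : C = A + B + 1 - D := by linear_combination -hCD
  field_simp
  ring

/-- The regular solution at `1`. -/
def sol₁ (A B C y : ℂ) : ℂ := gauss A B (A + B + 1 - C) (1 - y)

/-- The derivative of `sol₁`. -/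
def sol₁' (A B C y : ℂ) : ℂ := -gauss' A B (A + B + 1 - C) (1 - y)

/-- The singular solution at `1`. -/
def sol₂ (A B C y : ℂ) : ℂ :=
  (1 - y) ^ (C - A - B) * gauss (C - A) (C - B) (C - A - B + 1) (1 - y)

/-- The derivative of `sol₂`. -/
def sol₂' (A B C y : ℂ) : ℂ :=
  (1 - y) ^ (C - A - B) * (-gauss' (C - A) (C - B) (C - A - B + 1) (1 - y) -
    (C - A - B) * gauss (C - A) (C - B) (C - A - B + 1) (1 - y) / (1 - y))

lemma solvesHG_sol₁ {A B C : ℂ} (h : NotInt (C - A - B)) :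
    SolvesHG A B C lens (sol₁ A B C) (sol₁' A B C) := by
  have h1 := (solvesHG_gauss A B (C := A + B + 1 - C)
    (h.of_eq_sub 1 (by push_cast; ring)).ne_neg).reflect
  rw [sub_sub_cancel] at h1
  exact h1.mono fun y hy => mem_ball_zero_iff.2 (mem_lens.1 hy).2

lemma solvesHG_sol₂ {A B C : ℂ} (h : NotInt (C - A - B)) :
    SolvesHG A B C lens (sol₂ A B C) (sol₂' A B C) := by
  have h1 := (solvesHG_gauss (C - A) (C - B) (C := C - A - B + 1)
    (h.of_eq_add 1 (by push_cast; ring)).ne_neg).reflect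
  rw [show C - A + (C - B) + 1 - (C - A - B + 1) = C by ring] at h1
  exact (h1.mono fun y hy => mem_ball_zero_iff.2 (mem_lens.1 hy).2).cpow_mul
    fun y hy => one_sub_slit_of_norm_lt (mem_lens.1 hy).1

/-- Makes limits for y → 1 inside the lens unique; the constants below are evaluated by such limits.
-/
instance : (𝓝[lens] (1 : ℂ)).NeBot := by
  rw [← mem_closure_iff_nhdsWithin_neBot]
  rw [Metric.mem_closure_iff]
  intro ε hε
  have h0 : 0 < min ε 1 / 2 := by positivity
  have h1 : min ε 1 ≤ 1 := min_le_right _ _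
  have h2 : min ε 1 ≤ ε := min_le_left _ _
  refine ⟨((1 - min ε 1 / 2 : ℝ) : ℂ), mem_lens.2 ⟨?_, ?_⟩, ?_⟩
  · rw [Complex.norm_real, Real.norm_eq_abs, abs_lt]
    constructor <;> linarith
  · rw [show (1 : ℂ) - ((1 - min ε 1 / 2 : ℝ) : ℂ) = ((min ε 1 / 2 : ℝ) : ℂ) by push_cast; ring,
      Complex.norm_real, Real.norm_eq_abs, abs_of_pos h0]
    linarith
  · rw [dist_eq_norm, show (1 : ℂ) - ((1 - min ε 1 / 2 : ℝ) : ℂ) = ((min ε 1 / 2 : ℝ) : ℂ) by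
      push_cast; ring, Complex.norm_real, Real.norm_eq_abs, abs_of_pos h0]
    linarith

lemma continuousAt_gauss_one_sub (A B : ℂ) {D : ℂ} (hD : ∀ k : ℕ, D ≠ -(k : ℂ)) :
    ContinuousAt (fun y => gauss A B D (1 - y)) 1 ∧ ContinuousAt (fun y => gauss' A B D (1 - y)) 1 := by
  have h := solvesHG_gauss A B hD 0 (by simp)
  obtain ⟨h1, w, h2, -⟩ := h
  exact ⟨h1.continuousAt.comp_of_eq (by fun_prop) (by simp),
    h2.continuousAt.comp_of_eq (by fun_prop) (by simp)⟩

/-- The weighted Wronskian is constant on the lens, and its value is found by letting y tend to 1.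
Since C - A - B is not zero, the two solutions at 1 are independent. -/
lemma wronsk_sol {A B C : ℂ} (h : NotInt (C - A - B)) {y : ℂ} (hy : y ∈ lens) :
    y ^ C * (1 - y) ^ (A + B - C + 1) *
      wronsk (sol₁ A B C) (sol₁' A B C) (sol₂ A B C) (sol₂' A B C) y = -(C - A - B) := by
  obtain ⟨k, hk⟩ := (solvesHG_sol₁ h).wronsk_const (solvesHG_sol₂ h)
  rw [hk y hy]
  have hc1 := continuousAt_gauss_one_sub A B (D := A + B + 1 - C)
    (h.of_eq_sub 1 (by push_cast; ring)).ne_neg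
  have hc2 := continuousAt_gauss_one_sub (C - A) (C - B) (D := C - A - B + 1)
    (h.of_eq_add 1 (by push_cast; ring)).ne_neg
  -- The weighted Wronskian with the powers of 1 - y multiplied together beforehand: the exponents
  -- add up to 1, which cancels the denominator 1 - y in `sol₂'`, so this form is continuous at 1.
  let E : ℂ → ℂ := fun y => y ^ C * (gauss A B (A + B + 1 - C) (1 - y) *
      (-((1 - y) * gauss' (C - A) (C - B) (C - A - B + 1) (1 - y)) -
        (C - A - B) * gauss (C - A) (C - B) (C - A - B + 1) (1 - y)) +
      (1 - y) * gauss' A B (A + B + 1 - C) (1 - y) *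
        gauss (C - A) (C - B) (C - A - B + 1) (1 - y))
  have hE : ContinuousAt E 1 := by
    have h1 : ContinuousAt (fun y : ℂ => y ^ C) 1 :=
      continuousAt_id.cpow continuousAt_const (by simp)
    have h2 : ContinuousAt (fun y : ℂ => 1 - y) 1 := by fun_prop
    exact h1.mul ((hc1.1.mul ((h2.mul hc2.2).neg.sub (continuousAt_const.mul hc2.1))).add
      ((h2.mul hc1.2).mul hc2.1))
  have hE1 : E 1 = -(C - A - B) := by simp [E, gauss_zero]
  have hEk : ∀ y ∈ lens, E y = k := by
    intro y hy
    rw [← hk y hy]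
    have hu := one_sub_slit_of_norm_lt (mem_lens.1 hy).1
    have hu0 := Complex.slitPlane_ne_zero hu
    have hp : (1 - y) ^ (A + B - C + 1) * (1 - y) ^ (C - A - B) = 1 - y := by
      rw [← Complex.cpow_add _ _ hu0, show A + B - C + 1 + (C - A - B) = 1 by ring,
        Complex.cpow_one]
    simp only [E, wronsk, sol₁, sol₁', sol₂, sol₂']
    set p := (1 - y) ^ (A + B - C + 1)
    set q := (1 - y) ^ (C - A - B)
    have : ∀ X Y Z V : ℂ, y ^ C * p * (X * (q * (Y - Z / (1 - y))) - V) =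
        y ^ C * (X * (p * q) * (Y - Z / (1 - y))) - y ^ C * p * V := by intros; ring
    rw [this, hp]
    field_simp
    linear_combination (-(y ^ C) * gauss' A B (A + B + 1 - C) (1 - y) *
        gauss (C - A) (C - B) (C - A - B + 1) (1 - y)) * hp
  have h1 : Tendsto E (𝓝[lens] 1) (𝓝 (E 1)) := hE.tendsto.mono_left nhdsWithin_le_nhds
  have h2 : Tendsto E (𝓝[lens] 1) (𝓝 k) :=
    tendsto_const_nhds.congr' (eventually_nhdsWithin_of_forall fun y hy => (hEk y hy).symm)
  rw [← hE1, tendsto_nhds_unique h1 h2]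

lemma wronsk_sol_ne_zero {A B C : ℂ} (h : NotInt (C - A - B)) {y : ℂ} (hy : y ∈ lens) :
    wronsk (sol₁ A B C) (sol₁' A B C) (sol₂ A B C) (sol₂' A B C) y ≠ 0 := by
  intro h0
  have := wronsk_sol h hy
  rw [h0, mul_zero, eq_comm, neg_eq_zero] at this
  exact h 0 (by simpa using this)

/-- `P` and `Q` are the connection coefficients of Gauss's function at `1`. -/
def IsConn (A B C P Q : ℂ) : Prop :=
  ∀ y ∈ lens, gauss A B C y = P * sol₁ A B C y + Q * sol₂ A B C y

/-- Cramer's rule: the coefficients are quotients of Wronskians, and after multiplication by the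
common integrating factor numerator and denominator are constants. -/
lemma exists_isConn {A B C : ℂ} (hC : ∀ k : ℕ, C ≠ -(k : ℂ)) (h : NotInt (C - A - B)) :
    ∃ P Q, IsConn A B C P Q := by
  have h0 : SolvesHG A B C lens (gauss A B C) (gauss' A B C) :=
    (solvesHG_gauss A B hC).mono fun y hy => hy.1
  obtain ⟨k1, hk1⟩ := h0.wronsk_const (solvesHG_sol₂ h)
  obtain ⟨k2, hk2⟩ := (solvesHG_sol₁ h).wronsk_const h0
  have hγ : -(C - A - B) ≠ 0 := neg_ne_zero.2 (by simpa using h 0)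
  refine ⟨k1 / -(C - A - B), k2 / -(C - A - B), fun y hy => ?_⟩
  have h3 := wronsk_sol h hy
  have h1 := hk1 y hy
  have h2 := hk2 y hy
  simp only [wronsk] at h1 h2 h3
  rw [div_mul_eq_mul_div, div_mul_eq_mul_div, ← add_div, eq_div_iff hγ, ← h1, ← h2]
  linear_combination -(gauss A B C y) * h3

lemma isConn_unique {A B C P Q P' Q' : ℂ} (h : NotInt (C - A - B)) (h1 : IsConn A B C P Q)
    (h2 : IsConn A B C P' Q') : P = P' ∧ Q = Q' := by
  have hy : (1 / 2 : ℂ) ∈ lens := mem_lens.2 (by norm_num)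
  have hz : ∀ y ∈ lens, (P - P') * sol₁ A B C y + (Q - Q') * sol₂ A B C y = 0 := fun y hy => by
    linear_combination h2 y hy - h1 y hy
  have hd := (((solvesHG_sol₁ h) _ hy).1.const_mul (P - P')).add
    (((solvesHG_sol₂ h) _ hy).1.const_mul (Q - Q'))
  have hd2 := hd.unique ((hasDerivAt_const (1 / 2 : ℂ) (0 : ℂ)).congr_of_eventuallyEq
    (Filter.eventually_of_mem (isOpen_lens.mem_nhds hy) hz))
  have hw := wronsk_sol_ne_zero h hy
  have hz2 := hz _ hy
  simp only [wronsk] at hw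
  constructor
  · refine sub_eq_zero.1 ((mul_eq_zero.1 ?_).resolve_right hw)
    linear_combination sol₂' A B C (1 / 2) * hz2 - sol₂ A B C (1 / 2) * hd2
  · refine sub_eq_zero.1 ((mul_eq_zero.1 ?_).resolve_right hw)
    linear_combination sol₁ A B C (1 / 2) * hd2 - sol₁' A B C (1 / 2) * hz2

/-- The operator C + y d/dy is applied to both sides of the connection relation for C + 1; by the
three contiguous relations every term becomes a multiple of the corresponding function for C. -/
lemma IsConn.shift {A B C P Q : ℂ} (hC : ∀ k : ℕ, C ≠ -(k : ℂ)) (h : NotInt (C - A - B))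
    (hc : IsConn A B (C + 1) P Q) :
    IsConn A B C ((C - A) * (C - B) / (C * (C - A - B)) * P) (-(C - A - B + 1) / C * Q) := by
  have h' : NotInt (C + 1 - A - B) := h.of_eq_add 1 (by push_cast; ring)
  have hC0 : C ≠ 0 := by simpa using hC 0
  have hγ : C - A - B ≠ 0 := by simpa using h 0
  have hC1 : ∀ k : ℕ, C + 1 ≠ -(k : ℂ) := fun k h => hC (k + 1) (by push_cast; linear_combination h)
  intro y hy
  have hd0 := (solvesHG_gauss A B hC1 y hy.1).1
  have hd := (((solvesHG_sol₁ h') _ hy).1.const_mul P).add (((solvesHG_sol₂ h') _ hy).1.const_mul Q)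
  have hd1 := hd0.unique (hd.congr_of_eventuallyEq
    (Filter.eventually_of_mem (isOpen_lens.mem_nhds hy) hc))
  obtain ⟨hy1, hy2⟩ := mem_lens.1 hy
  have e1 := gauss_lower_contiguous A B hC hy1
  have e2 := gauss_raise_contiguous A B C (D := A + B - C)
    (h.of_eq_sub 0 (by push_cast; ring)).ne_neg (by ring) hy2
  have e3 := gauss_singular_contiguous (A := C - A) (B := C - B) (C := C) (D := C - A - B + 1)
    (h.of_eq_add 1 (by push_cast; ring)).ne_neg (by ring) hy2
  have hu0 := Complex.slitPlane_ne_zero (one_sub_slit_of_norm_lt hy1)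
  have hp : (1 - y) ^ (C + 1 - A - B) = (1 - y) ^ (C - A - B) * (1 - y) := by
    rw [show C + 1 - A - B = C - A - B + 1 by ring, Complex.cpow_add _ _ hu0, Complex.cpow_one]
  rw [hc y hy, hd1] at e1
  simp only [sol₁, sol₁', sol₂, sol₂', hp] at e1 ⊢
  rw [show A + B + 1 - (C + 1) = A + B - C by ring, show C + 1 - A - B + 1 = C - A - B + 1 + 1 by ring,
    show C + 1 - A = C - A + 1 by ring, show C + 1 - B = C - B + 1 by ring] at e1
  rw [show A + B + 1 - C = A + B - C + 1 by ring]
  have e2' : C * gauss A B (A + B - C) (1 - y) - (1 - (1 - y)) * gauss' A B (A + B - C) (1 - y) =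
      (C - A) * (C - B) / (C - A - B) * gauss A B (A + B - C + 1) (1 - y) := by
    field_simp
    linear_combination -e2
  refine mul_left_cancel₀ hC0 (e1.trans ?_)
  set p := (1 - y) ^ (C - A - B)
  have hdiv : ∀ X : ℂ, X / (1 - y) * (1 - y) = X := fun X => div_mul_cancel₀ _ hu0
  have e4 : C * ((C - A) * (C - B) / (C * (C - A - B)) * P * gauss A B (A + B - C + 1) (1 - y) +
      -(C - A - B + 1) / C * Q * (p * gauss (C - A) (C - B) (C - A - B + 1) (1 - y))) =
      P * ((C - A) * (C - B) / (C - A - B) * gauss A B (A + B - C + 1) (1 - y)) +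
      Q * p * (-(C - A - B + 1) * gauss (C - A) (C - B) (C - A - B + 1) (1 - y)) := by
    field_simp
  rw [e4, ← e2', ← e3]
  field_simp
  ring

end

/-! ### The values of the connection coefficients; Euler's transformation -/

noncomputable section

/-- If C - A - B has positive real part, the singular solution vanishes at 1 and the regular one
equals 1 there, so P is the boundary value of Gauss's function. -/
lemma IsConn.tendsto {A B C P Q : ℂ} (h : NotInt (C - A - B)) (hγ : 0 < (C - A - B).re)
    (hc : IsConn A B C P Q) : Tendsto (gauss A B C) (𝓝[lens] 1) (𝓝 P) := by
  have hc1 := continuousAt_gauss_one_sub A B (D := A + B + 1 - C)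
    (h.of_eq_sub 1 (by push_cast; ring)).ne_neg
  have hc2 := continuousAt_gauss_one_sub (C - A) (C - B) (D := C - A - B + 1)
    (h.of_eq_add 1 (by push_cast; ring)).ne_neg
  have hp : ContinuousAt (fun y : ℂ => (1 - y) ^ (C - A - B)) 1 := by
    refine ContinuousAt.comp_of_eq (g := fun u : ℂ => u ^ (C - A - B)) (y := 0)
      (Complex.continuousAt_cpow_const_of_re_pos (by simp) hγ) (by fun_prop) (by simp)
  have h1 : ContinuousAt (fun y => P * sol₁ A B C y + Q * sol₂ A B C y) 1 :=
    (continuousAt_const.mul hc1.1).add (continuousAt_const.mul (hp.mul hc2.1))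
  have h2 := h1.tendsto.mono_left (nhdsWithin_le_nhds (s := lens))
  have h3 : P * sol₁ A B C 1 + Q * sol₂ A B C 1 = P := by
    have : C - A - B ≠ 0 := by simpa using h 0
    simp [sol₁, sol₂, gauss_zero, Complex.zero_cpow this]
  rw [h3] at h2
  exact h2.congr' (eventually_nhdsWithin_of_forall fun y hy => (hc y hy).symm)

lemma IsConn.norm_sub_one_le {A B C P Q : ℂ} (hC : ∀ k : ℕ, C ≠ -(k : ℂ))
    (h : NotInt (C - A - B)) (hγ : 0 < (C - A - B).re) (hc : IsConn A B C P Q)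
    (hs : Summable fun n => ‖gcoef A B C (n + 1)‖) :
    ‖P - 1‖ ≤ ∑' n, ‖gcoef A B C (n + 1)‖ := by
  refine le_of_tendsto ((hc.tendsto h hγ).sub_const 1).norm
    (eventually_nhdsWithin_of_forall fun y hy => ?_)
  have h1 := (polyBdd_gcoef A B hC).hasSum_succ (mem_lens.1 hy).1
  rw [gcoef_zero] at h1
  refine h1.norm_le_of_bounded hs.hasSum fun n => ?_
  rw [norm_mul, norm_pow]
  exact mul_le_of_le_one_right (norm_nonneg _) (pow_le_one₀ (norm_nonneg _) (mem_lens.1 hy).1.le)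

lemma factorial_div_le_norm_asc {w : ℂ} {k : ℕ} (hw : (k : ℝ) + 1 ≤ w.re) (n : ℕ) :
    ((n + k).factorial : ℝ) / k.factorial ≤ ‖asc w n‖ := by
  induction n with
  | zero =>
    rw [asc_zero, norm_one, zero_add, div_self (by positivity)]
  | succ n ih =>
    rw [asc_succ, norm_mul, show n + 1 + k = n + k + 1 by ring, Nat.factorial_succ]
    have h1 : ((n + k + 1 : ℕ) : ℝ) ≤ ‖w + n‖ := by
      refine le_trans ?_ (Complex.re_le_norm _)
      simp
      linarith
    push_cast at h1 ⊢
    calc _ = (((n + k).factorial : ℝ) / k.factorial) * (n + k + 1) := by ring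
      _ ≤ _ := by gcongr

/-- The tail of F(A, B; C+N; ·) beyond its constant term tends to 0 uniformly on the closed disc:
each coefficient tends to 0 because (C+N)_(n+1) grows with N, and dominated convergence applies. -/
lemma tendsto_tsum_gcoef (A B C : ℂ) :
    (∀ᶠ N : ℕ in atTop, Summable fun n => ‖gcoef A B (C + N) (n + 1)‖) ∧
    Tendsto (fun N : ℕ => ∑' n, ‖gcoef A B (C + N) (n + 1)‖) atTop (𝓝 0) := by
  obtain ⟨K1, hK1, M1, H1⟩ := asc_norm_le A
  obtain ⟨K2, hK2, M2, H2⟩ := asc_norm_le B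
  -- M1 + M2 cancels the polynomial growth of (A)_n and (B)_n, and the additional 2 leaves the
  -- summable majorant 1/(n+1)².
  set k := M1 + M2 + 2 with hk
  have hre : ∀ᶠ N : ℕ in atTop, (k : ℝ) + 1 ≤ (C + N).re := by
    have : Tendsto (fun N : ℕ => (C + N).re) atTop atTop := by
      simp only [Complex.add_re, Complex.natCast_re]
      exact tendsto_atTop_add_const_left _ _ tendsto_natCast_atTop_atTop
    exact this.eventually_ge_atTop _
  have hfac : ∀ n : ℕ, (n.factorial : ℝ) * (n + 1) ^ k ≤ (n + k).factorial := fun n => by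
    exact_mod_cast Nat.factorial_mul_pow_le_factorial (m := n) (n := k)
  have hb : ∀ w : ℂ, (k : ℝ) + 1 ≤ w.re → ∀ n, ‖gcoef A B w n‖ ≤
      K1 * K2 * k.factorial * (1 / (n + 1 : ℝ) ^ 2) := by
    intro w hw n
    have h1 := factorial_div_le_norm_asc hw n
    have h2 : (n.factorial : ℝ) * (n + 1) ^ k / k.factorial ≤ ‖asc w n‖ :=
      le_trans (by gcongr; exact hfac n) h1
    have h3 : 0 < (n.factorial : ℝ) * (n + 1) ^ k / k.factorial := by positivity
    rw [gcoef, norm_div, norm_mul, norm_mul, Complex.norm_natCast]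
    calc ‖asc A n‖ * ‖asc B n‖ / (‖asc w n‖ * n.factorial)
        ≤ (K1 * (1 + n : ℝ) ^ M1 * n.factorial) * (K2 * (1 + n : ℝ) ^ M2 * n.factorial) /
          (((n.factorial : ℝ) * (n + 1) ^ k / k.factorial) * n.factorial) := by
          gcongr; exacts [H1 n, H2 n]
      _ = _ := by
        rw [hk, pow_add, pow_add, add_comm (1 : ℝ)]
        field_simp
  have hsum : Summable fun n : ℕ => K1 * K2 * k.factorial * (1 / (((n + 1 : ℕ) : ℝ) + 1) ^ 2) := by
    have h := (summable_nat_add_iff (f := fun n : ℕ => 1 / (n : ℝ) ^ 2) 2).2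
      (Real.summable_one_div_nat_pow.2 one_lt_two)
    refine (h.congr fun n => ?_).mul_left _
    push_cast
    ring_nf
  refine ⟨hre.mono fun N hN => hsum.of_nonneg_of_le (fun n => norm_nonneg _)
    fun n => hb _ hN (n + 1), ?_⟩
  have h0 : (0 : ℝ) = ∑' _ : ℕ, (0 : ℝ) := by simp
  rw [h0]
  refine tendsto_tsum_of_dominated_convergence hsum (fun n => ?_)
    (hre.mono fun N hN n => by rw [norm_norm]; exact hb _ hN (n + 1))
  have hlim : Tendsto (fun N : ℕ => ‖asc A (n + 1)‖ * ‖asc B (n + 1)‖ / (C + N).re) atTop (𝓝 0) := by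
    refine tendsto_const_nhds.div_atTop ?_
    simp only [Complex.add_re, Complex.natCast_re]
    exact tendsto_atTop_add_const_left _ _ tendsto_natCast_atTop_atTop
  refine squeeze_zero' (Eventually.of_forall fun _ => norm_nonneg _) ?_ hlim
  filter_upwards [hre] with N hN
  have hk0 : (0 : ℝ) ≤ k := k.cast_nonneg
  have h1 : (C + N).re ≤ ‖asc (C + N) (n + 1)‖ := by
    rw [asc_succ_left, norm_mul]
    refine (Complex.re_le_norm _).trans (le_mul_of_one_le_right (norm_nonneg _) ?_)
    have := factorial_div_le_norm_asc (w := C + N + 1) (k := 0) (by simp at hN ⊢; linarith) n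
    refine le_trans ?_ this
    simp only [add_zero, Nat.factorial_zero, Nat.cast_one, div_one]
    exact_mod_cast n.factorial_pos
  rw [gcoef, norm_div, norm_mul, norm_mul, Complex.norm_natCast]
  have h2 : (1 : ℝ) ≤ (n + 1).factorial := by exact_mod_cast (n + 1).factorial_pos
  have h3 : 0 < (C + N).re := by linarith
  gcongr
  exact h1.trans (le_mul_of_one_le_right (norm_nonneg _) h2)

lemma IsConn.shift_nat {A B : ℂ} (N : ℕ) : ∀ {C P Q : ℂ}, (∀ k : ℕ, C ≠ -(k : ℂ)) →
    NotInt (C - A - B) → IsConn A B (C + N) P Q →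
    ∃ Q', IsConn A B C
      (asc (C - A) N * asc (C - B) N / (asc C N * asc (C - A - B) N) * P) Q' := by
  induction N with
  | zero => intro C P Q hC h hc; exact ⟨Q, by simpa [asc_zero] using hc⟩
  | succ N ih =>
    intro C P Q hC h hc
    have hCN : ∀ k : ℕ, C + N ≠ -(k : ℂ) := fun k h => hC (k + N) (by
      push_cast; linear_combination h)
    have hN : NotInt (C + N - A - B) := h.of_eq_add N (by push_cast; ring)
    have h1 : IsConn A B (C + N + 1) P Q := by
      rw [show C + N + 1 = C + ((N + 1 : ℕ) : ℂ) by push_cast; ring]; exact hc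
    obtain ⟨Q', h2⟩ := ih hC h (h1.shift hCN hN)
    refine ⟨Q', ?_⟩
    convert! h2 using 1
    have e1 : C + N ≠ 0 := by simpa using hCN 0
    have e2 : C + N - A - B ≠ 0 := by simpa using hN 0
    have e3 : C - A - B + N ≠ 0 := by rwa [show C - A - B + N = C + N - A - B by ring]
    have e4 := asc_ne_zero hC N
    have e5 := asc_ne_zero h.ne_neg N
    simp only [asc_succ]
    rw [show C + N - A - B = C - A - B + N by ring]
    field_simp
    ring

lemma asc_eq_prod (s : ℂ) (n : ℕ) : asc s n = ∏ j ∈ Finset.range n, (s + j) := by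
  induction n with
  | zero => simp [asc_zero]
  | succ n ih => rw [asc_succ, ih, Finset.prod_range_succ]

/-- Euler's limit Γ(s) = lim n^s n!/(s)_(n+1) is used for all four parameters; the powers of n
cancel because a + b = c + d. -/
lemma tendsto_asc_ratio {a b c d : ℂ} (h : a + b = c + d) (ha : ∀ k : ℕ, a ≠ -(k : ℂ))
    (hb : ∀ k : ℕ, b ≠ -(k : ℂ)) :
    Tendsto (fun n : ℕ => asc a (n + 1) * asc b (n + 1) / (asc c (n + 1) * asc d (n + 1))) atTop
      (𝓝 (Complex.Gamma c * Complex.Gamma d / (Complex.Gamma a * Complex.Gamma b))) := by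
  have h1 := ((Complex.GammaSeq_tendsto_Gamma c).mul (Complex.GammaSeq_tendsto_Gamma d)).div
    ((Complex.GammaSeq_tendsto_Gamma a).mul (Complex.GammaSeq_tendsto_Gamma b))
    (mul_ne_zero (Complex.Gamma_ne_zero ha) (Complex.Gamma_ne_zero hb))
  refine h1.congr' ?_
  filter_upwards [eventually_ge_atTop 1] with n hn
  have hn0 : (n : ℂ) ≠ 0 := by exact_mod_cast (by omega : n ≠ 0)
  have e1 : (n : ℂ) ^ a * (n : ℂ) ^ b = (n : ℂ) ^ c * (n : ℂ) ^ d := by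
    rw [← Complex.cpow_add _ _ hn0, ← Complex.cpow_add _ _ hn0, h]
  have h2 := asc_ne_zero ha (n + 1)
  have h3 := asc_ne_zero hb (n + 1)
  have h4 : (n.factorial : ℂ) ≠ 0 := by exact_mod_cast n.factorial_ne_zero
  have p1 : (n : ℂ) ^ c ≠ 0 := by simp [Complex.cpow_eq_zero_iff, hn0]
  have p2 : (n : ℂ) ^ d ≠ 0 := by simp [Complex.cpow_eq_zero_iff, hn0]
  have p3 : (n : ℂ) ^ a ≠ 0 := by simp [Complex.cpow_eq_zero_iff, hn0]
  have p4 : (n : ℂ) ^ b ≠ 0 := by simp [Complex.cpow_eq_zero_iff, hn0]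
  simp only [Pi.div_apply, Complex.GammaSeq, ← asc_eq_prod]
  rw [div_mul_div_comm, div_mul_div_comm, div_div_div_eq,
    show (n : ℂ) ^ c * n.factorial * ((n : ℂ) ^ d * n.factorial) =
      (n : ℂ) ^ a * n.factorial * ((n : ℂ) ^ b * n.factorial) by
      linear_combination -(n.factorial : ℂ) ^ 2 * e1]
  rw [mul_comm, mul_div_mul_right _ _ (by simp [p3, p4, h4])]

/-- Shifting C by N multiplies P by an explicit quotient of Pochhammer symbols, and the coefficient
for C + N tends to 1. Hence P is the limit of these quotients. In this way no condition on the sign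
of the real part of C - A - B is needed. -/
theorem IsConn.left_eq {A B C P Q : ℂ} (hC : ∀ k : ℕ, C ≠ -(k : ℂ)) (h : NotInt (C - A - B))
    (hA : ∀ k : ℕ, C - A ≠ -(k : ℂ)) (hB : ∀ k : ℕ, C - B ≠ -(k : ℂ)) (hc : IsConn A B C P Q) :
    P = Complex.Gamma C * Complex.Gamma (C - A - B) /
      (Complex.Gamma (C - A) * Complex.Gamma (C - B)) := by
  have hCN : ∀ N k : ℕ, C + N ≠ -(k : ℂ) := fun N k h => hC (k + N) (by
      push_cast; linear_combination h)
  have hN : ∀ N : ℕ, NotInt (C + N - A - B) := fun N => h.of_eq_add N (by push_cast; ring)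
  choose p q hpq using fun N : ℕ => exists_isConn (hCN N) (hN N)
  have hP : ∀ N : ℕ, asc (C - A) N * asc (C - B) N / (asc C N * asc (C - A - B) N) * p N = P := by
    intro N
    obtain ⟨Q', h'⟩ := (hpq N).shift_nat N hC h
    exact (isConn_unique h h' hc).1
  have hlim : Tendsto p atTop (𝓝 1) := by
    obtain ⟨h1, h2⟩ := tendsto_tsum_gcoef A B C
    rw [tendsto_iff_norm_sub_tendsto_zero]
    refine squeeze_zero' (Eventually.of_forall fun _ => norm_nonneg _) ?_ h2
    have hre : ∀ᶠ N : ℕ in atTop, 0 < (C + N - A - B).re := by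
      have : Tendsto (fun N : ℕ => (C + N - A - B).re) atTop atTop := by
        simp only [Complex.add_re, Complex.sub_re, Complex.natCast_re, add_sub_right_comm _ (_ : ℝ)]
        exact tendsto_atTop_add_const_left _ _ tendsto_natCast_atTop_atTop
      exact this.eventually_gt_atTop _
    filter_upwards [h1, hre] with N hs hr
    exact (hpq N).norm_sub_one_le (hCN N) (hN N) hr hs
  have h3 := (tendsto_asc_ratio (a := C - A) (b := C - B) (c := C) (d := C - A - B) (by ring) hA
    hB).mul ((tendsto_add_atTop_iff_nat 1).2 hlim)
  rw [mul_one] at h3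
  exact tendsto_nhds_unique (tendsto_const_nhds.congr fun n => (hP (n + 1)).symm) h3

/-- If W were not identically zero near 0, then W = y^n g with g(0) ≠ 0, and comparison of the
lowest terms in Abel's equation would give n = -C, which is excluded. So the solution that is
holomorphic at 0 is unique up to a factor. -/
lemma wronsk_eventually_zero {A B C : ℂ} (hC : ∀ k : ℕ, C ≠ -(k : ℂ)) {W : ℂ → ℂ}
    (hW : AnalyticAt ℂ W 0)
    (hd : ∀ᶠ y in 𝓝 (0 : ℂ), y * (1 - y) * deriv W y = -(C - (A + B + 1) * y) * W y) :
    ∀ᶠ y in 𝓝 (0 : ℂ), W y = 0 := by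
  by_contra h0
  obtain ⟨n, g, hg, hg0, he⟩ := hW.exists_eventuallyEq_pow_smul_nonzero_iff.2 h0
  simp only [sub_zero, smul_eq_mul] at he
  have h1 : ∀ᶠ y in 𝓝[≠] (0 : ℂ), (1 - y) * (n * g y + y * deriv g y) +
      (C - (A + B + 1) * y) * g y = 0 := by
    have he' := eventually_eventually_nhds.2 he
    filter_upwards [nhdsWithin_le_nhds he', nhdsWithin_le_nhds he, nhdsWithin_le_nhds hd,
      nhdsWithin_le_nhds hg.eventually_analyticAt, self_mem_nhdsWithin] with y e1 e2 e3 e4 e5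
    have e5' : y ≠ 0 := e5
    have e6 : deriv W y = n * y ^ (n - 1) * g y + y ^ n * deriv g y := by
      rw [Filter.EventuallyEq.deriv_eq e1]
      have := (hasDerivAt_pow n y).mul e4.differentiableAt.hasDerivAt
      exact this.deriv
    rw [e6, e2] at e3
    have e7 : y * (n * y ^ (n - 1)) = n * y ^ n := by
      cases n with
      | zero => simp
      | succ m => simp; ring
    refine mul_left_cancel₀ (pow_ne_zero n e5') ?_
    linear_combination e3 - (1 - y) * g y * e7
  have hc : ContinuousAt (fun y => (1 - y) * (n * g y + y * deriv g y) +
      (C - (A + B + 1) * y) * g y) 0 := by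
    have c1 := hg.continuousAt
    have c2 := hg.deriv.continuousAt
    fun_prop
  have h2 := tendsto_nhds_unique (hc.tendsto.mono_left nhdsWithin_le_nhds)
    (tendsto_const_nhds.congr' (h1.mono fun y hy => hy.symm))
  simp only [sub_zero, one_mul, zero_mul, add_zero, mul_zero] at h2
  have h3 : (n + C) * g 0 = 0 := by linear_combination h2
  exact hC n (by linear_combination (mul_eq_zero.1 h3).resolve_right hg0)

lemma SolvesHG.analyticOnNhd {A B C : ℂ} {S : Set ℂ} {w w' : ℂ → ℂ} (hS : IsOpen S)
    (h : SolvesHG A B C S w w') : AnalyticOnNhd ℂ w S ∧ AnalyticOnNhd ℂ w' S := by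
  refine ⟨DifferentiableOn.analyticOnNhd (fun y hy => ?_) hS,
    DifferentiableOn.analyticOnNhd (fun y hy => ?_) hS⟩
  · exact (h y hy).1.differentiableAt.differentiableWithinAt
  · obtain ⟨-, w'', h2, -⟩ := h y hy
    exact h2.differentiableAt.differentiableWithinAt

/-- Euler's transformation. -/
theorem gauss_euler (A B : ℂ) {C : ℂ} (hC : ∀ k : ℕ, C ≠ -(k : ℂ)) {y : ℂ} (hy : ‖y‖ < 1) :
    gauss A B C y = (1 - y) ^ (C - A - B) * gauss (C - A) (C - B) C y := by
  have h1 := solvesHG_gauss A B hC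
  have h2 := (solvesHG_gauss (C - A) (C - B) hC).cpow_mul (A := A) (B := B)
    fun y hy => one_sub_slit_of_norm_lt (mem_ball_zero_iff.1 hy)
  set v := fun y => (1 - y) ^ (C - A - B) * gauss (C - A) (C - B) C y with hv
  set v' := fun y => (1 - y) ^ (C - A - B) * (gauss' (C - A) (C - B) C y -
    (C - A - B) * gauss (C - A) (C - B) C y / (1 - y)) with hv'
  obtain ⟨a1, a2⟩ := h1.analyticOnNhd Metric.isOpen_ball
  obtain ⟨a3, a4⟩ := h2.analyticOnNhd Metric.isOpen_ball
  have h0 : (0 : ℂ) ∈ Metric.ball (0 : ℂ) 1 := by simp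
  have hball := Metric.isOpen_ball.mem_nhds h0
  have hW : AnalyticAt ℂ (wronsk (gauss A B C) (gauss' A B C) v v') 0 :=
    ((a1 0 h0).mul (a4 0 h0)).sub ((a2 0 h0).mul (a3 0 h0))
  -- Both sides solve the same equation and are holomorphic at 0, so their Wronskian vanishes near
  -- 0; their quotient is then constant there, with value 1 at 0.
  have hz := wronsk_eventually_zero (A := A) (B := B) hC hW (by
    filter_upwards [hball] with y hy
    obtain ⟨d, hd1, hd2⟩ := h1.wronsk_deriv h2 hy
    rw [hd1.deriv, hd2])
  have hne : ∀ᶠ y in 𝓝 (0 : ℂ), gauss A B C y ≠ 0 :=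
    (a1 0 h0).continuousAt.eventually_ne (by simp [gauss_zero])
  obtain ⟨r, hr, hrb⟩ := Metric.eventually_nhds_iff_ball.1 (hz.and (hne.and hball))
  have hq : ∀ y ∈ Metric.ball (0 : ℂ) r, HasDerivAt (fun y => v y / gauss A B C y) 0 y := by
    intro y hy
    obtain ⟨e1, e2, e3⟩ := hrb y hy
    have := (h2 y e3).1.div (h1 y e3).1 e2
    convert! this using 1
    rw [eq_comm, div_eq_zero_iff]
    left
    simp only [wronsk] at e1
    linear_combination e1
  have hev : gauss A B C =ᶠ[𝓝 0] v := by
    filter_upwards [Metric.ball_mem_nhds 0 hr] with y hy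
    have hconst := (convex_ball (0 : ℂ) r).is_const_of_fderivWithin_eq_zero (𝕜 := ℂ)
      (f := fun y => v y / gauss A B C y)
      (fun y hy => (hq y hy).differentiableAt.differentiableWithinAt)
      (fun y hy => by
        rw [fderivWithin_of_isOpen Metric.isOpen_ball hy]
        ext; simp [(hq y hy).deriv]) hy (Metric.mem_ball_self hr)
    simp only [hv, gauss_zero, sub_zero, Complex.one_cpow, mul_one, div_one] at hconst
    have := (hrb y hy).2.1
    rw [div_eq_one_iff_eq this] at hconst
    simp only [hv]
    exact hconst.symm
  exact a1.eqOn_of_preconnected_of_eventuallyEq a3 (convex_ball _ _).isPreconnected h0 hev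
    (mem_ball_zero_iff.2 hy)

/-- Gauss's connection formula between `0` and `1`. -/
theorem gauss_connection {A B C : ℂ} (hC : ∀ k : ℕ, C ≠ -(k : ℂ)) (h : NotInt (C - A - B))
    (hA : ∀ k : ℕ, A ≠ -(k : ℂ)) (hB : ∀ k : ℕ, B ≠ -(k : ℂ))
    (hCA : ∀ k : ℕ, C - A ≠ -(k : ℂ)) (hCB : ∀ k : ℕ, C - B ≠ -(k : ℂ)) {y : ℂ}
    (hy : ‖y‖ < 1) (hy' : ‖1 - y‖ < 1) :
    gauss A B C y =
      Complex.Gamma C * Complex.Gamma (C - A - B) /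
        (Complex.Gamma (C - A) * Complex.Gamma (C - B)) * gauss A B (A + B + 1 - C) (1 - y) +
      Complex.Gamma C * Complex.Gamma (A + B - C) / (Complex.Gamma A * Complex.Gamma B) *
        ((1 - y) ^ (C - A - B) * gauss (C - A) (C - B) (C - A - B + 1) (1 - y)) := by
  obtain ⟨P, Q, hc⟩ := exists_isConn hC h
  have h' : NotInt (C - (C - A) - (C - B)) := h.of_eq_sub 0 (by push_cast; ring)
  obtain ⟨P', Q', hc'⟩ := exists_isConn hC h'
  -- Multiplication by (1-y)^(C-A-B), which is Euler's transformation at 0, exchanges the regular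
  -- and the singular solution at 1. So the singular coefficient for (A, B, C) is the regular one
  -- for (C-A, C-B, C), which `left_eq` evaluates.
  have h2 : IsConn A B C Q' P' := by
    intro y hy
    have hu0 := Complex.slitPlane_ne_zero (one_sub_slit_of_norm_lt (mem_lens.1 hy).1)
    have e1 := hc' y hy
    rw [gauss_euler A B hC (mem_lens.1 hy).1, e1]
    simp only [sol₁, sol₂, sub_sub_cancel]
    have hp : (1 - y) ^ (C - A - B) * (1 - y) ^ (A - (C - B)) = 1 := by
      rw [← Complex.cpow_add _ _ hu0, show C - A - B + (A - (C - B)) = 0 by ring, Complex.cpow_zero]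
    rw [show C - A + (C - B) + 1 - C = C - A - B + 1 by ring,
      show A - (C - B) + 1 = A + B + 1 - C by ring]
    linear_combination (Q' * gauss A B (A + B + 1 - C) (1 - y)) * hp
  have e := isConn_unique h hc h2
  have hP := hc.left_eq hC h hCA hCB
  have hP' := hc'.left_eq hC h' (by simpa using hA) (by simpa using hB)
  rw [hc y (mem_lens.2 ⟨hy, hy'⟩), hP, e.2, hP', sub_sub_cancel, sub_sub_cancel,
    show A - (C - B) = A + B - C by ring]
  rfl

end

/-! ### Polynomials in z d/dz applied to a power of 1 - z -/

noncomputable section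

/-- The binomial series. -/
lemma hasSum_one_sub_cpow_neg (s : ℂ) {z : ℂ} (hz : ‖z‖ < 1) :
    HasSum (fun m : ℕ => asc s m / m.factorial * z ^ m) ((1 - z) ^ (-s)) := by
  have h1 : ∀ k : ℕ, (1 : ℂ) ≠ -(k : ℂ) := fun k h => by
    have : ((k + 1 : ℕ) : ℂ) = 0 := by push_cast; linear_combination h
    exact k.succ_ne_zero (by exact_mod_cast this)
  have h2 := (polyBdd_gcoef s 1 h1).hasSum hz
  have h3 := gauss_euler s 1 h1 hz
  -- With B = C = 1 the transformed series has the upper parameter 0 and reduces to its first term,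
  -- so Euler's transformation is the binomial theorem.
  have h4 : gauss (1 - s) (1 - 1) 1 z = 1 := by
    rw [gauss, pser, tsum_eq_single 0 fun n hn => ?_]
    · simp [gcoef, asc_zero]
    · simp [gcoef, asc, hn]
  rw [h4, mul_one, show 1 - s - 1 = -s by ring] at h3
  rw [← h3]
  refine h2.congr_fun fun n => ?_
  have := asc_ne_zero h1 n
  rw [gcoef, mul_comm (asc s n), mul_div_mul_left _ _ this]

section Expansion

variable (β : ℂ) (κ : ℕ → ℂ)

/-- The coefficients of `∏ i < N, (θ + κ i)` applied to `(1 - z) ^ (-β)` in terms of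
`(1 - z) ^ (-(β + j))`, where `θ = z d/dz`. -/
def expCoef : ℕ → ℕ → ℂ
  | 0, j => if j = 0 then 1 else 0
  | N + 1, 0 => (κ N - β) * expCoef N 0
  | N + 1, j + 1 => (κ N - β - (j + 1)) * expCoef N (j + 1) + (β + j) * expCoef N j

lemma expCoef_eq_zero : ∀ N j : ℕ, N < j → expCoef β κ N j = 0 := by
  intro N
  induction N with
  | zero => intro j hj; simp [expCoef, hj.ne']
  | succ N ih =>
    intro j hj
    obtain ⟨j, rfl⟩ := Nat.exists_eq_succ_of_ne_zero (by omega : j ≠ 0)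
    simp [expCoef, ih j (by omega), ih (j + 1) (by omega)]

/-- The recursion in transposed form. It expresses (θ + κ)(1-z)^(-(β+j)) = (κ - β - j)(1-z)^(-(β+j))
+ (β + j)(1-z)^(-(β+j+1)), but with an arbitrary sequence e in place of the powers, so that it can
be applied to their expansion coefficients at 0 and at infinity. -/
lemma expCoef_sum_succ (N : ℕ) (e : ℕ → ℂ) :
    ∑ j ∈ Finset.range (N + 2), expCoef β κ (N + 1) j * e j =
      ∑ j ∈ Finset.range (N + 1), expCoef β κ N j *
        ((κ N - β - j) * e j + (β + j) * e (j + 1)) := by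
  have h1 : ∑ j ∈ Finset.range (N + 1), expCoef β κ N j * ((κ N - β - j) * e j) =
      (κ N - β) * expCoef β κ N 0 * e 0 + ∑ j ∈ Finset.range (N + 1),
        (κ N - β - (j + 1)) * expCoef β κ N (j + 1) * e (j + 1) := by
    have h2 := Finset.sum_range_succ (fun j => expCoef β κ N j * ((κ N - β - j) * e j)) (N + 1)
    rw [expCoef_eq_zero β κ N (N + 1) (by omega), zero_mul, add_zero] at h2
    rw [← h2, Finset.sum_range_succ']
    rw [add_comm]
    congr 1
    · simp; ring
    · refine Finset.sum_congr rfl fun j _ => ?_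
      push_cast; ring
  have h2 : ∑ j ∈ Finset.range (N + 1), expCoef β κ N j *
        ((κ N - β - j) * e j + (β + j) * e (j + 1)) =
      ∑ j ∈ Finset.range (N + 1), expCoef β κ N j * ((κ N - β - j) * e j) +
        ∑ j ∈ Finset.range (N + 1), (β + j) * expCoef β κ N j * e (j + 1) := by
    rw [← Finset.sum_add_distrib]
    exact Finset.sum_congr rfl fun j _ => by ring
  have h3 : ∑ j ∈ Finset.range (N + 1), expCoef β κ (N + 1) (j + 1) * e (j + 1) =
      ∑ j ∈ Finset.range (N + 1), (κ N - β - (j + 1)) * expCoef β κ N (j + 1) * e (j + 1) +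
        ∑ j ∈ Finset.range (N + 1), (β + j) * expCoef β κ N j * e (j + 1) := by
    rw [← Finset.sum_add_distrib]
    exact Finset.sum_congr rfl fun j _ => by simp only [expCoef]; ring
  rw [Finset.sum_range_succ', h2, h1, h3]
  simp only [expCoef]
  ring

/-- One factor θ + κ multiplies the sum of the moduli by at most 3L: at most 2L for staying at the
index j and at most L for moving to j + 1. -/
lemma expCoef_norm_sum {L : ℝ} (N : ℕ) (hκ : ∀ i < N, ‖κ i‖ ≤ L) (hβ : ‖β‖ + N ≤ L) :
    ∑ j ∈ Finset.range (N + 1), ‖expCoef β κ N j‖ ≤ (3 * L) ^ N := by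
  induction N with
  | zero => simp [expCoef]
  | succ N ih =>
    have hL : 0 ≤ L := le_trans (by positivity) hβ
    have hN := ih (fun i hi => hκ i (by omega)) (le_trans (by push_cast; linarith) hβ)
    have h2 := Finset.sum_range_succ (fun j => ‖expCoef β κ N j‖) (N + 1)
    rw [expCoef_eq_zero β κ N (N + 1) (by omega), norm_zero, add_zero, Finset.sum_range_succ'] at h2
    have hb : ∀ j ≤ N, ‖β + j‖ ≤ L := fun j hj => by
      refine (norm_add_le _ _).trans ?_
      rw [Complex.norm_natCast]
      have : (j : ℝ) ≤ N := by exact_mod_cast hj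
      push_cast at hβ
      linarith
    have hc : ∀ j ≤ N + 1, ‖κ N - β - j‖ ≤ 2 * L := fun j hj => by
      have h3 := norm_sub_le (κ N - β) j
      have h4 := norm_sub_le (κ N) β
      have h5 := hκ N (by omega)
      rw [Complex.norm_natCast] at h3
      have : (j : ℝ) ≤ N + 1 := by exact_mod_cast hj
      push_cast at hβ
      linarith
    rw [Finset.sum_range_succ']
    have h3 : ∀ j ∈ Finset.range (N + 1), ‖expCoef β κ (N + 1) (j + 1)‖ ≤
        2 * L * ‖expCoef β κ N (j + 1)‖ + L * ‖expCoef β κ N j‖ := by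
      intro j hj
      have hj' : j ≤ N := by rw [Finset.mem_range] at hj; omega
      simp only [expCoef]
      refine (norm_add_le _ _).trans ?_
      rw [norm_mul, norm_mul]
      have := hc (j + 1) (by omega)
      push_cast at this
      gcongr
      exact hb j hj'
    have h4 : ‖expCoef β κ (N + 1) 0‖ ≤ 2 * L * ‖expCoef β κ N 0‖ := by
      simp only [expCoef, norm_mul]
      have := hc 0 (by omega)
      simp only [Nat.cast_zero, sub_zero] at this
      gcongr
    have h5 := Finset.sum_le_sum h3
    rw [Finset.sum_add_distrib, ← Finset.mul_sum, ← Finset.mul_sum] at h5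
    calc _ ≤ 2 * L * ∑ j ∈ Finset.range (N + 1), ‖expCoef β κ N j‖ +
          L * ∑ j ∈ Finset.range (N + 1), ‖expCoef β κ N j‖ := by
          nlinarith
      _ = 3 * L * ∑ j ∈ Finset.range (N + 1), ‖expCoef β κ N j‖ := by ring
      _ ≤ 3 * L * (3 * L) ^ N := by gcongr
      _ = _ := by ring

/-- Comparison of the coefficients of z^m, on which θ + κ acts as m + κ. -/
lemma expCoef_asc (N m : ℕ) :
    ∑ j ∈ Finset.range (N + 1), expCoef β κ N j * asc (β + j) m =
      asc β m * ∏ i ∈ Finset.range N, (m + κ i) := by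
  induction N with
  | zero => simp [expCoef]
  | succ N ih =>
    rw [expCoef_sum_succ, Finset.prod_range_succ, ← mul_assoc, ← ih, Finset.sum_mul]
    refine Finset.sum_congr rfl fun j _ => ?_
    have h := asc_succ_left (β + j) m
    rw [asc_succ] at h
    push_cast
    rw [← add_assoc β]
    linear_combination -expCoef β κ N j * h

/-- The coefficients of `(-z) ^ β * (1 - z) ^ (-(β + j))` in powers of `z⁻¹`. -/
def infCoef (j K : ℕ) : ℂ :=
  if j ≤ K then (-1) ^ j * (asc (β + j) (K - j) / (K - j).factorial) else 0

/-- The coefficient form of θ(1-z)^(-(β+j)) = (β+j)((1-z)^(-(β+j+1)) - (1-z)^(-(β+j))) at infinity,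
where θ acts on (-z)^(-β) z^(-K) as -β - K. -/
lemma infCoef_succ (j K : ℕ) : ((j : ℂ) - K) * infCoef β j K = (β + j) * infCoef β (j + 1) K := by
  unfold infCoef
  rcases lt_trichotomy j K with h | rfl | h
  · obtain ⟨l, rfl⟩ := Nat.exists_eq_add_of_lt h
    have h1 : (l.factorial : ℂ) ≠ 0 := by exact_mod_cast l.factorial_ne_zero
    have h2 : (l + 1 : ℂ) ≠ 0 := by exact_mod_cast l.succ_ne_zero
    rw [if_pos (by omega), if_pos (by omega), show j + l + 1 - j = l + 1 by omega,
      show j + l + 1 - (j + 1) = l by omega, asc_succ_left, Nat.factorial_succ, pow_succ]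
    push_cast
    rw [← add_assoc]
    field_simp
    ring
  · simp
  · rw [if_neg (by omega), if_neg (by omega)]; simp

lemma expCoef_infCoef (N K : ℕ) :
    ∑ j ∈ Finset.range (N + 1), expCoef β κ N j * infCoef β j K =
      asc β K / K.factorial * ∏ i ∈ Finset.range N, (κ i - β - K) := by
  induction N with
  | zero => simp [expCoef, infCoef]
  | succ N ih =>
    rw [expCoef_sum_succ, Finset.prod_range_succ, ← mul_assoc, ← ih, Finset.sum_mul]
    refine Finset.sum_congr rfl fun j _ => ?_
    linear_combination -expCoef β κ N j * infCoef_succ β j K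

/-- `∏ i < N, (θ + κ i)` applied to `(1 - z) ^ (-β)`. -/
def expFun (N : ℕ) (z : ℂ) : ℂ :=
  ∑ j ∈ Finset.range (N + 1), expCoef β κ N j * (1 - z) ^ (-(β + j))

lemma hasSum_expFun (N : ℕ) {z : ℂ} (hz : ‖z‖ < 1) :
    HasSum (fun m : ℕ => asc β m / m.factorial * (∏ i ∈ Finset.range N, (m + κ i)) * z ^ m)
      (expFun β κ N z) := by
  have h := hasSum_sum fun j (_ : j ∈ Finset.range (N + 1)) =>
    (hasSum_one_sub_cpow_neg (β + j) hz).mul_left (expCoef β κ N j)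
  refine h.congr_fun fun m => ?_
  rw [div_mul_eq_mul_div, ← expCoef_asc, Finset.sum_div, Finset.sum_mul]
  exact Finset.sum_congr rfl fun j _ => by ring

lemma neg_slit_of_cutPlane {z : ℂ} (hz : z ∈ cutPlane) (h1 : 1 < ‖z‖) :
    -z ∈ Complex.slitPlane := by
  rw [cutPlane, mem_ofPred_eq, Complex.mem_slitPlane_iff] at hz
  rw [Complex.mem_slitPlane_iff]
  simp only [Complex.sub_re, Complex.one_re, Complex.sub_im, Complex.one_im, zero_sub,
    Complex.neg_re, Complex.neg_im, ne_eq, neg_eq_zero] at hz ⊢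
  by_cases him : z.im = 0
  · left
    have hre : z = (z.re : ℂ) := Complex.ext rfl (by simp [him])
    rw [hre, Complex.norm_real, Real.norm_eq_abs, lt_abs] at h1
    rcases hz with hz | hz
    · rcases h1 with h | h <;> linarith
    · exact absurd him hz
  · exact Or.inr him

/-- The principal powers are multiplicative here because the arguments of -z and 1 - 1/z do not have
the same sign: their imaginary parts are -Im z and a positive multiple of Im z. So their sum stays
in (-π, π]. -/
lemma one_sub_cpow_at_infinity {z : ℂ} (hz : z ∈ cutPlane) (h1 : 1 < ‖z‖) (s : ℂ) :
    (1 - z) ^ s = (-z) ^ s * (1 - z⁻¹) ^ s := by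
  have hz0 : z ≠ 0 := norm_pos_iff.1 (one_pos.trans h1)
  have hn := neg_slit_of_cutPlane hz h1
  have hi : ‖z⁻¹‖ < 1 := by rw [norm_inv]; exact inv_lt_one_of_one_lt₀ h1
  have hs := one_sub_slit_of_norm_lt hi
  have hre : 0 < (1 - z⁻¹).re := by
    have := (Complex.re_le_norm z⁻¹).trans_lt hi
    simp only [Complex.sub_re, Complex.one_re]
    linarith
  have hadd : Complex.arg (-z) + Complex.arg (1 - z⁻¹) ∈ Ioc (-Real.pi) Real.pi := by
    have b1 := Complex.abs_arg_lt_pi_div_two_iff.2 (Or.inl hre)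
    rw [abs_lt] at b1
    have hns : 0 < Complex.normSq z := Complex.normSq_pos.2 hz0
    have him : (1 - z⁻¹).im = z.im / Complex.normSq z := by
      simp [Complex.inv_im, neg_div]
    have c1 := Complex.arg_le_pi (-z)
    have c2 := Complex.neg_pi_lt_arg (-z)
    have hpi := Real.pi_pos
    rcases lt_trichotomy z.im 0 with h | h | h
    · have d1 : Complex.arg (1 - z⁻¹) < 0 := Complex.arg_neg_iff.2 (by
        rw [him]; exact div_neg_of_neg_of_pos h hns)
      have d2 : 0 ≤ Complex.arg (-z) := Complex.arg_nonneg_iff.2 (by simp [h.le])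
      constructor <;> linarith
    · have d1 : Complex.arg (-z) = 0 := by
        rw [Complex.arg_eq_zero_iff]
        rw [Complex.mem_slitPlane_iff] at hn
        simp only [Complex.neg_re, Complex.neg_im, h, neg_zero, ne_eq, not_true_eq_false,
          or_false] at hn ⊢
        exact ⟨hn.le, trivial⟩
      constructor <;> linarith
    · have d1 : 0 ≤ Complex.arg (1 - z⁻¹) := Complex.arg_nonneg_iff.2 (by
        rw [him]; exact (div_pos h hns).le)
      have d2 : Complex.arg (-z) < 0 := Complex.arg_neg_iff.2 (by simp [h])
      constructor <;> linarith
  have hne1 : -z ≠ 0 := neg_ne_zero.2 hz0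
  have hne2 : (1 - z⁻¹) ≠ 0 := Complex.slitPlane_ne_zero hs
  have hmul : 1 - z = -z * (1 - z⁻¹) := by field_simp; ring
  rw [hmul, Complex.cpow_def_of_ne_zero (mul_ne_zero hne1 hne2), Complex.cpow_def_of_ne_zero hne1,
    Complex.cpow_def_of_ne_zero hne2, Complex.log_mul hne1 hne2 hadd, ← Complex.exp_add, add_mul]

/-- Every power (1-z)^(-(β+j)) contributes only exponents in -β - ℕ at infinity. This is the reason
why a single term of the connection formula occurs. -/
lemma hasSum_expFun_at_infinity (N : ℕ) {z : ℂ} (hz : z ∈ cutPlane) (h1 : 1 < ‖z‖) :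
    HasSum (fun K : ℕ => (-z) ^ (-β) * (asc β K / K.factorial *
      (∏ i ∈ Finset.range N, (κ i - β - K)) * z⁻¹ ^ K)) (expFun β κ N z) := by
  have hz0 : z ≠ 0 := norm_pos_iff.1 (one_pos.trans h1)
  have hi : ‖z⁻¹‖ < 1 := by rw [norm_inv]; exact inv_lt_one_of_one_lt₀ h1
  have key : ∀ j : ℕ, HasSum (fun K : ℕ => (-z) ^ (-β) * (infCoef β j K * z⁻¹ ^ K))
      ((1 - z) ^ (-(β + j))) := by
    intro j
    have h2 := (hasSum_one_sub_cpow_neg (β + j) hi).mul_left ((-z) ^ (-(β + j)))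
    rw [← one_sub_cpow_at_infinity hz h1] at h2
    have h3 := (hasSum_nat_add_iff (f := fun K : ℕ => (-z) ^ (-β) * (infCoef β j K * z⁻¹ ^ K)) j
      (g := (1 - z) ^ (-(β + j)))).1 (h2.congr_fun fun m => ?_)
    · rwa [Finset.sum_eq_zero, add_zero] at h3
      intro K hK
      rw [Finset.mem_range] at hK
      simp [infCoef, not_le.2 hK]
    · rw [infCoef, if_pos (by omega), show m + j - j = m by omega, neg_add,
        Complex.cpow_add _ _ (neg_ne_zero.2 hz0), Complex.cpow_neg _ (j : ℂ), Complex.cpow_natCast,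
        neg_pow z, mul_inv, ← inv_pow, ← inv_pow, pow_add]
      norm_num
      ring
  have h := hasSum_sum fun j (_ : j ∈ Finset.range (N + 1)) => (key j).mul_left (expCoef β κ N j)
  refine h.congr_fun fun K => ?_
  rw [← expCoef_infCoef, Finset.sum_mul, Finset.mul_sum]
  exact Finset.sum_congr rfl fun j _ => by ring

lemma analyticOnNhd_expFun (N : ℕ) : AnalyticOnNhd ℂ (expFun β κ N) cutPlane := by
  intro z hz
  unfold expFun
  refine Finset.analyticAt_fun_sum _ fun j _ => analyticAt_const.mul ?_
  exact (analyticAt_const.sub analyticAt_id).cpow analyticAt_const hz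

end Expansion

end

/-! ### The coefficients of S₂ and S₂' as values of one polynomial -/

noncomputable section

lemma poch_reflect {w : ℂ} (hw : NotInt w) (k : ℤ) : poch (1 - w) (-k) * poch w k = (-1) ^ k := by
  have hw' : NotInt (1 - w) := hw.of_eq_sub 1 (by push_cast; ring)
  obtain ⟨n, rfl | rfl⟩ := Int.eq_nat_or_neg k
  · rw [poch_neg_natCast', sub_sub_cancel, poch_natCast, mul_assoc,
      inv_mul_cancel₀ (asc_ne_zero hw.ne_neg n), mul_one, zpow_natCast]
  · rw [neg_neg, poch_neg_natCast', poch_natCast, mul_comm, mul_assoc,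
      inv_mul_cancel₀ (asc_ne_zero hw'.ne_neg n), mul_one, zpow_neg, zpow_natCast, ← inv_pow]
    norm_num

lemma asc_two_mul (w : ℂ) (m : ℕ) : asc w (2 * m) = 4 ^ m * asc (w / 2) m * asc ((w + 1) / 2) m := by
  induction m with
  | zero => simp [asc_zero]
  | succ m ih =>
    rw [show 2 * (m + 1) = 2 * m + 1 + 1 by ring, asc_succ, asc_succ, ih, asc_succ, asc_succ]
    push_cast
    ring

/-- The product (v-K)_(n+K) is split after n and after K factors, and the blocks of length K are
reflected. -/
lemma asc_shift (v : ℂ) (n K : ℕ) :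
    asc (v - K) n * asc (1 - v - n) K = asc (1 - v) K * asc v n := by
  have h1 := asc_add (v - K) n K
  have h2 := asc_add (v - K) K n
  rw [add_comm K n, h1, sub_add_cancel, asc_reflect (v - K) K, asc_reflect (v - K + n) K,
    show 1 - (v - K + n) - (K : ℂ) = 1 - v - n by ring,
    show 1 - (v - K) - (K : ℂ) = 1 - v by ring] at h2
  have h3 : ((-1 : ℂ) ^ K) ≠ 0 := pow_ne_zero _ (by norm_num)
  refine mul_left_cancel₀ h3 ?_
  linear_combination h2

/-- The genericity hypotheses. -/
structure Generic (a b c : ℂ) : Prop where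
  a_ne : ∀ k : ℕ, a ≠ -(k : ℂ)
  c_ne : ∀ k : ℕ, c ≠ -(k : ℂ)
  cb_ne : ∀ k : ℕ, c - b ≠ -(k : ℂ)
  b_int : NotInt b
  ca_int : NotInt (c - a)
  abc_int : NotInt (a + b - c)
  abc₁_int : NotInt (a + 2 * b - c)
  abc₂_int : NotInt (a + 2 * b - 2 * c)

/-- The roots of the polynomial, up to sign, in the coefficients of the `n`-th function. -/
def kap (a b c : ℂ) (n i : ℕ) : ℂ :=
  if i < n then c - b + i else (a - c - n + 1 + ((i - n : ℕ) : ℂ)) / 2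

lemma prod_kap (a b c : ℂ) (n : ℕ) (w : ℂ) :
    (∏ i ∈ Finset.range (2 * n), (w + kap a b c n i)) * 2 ^ n =
      asc (c - b + w) n * asc (a - c - n + 1 + 2 * w) n := by
  rw [two_mul, Finset.prod_range_add, mul_assoc]
  congr 1
  · rw [asc_eq_prod]
    refine Finset.prod_congr rfl fun i hi => ?_
    rw [kap, if_pos (Finset.mem_range.1 hi)]; ring
  · have h2 : (2 : ℂ) ^ n = ∏ _i ∈ Finset.range n, (2 : ℂ) := by simp
    rw [asc_eq_prod, h2, ← Finset.prod_mul_distrib]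
    refine Finset.prod_congr rfl fun i _ => ?_
    rw [kap, if_neg (by omega), Nat.add_sub_cancel_left]; ring

/-- The factor in front of the `n`-th function. -/
def psiConst (a b c : ℂ) (n : ℕ) : ℂ := (-2) ^ n / (n.factorial * asc (c - a - b + 1) n)

/-- The continuation of the coefficient of `(1 - y) ^ n` in the second series. -/
def psi (a b c : ℂ) (n : ℕ) (z : ℂ) : ℂ :=
  psiConst a b c n * expFun (a + b - c - n) (kap a b c n) (2 * n) z

/-- The coefficients of the second series. -/
def secondCoef (a b c : ℂ) (k : ℕ × ℕ) : ℂ :=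
  poch (a - c + 1) (2 * k.1) * poch (c - a) (k.2 - 2 * k.1) * poch (c - b) (k.1 + k.2) /
      (poch (c - b) k.1 * poch (c - a - b + 1) (k.2 - k.1)) / (k.1.factorial * k.2.factorial)

lemma secondTerm_eq (a b c : ℂ) (p : ℂ × ℂ) (k : ℕ × ℕ) : secondTerm a b c p k =
    secondCoef a b c k * ((-(p.1 / (1 - p.2))) ^ k.1 * (1 - p.2) ^ k.2) := by
  simp only [secondTerm, secondCoef]; ring

/-- The coefficients of the new series. -/
def newCoef (a b c : ℂ) (k : ℕ × ℕ) : ℂ :=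
  poch (a + 2 * b - 2 * c + 1) (k.1 - k.2) * poch (a + b - c) (k.1 - k.2) *
      poch (a + 2 * b - c) (2 * k.1 - k.2) /
      (poch (a + 2 * b - 2 * c + 1) (k.1 - 2 * k.2) * poch (a + 2 * b - c) (2 * (k.1 - k.2))) /
    (k.1.factorial * k.2.factorial)

lemma newTerm_eq (a b c : ℂ) (p : ℂ × ℂ) (k : ℕ × ℕ) : newTerm a b c p k =
    newCoef a b c k * (((1 - p.2) / p.1) ^ k.1 * (-p.1) ^ k.2) := by
  simp only [newTerm, newCoef]; ring

variable {a b c : ℂ}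

lemma poch_add_asc {w : ℂ} (hw : NotInt w) (k l : ℤ) (n : ℕ) (h : k = l + n) :
    poch w k = poch w l * asc (w + l) n := by
  rw [h, poch_add hw, poch_natCast]

lemma asc_abc_eq (hg : Generic a b c) (m n : ℕ) :
    poch (a + b - c) (m - n) * asc (c - a - b + 1) n = (-1) ^ n * asc (a + b - c - n) m := by
  have h1 := poch_reflect hg.abc_int (-(n : ℤ))
  rw [neg_neg, poch_natCast, show 1 - (a + b - c) = c - a - b + 1 by ring] at h1
  have h2 := poch_add hg.abc_int (-(n : ℤ)) m
  rw [poch_natCast, show -(n : ℤ) + m = m - n by ring] at h2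
  push_cast at h2
  rw [zpow_neg, zpow_natCast, ← inv_pow] at h1
  rw [h2, ← sub_eq_add_neg]
  norm_num at h1
  linear_combination asc (a + b - c - n) m * h1

/-- (a-c+1)_(2m) (c-a)_(n-2m) is, up to sign, (a-c-n+1+2m)_n, and (c-b)_(m+n)/(c-b)_m is (c-b+m)_n.
Both are polynomials in m of degree n, and together they are the 2n linear factors of `prod_kap`.
The remaining symbol reflects to (a+b-c-n)_m. -/
lemma secondCoef_eq (hg : Generic a b c) (m n : ℕ) : secondCoef a b c (m, n) * (-1) ^ m =
    psiConst a b c n * (asc (a + b - c - n) m / m.factorial *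
      ∏ i ∈ Finset.range (2 * n), (m + kap a b c n i)) := by
  have hw : NotInt (a - c + 1) := hg.ca_int.of_eq_sub 1 (by push_cast; ring)
  have hq : NotInt (c - a - b + 1) := hg.abc_int.of_eq_sub 1 (by push_cast; ring)
  have h1 := poch_reflect hw (2 * m - n)
  have h2 := poch_add_asc hw (2 * m) (2 * m - n) n (by ring)
  have h3 := poch_reflect hg.abc_int (m - n)
  rw [show 1 - (a - c + 1) = c - a by ring, show -(2 * (m : ℤ) - n) = n - 2 * m by ring] at h1
  rw [show 1 - (a + b - c) = c - a - b + 1 by ring, show -((m : ℤ) - n) = n - m by ring] at h3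
  have h4 := asc_abc_eq hg m n
  have h5 : poch (c - b) ((m : ℤ) + n) = asc (c - b) m * asc (c - b + m) n := by
    rw [← asc_add, ← poch_natCast]; push_cast; rfl
  have h6 := prod_kap a b c n m
  have e1 := asc_ne_zero hg.cb_ne m
  have e2 := asc_ne_zero hq.ne_neg n
  have e3 := poch_ne_zero hq (n - m)
  have e4 := poch_ne_zero hg.abc_int (m - n)
  have e5 := poch_ne_zero hw (2 * m - n)
  have f1 : (m.factorial : ℂ) ≠ 0 := by exact_mod_cast m.factorial_ne_zero
  have f2 : (n.factorial : ℂ) ≠ 0 := by exact_mod_cast n.factorial_ne_zero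
  have s1 : ((-1 : ℂ) ^ (2 * (m : ℤ) - n)) = (-1) ^ n := by
    rw [zpow_sub₀ (by norm_num), zpow_mul, zpow_natCast, zpow_natCast]
    rcases neg_one_pow_eq_or ℂ n with h | h <;> simp [h]
  have s2 : ((-1 : ℂ) ^ ((m : ℤ) - n)) = (-1) ^ m * (-1) ^ n := by
    rw [zpow_sub₀ (by norm_num), zpow_natCast, zpow_natCast]
    rcases neg_one_pow_eq_or ℂ n with h | h <;> simp [h, div_neg]
  rw [s1] at h1
  rw [s2] at h3
  have g1 : poch (c - a) (n - 2 * m) = (-1) ^ n / poch (a - c + 1) (2 * m - n) :=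
    (eq_div_iff e5).2 h1
  have g3 : poch (c - a - b + 1) (n - m) = (-1) ^ m * (-1) ^ n / poch (a + b - c) (m - n) :=
    (eq_div_iff e4).2 h3
  have g4 : poch (a + b - c) (m - n) = (-1) ^ n * asc (a + b - c - n) m / asc (c - a - b + 1) n :=
    (eq_div_iff e2).2 h4
  have g6 : ∏ i ∈ Finset.range (2 * n), (m + kap a b c n i) =
      asc (c - b + m) n * asc (a - c - n + 1 + 2 * m) n / 2 ^ n := (eq_div_iff (by simp)).2 h6
  have g2 : (a - c + 1 + ((2 * m - n : ℤ) : ℂ)) = a - c - n + 1 + 2 * m := by push_cast; ring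
  rw [g2] at h2
  simp only [secondCoef, psiConst]
  have h7 : poch (c - b) (m : ℤ) = asc (c - b) m := rfl
  rw [h7, h5, h2, g1, g3, g6]
  have t1 : ((-1 : ℂ) ^ n) ^ 2 = 1 := by rw [← pow_mul, mul_comm, pow_mul]; simp
  have t2 : ((-1 : ℂ) ^ m) ≠ 0 := pow_ne_zero _ (by norm_num)
  have t3 : ((-1 : ℂ) ^ n) ≠ 0 := pow_ne_zero _ (by norm_num)
  have t4 : (-2 : ℂ) ^ n = (-1) ^ n * 2 ^ n := by rw [← mul_pow]; norm_num
  rw [t4]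
  field_simp
  rw [g4]
  field_simp

/-- The polynomial of `secondCoef_eq` evaluated at -(a+b-c-n) - k. Reflection of its two blocks of n
factors gives the two quotients of Pochhammer symbols that make up the coefficient of the new
series. -/
lemma newCoef_eq (hg : Generic a b c) (k n : ℕ) : newCoef a b c (k, n) =
    psiConst a b c n * (asc (a + b - c - n) k / k.factorial *
      ∏ i ∈ Finset.range (2 * n), (kap a b c n i - (a + b - c - n) - k)) := by
  have hβ : NotInt (a + 2 * b - 2 * c + 1) := hg.abc₂_int.of_eq_add 1 (by push_cast; ring)
  have hq : NotInt (c - a - b + 1) := hg.abc_int.of_eq_sub 1 (by push_cast; ring)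
  have h1 := poch_add_asc hβ (k - n) (k - 2 * n) n (by ring)
  have h2 := poch_add_asc hg.abc₁_int (2 * k - n) (2 * (k - n)) n (by ring)
  have h4 := asc_abc_eq hg k n
  have h6 := prod_kap a b c n (-(a + b - c - n) - k)
  have e2 := asc_ne_zero hq.ne_neg n
  have g4 : poch (a + b - c) (k - n) = (-1) ^ n * asc (a + b - c - n) k / asc (c - a - b + 1) n :=
    (eq_div_iff e2).2 h4
  rw [asc_reflect (c - b + _), asc_reflect (a - c - n + 1 + _),
    show (1 - (c - b + (-(a + b - c - n) - k)) - n : ℂ) =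
      a + 2 * b - 2 * c + 1 + ((k - 2 * n : ℤ) : ℂ) by push_cast; ring,
    show (1 - (a - c - n + 1 + 2 * (-(a + b - c - n) - k)) - n : ℂ) =
      a + 2 * b - c + ((2 * (k - n) : ℤ) : ℂ) by push_cast; ring] at h6
  have g6 : ∏ i ∈ Finset.range (2 * n), (kap a b c n i - (a + b - c - n) - k) =
      (-1) ^ n * asc (a + 2 * b - 2 * c + 1 + ((k - 2 * n : ℤ) : ℂ)) n *
      ((-1) ^ n * asc (a + 2 * b - c + ((2 * (k - n) : ℤ) : ℂ)) n) / 2 ^ n := by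
    rw [eq_div_iff (by simp), ← h6]
    congr 1
    exact Finset.prod_congr rfl fun i _ => by ring
  have e3 := poch_ne_zero hβ (k - 2 * n)
  have e4 := poch_ne_zero hg.abc₁_int (2 * (k - n))
  have f1 : (k.factorial : ℂ) ≠ 0 := by exact_mod_cast k.factorial_ne_zero
  have f2 : (n.factorial : ℂ) ≠ 0 := by exact_mod_cast n.factorial_ne_zero
  have t1 : ((-1 : ℂ) ^ n) * (-1) ^ n = 1 := by rw [← mul_pow]; simp
  have t4 : (-2 : ℂ) ^ n = (-1) ^ n * 2 ^ n := by rw [← mul_pow]; norm_num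
  simp only [newCoef, psiConst]
  rw [h1, h2, g4, g6, t4]
  field_simp
  linear_combination (-asc (a + 2 * b - 2 * c + 1 + ((k - 2 * n : ℤ) : ℂ)) n *
    asc (a + 2 * b - c + ((2 * (k - n) : ℤ) : ℂ)) n * asc (a + b - c - n) k) * t1

lemma hasSum_psi (hg : Generic a b c) (n : ℕ) {z : ℂ} (hz : ‖z‖ < 1) :
    HasSum (fun m : ℕ => secondCoef a b c (m, n) * (-z) ^ m) (psi a b c n z) := by
  refine ((hasSum_expFun (a + b - c - n) (kap a b c n) (2 * n) hz).mul_left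
    (psiConst a b c n)).congr_fun fun m => ?_
  rw [neg_pow z, ← mul_assoc, secondCoef_eq hg]
  ring

lemma hasSum_psi_at_infinity (hg : Generic a b c) (n : ℕ) {z : ℂ} (hz : z ∈ cutPlane)
    (h1 : 1 < ‖z‖) :
    HasSum (fun k : ℕ => (-z) ^ (c - a - b) * (newCoef a b c (k, n) * (z⁻¹ ^ k * (-z) ^ n)))
      (psi a b c n z) := by
  have hz0 : -z ≠ 0 := neg_ne_zero.2 (norm_pos_iff.1 (one_pos.trans h1))
  refine ((hasSum_expFun_at_infinity (a + b - c - n) (kap a b c n) (2 * n) hz h1).mul_left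
    (psiConst a b c n)).congr_fun fun k => ?_
  rw [newCoef_eq hg, show -(a + b - c - (n : ℂ)) = c - a - b + n by ring,
    Complex.cpow_add _ _ hz0, Complex.cpow_natCast]
  ring

lemma analyticOnNhd_psi (n : ℕ) : AnalyticOnNhd ℂ (psi a b c n) cutPlane :=
  analyticOnNhd_const.mul (analyticOnNhd_expFun _ _ _)

/-- The factor `(c - a)_n (c - b)_n / (n! (c - a - b + 1)_n)`. -/
def sumConst (a b c : ℂ) (n : ℕ) : ℂ :=
  asc (c - a) n * asc (c - b) n / (n.factorial * asc (c - a - b + 1) n)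

lemma sumConst_ne_zero (hg : Generic a b c) (n : ℕ) : sumConst a b c n ≠ 0 := by
  have hq : NotInt (c - a - b + 1) := hg.abc_int.of_eq_sub 1 (by push_cast; ring)
  have f2 : (n.factorial : ℂ) ≠ 0 := by exact_mod_cast n.factorial_ne_zero
  exact div_ne_zero (mul_ne_zero (asc_ne_zero hg.ca_int.ne_neg n) (asc_ne_zero hg.cb_ne n))
    (mul_ne_zero f2 (asc_ne_zero hq.ne_neg n))

lemma hyp4F3_eq_tsum (a₁ a₂ a₃ a₄ : ℂ) {b₁ b₂ b₃ : ℂ} (h₁ : ∀ k : ℕ, b₁ ≠ -(k : ℂ))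
    (h₂ : ∀ k : ℕ, b₂ ≠ -(k : ℂ)) (h₃ : ∀ k : ℕ, b₃ ≠ -(k : ℂ)) (z : ℂ) :
    hyp4F3 a₁ a₂ a₃ a₄ b₁ b₂ b₃ z = ∑' n : ℕ, asc a₁ n * asc a₂ n * asc a₃ n * asc a₄ n /
      (asc b₁ n * asc b₂ n * asc b₃ n * n.factorial) * z ^ n := by
  rw [hyp4F3, Complex.regularizedHGFun, FormalMultilinearSeries.sum, ← tsum_mul_left]
  refine tsum_congr fun n => ?_
  have g1 := Complex.Gamma_ne_zero h₁
  have g2 := Complex.Gamma_ne_zero h₂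
  have g3 := Complex.Gamma_ne_zero h₃
  have k1 := asc_ne_zero h₁ n
  have k2 := asc_ne_zero h₂ n
  have k3 := asc_ne_zero h₃ n
  have f : (n.factorial : ℂ) ≠ 0 := by exact_mod_cast n.factorial_ne_zero
  simp only [Complex.regularizedHGFunSeries, FormalMultilinearSeries.ofScalars_apply_eq,
    Complex.regularizedHGFunCoeff, Multiset.insert_eq_cons, Multiset.map_cons,
    Multiset.map_singleton, Multiset.prod_cons, Multiset.prod_singleton, smul_eq_mul,
    ← asc_mul_Gamma h₁, ← asc_mul_Gamma h₂, ← asc_mul_Gamma h₃]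
  field_simp

/-- The duplication `asc_two_mul` combines the parameters that contain halves into (a-c+1)_(2m) and
(a-c-n+1)_(2m); the rest is the comparison of two ways of splitting longer products. -/
lemma sumConst_mul_inner4F3 (hg : Generic a b c) (n : ℕ) {z : ℂ} (hz : ‖z‖ < 1) :
    sumConst a b c n * inner4F3 a b c n z = psi a b c n z := by
  have hi : ∀ k : ℤ, NotInt (a - c - n + k) := fun k =>
    hg.ca_int.of_eq_sub (k - n) (by push_cast; ring)
  have hh : ∀ w : ℂ, NotInt (2 * w) → ∀ k : ℕ, w ≠ -(k : ℂ) := fun w hw k h =>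
    hw (-2 * k) (by rw [h]; push_cast; ring)
  have hb2 := hh ((a - c - n + 1) / 2) ((hi 1).of_eq_add 0 (by push_cast; ring))
  have hb3 := hh ((a - c - n) / 2 + 1) ((hi 2).of_eq_add 0 (by push_cast; ring))
  rw [inner4F3, hyp4F3_eq_tsum _ _ _ _ hg.cb_ne hb2 hb3, ← tsum_mul_left,
    ← (hasSum_psi hg n hz).tsum_eq]
  refine tsum_congr fun m => ?_
  rw [neg_pow z, ← mul_assoc, ← mul_assoc, secondCoef_eq hg]
  congr 1
  have h6 := prod_kap a b c n m
  have g6 : ∏ i ∈ Finset.range (2 * n), (m + kap a b c n i) =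
      asc (c - b + m) n * asc (a - c - n + 1 + 2 * m) n / 2 ^ n := (eq_div_iff (by simp)).2 h6
  have d1 := asc_two_mul (a - c + 1) m
  rw [show (a - c + 1 + 1) / 2 = (a - c) / 2 + 1 by ring] at d1
  have d2 := asc_two_mul (a - c - n + 1) m
  rw [show (a - c - n + 1 + 1) / 2 = (a - c - n) / 2 + 1 by ring] at d2
  have e1 := asc_add (a - c - n + 1) (2 * m) n
  have e2 := asc_add (a - c - n + 1) n (2 * m)
  rw [add_comm n, e1, show a - c - n + 1 + (n : ℂ) = a - c + 1 by ring] at e2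
  push_cast at e2
  have e3 := asc_reflect (a - c - n + 1) n
  rw [show (1 - (a - c - n + 1) - n : ℂ) = c - a by ring] at e3
  have e4 := asc_add (c - b) n m
  rw [add_comm, asc_add] at e4
  have hq : NotInt (c - a - b + 1) := hg.abc_int.of_eq_sub 1 (by push_cast; ring)
  have k1 := asc_ne_zero hq.ne_neg n
  have k2 := asc_ne_zero hg.cb_ne m
  have k3 := asc_ne_zero hb2 m
  have k4 := asc_ne_zero hb3 m
  have f1 : (m.factorial : ℂ) ≠ 0 := by exact_mod_cast m.factorial_ne_zero
  have f2 : (n.factorial : ℂ) ≠ 0 := by exact_mod_cast n.factorial_ne_zero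
  have t1 : ((-1 : ℂ) ^ n) * (-1) ^ n = 1 := by rw [← mul_pow]; simp
  have t4 : (-2 : ℂ) ^ n = (-1) ^ n * 2 ^ n := by rw [← mul_pow]; norm_num
  rw [g6]
  simp only [sumConst, psiConst]
  rw [t4]
  have key : asc (c - a) n * asc (c - b) n * (asc ((a - c + 1) / 2) m * asc ((a - c) / 2 + 1) m *
      asc (c - b + n) m) = (-1) ^ n * asc (c - b + m) n * asc (a - c - n + 1 + 2 * m) n *
      (asc (c - b) m * asc ((a - c - n + 1) / 2) m * asc ((a - c - n) / 2 + 1) m) := by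
    have t5 : ((4 : ℂ) ^ m) ≠ 0 := by simp
    rw [d1, d2, e3] at e2
    refine mul_left_cancel₀ t5 ?_
    linear_combination (-(-1 : ℂ) ^ n * asc (c - b) m * asc (c - b + m) n) * e2 -
      4 ^ m * asc (c - a) n * asc ((a - c + 1) / 2) m * asc ((a - c) / 2 + 1) m * e4 +
      (-(4 ^ m * asc (c - a) n * asc ((a - c + 1) / 2) m * asc ((a - c) / 2 + 1) m) *
        asc (c - b) m * asc (c - b + m) n) * t1
  generalize asc ((a - c) / 2 + 1) m = A2 at *
  generalize asc ((a - c + 1) / 2) m = A1 at *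
  generalize asc ((a - c - n + 1) / 2) m = B2 at *
  generalize asc ((a - c - n) / 2 + 1) m = B3 at *
  generalize asc (a - c - n + 1 + 2 * m) n = B4 at *
  generalize asc (a + b - c - n) m = A3 at *
  generalize asc (c - b + n) m = A4 at *
  generalize asc (c - b + m) n = A5 at *
  generalize asc (c - a) n = A6 at *
  generalize asc (c - b) n = A7 at *
  field_simp
  linear_combination A3 * key

end

/-! ### The remaining term of the connection formula at infinity -/

noncomputable section
variable {a b c : ℂ}

/-- A step n → n + 1 exchanges the two Gamma arguments up to one shift by 1, so only Γ(s+1) = sΓ(s)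
is needed and not the duplication formula itself. -/
lemma Gamma_duplication_asc {w : ℂ} (hw : NotInt w) (n : ℕ) :
    Complex.Gamma ((w + n) / 2) * Complex.Gamma ((w + n + 1) / 2) * 2 ^ n =
      asc w n * (Complex.Gamma (w / 2) * Complex.Gamma ((w + 1) / 2)) := by
  induction n with
  | zero => simp [asc_zero]
  | succ n ih =>
    have h0 : (w + n) / 2 ≠ 0 := by
      intro h
      have : w = ((-n : ℤ) : ℂ) := by push_cast; linear_combination 2 * h
      exact hw _ this
    have h1 := Complex.Gamma_add_one _ h0
    push_cast
    rw [show (w + (n + 1) + 1) / 2 = (w + n) / 2 + 1 by ring, h1, asc_succ, ← add_assoc]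
    linear_combination (w + n) * ih

set_option maxHeartbeats 800000 in
-- Both sides are compared termwise at infinity. The Gamma factors reduce to Pochhammer symbols by
-- the functional equation, and the coefficients of the ₄F₃ in 1/z arise from the 2n linear factors
-- by `asc_shift`.
lemma sumConst_mul_inner4F3AtInfinity (hg : Generic a b c) (n : ℕ) {z : ℂ} (hz : z ∈ cutPlane)
    (h1 : 1 < ‖z‖) : sumConst a b c n * inner4F3AtInfinity a b c n z = psi a b c n z := by
  have hv : NotInt (c - b - (a + b - c - n)) := hg.abc₂_int.of_eq_sub n (by push_cast; ring)
  have hV : NotInt (a - c - n + 1 - 2 * (a + b - c - n)) :=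
    hg.abc₁_int.of_eq_sub (n + 1) (by push_cast; ring)
  have hw : NotInt (a - c - n + 1) := hg.ca_int.of_eq_sub (1 - n) (by push_cast; ring)
  have hh : ∀ w : ℂ, NotInt (2 * w) → ∀ k : ℕ, w ≠ -(k : ℂ) := fun w hw k h =>
    hw (-2 * k) (by rw [h]; push_cast; ring)
  set a₃ := a + b - c - (n : ℂ) with ha₃
  -- In terms of the parameters of the ₄F₃, v = b₁ - a₃, V/2 = b₂ - a₃ and w/2 = b₂; all other
  -- differences arise from these by shifts that involve n and by halves.
  set v := c - b - a₃ with hvdef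
  set V := a - c - n + 1 - 2 * a₃ with hVdef
  set w := a - c - (n : ℂ) + 1 with hwdef
  have hd1 : ∀ k : ℕ, 1 - (V + n) / 2 ≠ -(k : ℂ) := 
    hh _ (hV.of_eq_sub (2 - n) (by push_cast; ring))
  have hd2 : ∀ k : ℕ, (1 - V - n) / 2 ≠ -(k : ℂ) := 
    hh _ (hV.of_eq_sub (1 - n) (by push_cast; ring))
  have hd3 : ∀ k : ℕ, 1 - v - n ≠ -(k : ℂ) := 
    NotInt.ne_neg (hv.of_eq_sub (1 - n) (by push_cast; ring))
  have hz0 : -z ≠ 0 := neg_ne_zero.2 (norm_pos_iff.1 (one_pos.trans h1))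
  simp only [inner4F3AtInfinity]
  rw [← ha₃, show (a - c + 1) / 2 - a₃ = (V + n) / 2 by rw [hVdef]; ring,
    show (a - c) / 2 + 1 - a₃ = (V + n + 1) / 2 by rw [hVdef]; ring,
    show c - b + n - a₃ = v + n by rw [hvdef]; ring,
    show (a - c - n + 1) / 2 - a₃ = V / 2 by rw [hVdef]; ring,
    show (a - c - n) / 2 + 1 - a₃ = (V + 1) / 2 by rw [hVdef]; ring,
    show 1 + a₃ - (c - b) = 1 - v by rw [hvdef]; ring,
    show 1 + a₃ - w / 2 = 1 - V / 2 by rw [hVdef]; ring,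
    show 1 + a₃ - ((a - c - n) / 2 + 1) = (1 - V) / 2 by rw [hVdef, hwdef]; ring,
    show 1 + a₃ - (a - c + 1) / 2 = 1 - (V + n) / 2 by rw [hVdef, hwdef]; ring,
    show 1 + a₃ - ((a - c) / 2 + 1) = (1 - V - n) / 2 by rw [hVdef, hwdef]; ring,
    show 1 + a₃ - (c - b + n) = 1 - v - n by rw [hvdef]; ring, 
    hyp4F3_eq_tsum _ _ _ _ hd1 hd2 hd3, ← (hasSum_psi_at_infinity hg n hz h1).tsum_eq,
    ← tsum_mul_left, ← tsum_mul_left]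
  refine tsum_congr fun k => ?_
  have p1 : (-z) ^ (-a₃) = (-z) ^ (c - a - b) * (-z) ^ n := by
    rw [show -a₃ = c - a - b + n by rw [ha₃]; ring, Complex.cpow_add _ _ hz0, Complex.cpow_natCast]
  rw [p1, newCoef_eq hg]
  have h6 := prod_kap a b c n (-a₃ - k)
  rw [show c - b + (-a₃ - k) = v - k by rw [hvdef]; ring,
    show a - c - n + 1 + 2 * (-a₃ - k) = V - ((2 * k : ℕ) : ℂ) by push_cast; ring] at h6
  have g6 : ∏ i ∈ Finset.range (2 * n), (kap a b c n i - a₃ - k) =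
      asc (v - k) n * asc (V - ((2 * k : ℕ) : ℂ)) n / 2 ^ n := by
    rw [eq_div_iff (by simp), ← h6]
    congr 1
    exact Finset.prod_congr rfl fun i _ => by ring
  have s1 := asc_shift v n k
  have s2 := asc_shift V n (2 * k)
  rw [asc_two_mul (1 - V), asc_two_mul (1 - V - n),
    show (1 - V - n + 1) / 2 = 1 - (V + n) / 2 by ring,
    show (1 - V + 1) / 2 = 1 - V / 2 by ring] at s2
  have q1 := asc_mul_Gamma hg.cb_ne n
  have q2 := asc_mul_Gamma hv.ne_neg n
  have q3 := Gamma_duplication_asc hV n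
  have q4 := Gamma_duplication_asc hw n
  rw [show w + (n : ℂ) + 1 = ((a - c) / 2 + 1) * 2 by rw [hwdef]; ring,
    show w + (n : ℂ) = a - c + 1 by rw [hwdef]; ring,
    show (w + 1) / 2 = (a - c - n) / 2 + 1 by rw [hwdef]; ring, mul_div_cancel_right₀ _ (by norm_num),
    asc_reflect, show 1 - w - n = c - a by rw [hwdef]; ring] at q4
  have n0 := asc_ne_zero hg.cb_ne n
  have n1 := asc_ne_zero hg.ca_int.ne_neg n
  have n2 := asc_ne_zero hd1 k
  have n3 := asc_ne_zero hd2 k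
  have n4 := asc_ne_zero hd3 k
  have m1 := Complex.Gamma_ne_zero (hh ((a - c + 1) / 2)
    (hg.ca_int.of_eq_sub 1 (by push_cast; ring)))
  have m2 := Complex.Gamma_ne_zero (hh ((a - c) / 2 + 1)
    (hg.ca_int.of_eq_sub 2 (by push_cast; ring)))
  have m3 := Complex.Gamma_ne_zero hg.cb_ne
  have m4 := Complex.Gamma_ne_zero hv.ne_neg
  have m5 := Complex.Gamma_ne_zero (hh (V / 2) (hV.of_eq_add 0 (by push_cast; ring)))
  have m6 := Complex.Gamma_ne_zero (hh ((V + 1) / 2) (hV.of_eq_add 1 (by push_cast; ring)))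
  have hq : NotInt (c - a - b + 1) := hg.abc_int.of_eq_sub 1 (by push_cast; ring)
  have n5 := asc_ne_zero hq.ne_neg n
  have f1 : (k.factorial : ℂ) ≠ 0 := by exact_mod_cast k.factorial_ne_zero
  have f2 : (n.factorial : ℂ) ≠ 0 := by exact_mod_cast n.factorial_ne_zero
  have t1 : ((-1 : ℂ) ^ n) * (-1) ^ n = 1 := by rw [← mul_pow]; simp
  have t2 : (2 : ℂ) ^ n ≠ 0 := by simp
  have t3 : (4 : ℂ) ^ k ≠ 0 := by simp
  have t4 : (-2 : ℂ) ^ n = (-1) ^ n * 2 ^ n := by rw [← mul_pow]; norm_num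
  rw [g6]
  simp only [sumConst, psiConst, t4]
  rw [← q1, ← q2]
  simp only [← hwdef, ← hvdef, ← ha₃]
  clear_value a₃ v V w
  clear hh hd1 hd2 hd3 hv hV hw hq hz hz0 hvdef hVdef hwdef ha₃
  clear q1 q2 g6 h6 p1
  generalize (-z) ^ (c - a - b) = Z
  generalize (-z) ^ n = Z'
  generalize z⁻¹ ^ k = Z''
  generalize Complex.Gamma ((a - c + 1) / 2) = G1 at *
  generalize Complex.Gamma ((a - c) / 2 + 1) = G2 at *
  generalize Complex.Gamma ((V + 1) / 2) = G3 at *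
  generalize Complex.Gamma (V / 2) = G4 at *
  generalize Complex.Gamma ((V + n + 1) / 2) = G5 at *
  generalize Complex.Gamma ((V + n) / 2) = G6 at *
  generalize Complex.Gamma ((a - c - n) / 2 + 1) = G7 at *
  generalize Complex.Gamma (w / 2) = G8 at *
  generalize Complex.Gamma (c - b) = G9 at *
  generalize Complex.Gamma v = G10 at *
  generalize asc (c - a) n = A1 at *
  generalize asc (c - b) n = A2 at *
  generalize asc (c - a - b + 1) n = A3 at *
  generalize asc a₃ k = A4 at *
  generalize asc (1 - v) k = A5 at *
  generalize asc (1 - V / 2) k = A6 at *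
  generalize asc ((1 - V) / 2) k = A7 at *
  generalize asc (1 - (V + n) / 2) k = A8 at *
  generalize asc ((1 - V - n) / 2) k = A9 at *
  generalize asc (1 - v - n) k = A10 at *
  generalize asc (v - k) n = A11 at *
  generalize asc (V - (2 * k : ℕ)) n = A12 at *
  generalize asc v n = A13 at *
  generalize asc V n = A14 at *
  have r1 : G6 * G5 = A14 * (G4 * G3) / 2 ^ n := (eq_div_iff t2).2 q3
  have r2 : A1 * (G8 * G7) = (-1) ^ n * (G1 * G2 * 2 ^ n) := by
    linear_combination (-(-1) ^ n) * q4 - A1 * G8 * G7 * t1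
  have r3 : A11 = A5 * A13 / A10 := (eq_div_iff n4).2 s1
  have r4 : A12 = A7 * A6 * A14 / (A9 * A8) := by
    rw [eq_div_iff (mul_ne_zero n3 n2)]
    refine mul_left_cancel₀ t3 ?_
    linear_combination s2
  rw [r3, r4]
  clear r3 r4 q3 q4 s1 s2
  have r5 : G9 * G8 * G7 * G6 * G5 * (A13 * G10) / (G1 * G2 * (A2 * G9) * G10 * G4 * G3) =
      (-1) ^ n * A13 * A14 / (A1 * A2) := by
    have r1' : G6 * G5 * 2 ^ n = A14 * (G4 * G3) := by rw [r1, div_mul_cancel₀ _ t2]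
    rw [div_eq_div_iff (by simp [*]) (by simp [*])]
    refine mul_left_cancel₀ t2 ?_
    linear_combination (G9 * A13 * G10 * A2 * G6 * G5 * 2 ^ n) * r2 +
      (G9 * A13 * G10 * A2 * (-1) ^ n * (G1 * G2 * 2 ^ n)) * r1'
  rw [r5]
  clear r1 r2 r5 m1 m2 m3 m4 m5 m6
  generalize (-1 : ℂ) ^ n = e
  generalize (2 : ℂ) ^ n = t at *
  generalize (n.factorial : ℂ) = F at *
  generalize (k.factorial : ℂ) = F' at *
  field_simp

end

/-! ### Geometric growth in n and analyticity of the sum over n -/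

noncomputable section
variable {a b c : ℂ}

lemma norm_kap_le (a b c : ℂ) {n i : ℕ} (hi : i < 2 * n) :
    ‖kap a b c n i‖ ≤ ((‖a‖ + ‖b‖ + ‖c‖ + 3) * (n + 1)) := by
  have h0 : (0 : ℝ) ≤ n := n.cast_nonneg
  have ha := norm_nonneg a
  have hb := norm_nonneg b
  have hc := norm_nonneg c
  have hp : 0 ≤ (‖a‖ + ‖b‖ + ‖c‖) * n := by positivity
  unfold kap
  split_ifs with h
  · have h1 : ((i : ℕ) : ℝ) ≤ n := by exact_mod_cast h.le
    calc ‖c - b + (i : ℂ)‖ ≤ ‖c‖ + ‖b‖ + i := by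
          refine (norm_add_le _ _).trans (add_le_add (norm_sub_le _ _) ?_)
          simp
      _ ≤ _ := by nlinarith
  · have h1 : (((i - n : ℕ) : ℕ) : ℝ) ≤ n := by exact_mod_cast (by omega : i - n ≤ n)
    rw [norm_div, Complex.norm_ofNat, div_le_iff₀ two_pos]
    calc ‖a - c - (n : ℂ) + 1 + ((i - n : ℕ) : ℂ)‖ ≤ ‖a‖ + ‖c‖ + n + 1 + (i - n : ℕ) := by
          refine (norm_add_le _ _).trans (add_le_add ((norm_add_le _ _).trans (add_le_add
            ((norm_sub_le _ _).trans (add_le_add (norm_sub_le _ _) ?_)) ?_)) ?_) <;> simp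
      _ ≤ _ := by nlinarith

lemma succ_pow_le_exp (M n : ℕ) : (1 + n : ℝ) ^ M ≤ M.factorial * Real.exp (1 + n) := by
  have := Real.pow_div_factorial_le_exp (1 + n : ℝ) (by positivity) M
  rwa [div_le_iff₀' (by positivity)] at this

/-- The sum of moduli (3B(n+1))^(2n) is balanced by the factor 1/(n! (c-a-b+1)_n): since (n+1)^n ≤
n! e^(n+1), the factorials cancel and only a geometric factor remains. -/
lemma psi_bound (hg : Generic a b c) : ∃ C ≥ 1, ∀ (n : ℕ), ∀ z ∈ cutPlane,
    ‖psi a b c n z‖ ≤ C * (C * max ‖1 - z‖ ‖1 - z‖⁻¹) ^ n * ‖(1 - z) ^ (c - a - b)‖ := by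
  have hq : NotInt (c - a - b + 1) := hg.abc_int.of_eq_sub 1 (by push_cast; ring)
  obtain ⟨C, hC, M, h⟩ := factorial_le_asc_norm hq.ne_neg
  set B := ‖a‖ + ‖b‖ + ‖c‖ + 3 with hB
  have hB0 : 3 ≤ B := by rw [hB]; linarith [norm_nonneg a, norm_nonneg b, norm_nonneg c]
  set D := 2 * (9 * B ^ 2) * Real.exp 3 + C * M.factorial * Real.exp 3 with hD
  have e3 : 1 ≤ Real.exp 3 := Real.one_le_exp (by norm_num)
  have hD1 : 2 * (9 * B ^ 2) * Real.exp 3 ≤ D := by rw [hD]; nlinarith [show 0 ≤ C * M.factorial * Real.exp 3 by positivity]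
  have hD2 : C * M.factorial * Real.exp 3 ≤ D := by rw [hD]; nlinarith [show 0 ≤ 2 * (9 * B ^ 2) * Real.exp 3 by positivity]
  have hDone : 1 ≤ D := le_trans (by nlinarith) hD1
  refine ⟨D, hDone, fun n z hz => ?_⟩
  have hz0 : 1 - z ≠ 0 := Complex.slitPlane_ne_zero hz
  have hpos : 0 < ‖1 - z‖ := norm_pos_iff.2 hz0
  set X := max ‖1 - z‖ ‖1 - z‖⁻¹ with hX
  have hX1 : 1 ≤ X := by
    rcases le_total 1 ‖1 - z‖ with h | h
    · exact h.trans (le_max_left _ _)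
    · exact (one_le_inv₀ hpos |>.2 h).trans (le_max_right _ _)
  -- The exponents that occur are c-a-b + (n-j) with 0 ≤ j ≤ 2n, so they differ from c-a-b by at
  -- most n in either direction; this explains the maximum of ‖1-z‖ and its inverse.
  have hpow : ∀ j ∈ Finset.range (2 * n + 1),
      ‖(1 - z) ^ (-(a + b - c - n + j))‖ ≤ X ^ n * ‖(1 - z) ^ (c - a - b)‖ := by
    intro j hj
    have hj' : j < 2 * n + 1 := Finset.mem_range.1 hj
    rcases le_total j n with hjn | hjn
    · have : -(a + b - c - (n : ℂ) + j) = ((n - j : ℕ) : ℂ) + (c - a - b) := by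
        push_cast [hjn]; ring
      rw [this, Complex.cpow_add _ _ hz0, norm_mul, Complex.cpow_natCast, norm_pow]
      gcongr
      calc ‖1 - z‖ ^ (n - j) ≤ X ^ (n - j) := by gcongr; exact le_max_left _ _
        _ ≤ X ^ n := pow_le_pow_right₀ hX1 (Nat.sub_le _ _)
    · have : -(a + b - c - (n : ℂ) + j) = -((j - n : ℕ) : ℂ) + (c - a - b) := by
        push_cast [hjn]; ring
      rw [this, Complex.cpow_add _ _ hz0, norm_mul, Complex.cpow_neg, Complex.cpow_natCast,
        norm_inv, norm_pow, ← inv_pow]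
      gcongr
      calc ‖1 - z‖⁻¹ ^ (j - n) ≤ X ^ (j - n) := by gcongr; exact le_max_right _ _
        _ ≤ X ^ n := pow_le_pow_right₀ hX1 (by omega)
  have hsum := expCoef_norm_sum (β := a + b - c - n) (κ := kap a b c n) (L := B * (n + 1)) (2 * n)
    (fun i hi => norm_kap_le a b c hi) (by
      have : ‖a + b - c - (n : ℂ)‖ ≤ ‖a‖ + ‖b‖ + ‖c‖ + n := by
        refine (norm_sub_le _ _).trans (add_le_add ((norm_sub_le _ _).trans
          (add_le_add (norm_add_le _ _) le_rfl)) ?_)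
        simp
      have h0 : (0 : ℝ) ≤ n := n.cast_nonneg
      have hp : 0 ≤ (‖a‖ + ‖b‖ + ‖c‖) * n := by positivity
      push_cast
      rw [hB]
      nlinarith)
  have h1 : ‖expFun (a + b - c - n) (kap a b c n) (2 * n) z‖ ≤
      (3 * (B * (n + 1))) ^ (2 * n) * (X ^ n * ‖(1 - z) ^ (c - a - b)‖) := by
    unfold expFun
    refine (norm_sum_le _ _).trans ((Finset.sum_le_sum fun j hj => ?_).trans
      ((Finset.sum_mul _ _ _).symm.le.trans (mul_le_mul_of_nonneg_right hsum (by positivity))))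
    rw [norm_mul]
    exact mul_le_mul_of_nonneg_left (hpow j hj) (norm_nonneg _)
  have h2 : ‖psiConst a b c n‖ ≤ 2 ^ n * (C * (1 + n) ^ M) / (n.factorial : ℝ) ^ 2 := by
    have hA := norm_pos_iff.2 (asc_ne_zero hq.ne_neg n)
    rw [psiConst, norm_div, norm_pow, norm_neg, Complex.norm_ofNat, norm_mul,
      Complex.norm_natCast, div_le_div_iff₀ (by positivity) (by positivity)]
    calc 2 ^ n * (n.factorial : ℝ) ^ 2 = 2 ^ n * n.factorial * n.factorial := by ring
      _ ≤ 2 ^ n * n.factorial * (C * (1 + n : ℝ) ^ M * ‖asc (c - a - b + 1) n‖) := by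
        gcongr; exact h n
      _ = _ := by ring
  have h3 : ((n : ℝ) + 1) ^ n ≤ n.factorial * Real.exp (1 + n) := by
    rw [add_comm]; exact succ_pow_le_exp n n
  have h4 := succ_pow_le_exp M n
  rw [psi, norm_mul]
  calc _ ≤ 2 ^ n * (C * (1 + n : ℝ) ^ M) / (n.factorial : ℝ) ^ 2 *
        ((3 * (B * (n + 1))) ^ (2 * n) * (X ^ n * ‖(1 - z) ^ (c - a - b)‖)) := by gcongr
    _ = (2 * (9 * B ^ 2)) ^ n * C * (1 + n : ℝ) ^ M * (((n : ℝ) + 1) ^ n) ^ 2 /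
        (n.factorial : ℝ) ^ 2 * X ^ n * ‖(1 - z) ^ (c - a - b)‖ := by
      generalize (n : ℝ) + 1 = N
      rw [pow_mul (3 * (B * N)) 2 n, show (3 * (B * N)) ^ 2 = 9 * B ^ 2 * N ^ 2 by ring,
        mul_pow (9 * B ^ 2), mul_pow 2 (9 * B ^ 2) n]
      ring
    _ ≤ (2 * (9 * B ^ 2)) ^ n * C * (M.factorial * Real.exp (1 + n)) *
        (n.factorial * Real.exp (1 + n)) ^ 2 /
        (n.factorial : ℝ) ^ 2 * X ^ n * ‖(1 - z) ^ (c - a - b)‖ := by gcongr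
    _ = (C * M.factorial * Real.exp 3) * ((2 * (9 * B ^ 2) * Real.exp 3) * X) ^ n *
        ‖(1 - z) ^ (c - a - b)‖ := by
      have : Real.exp 3 * Real.exp 3 ^ n = Real.exp (1 + n) ^ 3 := by
        rw [← Real.exp_nat_mul, ← Real.exp_nat_mul, ← Real.exp_add]; congr 1; push_cast; ring
      rw [mul_pow _ X, mul_pow _ (Real.exp 3)]
      field_simp
      linear_combination (-‖(1 - z) ^ (c - a - b)‖) * this
    _ ≤ _ := by gcongr

/-- The sum over `n` of the continued coefficients. -/
def psiSum (a b c : ℂ) (q : ℂ × ℂ) : ℂ := ∑' n : ℕ, q.1 ^ n * psi a b c n q.2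

/-- Near which points `psiSum` converges locally uniformly. -/
lemma exists_analyticAt_psiSum (hg : Generic a b c) : ∃ C ≥ 1, ∀ u : ℂ, ∀ z ∈ cutPlane,
    C * ‖u‖ < ‖1 - z‖ → C * ‖u‖ * ‖1 - z‖ < 1 → AnalyticAt ℂ (psiSum a b c) (u, z) := by
  obtain ⟨C, hC, h⟩ := psi_bound hg
  refine ⟨C, hC, fun u z hz h1 h2 => ?_⟩
  have hpos : 0 < ‖1 - z‖ := norm_pos_iff.2 (Complex.slitPlane_ne_zero hz)
  have hC0 : 0 < C := by linarith
  have hm : ‖u‖ * (C * max ‖1 - z‖ ‖1 - z‖⁻¹) < 1 := by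
    rw [← mul_assoc, mul_comm ‖u‖, mul_max_of_nonneg _ _ (by positivity), max_lt_iff]
    exact ⟨h2, by rwa [← div_eq_mul_inv, div_lt_one hpos]⟩
  obtain ⟨ρ, hρu, hρ⟩ : ∃ ρ, ‖u‖ < ρ ∧ ρ * (C * max ‖1 - z‖ ‖1 - z‖⁻¹) < 1 := by
    have hp : 0 < C * max ‖1 - z‖ ‖1 - z‖⁻¹ := mul_pos hC0 (hpos.trans_le (le_max_left _ _))
    obtain ⟨ρ, h3, h4⟩ := exists_between ((lt_div_iff₀ hp).2 hm)
    exact ⟨ρ, h3, (lt_div_iff₀ hp).1 h4⟩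
  have hρ0 : 0 < ρ := (norm_nonneg u).trans_lt hρu
  have hopen : IsOpen cutPlane := Complex.isOpen_slitPlane.preimage (continuous_const.sub continuous_id)
  have hcont : ContinuousAt (fun w : ℂ => ρ * (C * max ‖1 - w‖ ‖1 - w‖⁻¹)) z := by
    have : ContinuousAt (fun w : ℂ => ‖1 - w‖) z := by fun_prop
    exact continuousAt_const.mul (continuousAt_const.mul (this.max (this.inv₀ hpos.ne')))
  have hcont' : ContinuousAt (fun w : ℂ => ‖(1 - w) ^ (c - a - b)‖) z :=
    ((analyticAt_const.sub analyticAt_id).cpow analyticAt_const hz).continuousAt.norm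
  have ev := Filter.Eventually.and (hopen.mem_nhds hz) ((hcont.eventually (gt_mem_nhds hρ)).and
    (hcont'.eventually (gt_mem_nhds (lt_add_one _))))
  obtain ⟨δ, hδ, hball⟩ := Metric.eventually_nhds_iff_ball.1 (show ∀ᶠ w in 𝓝 z, _ from ev)
  refine analyticAt_tsum_pow_mul hδ (ψ := psi a b c) (ρ := ρ)
    (M := C * (‖(1 - z) ^ (c - a - b)‖ + 1)) (fun n w hw =>
      (analyticOnNhd_psi n w (hball w hw).1).differentiableAt.differentiableWithinAt)
    (fun n w hw => ?_) hρu
  obtain ⟨g1, g2, g3⟩ := hball w hw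
  have hX : 0 ≤ C * max ‖1 - w‖ ‖1 - w‖⁻¹ := by positivity
  calc ‖psi a b c n w‖ * ρ ^ n ≤
      (C * (C * max ‖1 - w‖ ‖1 - w‖⁻¹) ^ n * ‖(1 - w) ^ (c - a - b)‖) * ρ ^ n := by
        gcongr; exact h n w g1
    _ = C * ‖(1 - w) ^ (c - a - b)‖ * (ρ * (C * max ‖1 - w‖ ‖1 - w‖⁻¹)) ^ n := by
        rw [mul_pow ρ]; ring
    _ ≤ C * (‖(1 - z) ^ (c - a - b)‖ + 1) * 1 := by
        gcongr
        exact pow_le_one₀ (by positivity) g2.le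
    _ = _ := mul_one _

lemma exists_continuation_inner4F3 (hg : Generic a b c) (n : ℕ) :
    ∃ g : ℂ → ℂ, AnalyticOnNhd ℂ g cutPlane ∧
      (∀ z : ℂ, ‖z‖ < 1 → g z = inner4F3 a b c n z) ∧
      (∀ z ∈ cutPlane, 1 < ‖z‖ → g z = inner4F3AtInfinity a b c n z) := by
  have h0 := sumConst_ne_zero hg n
  refine ⟨fun z => (sumConst a b c n)⁻¹ * psi a b c n z,
    analyticOnNhd_const.mul (analyticOnNhd_psi n), fun z hz => ?_, fun z hz h1 => ?_⟩
  · beta_reduce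
    rw [← sumConst_mul_inner4F3 hg n hz, inv_mul_cancel_left₀ h0]
  · beta_reduce
    rw [← sumConst_mul_inner4F3AtInfinity hg n hz h1, inv_mul_cancel_left₀ h0]

end

/-! ### Regions of convergence as unions of polydiscs -/

noncomputable section

/-- The interior of the region of convergence of the power series with coefficients `c`. -/
def convSet (c : ℕ × ℕ → ℂ) : Set (ℂ × ℂ) :=
  {q | ∃ A B : ℝ, ‖q.1‖ < A ∧ ‖q.2‖ < B ∧ Summable fun k : ℕ × ℕ => ‖c k‖ * (A ^ k.1 * B ^ k.2)}

variable {co : ℕ × ℕ → ℂ}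

lemma isOpen_convSet (co : ℕ × ℕ → ℂ) : IsOpen (convSet co) := by
  refine isOpen_iff_mem_nhds.2 fun q ⟨A, B, hA, hB, h⟩ => ?_
  have h1 : ContinuousAt (fun q : ℂ × ℂ => ‖q.1‖) q := by fun_prop
  have h2 : ContinuousAt (fun q : ℂ × ℂ => ‖q.2‖) q := by fun_prop
  filter_upwards [h1.eventually (gt_mem_nhds hA), h2.eventually (gt_mem_nhds hB)] with w hw1 hw2
  exact ⟨A, B, hw1, hw2, h⟩

lemma convSet_mono {q q' : ℂ × ℂ} (hq : q ∈ convSet co) (h1 : ‖q'.1‖ ≤ ‖q.1‖)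
    (h2 : ‖q'.2‖ ≤ ‖q.2‖) : q' ∈ convSet co := by
  obtain ⟨A, B, hA, hB, h⟩ := hq
  exact ⟨A, B, h1.trans_lt hA, h2.trans_lt hB, h⟩

lemma summable_norm_of_mem_convSet {q : ℂ × ℂ} (hq : q ∈ convSet co) :
    Summable fun k : ℕ × ℕ => ‖co k‖ * (‖q.1‖ ^ k.1 * ‖q.2‖ ^ k.2) := by
  obtain ⟨A, B, hA, hB, h⟩ := hq
  refine Summable.of_nonneg_of_le (fun k => by positivity) (fun k => ?_) h
  have hA0 : 0 ≤ A := (norm_nonneg _).trans hA.le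
  gcongr

lemma summable_of_mem_convSet {q : ℂ × ℂ} (hq : q ∈ convSet co) :
    Summable fun k : ℕ × ℕ => co k * (q.1 ^ k.1 * q.2 ^ k.2) := by
  refine Summable.of_norm ((summable_norm_of_mem_convSet hq).congr fun k => ?_)
  simp

lemma analyticAt_of_mem_convSet {q : ℂ × ℂ} (hq : q ∈ convSet co) :
    AnalyticAt ℂ (fun p : ℂ × ℂ => ∑' k : ℕ × ℕ, co k * (p.1 ^ k.1 * p.2 ^ k.2)) q := by
  obtain ⟨A, B, hA, hB, h⟩ := hq
  exact analyticAt_doubleSeries h hA hB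

lemma exists_norm_gt_near (w : ℂ) {ε : ℝ} (hε : 0 < ε) : ∃ w' : ℂ, dist w' w < ε ∧ ‖w‖ < ‖w'‖ := by
  rcases eq_or_ne w 0 with rfl | hw
  · refine ⟨((ε / 2 : ℝ) : ℂ), ?_, ?_⟩
    · rw [dist_zero_right, Complex.norm_real, Real.norm_of_nonneg (by positivity)]; linarith
    · rw [norm_zero, Complex.norm_real, Real.norm_of_nonneg (by positivity)]; linarith
  · have hw' := norm_pos_iff.2 hw
    refine ⟨((1 + ε / (2 * ‖w‖) : ℝ) : ℂ) * w, ?_, ?_⟩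
    · rw [dist_eq_norm, show ((1 + ε / (2 * ‖w‖) : ℝ) : ℂ) * w - w =
        ((ε / (2 * ‖w‖) : ℝ) : ℂ) * w by push_cast; ring, norm_mul, Complex.norm_real,
        Real.norm_of_nonneg (by positivity)]
      field_simp
      linarith
    · rw [norm_mul, Complex.norm_real, Real.norm_of_nonneg (by positivity)]
      have : 0 < ε / (2 * ‖w‖) := by positivity
      nlinarith

/-- Near an interior point there are points of convergence with both moduli strictly larger, and
convergence at such a point gives a polydisc. -/
lemma interior_summable (co : ℕ × ℕ → ℂ) :
    interior {q : ℂ × ℂ | Summable fun k : ℕ × ℕ => co k * (q.1 ^ k.1 * q.2 ^ k.2)} =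
      convSet co := by
  refine Subset.antisymm (fun q hq => ?_)
    (interior_maximal (fun q hq => summable_of_mem_convSet hq) (isOpen_convSet co))
  obtain ⟨ε, hε, hball⟩ := Metric.mem_nhds_iff.1 (mem_interior_iff_mem_nhds.1 hq)
  obtain ⟨w₁, h1, h1'⟩ := exists_norm_gt_near q.1 hε
  obtain ⟨w₂, h2, h2'⟩ := exists_norm_gt_near q.2 hε
  have hmem : (w₁, w₂) ∈ Metric.ball q ε := by
    rw [Metric.mem_ball, Prod.dist_eq]; exact max_lt h1 h2
  refine ⟨‖w₁‖, ‖w₂‖, h1', h2', ((hball hmem : Summable _).norm).congr fun k => ?_⟩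
  simp

/-- A change of variables that is locally a homeomorphism carries interior to interior, so the
region of a series in other variables can be read off from those variables. -/
lemma mem_interior_summable_iff {φ ψ : ℂ × ℂ → ℂ × ℂ} {p : ℂ × ℂ} (hφ : ContinuousAt φ p)
    (hψ : ContinuousAt ψ (φ p)) (hp : ψ (φ p) = p) (hinv : ∀ᶠ q in 𝓝 (φ p), φ (ψ q) = q) :
    p ∈ interior {p : ℂ × ℂ | Summable fun k : ℕ × ℕ => co k * ((φ p).1 ^ k.1 * (φ p).2 ^ k.2)} ↔
      φ p ∈ convSet co := by
  rw [← interior_summable, mem_interior_iff_mem_nhds, mem_interior_iff_mem_nhds]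
  constructor
  · intro h
    have h1 : ContinuousAt ψ (φ p) := hψ
    rw [ContinuousAt, hp] at h1
    filter_upwards [h1 h, hinv] with q h2 h3
    have h4 : Summable fun k : ℕ × ℕ => co k * ((φ (ψ q)).1 ^ k.1 * (φ (ψ q)).2 ^ k.2) := h2
    rwa [h3] at h4
  · intro h
    exact hφ h

variable {a b c : ℂ}

/-- The coefficients of `H₅`. -/
def hornCoef (a b c : ℂ) (k : ℕ × ℕ) : ℂ :=
  poch a (2 * k.1 + k.2) * poch b (k.2 - k.1) / poch c k.2 / (k.1.factorial * k.2.factorial)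

/-- The coefficients of the first series. -/
def firstCoef (a b c : ℂ) (k : ℕ × ℕ) : ℂ :=
  poch (a - c + 1) (2 * k.1) * poch a (2 * k.1 + k.2) * poch b (k.2 - k.1) /
      (poch (c - b) k.1 * poch (a + b - c + 1) (k.1 + k.2)) / (k.1.factorial * k.2.factorial)

lemma hornH5Term_eq (a b c : ℂ) (p : ℂ × ℂ) (k : ℕ × ℕ) : hornH5Term a b c p k =
    hornCoef a b c k * (p.1 ^ k.1 * p.2 ^ k.2) := by
  simp only [hornH5Term, hornCoef]; ring

lemma firstTerm_eq (a b c : ℂ) (p : ℂ × ℂ) (k : ℕ × ℕ) : firstTerm a b c p k =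
    firstCoef a b c k * ((-p.1) ^ k.1 * (1 - p.2) ^ k.2) := by
  simp only [firstTerm, firstCoef]; ring

lemma regionOfConvergence_hornH5Term :
    regionOfConvergence (hornH5Term a b c) = convSet (hornCoef a b c) := by
  rw [← interior_summable, regionOfConvergence]
  congr 1
  ext p
  exact summable_congr fun k => hornH5Term_eq a b c p k

lemma mem_region_first_iff {p : ℂ × ℂ} : p ∈ regionOfConvergence (firstTerm a b c) ↔
    (-p.1, 1 - p.2) ∈ convSet (firstCoef a b c) := by
  have h : {p | Summable (firstTerm a b c p)} = {p : ℂ × ℂ | Summable fun k : ℕ × ℕ =>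
      firstCoef a b c k * ((-p.1) ^ k.1 * (1 - p.2) ^ k.2)} := by
    ext p
    exact summable_congr fun k => firstTerm_eq a b c p k
  rw [regionOfConvergence, h]
  exact mem_interior_summable_iff (φ := fun p => (-p.1, 1 - p.2)) (ψ := fun p => (-p.1, 1 - p.2))
    (by fun_prop) (by fun_prop) (by simp) (by simp)

lemma mem_region_second_iff {p : ℂ × ℂ} (hp : 1 - p.2 ≠ 0) :
    p ∈ regionOfConvergence (secondTerm a b c) ↔
    (-(p.1 / (1 - p.2)), 1 - p.2) ∈ convSet (secondCoef a b c) := by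
  have h : {p | Summable (secondTerm a b c p)} = {p : ℂ × ℂ | Summable fun k : ℕ × ℕ =>
      secondCoef a b c k * ((-(p.1 / (1 - p.2))) ^ k.1 * (1 - p.2) ^ k.2)} := by
    ext p
    exact summable_congr fun k => secondTerm_eq a b c p k
  rw [regionOfConvergence, h]
  refine mem_interior_summable_iff (φ := fun p => (-(p.1 / (1 - p.2)), 1 - p.2))
    (ψ := fun q => (-(q.1 * q.2), 1 - q.2)) ?_ (by fun_prop) ?_ ?_
  · exact ((continuousAt_fst.div (continuousAt_const.sub continuousAt_snd) hp).neg).prodMk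
      (continuousAt_const.sub continuousAt_snd)
  · ext <;> simp [div_mul_cancel₀ _ hp]
  · have : ContinuousAt (fun q : ℂ × ℂ => q.2) (-(p.1 / (1 - p.2)), 1 - p.2) := by fun_prop
    filter_upwards [this.eventually_ne hp] with q hq
    ext
    · simp [neg_div, mul_div_cancel_right₀ _ (show q.2 ≠ 0 from hq)]
    · simp

lemma mem_region_new_iff {p : ℂ × ℂ} (hp : p.1 ≠ 0) :
    p ∈ regionOfConvergence (newTerm a b c) ↔
    ((1 - p.2) / p.1, -p.1) ∈ convSet (newCoef a b c) := by
  have h : {p | Summable (newTerm a b c p)} = {p : ℂ × ℂ | Summable fun k : ℕ × ℕ =>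
      newCoef a b c k * (((1 - p.2) / p.1) ^ k.1 * (-p.1) ^ k.2)} := by
    ext p
    exact summable_congr fun k => newTerm_eq a b c p k
  rw [regionOfConvergence, h]
  refine mem_interior_summable_iff (φ := fun p => ((1 - p.2) / p.1, -p.1))
    (ψ := fun q => (-q.2, 1 + q.1 * q.2)) ?_ (by fun_prop) ?_ ?_
  · exact ((continuousAt_const.sub continuousAt_snd).div continuousAt_fst hp).prodMk
      continuousAt_fst.neg
  · ext
    · simp
    · simp [div_mul_cancel₀ _ hp]
  · have : ContinuousAt (fun q : ℂ × ℂ => q.2) ((1 - p.2) / p.1, -p.1) := by fun_prop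
    filter_upwards [this.eventually_ne (neg_ne_zero.2 hp)] with q hq
    have hq' : q.2 ≠ 0 := hq
    ext
    · simp only; field_simp; ring
    · simp

end

/-! ### Comparison of the coefficients with products of factorials -/

noncomputable section
variable {a b c : ℂ}

lemma PolyLE.div {f g f' g' : ℕ × ℕ → ℝ} (h : PolyLE f g) (h' : PolyLE f' g')
    (hg : ∀ k, 0 ≤ g k) (hf' : ∀ k, 0 < f' k) (hg' : ∀ k, 0 < g' k) :
    PolyLE (fun k => f k / g' k) (fun k => g k / f' k) := by
  simp only [div_eq_mul_inv]
  exact h.mul (h'.inv hf' hg') (fun k => (inv_pos.2 (hg' k)).le) hg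

lemma PolyLE.refl (f : ℕ × ℕ → ℝ) : PolyLE f f := PolyLE.of_le fun _ => le_rfl

/-- The product of factorials to which the coefficients of the new series are compared. -/
def newMaj (k : ℕ × ℕ) : ℝ :=
  zfact (k.1 - k.2) * zfact (k.1 - k.2) * zfact (2 * k.1 - k.2) /
    (zfact (k.1 - 2 * k.2) * zfact (2 * (k.1 - k.2))) / (k.1.factorial * k.2.factorial)

/-- The product of factorials to which the coefficients of the second series are compared. -/
def secondMaj (k : ℕ × ℕ) : ℝ :=
  zfact (2 * k.1) * zfact (k.2 - 2 * k.1) * zfact (k.1 + k.2) /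
    (zfact k.1 * zfact (k.2 - k.1)) / (k.1.factorial * k.2.factorial)

/-- The product of factorials to which the coefficients of the first series are compared. -/
def firstMaj (k : ℕ × ℕ) : ℝ :=
  zfact (2 * k.1) * zfact (2 * k.1 + k.2) * zfact (k.2 - k.1) /
    (zfact k.1 * zfact (k.1 + k.2)) / (k.1.factorial * k.2.factorial)

/-- The product of factorials to which the coefficients of `H₅` are compared. -/
def hornMaj (k : ℕ × ℕ) : ℝ :=
  zfact (2 * k.1 + k.2) * zfact (k.2 - k.1) / zfact k.2 / (k.1.factorial * k.2.factorial)

lemma poch_norm_pos {w : ℂ} (hw : NotInt w) (k : ℤ) : 0 < ‖poch w k‖ :=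
  norm_pos_iff.2 (poch_ne_zero hw k)

lemma asc_norm_pos {w : ℂ} (hw : ∀ k : ℕ, w ≠ -(k : ℂ)) (n : ℕ) : 0 < ‖asc w n‖ :=
  norm_pos_iff.2 (asc_ne_zero hw n)

lemma norm_newCoef (k : ℕ × ℕ) : ‖newCoef a b c k‖ = ‖poch (a + 2 * b - 2 * c + 1) (k.1 - k.2)‖ *
    ‖poch (a + b - c) (k.1 - k.2)‖ * ‖poch (a + 2 * b - c) (2 * k.1 - k.2)‖ /
      (‖poch (a + 2 * b - 2 * c + 1) (k.1 - 2 * k.2)‖ *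
        ‖poch (a + 2 * b - c) (2 * (k.1 - k.2))‖) / (k.1.factorial * k.2.factorial) := by
  simp [newCoef]

lemma polyLE_newCoef (hg : Generic a b c) : PolyLE (fun k => ‖newCoef a b c k‖) newMaj ∧
    PolyLE newMaj (fun k => ‖newCoef a b c k‖) := by
  have h1 : NotInt (a + 2 * b - 2 * c + 1) := hg.abc₂_int.of_eq_add 1 (by push_cast; ring)
  have l1 : ∀ k : ℕ × ℕ, ((k.1 : ℤ) - k.2).natAbs ≤ 2 * (k.1 + k.2) := fun k => by omega
  have l2 : ∀ k : ℕ × ℕ, (2 * (k.1 : ℤ) - k.2).natAbs ≤ 2 * (k.1 + k.2) := fun k => by omega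
  have l3 : ∀ k : ℕ × ℕ, ((k.1 : ℤ) - 2 * k.2).natAbs ≤ 2 * (k.1 + k.2) := fun k => by omega
  have l4 : ∀ k : ℕ × ℕ, (2 * ((k.1 : ℤ) - k.2)).natAbs ≤ 2 * (k.1 + k.2) := fun k => by omega
  have z1 : ∀ j, 0 ≤ zfact j := fun j => (zfact_pos j).le
  have z2 := zfact_pos
  have p1 := fun j => poch_norm_pos h1 j
  have p2 := fun j => poch_norm_pos hg.abc_int j
  have p3 := fun j => poch_norm_pos hg.abc₁_int j
  have q1 := fun j => (poch_norm_pos h1 j).le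
  have q2 := fun j => (poch_norm_pos hg.abc_int j).le
  have q3 := fun j => (poch_norm_pos hg.abc₁_int j).le
  constructor
  · refine ((((((polyLE_poch h1 _ l1).mul (polyLE_poch hg.abc_int _ l1) ?_ ?_).mul
      (polyLE_poch hg.abc₁_int _ l2) ?_ ?_).div ((polyLE_zfact h1 _ l3).mul
      (polyLE_zfact hg.abc₁_int _ l4) ?_ ?_) ?_ ?_ ?_).div (PolyLE.refl
        fun k => (k.1.factorial * k.2.factorial : ℝ)) ?_ ?_ ?_)).congr norm_newCoef fun k => rfl
    all_goals
      intro k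
      repeat' first
        | exact z1 _ | exact z2 _ | exact p1 _ | exact p2 _ | exact p3 _ | exact q1 _ | exact q2 _
        | exact q3 _ | positivity | apply mul_pos | apply mul_nonneg | apply div_nonneg
        | apply inv_nonneg.2
  · refine ((((((polyLE_zfact h1 _ l1).mul (polyLE_zfact hg.abc_int _ l1) ?_ ?_).mul
      (polyLE_zfact hg.abc₁_int _ l2) ?_ ?_).div ((polyLE_poch h1 _ l3).mul
      (polyLE_poch hg.abc₁_int _ l4) ?_ ?_) ?_ ?_ ?_).div (PolyLE.refl
        fun k => (k.1.factorial * k.2.factorial : ℝ)) ?_ ?_ ?_)).congr (fun k => rfl)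
        fun k => (norm_newCoef k).symm
    all_goals
      intro k
      repeat' first
        | exact z1 _ | exact z2 _ | exact p1 _ | exact p2 _ | exact p3 _ | exact q1 _ | exact q2 _
        | exact q3 _ | positivity | apply mul_pos

lemma norm_secondCoef (k : ℕ × ℕ) : ‖secondCoef a b c k‖ = ‖asc (a - c + 1) (2 * k.1)‖ *
    ‖poch (c - a) (k.2 - 2 * k.1)‖ * ‖asc (c - b) (k.1 + k.2)‖ /
      (‖asc (c - b) k.1‖ * ‖poch (c - a - b + 1) (k.2 - k.1)‖) /
        (k.1.factorial * k.2.factorial) := by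
  rw [← poch_natCast, ← poch_natCast, ← poch_natCast]
  simp [secondCoef]

/-- The symbols in c - b have natural indices only, so it suffices that c - b is not a non-positive
integer. -/
lemma polyLE_secondCoef (hg : Generic a b c) : PolyLE (fun k => ‖secondCoef a b c k‖) secondMaj ∧
    PolyLE secondMaj (fun k => ‖secondCoef a b c k‖) := by
  have h1 : NotInt (a - c + 1) := hg.ca_int.of_eq_sub 1 (by push_cast; ring)
  have h2 : NotInt (c - a - b + 1) := hg.abc_int.of_eq_sub 1 (by push_cast; ring)
  have l1 : ∀ k : ℕ × ℕ, 2 * k.1 ≤ 2 * (k.1 + k.2) := fun k => by omega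
  have l2 : ∀ k : ℕ × ℕ, ((k.2 : ℤ) - 2 * k.1).natAbs ≤ 2 * (k.1 + k.2) := fun k => by omega
  have l3 : ∀ k : ℕ × ℕ, k.1 + k.2 ≤ 2 * (k.1 + k.2) := fun k => by omega
  have l4 : ∀ k : ℕ × ℕ, k.1 ≤ 2 * (k.1 + k.2) := fun k => by omega
  have l5 : ∀ k : ℕ × ℕ, ((k.2 : ℤ) - k.1).natAbs ≤ 2 * (k.1 + k.2) := fun k => by omega
  have z1 : ∀ j, 0 ≤ zfact j := fun j => (zfact_pos j).le
  have z2 := zfact_pos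
  have p1 := fun j => asc_norm_pos h1.ne_neg j
  have p2 := fun j => asc_norm_pos hg.cb_ne j
  have p3 := fun j => poch_norm_pos h2 j
  have q1 := fun j => poch_norm_pos hg.ca_int j
  have q2 := fun j => (q1 j).le
  constructor
  · refine ((((((polyLE_asc (a - c + 1) _ l1).mul (polyLE_poch hg.ca_int _ l2) ?_ ?_).mul
      (polyLE_asc (c - b) _ l3) ?_ ?_).div ((polyLE_zfact_asc hg.cb_ne _ l4).mul
      (polyLE_zfact h2 _ l5) ?_ ?_) ?_ ?_ ?_).div (PolyLE.refl
        fun k => (k.1.factorial * k.2.factorial : ℝ)) ?_ ?_ ?_)).congr norm_secondCoef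
        fun k => by simp [secondMaj]
    all_goals
      intro k
      repeat' first
        | exact z1 _ | exact z2 _ | exact p1 _ | exact p2 _ | exact p3 _ | exact q1 _ | exact q2 _
        | exact q3 _ | positivity | apply mul_pos | apply mul_nonneg | apply div_nonneg
        | apply inv_nonneg.2
  · refine ((((((polyLE_zfact_asc h1.ne_neg _ l1).mul (polyLE_zfact hg.ca_int _ l2) ?_ ?_).mul
      (polyLE_zfact_asc hg.cb_ne _ l3) ?_ ?_).div ((polyLE_asc (c - b) _ l4).mul
      (polyLE_poch h2 _ l5) ?_ ?_) ?_ ?_ ?_).div (PolyLE.refl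
        fun k => (k.1.factorial * k.2.factorial : ℝ)) ?_ ?_ ?_)).congr
        (fun k => by simp [secondMaj]) fun k => (norm_secondCoef k).symm
    all_goals
      intro k
      repeat' first
        | exact z1 _ | exact z2 _ | exact p1 _ | exact p2 _ | exact p3 _ | exact q1 _ | exact q2 _
        | exact q3 _ | positivity | apply mul_pos

lemma norm_firstCoef (k : ℕ × ℕ) : ‖firstCoef a b c k‖ = ‖asc (a - c + 1) (2 * k.1)‖ *
    ‖asc a (2 * k.1 + k.2)‖ * ‖poch b (k.2 - k.1)‖ /
      (‖asc (c - b) k.1‖ * ‖asc (a + b - c + 1) (k.1 + k.2)‖) /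
        (k.1.factorial * k.2.factorial) := by
  rw [← poch_natCast, ← poch_natCast, ← poch_natCast, ← poch_natCast]
  simp [firstCoef]

/-- An upper bound only: the first series has to be shown convergent on certain sets, and its exact
region plays no role. -/
lemma polyLE_firstCoef (hg : Generic a b c) :
    PolyLE (fun k => ‖firstCoef a b c k‖) firstMaj := by
  have h2 : NotInt (a + b - c + 1) := hg.abc_int.of_eq_add 1 (by push_cast; ring)
  have l1 : ∀ k : ℕ × ℕ, 2 * k.1 ≤ 2 * (k.1 + k.2) := fun k => by omega
  have l2 : ∀ k : ℕ × ℕ, 2 * k.1 + k.2 ≤ 2 * (k.1 + k.2) := fun k => by omega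
  have l3 : ∀ k : ℕ × ℕ, k.1 + k.2 ≤ 2 * (k.1 + k.2) := fun k => by omega
  have l4 : ∀ k : ℕ × ℕ, k.1 ≤ 2 * (k.1 + k.2) := fun k => by omega
  have l5 : ∀ k : ℕ × ℕ, ((k.2 : ℤ) - k.1).natAbs ≤ 2 * (k.1 + k.2) := fun k => by omega
  have z1 : ∀ j, 0 ≤ zfact j := fun j => (zfact_pos j).le
  have z2 := zfact_pos
  have p1 := fun j => asc_norm_pos hg.cb_ne j
  have p2 := fun j => asc_norm_pos h2.ne_neg j
  have p3 := fun j => poch_norm_pos hg.b_int j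
  have q1 := fun j => (p1 j).le
  have q2 := fun j => (p2 j).le
  have q3 := fun j => (p3 j).le
  refine ((((((polyLE_asc (a - c + 1) _ l1).mul (polyLE_asc a _ l2) ?_ ?_).mul
    (polyLE_poch hg.b_int _ l5) ?_ ?_).div ((polyLE_zfact_asc hg.cb_ne _ l4).mul
    (polyLE_zfact_asc h2.ne_neg _ l3) ?_ ?_) ?_ ?_ ?_).div (PolyLE.refl
      fun k => (k.1.factorial * k.2.factorial : ℝ)) ?_ ?_ ?_)).congr norm_firstCoef
      fun k => by simp [firstMaj]
  all_goals
    intro k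
    repeat' first
      | exact z1 _ | exact z2 _ | exact p1 _ | exact p2 _ | exact p3 _ | exact q1 _ | exact q2 _
      | exact q3 _ | positivity | apply mul_pos | apply mul_nonneg | apply div_nonneg
        | apply inv_nonneg.2

lemma norm_hornCoef (k : ℕ × ℕ) : ‖hornCoef a b c k‖ = ‖asc a (2 * k.1 + k.2)‖ *
    ‖poch b (k.2 - k.1)‖ / ‖asc c k.2‖ / (k.1.factorial * k.2.factorial) := by
  rw [← poch_natCast, ← poch_natCast]
  simp [hornCoef]

lemma polyLE_hornCoef (hg : Generic a b c) : PolyLE (fun k => ‖hornCoef a b c k‖) hornMaj ∧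
    PolyLE hornMaj (fun k => ‖hornCoef a b c k‖) := by
  have l2 : ∀ k : ℕ × ℕ, 2 * k.1 + k.2 ≤ 2 * (k.1 + k.2) := fun k => by omega
  have l4 : ∀ k : ℕ × ℕ, k.2 ≤ 2 * (k.1 + k.2) := fun k => by omega
  have l5 : ∀ k : ℕ × ℕ, ((k.2 : ℤ) - k.1).natAbs ≤ 2 * (k.1 + k.2) := fun k => by omega
  have z1 : ∀ j, 0 ≤ zfact j := fun j => (zfact_pos j).le
  have z2 := zfact_pos
  have p1 := fun j => asc_norm_pos hg.a_ne j
  have p2 := fun j => asc_norm_pos hg.c_ne j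
  have p3 := fun j => poch_norm_pos hg.b_int j
  have q1 := fun j => (p1 j).le
  have q2 := fun j => (p2 j).le
  have q3 := fun j => (p3 j).le
  constructor
  · refine (((((polyLE_asc a _ l2).mul (polyLE_poch hg.b_int _ l5) ?_ ?_).div
      (polyLE_zfact_asc hg.c_ne _ l4) ?_ ?_ ?_).div (PolyLE.refl
        fun k => (k.1.factorial * k.2.factorial : ℝ)) ?_ ?_ ?_)).congr norm_hornCoef
        fun k => by simp [hornMaj]
    all_goals
      intro k
      repeat' first
        | exact z1 _ | exact z2 _ | exact p1 _ | exact p2 _ | exact p3 _ | exact q1 _ | exact q2 _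
        | exact q3 _ | positivity | apply mul_pos | apply mul_nonneg | apply div_nonneg
        | apply inv_nonneg.2
  · refine (((((polyLE_zfact_asc hg.a_ne _ l2).mul (polyLE_zfact hg.b_int _ l5) ?_ ?_).div
      (polyLE_asc c _ l4) ?_ ?_ ?_).div (PolyLE.refl
        fun k => (k.1.factorial * k.2.factorial : ℝ)) ?_ ?_ ?_)).congr
        (fun k => by simp [hornMaj]) fun k => (norm_hornCoef k).symm
    all_goals
      intro k
      repeat' first
        | exact z1 _ | exact z2 _ | exact p1 _ | exact p2 _ | exact p3 _ | exact q1 _ | exact q2 _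
        | exact q3 _ | positivity

end

/-! ### Factorial estimates for the new series: sufficiency -/

noncomputable section

lemma zfact_of_eq {k : ℤ} (n : ℕ) (h : k = n) : zfact k = n.factorial := by
  rw [h, zfact_natCast]

lemma zfact_of_eq_neg {k : ℤ} (n : ℕ) (h : k = -(n : ℤ)) : zfact k = (n.factorial : ℝ)⁻¹ := by
  rw [h, zfact_neg_natCast]

section Factorial

open Nat

lemma factorial_add_mul_pow_le {x y : ℝ} (hx : 0 ≤ x) (hy : 0 ≤ y) (i j : ℕ) :
    ((i + j)! : ℝ) * (x ^ i * y ^ j) ≤ i ! * j ! * (x + y) ^ (i + j) := by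
  have h : x ^ i * y ^ j * ((i + j).choose i : ℝ) ≤ (x + y) ^ (i + j) := by
    rw [add_pow]
    have := Finset.single_le_sum (f := fun m => x ^ m * y ^ (i + j - m) * ((i + j).choose m : ℝ))
      (fun m _ => by positivity) (Finset.mem_range.2 (by omega : i < i + j + 1))
    simpa using this
  have h2 : ((i + j)! : ℝ) = (i + j).choose i * i ! * j ! := by
    have := Nat.add_choose_mul_factorial_mul_factorial i j
    rw [Nat.choose_symm_add]
    exact_mod_cast this.symm
  rw [h2]
  calc _ = i ! * j ! * (x ^ i * y ^ j * ((i + j).choose i : ℝ)) := by ring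
    _ ≤ _ := by gcongr

lemma factorial_add_add_mul_pow_le {p q t : ℝ} (hp : 0 ≤ p) (hq : 0 ≤ q) (ht : 0 ≤ t)
    (h : p + q + t ≤ 1) (i j k : ℕ) :
    ((i + j + k)! : ℝ) * (p ^ i * q ^ j * t ^ k) ≤ i ! * j ! * k ! := by
  have h1 := factorial_add_mul_pow_le hp hq i j
  have h2 := factorial_add_mul_pow_le (add_nonneg hp hq) ht (i + j) k
  have h3 : (p + q + t) ^ (i + j + k) ≤ 1 := pow_le_one₀ (by positivity) h
  have hf : (0 : ℝ) < (i + j)! := by positivity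
  refine le_of_mul_le_mul_left ?_ hf
  calc ((i + j)! : ℝ) * (((i + j + k)! : ℝ) * (p ^ i * q ^ j * t ^ k)) =
      (((i + j)! : ℝ) * (p ^ i * q ^ j)) * (((i + j + k)! : ℝ) * t ^ k) := by ring
    _ ≤ (i ! * j ! * (p + q) ^ (i + j)) * (((i + j + k)! : ℝ) * t ^ k) := by gcongr
    _ = i ! * j ! * (((i + j + k)! : ℝ) * ((p + q) ^ (i + j) * t ^ k)) := by ring
    _ ≤ i ! * j ! * ((i + j)! * k ! * (p + q + t) ^ (i + j + k)) := by gcongr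
    _ ≤ i ! * j ! * ((i + j)! * k ! * 1) := by gcongr
    _ = _ := by ring

lemma factorial_add_le (i j : ℕ) : ((i + j)! : ℝ) ≤ 2 ^ (i + j) * (i ! * j !) := by
  have := factorial_add_mul_pow_le zero_le_one zero_le_one i j
  norm_num at this
  linarith

lemma factorial_mul_le (i j : ℕ) : (i ! * j ! : ℝ) ≤ (i + j)! := by
  exact_mod_cast Nat.le_of_dvd (factorial_pos _) (factorial_mul_factorial_dvd_factorial_add i j)

lemma factorial_two_mul_le_four_pow (k : ℕ) : ((2 * k)! : ℝ) ≤ 4 ^ k * (k ! * k !) := by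
  have := factorial_add_le k k
  rwa [← two_mul, pow_mul, show (2 : ℝ) ^ 2 = 4 by norm_num] at this

lemma four_pow_mul_le (k : ℕ) : (4 : ℝ) ^ k * (k ! * k !) ≤ (2 * k + 1) * (2 * k)! := by
  have h := Nat.four_pow_le_two_mul_add_one_mul_central_binom k
  have h2 : ((2 * k)! : ℝ) = centralBinom k * (k ! * k !) := by
    rw [centralBinom_eq_two_mul_choose]
    have := Nat.add_choose_mul_factorial_mul_factorial k k
    rw [← two_mul, mul_assoc] at this
    exact_mod_cast this.symm
  have h3 : (4 : ℝ) ^ k ≤ (2 * k + 1) * centralBinom k := by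
    rw [centralBinom_eq_two_mul_choose]
    exact_mod_cast h
  rw [h2]
  calc _ ≤ ((2 * k + 1) * centralBinom k : ℝ) * (k ! * k !) := by gcongr
    _ = _ := by ring

/-- The multinomial estimate on the lines that occur for the new series. -/
lemma factorial_line_le {A B p q t : ℝ} (hA : 0 ≤ A) (hB : 0 ≤ B) (hp : 0 < p) (hq : 0 ≤ q)
    (ht : 0 ≤ t) (h : p + q + t ≤ 1) (h1 : A ≤ 4 * (p * q)) (h2 : 4 * B * p ^ 2 ≤ t) (i n : ℕ) :
    ((3 * n + 2 * i)! : ℝ) * (A ^ (2 * n + i) * B ^ n) ≤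
      4 ^ (n + i) * (i ! * (2 * n + i)! * n !) := by
  have h3 := factorial_add_add_mul_pow_le hp.le hq ht h i (2 * n + i) n
  rw [show i + (2 * n + i) + n = 3 * n + 2 * i by ring] at h3
  -- The monomial in A and B is rewritten in the trinomial weights: the surplus factor p^(2n) of
  -- (pq)^(2n+i) goes to B^n and turns it into (4Bp²)^n.
  have h4 : A ^ (2 * n + i) * B ^ n ≤ 4 ^ (n + i) * (p ^ i * q ^ (2 * n + i) * t ^ n) := by
    calc A ^ (2 * n + i) * B ^ n ≤ (4 * (p * q)) ^ (2 * n + i) * B ^ n := by gcongr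
      _ = 4 ^ (n + i) * (p ^ i * q ^ (2 * n + i) * (4 * B * p ^ 2) ^ n) := by ring
      _ ≤ _ := by gcongr
  calc _ ≤ ((3 * n + 2 * i)! : ℝ) * (4 ^ (n + i) * (p ^ i * q ^ (2 * n + i) * t ^ n)) := by gcongr
    _ = 4 ^ (n + i) * (((3 * n + 2 * i)! : ℝ) * (p ^ i * q ^ (2 * n + i) * t ^ n)) := by ring
    _ ≤ _ := by gcongr

/-- The forms m - n, 2m - n and m - 2n have constant signs in each of the four cones m ≥ 2n, n ≤ m ≤
2n, m ≤ n ≤ 2m and n ≥ 2m. This lemma and the next three write the quotient of factorials in these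
cones, in natural coordinates. -/
lemma newMaj_line_one (n i : ℕ) : newMaj (2 * n + i, n) =
    (n + i)! * (n + i)! * (3 * n + 2 * i)! / (i ! * (2 * (n + i))!) / ((2 * n + i)! * n !) := by
  simp only [newMaj]
  rw [zfact_of_eq (n + i) (by push_cast; ring), zfact_of_eq (3 * n + 2 * i) (by push_cast; ring),
    zfact_of_eq i (by push_cast; ring), zfact_of_eq (2 * (n + i)) (by push_cast; ring)]

lemma newMaj_line_two (l j : ℕ) : newMaj (l + 2 * j, l + j) =
    j ! * j ! * (l + 3 * j)! * l ! / (2 * j)! / ((l + 2 * j)! * (l + j)!) := by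
  simp only [newMaj]
  rw [zfact_of_eq j (by push_cast; ring), zfact_of_eq (l + 3 * j) (by push_cast; ring),
    zfact_of_eq_neg l (by push_cast; ring), zfact_of_eq (2 * j) (by push_cast; ring)]
  field_simp

lemma newMaj_line_three (l j : ℕ) : newMaj (l + j, l + 2 * j) =
    (2 * j)! / (j ! * j !) * ((l + 3 * j)! * l !) / ((l + j)! * (l + 2 * j)!) := by
  simp only [newMaj]
  rw [zfact_of_eq_neg j (by push_cast; ring), zfact_of_eq l (by push_cast; ring),
    zfact_of_eq_neg (l + 3 * j) (by push_cast; ring), zfact_of_eq_neg (2 * j) (by push_cast; ring)]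
  field_simp

lemma newMaj_line_four (m i : ℕ) : newMaj (m, 2 * m + i) =
    (2 * (m + i))! / ((m + i)! * (m + i)!) * (3 * m + 2 * i)! / (i ! * (m ! * (2 * m + i)!)) := by
  simp only [newMaj]
  rw [zfact_of_eq_neg (m + i) (by push_cast; ring),
    zfact_of_eq_neg i (by push_cast; ring), zfact_of_eq_neg (3 * m + 2 * i) (by push_cast; ring),
    zfact_of_eq_neg (2 * (m + i)) (by push_cast; ring)]
  field_simp

/-- Only the two outer cones restrict (A, B) beyond A ≤ 1 and B ≤ 1/16. There the central binomial
factor is about 4^(n+i), respectively its inverse, and the trinomial estimate applies; the cone n ≥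
2m has the same form as the cone m ≥ 2n with (16B, A/16) in place of (A, B). This is why two systems
of weights occur. -/
lemma newMaj_mul_le {A B p q t p' q' t' : ℝ} (hA : 0 ≤ A) (hB : 0 ≤ B) (hA1 : A ≤ 1)
    (hB1 : B ≤ 1 / 16) (hp : 0 < p) (hq : 0 ≤ q) (ht : 0 ≤ t) (h : p + q + t ≤ 1)
    (h1 : A ≤ 4 * (p * q)) (h2 : 4 * B * p ^ 2 ≤ t) (hp' : 0 < p') (hq' : 0 ≤ q') (ht' : 0 ≤ t')
    (h' : p' + q' + t' ≤ 1) (h1' : 16 * B ≤ 4 * (p' * q')) (h2' : 4 * (A / 16) * p' ^ 2 ≤ t')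
    (k : ℕ × ℕ) : newMaj k * (A ^ k.1 * B ^ k.2) ≤ 2 * (1 + k.1 + k.2) := by
  obtain ⟨m, n⟩ := k
  -- In the middle cones both products of two factorials have the total 2l + 3j, so they differ by a
  -- power of 2 at most.
  have key : ∀ l j : ℕ, ((l + 3 * j)! * l ! : ℝ) ≤ 2 ^ (2 * l + 3 * j) *
      ((l + j)! * (l + 2 * j)!) := by
    intro l j
    have e1 := factorial_mul_le (l + 3 * j) l
    have e2 := factorial_add_le (l + j) (l + 2 * j)
    rw [show l + j + (l + 2 * j) = 2 * l + 3 * j by ring] at e2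
    rw [show l + 3 * j + l = 2 * l + 3 * j by ring] at e1
    exact e1.trans e2
  rcases le_total (2 * n) m with hc | hc
  · obtain ⟨i, rfl⟩ := Nat.exists_eq_add_of_le hc
    simp only
    rw [newMaj_line_one]
    have e1 := factorial_line_le hA hB hp hq ht h h1 h2 i n
    have e2 := four_pow_mul_le (n + i)
    rw [div_div, div_mul_eq_mul_div, div_le_iff₀ (by positivity)]
    have e3 : (2 * ((n + i : ℕ) : ℝ) + 1) ≤ 2 * (1 + ((2 * n + i : ℕ) : ℝ) + n) := by
      push_cast; nlinarith [(n.cast_nonneg : (0 : ℝ) ≤ n), (i.cast_nonneg : (0 : ℝ) ≤ i)]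
    calc _ = ((n + i)! * (n + i)! : ℝ) *
          ((3 * n + 2 * i)! * (A ^ (2 * n + i) * B ^ n)) := by ring
      _ ≤ ((n + i)! * (n + i)! : ℝ) * (4 ^ (n + i) * (i ! * (2 * n + i)! * n !)) := by gcongr
      _ = (4 ^ (n + i) * ((n + i)! * (n + i)!)) * (i ! * (2 * n + i)! * n !) := by ring
      _ ≤ ((2 * (n + i : ℕ) + 1) * (2 * (n + i))!) * (i ! * (2 * n + i)! * n !) := by gcongr
      _ ≤ ((2 * (1 + (2 * n + i : ℕ) + n)) * (2 * (n + i))!) * (i ! * (2 * n + i)! * n !) := by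
        gcongr
      _ = _ := by ring
  rcases le_total n m with hc2 | hc2
  · obtain ⟨j, rfl⟩ := Nat.exists_eq_add_of_le hc2
    obtain ⟨l, rfl⟩ := Nat.exists_eq_add_of_le (by omega : j ≤ n)
    rw [show j + l + j = l + 2 * j by ring, show j + l = l + j by ring]
    simp only
    rw [newMaj_line_two]
    have e1 := key l j
    have e2 := four_pow_mul_le j
    have e3 : (2 * (j : ℝ) + 1) ≤ 2 * (1 + ((l + 2 * j : ℕ) : ℝ) + (l + j : ℕ)) := by
      push_cast; nlinarith [(l.cast_nonneg : (0 : ℝ) ≤ l), (j.cast_nonneg : (0 : ℝ) ≤ j)]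
    have e4 : (2 : ℝ) ^ (2 * l + 3 * j) * (A ^ (l + 2 * j) * B ^ (l + j)) ≤ 4 ^ j := by
      calc (2 : ℝ) ^ (2 * l + 3 * j) * (A ^ (l + 2 * j) * B ^ (l + j)) ≤
          2 ^ (2 * l + 3 * j) * (1 ^ (l + 2 * j) * (1 / 16) ^ (l + j)) := by gcongr
        _ = (1 / 4) ^ l * (1 / 2) ^ j := by
          rw [one_pow, one_mul, pow_add, pow_mul, pow_mul, pow_add]
          rw [show (1 / 4 : ℝ) = 2 ^ 2 * (1 / 16) by norm_num,
            show (1 / 2 : ℝ) = 2 ^ 3 * (1 / 16) by norm_num, mul_pow, mul_pow]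
          ring
        _ ≤ 1 * 1 := by
          gcongr <;> exact pow_le_one₀ (by norm_num) (by norm_num)
        _ ≤ 4 ^ j := by rw [one_mul]; exact one_le_pow₀ (by norm_num)
    rw [div_div, div_mul_eq_mul_div, div_le_iff₀ (by positivity)]
    calc _ = (j ! * j ! : ℝ) * ((l + 3 * j)! * l !) * (A ^ (l + 2 * j) * B ^ (l + j)) := by ring
      _ ≤ (j ! * j ! : ℝ) * (2 ^ (2 * l + 3 * j) * ((l + j)! * (l + 2 * j)!)) *
          (A ^ (l + 2 * j) * B ^ (l + j)) := by gcongr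
      _ = (2 ^ (2 * l + 3 * j) * (A ^ (l + 2 * j) * B ^ (l + j))) * (j ! * j !) *
          ((l + j)! * (l + 2 * j)!) := by ring
      _ ≤ 4 ^ j * (j ! * j !) * ((l + j)! * (l + 2 * j)!) := by gcongr
      _ ≤ ((2 * j + 1) * (2 * j)!) * ((l + j)! * (l + 2 * j)!) := by gcongr
      _ ≤ ((2 * (1 + (l + 2 * j : ℕ) + (l + j : ℕ))) * (2 * j)!) *
          ((l + j)! * (l + 2 * j)!) := by gcongr
      _ = _ := by ring
  have hone : ∀ {X : ℝ}, X ≤ 1 → X ≤ 2 * (1 + (m : ℝ) + n) := fun hX => by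
    nlinarith [(n.cast_nonneg : (0 : ℝ) ≤ n), (m.cast_nonneg : (0 : ℝ) ≤ m)]
  refine hone ?_
  rcases le_total n (2 * m) with hc3 | hc3
  · obtain ⟨j, rfl⟩ := Nat.exists_eq_add_of_le hc2
    obtain ⟨l, rfl⟩ := Nat.exists_eq_add_of_le (by omega : j ≤ m)
    rw [show j + l + j = l + 2 * j by ring, show j + l = l + j by ring]
    simp only
    rw [newMaj_line_three]
    have e1 := key l j
    have e2 := factorial_two_mul_le_four_pow j
    have e4 : (4 : ℝ) ^ j * 2 ^ (2 * l + 3 * j) * (A ^ (l + j) * B ^ (l + 2 * j)) ≤ 1 := by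
      calc (4 : ℝ) ^ j * 2 ^ (2 * l + 3 * j) * (A ^ (l + j) * B ^ (l + 2 * j)) ≤
          4 ^ j * 2 ^ (2 * l + 3 * j) * (1 ^ (l + j) * (1 / 16) ^ (l + 2 * j)) := by gcongr
        _ = (1 / 4) ^ l * (1 / 8) ^ j := by
          rw [one_pow, one_mul, pow_add, pow_mul, pow_mul, pow_add, pow_mul]
          rw [show (1 / 4 : ℝ) = 2 ^ 2 * (1 / 16) by norm_num,
            show (1 / 8 : ℝ) = 4 * 2 ^ 3 * (1 / 16) ^ 2 by norm_num, mul_pow, mul_pow, mul_pow]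
          ring
        _ ≤ 1 * 1 := by
          gcongr <;> exact pow_le_one₀ (by norm_num) (by norm_num)
        _ = 1 := one_mul 1
    rw [div_mul_eq_mul_div, div_le_iff₀ (by positivity), one_mul]
    have e5 : ((2 * j)! : ℝ) / (j ! * j !) ≤ 4 ^ j := by rwa [div_le_iff₀ (by positivity)]
    calc _ ≤ 4 ^ j * (2 ^ (2 * l + 3 * j) * ((l + j)! * (l + 2 * j)!)) *
          (A ^ (l + j) * B ^ (l + 2 * j)) := by gcongr
      _ = 4 ^ j * 2 ^ (2 * l + 3 * j) * (A ^ (l + j) * B ^ (l + 2 * j)) *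
          ((l + j)! * (l + 2 * j)!) := by ring
      _ ≤ 1 * ((l + j)! * (l + 2 * j)!) := by gcongr
      _ = _ := one_mul _
  · obtain ⟨i, rfl⟩ := Nat.exists_eq_add_of_le hc3
    simp only
    rw [newMaj_line_four]
    have e1 := factorial_line_le (by positivity : 0 ≤ 16 * B) (by positivity : 0 ≤ A / 16)
      hp' hq' ht' h' h1' h2' i m
    have e5 : ((2 * (m + i))! : ℝ) / ((m + i)! * (m + i)!) ≤ 4 ^ (m + i) := by
      rw [div_le_iff₀ (by positivity)]; exact factorial_two_mul_le_four_pow _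
    have e6 : (4 : ℝ) ^ (m + i) * 4 ^ (m + i) * (A ^ m * B ^ (2 * m + i)) =
        (16 * B) ^ (2 * m + i) * (A / 16) ^ m := by
      rw [mul_pow, div_pow, ← mul_pow, show (4 : ℝ) * 4 = 16 by norm_num]
      field_simp
      ring
    rw [div_mul_eq_mul_div, div_le_iff₀ (by positivity), one_mul]
    have e7 : (0 : ℝ) < 4 ^ (m + i) := by positivity
    refine le_of_mul_le_mul_left ?_ e7
    calc _ ≤ (4 : ℝ) ^ (m + i) * (4 ^ (m + i) * (3 * m + 2 * i)! * (A ^ m * B ^ (2 * m + i))) := by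
          gcongr
      _ = (3 * m + 2 * i)! * (4 ^ (m + i) * 4 ^ (m + i) * (A ^ m * B ^ (2 * m + i))) := by ring
      _ = (3 * m + 2 * i)! * ((16 * B) ^ (2 * m + i) * (A / 16) ^ m) := by rw [e6]
      _ ≤ _ := e1
      _ = _ := by ring

end Factorial

end

/-! ### Estimates for the other series, and growth along the axes -/

noncomputable section

section Factorial

open Nat

/-- For n ≥ m crude powers of 2 suffice. For m ≥ n the factorial of 2m + n is estimated by the
trinomial theorem, and the two conditions on the weights are what turns (4A)^(n+j) B^n into p^j
q^(2n+j) t^n. -/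
lemma firstMaj_mul_le {A B p q t : ℝ} (hA : 0 ≤ A) (hB : 0 ≤ B) (hA1 : A ≤ 1 / 16)
    (hB1 : B ≤ 1 / 16) (hp : 0 < p) (hq : 0 ≤ q) (ht : 0 ≤ t) (h : p + q + t ≤ 1)
    (h1 : 4 * A ≤ p * q) (h2 : B * p ≤ t * q) (k : ℕ × ℕ) :
    firstMaj k * (A ^ k.1 * B ^ k.2) ≤ 1 := by
  obtain ⟨m, n⟩ := k
  simp only [firstMaj]
  rw [zfact_of_eq (2 * m) (by push_cast; ring), zfact_of_eq (2 * m + n) (by push_cast; ring),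
    zfact_of_eq m rfl,
    show zfact ((m : ℤ) + n) = ((m + n)! : ℝ) from zfact_of_eq (m + n) (by push_cast; ring)]
  have e0 := factorial_two_mul_le_four_pow m
  rcases le_total m n with hc | hc
  · obtain ⟨j, rfl⟩ := Nat.exists_eq_add_of_le hc
    rw [zfact_of_eq j (by push_cast; ring), show 2 * m + (m + j) = 3 * m + j by ring,
      show m + (m + j) = 2 * m + j by ring]
    have e1 := factorial_mul_le (3 * m + j) j
    have e2 := factorial_add_le (2 * m + j) (m + j)
    rw [show 2 * m + j + (m + j) = 3 * m + j + j by ring] at e2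
    have e4 : (4 : ℝ) ^ m * 2 ^ (3 * m + j + j) * (A ^ m * B ^ (m + j)) ≤ 1 := by
      calc (4 : ℝ) ^ m * 2 ^ (3 * m + j + j) * (A ^ m * B ^ (m + j)) ≤
          4 ^ m * 2 ^ (3 * m + j + j) * ((1 / 16) ^ m * (1 / 16) ^ (m + j)) := by gcongr
        _ = (1 / 8) ^ m * (1 / 4) ^ j := by
          rw [pow_add, pow_add, pow_mul, pow_add]
          rw [show (1 / 8 : ℝ) = 4 * 2 ^ 3 * (1 / 16) * (1 / 16) by norm_num,
            show (1 / 4 : ℝ) = 2 * 2 * (1 / 16) by norm_num, mul_pow, mul_pow, mul_pow, mul_pow,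
            mul_pow]
          ring
        _ ≤ 1 * 1 := by
          gcongr <;> exact pow_le_one₀ (by norm_num) (by norm_num)
        _ = 1 := one_mul 1
    rw [div_div, div_mul_eq_mul_div, div_le_iff₀ (by positivity), one_mul]
    have e3 := e1.trans e2
    calc _ = ((2 * m)! : ℝ) * ((3 * m + j)! * j !) * (A ^ m * B ^ (m + j)) := by ring
      _ ≤ (4 ^ m * (m ! * m !)) * (2 ^ (3 * m + j + j) * ((2 * m + j)! * (m + j)!)) *
          (A ^ m * B ^ (m + j)) := by gcongr
      _ = (4 ^ m * 2 ^ (3 * m + j + j) * (A ^ m * B ^ (m + j))) *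
          (m ! * m ! * (2 * m + j)! * (m + j)!) := by ring
      _ ≤ 1 * (m ! * m ! * (2 * m + j)! * (m + j)!) := by gcongr
      _ = _ := by ring
  · obtain ⟨j, rfl⟩ := Nat.exists_eq_add_of_le hc
    rw [zfact_of_eq_neg j (by push_cast; ring), show 2 * (n + j) + n = j + (2 * n + j) + n by ring,
      show n + j + n = 2 * n + j by ring]
    have e1 := factorial_add_add_mul_pow_le hp.le hq ht h j (2 * n + j) n
    have e4 : (4 : ℝ) ^ (n + j) * (A ^ (n + j) * B ^ n) ≤ p ^ j * q ^ (2 * n + j) * t ^ n := by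
      have e5 : B ≤ t * q / p := by rwa [le_div_iff₀ hp]
      calc (4 : ℝ) ^ (n + j) * (A ^ (n + j) * B ^ n) = (4 * A) ^ (n + j) * B ^ n := by
            rw [mul_pow]; ring
        _ ≤ (p * q) ^ (n + j) * (t * q / p) ^ n := by gcongr
        _ = _ := by
          rw [mul_pow, div_pow, mul_pow t, pow_add p]; field_simp; ring
    rw [div_div, div_mul_eq_mul_div, div_le_iff₀ (by positivity), one_mul]
    calc _ = ((2 * (n + j))! : ℝ) * ((j + (2 * n + j) + n)! * (A ^ (n + j) * B ^ n)) *
          (j ! : ℝ)⁻¹ := by ring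
      _ ≤ (4 ^ (n + j) * ((n + j)! * (n + j)!)) *
          ((j + (2 * n + j) + n)! * (A ^ (n + j) * B ^ n)) * (j ! : ℝ)⁻¹ := by gcongr
      _ = ((n + j)! * (n + j)!) * ((j + (2 * n + j) + n)! *
          (4 ^ (n + j) * (A ^ (n + j) * B ^ n))) * (j ! : ℝ)⁻¹ := by ring
      _ ≤ ((n + j)! * (n + j)!) * ((j + (2 * n + j) + n)! *
          (p ^ j * q ^ (2 * n + j) * t ^ n)) * (j ! : ℝ)⁻¹ := by gcongr
      _ ≤ ((n + j)! * (n + j)!) * (j ! * (2 * n + j)! * n !) * (j ! : ℝ)⁻¹ := by gcongr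
      _ = _ := by field_simp

/-- Not the sharp region of H₅: only a neighbourhood of the disc x = 0, |y| < 1 is wanted. For m ≤ n
the binomial theorem is used with the weights 1 - B and B; for m ≥ n the bound A ≤ 1/64 absorbs all
powers of 2. -/
lemma hornMaj_mul_le {A B : ℝ} (hA : 0 ≤ A) (hB : 0 ≤ B) (hB1 : B ≤ 1) (hA1 : A ≤ 1 / 64)
    (hAB : 4 * A ≤ (1 - B) ^ 2) (k : ℕ × ℕ) : hornMaj k * (A ^ k.1 * B ^ k.2) ≤ 1 := by
  obtain ⟨m, n⟩ := k
  simp only [hornMaj]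
  rw [zfact_of_eq (2 * m + n) (by push_cast; ring), zfact_of_eq n rfl]
  rcases le_total m n with hc | hc
  · obtain ⟨j, rfl⟩ := Nat.exists_eq_add_of_le hc
    rw [zfact_of_eq j (by push_cast; ring), div_div, div_mul_eq_mul_div,
      div_le_iff₀ (by positivity), one_mul]
    have e0 := factorial_two_mul_le_four_pow m
    have e1 := factorial_mul_le m j
    have e2 := factorial_add_mul_pow_le (sub_nonneg.2 hB1) hB (2 * m) (m + j)
    rw [sub_add_cancel, one_pow, mul_one] at e2
    have e7 : (0 : ℝ) < 4 ^ m := by positivity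
    refine le_of_mul_le_mul_left ?_ e7
    have e8 : (4 : ℝ) ^ m * A ^ m ≤ (1 - B) ^ (2 * m) := by
      rw [← mul_pow, pow_mul]; gcongr
    calc _ = ((2 * m + (m + j))! * ((4 : ℝ) ^ m * A ^ m * B ^ (m + j))) * j ! := by ring
      _ ≤ ((2 * m + (m + j))! * ((1 - B) ^ (2 * m) * B ^ (m + j))) * j ! := by gcongr
      _ ≤ ((2 * m)! * (m + j)!) * j ! := by gcongr
      _ ≤ ((4 ^ m * (m ! * m !)) * (m + j)!) * j ! := by gcongr
      _ = 4 ^ m * m ! * (m + j)! * (m ! * j !) := by ring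
      _ ≤ 4 ^ m * m ! * (m + j)! * (m + j)! := by gcongr
      _ = _ := by ring
  · obtain ⟨j, rfl⟩ := Nat.exists_eq_add_of_le hc
    rw [zfact_of_eq_neg j (by push_cast; ring), div_div, div_mul_eq_mul_div,
      div_le_iff₀ (by positivity), one_mul]
    have e1 := factorial_add_le (n + j) (2 * n + j)
    have e2 := factorial_add_le n (n + j)
    have e3 := factorial_add_le n j
    rw [show n + j + (2 * n + j) = 2 * (n + j) + n by ring] at e1
    rw [show n + (n + j) = 2 * n + j by ring] at e2
    have e8 : (2 : ℝ) ^ (2 * (n + j) + n) * 2 ^ (2 * n + j) * 2 ^ (n + j) *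
        (A ^ (n + j) * B ^ n) ≤ 1 := by
      calc _ ≤ (2 : ℝ) ^ (2 * (n + j) + n) * 2 ^ (2 * n + j) * 2 ^ (n + j) *
          ((1 / 64) ^ (n + j) * 1 ^ n) := by gcongr
        _ = (1 / 4) ^ j := by
          rw [← pow_add, ← pow_add, show 2 * (n + j) + n + (2 * n + j) + (n + j) =
            6 * n + 4 * j by ring, pow_add, pow_mul, pow_mul, pow_add,
            show (1 / 4 : ℝ) = 2 ^ 4 * (1 / 64) by norm_num, mul_pow (2 ^ 4 : ℝ), one_pow, mul_one]
          have : ((2 : ℝ) ^ 6) ^ n * (1 / 64) ^ n = 1 := by rw [← mul_pow]; norm_num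
          linear_combination ((2 ^ 4 : ℝ) ^ j * (1 / 64) ^ j) * this
        _ ≤ 1 := pow_le_one₀ (by norm_num) (by norm_num)
    calc _ = ((2 * (n + j) + n)! : ℝ) * (j ! : ℝ)⁻¹ * (A ^ (n + j) * B ^ n) := by ring
      _ ≤ (2 ^ (2 * (n + j) + n) * ((n + j)! * (2 ^ (2 * n + j) * (n ! *
          (2 ^ (n + j) * (n ! * j !)))))) * (j ! : ℝ)⁻¹ * (A ^ (n + j) * B ^ n) := by
        gcongr
        exact e1.trans (by gcongr; exact e2.trans (by gcongr))
      _ = ((2 : ℝ) ^ (2 * (n + j) + n) * 2 ^ (2 * n + j) * 2 ^ (n + j) *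
          (A ^ (n + j) * B ^ n)) * (n ! * ((n + j)! * n !)) := by field_simp
      _ ≤ 1 * (n ! * ((n + j)! * n !)) := by gcongr
      _ = _ := one_mul _

/-- Source of the necessary condition |x| + |y| < 1: the binomial coefficients on the left are those
of (A + B)^N. -/
lemma choose_le_hornMaj (m j : ℕ) : ((m + (m + j)).choose m : ℝ) ≤ hornMaj (m, m + j) := by
  simp only [hornMaj]
  rw [zfact_of_eq (2 * m + (m + j)) (by push_cast; ring), zfact_of_eq j (by push_cast; ring),
    zfact_of_eq (m + j) (by push_cast; ring), div_div, le_div_iff₀ (by positivity)]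
  have h1 : ((m + (m + j)).choose m : ℝ) * m ! * (m + j)! = (m + (m + j))! := by
    have := Nat.add_choose_mul_factorial_mul_factorial m (m + j)
    rw [Nat.choose_symm_add]
    exact_mod_cast this
  have h2 : ((m + j).choose m : ℝ) * m ! * j ! = (m + j)! := by
    have := Nat.add_choose_mul_factorial_mul_factorial m j
    rw [Nat.choose_symm_add]
    exact_mod_cast this
  have h3 : ((m + (2 * m + j)).choose m : ℝ) * m ! * (2 * m + j)! = (m + (2 * m + j))! := by
    have := Nat.add_choose_mul_factorial_mul_factorial m (2 * m + j)
    rw [Nat.choose_symm_add]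
    exact_mod_cast this
  have h4 : ((m + j).choose m : ℝ) ≤ (m + (2 * m + j)).choose m := by
    exact_mod_cast Nat.choose_le_choose m (by omega : m + j ≤ m + (2 * m + j))
  rw [show 2 * m + (m + j) = m + (2 * m + j) by ring, ← h3]
  calc _ = ((m + (m + j)).choose m * m ! * (m + j)! : ℝ) * (m + j)! := by ring
    _ = ((m + (m + j))! : ℝ) * ((m + j).choose m * m ! * j !) := by rw [h1, h2]
    _ ≤ ((m + (m + j))! : ℝ) * ((m + (2 * m + j)).choose m * m ! * j !) := by gcongr
    _ = _ := by rw [show m + (m + j) = 2 * m + j by ring]; ring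

lemma hornMaj_zero_right (m : ℕ) : 4 ^ m / (2 * m + 1 : ℝ) ≤ hornMaj (m, 0) := by
  simp only [hornMaj]
  rw [zfact_of_eq (2 * m) (by push_cast; ring), zfact_of_eq_neg m (by push_cast; ring),
    zfact_of_eq 0 rfl, div_div, div_le_div_iff₀ (by positivity) (by positivity)]
  have := four_pow_mul_le m
  calc _ = ((4 : ℝ) ^ m * (m ! * m !)) * (m ! : ℝ)⁻¹ := by simp; field_simp
    _ ≤ ((2 * m + 1) * (2 * m)!) * (m ! : ℝ)⁻¹ := by gcongr
    _ = _ := by ring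

lemma secondMaj_zero_right (m : ℕ) : secondMaj (m, 0) = 1 := by
  simp only [secondMaj]
  rw [zfact_of_eq (2 * m) (by push_cast; ring), zfact_of_eq_neg (2 * m) (by push_cast; ring),
    zfact_of_eq m (by push_cast; ring), zfact_of_eq m rfl,
    zfact_of_eq_neg m (by push_cast; ring)]
  simp only [Nat.factorial_zero, Nat.cast_one]
  field_simp

/-- Rough bound, sufficient for convergence of S₂ in a small polydisc; each of the three cones n ≥
2m, m ≤ n ≤ 2m and n ≤ m costs at most 6(m+n) powers of 2. -/
lemma secondMaj_le (k : ℕ × ℕ) : secondMaj k ≤ 64 ^ (k.1 + k.2) := by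
  obtain ⟨m, n⟩ := k
  simp only [secondMaj]
  rw [zfact_of_eq (2 * m) (by push_cast; ring),
    show zfact ((m : ℤ) + n) = ((m + n)! : ℝ) from zfact_of_eq (m + n) (by push_cast; ring),
    show zfact (m : ℤ) = (m ! : ℝ) from rfl]
  have e0 := factorial_two_mul_le_four_pow m
  have hpow : ∀ i j : ℕ, i + j ≤ 6 * (m + n) → (2 : ℝ) ^ i * 2 ^ j ≤ 64 ^ (m + n) := by
    intro i j h
    rw [show (64 : ℝ) = 2 ^ 6 by norm_num, ← pow_mul, ← pow_add]
    exact pow_le_pow_right₀ (by norm_num) h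
  have h4 : (4 : ℝ) ^ m = 2 ^ (2 * m) := by rw [pow_mul]; norm_num
  rw [h4] at e0
  rcases le_total (2 * m) n with hc | hc
  · obtain ⟨j, rfl⟩ := Nat.exists_eq_add_of_le hc
    rw [zfact_of_eq j (by push_cast; ring), zfact_of_eq (m + j) (by push_cast; ring), div_div,
      div_le_iff₀ (by positivity)]
    have e1 := factorial_mul_le j (m + (2 * m + j))
    have e2 := factorial_add_le (m + j) (2 * m + j)
    rw [show m + j + (2 * m + j) = j + (m + (2 * m + j)) by ring] at e2
    have e3 := e1.trans e2
    calc _ = ((2 * m)! : ℝ) * (j ! * (m + (2 * m + j))!) := by ring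
      _ ≤ (2 ^ (2 * m) * (m ! * m !)) * (2 ^ (j + (m + (2 * m + j))) *
          ((m + j)! * (2 * m + j)!)) := by gcongr
      _ = (2 ^ (2 * m) * 2 ^ (j + (m + (2 * m + j)))) *
          (m ! * (m + j)! * (m ! * (2 * m + j)!)) := by ring
      _ ≤ _ := by gcongr; exact hpow _ _ (by omega)
  rw [zfact_of_eq_neg (2 * m - n) (by rw [Nat.cast_sub hc]; push_cast; ring)]
  rcases le_total m n with hc2 | hc2
  · obtain ⟨j, rfl⟩ := Nat.exists_eq_add_of_le hc2
    obtain ⟨l, rfl⟩ := Nat.exists_eq_add_of_le (by omega : j ≤ m)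
    rw [zfact_of_eq j (by push_cast; ring), div_div, div_le_iff₀ (by positivity),
      show 2 * (j + l) - (j + l + j) = l by omega]
    have e1 := factorial_add_le (j + l) (j + l + j)
    have e2 := factorial_add_le j l
    calc _ = ((2 * (j + l))! : ℝ) * (j + l + (j + l + j))! * (l ! : ℝ)⁻¹ := by ring
      _ ≤ (2 ^ (2 * (j + l)) * ((j + l)! * (j + l)!)) * (2 ^ (j + l + (j + l + j)) *
          ((2 ^ (j + l) * (j ! * l !)) * (j + l + j)!)) * (l ! : ℝ)⁻¹ := by
        gcongr
        exact e1.trans (by gcongr)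
      _ = (2 ^ (2 * (j + l)) * 2 ^ (j + l + (j + l + j) + (j + l))) *
          ((j + l)! * j ! * ((j + l)! * (j + l + j)!)) := by
        rw [pow_add 2 (j + l + (j + l + j))]; field_simp
      _ ≤ _ := by gcongr; exact hpow _ _ (by omega)
  · obtain ⟨j, rfl⟩ := Nat.exists_eq_add_of_le hc2
    rw [zfact_of_eq_neg j (by push_cast; ring), div_div, div_le_iff₀ (by positivity),
      show 2 * (n + j) - n = n + 2 * j by omega]
    have e1 := factorial_mul_le j (n + j + n)
    have e2 := factorial_add_le n (n + 2 * j)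
    rw [show n + (n + 2 * j) = j + (n + j + n) by ring] at e2
    have e3 := e1.trans e2
    calc _ = ((2 * (n + j))! : ℝ) * (j ! * (n + j + n)!) * ((j ! : ℝ)⁻¹ * ((n + 2 * j)! : ℝ)⁻¹) := by
          field_simp
      _ ≤ (2 ^ (2 * (n + j)) * ((n + j)! * (n + j)!)) * (2 ^ (j + (n + j + n)) *
          (n ! * (n + 2 * j)!)) * ((j ! : ℝ)⁻¹ * ((n + 2 * j)! : ℝ)⁻¹) := by
        gcongr
      _ = (2 ^ (2 * (n + j)) * 2 ^ (j + (n + j + n))) *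
          ((n + j)! * (j ! : ℝ)⁻¹ * ((n + j)! * n !)) := by field_simp
      _ ≤ _ := by gcongr; exact hpow _ _ (by omega)

lemma newMaj_zero_right (m : ℕ) : newMaj (m, 0) = 1 := by
  have h := newMaj_line_one 0 m
  simp only [mul_zero, zero_add, Nat.factorial_zero, Nat.cast_one, mul_one] at h
  rw [h]
  field_simp

lemma newMaj_zero_left (n : ℕ) : 16 ^ n / (2 * n + 1 : ℝ) ^ 2 ≤ newMaj (0, n) := by
  have h := newMaj_line_four 0 n
  simp only [mul_zero, zero_add, Nat.factorial_zero, Nat.cast_one, one_mul] at h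
  rw [h, div_mul_eq_mul_div, div_div, div_le_div_iff₀ (by positivity) (by positivity)]
  have := four_pow_mul_le n
  calc _ = ((4 : ℝ) ^ n * (n ! * n !)) * ((4 : ℝ) ^ n * (n ! * n !)) := by
        rw [show (16 : ℝ) = 4 * 4 by norm_num, mul_pow]; ring
    _ ≤ ((2 * n + 1) * (2 * n)!) * ((2 * n + 1) * (2 * n)!) := by gcongr
    _ = _ := by ring

end Factorial

end

/-! ### Necessary conditions from growth along rays of lattice points -/

noncomputable section

lemma mem_convSet_of_bound {co : ℕ × ℕ → ℂ} {g : ℕ × ℕ → ℝ} (h : PolyLE (fun k => ‖co k‖) g)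
    {A B D : ℝ} (hb : ∀ k : ℕ × ℕ, g k * (A ^ k.1 * B ^ k.2) ≤ D) {q : ℂ × ℂ} (h1 : ‖q.1‖ < A)
    (h2 : ‖q.2‖ < B) : q ∈ convSet co := by
  obtain ⟨A', hA', hA''⟩ := exists_between h1
  obtain ⟨B', hB', hB''⟩ := exists_between h2
  exact ⟨A', B', hA', hB', h.summable (fun k => norm_nonneg _) ((norm_nonneg _).trans hA'.le) hA''
    ((norm_nonneg _).trans hB'.le) hB'' hb⟩

/-- The converse direction of the comparison: terms of a convergent series are bounded, so the
majorant grows at most polynomially even at slightly larger radii. -/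
lemma exists_bound_of_mem_convSet {co : ℕ × ℕ → ℂ} {g : ℕ × ℕ → ℝ}
    (h : PolyLE g (fun k => ‖co k‖)) {q : ℂ × ℂ} (hq : q ∈ convSet co) :
    ∃ A B : ℝ, ‖q.1‖ < A ∧ ‖q.2‖ < B ∧ ∃ C > 0, ∃ M : ℕ, ∀ k : ℕ × ℕ,
      g k * (A ^ k.1 * B ^ k.2) ≤ C * (1 + k.1 + k.2 : ℝ) ^ M := by
  obtain ⟨A, B, hA, hB, hs⟩ := hq
  obtain ⟨C, hC, M, h⟩ := h
  have hA0 := (norm_nonneg _).trans hA.le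
  have hB0 := (norm_nonneg _).trans hB.le
  set T := ∑' k : ℕ × ℕ, ‖co k‖ * (A ^ k.1 * B ^ k.2) with hT
  have hT0 : 0 ≤ T := tsum_nonneg fun k => by positivity
  refine ⟨A, B, hA, hB, C * (T + 1), by positivity, M, fun k => ?_⟩
  have h1 : ‖co k‖ * (A ^ k.1 * B ^ k.2) ≤ T + 1 :=
    (hs.le_tsum k fun j _ => by positivity).trans (by linarith)
  calc g k * (A ^ k.1 * B ^ k.2) ≤ (C * (1 + k.1 + k.2 : ℝ) ^ M * ‖co k‖) *
        (A ^ k.1 * B ^ k.2) := by gcongr; exact h k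
    _ = C * (1 + k.1 + k.2 : ℝ) ^ M * (‖co k‖ * (A ^ k.1 * B ^ k.2)) := by ring
    _ ≤ C * (1 + k.1 + k.2 : ℝ) ^ M * (T + 1) := by gcongr
    _ = _ := by ring

/-- Exponential growth beats every polynomial, so a polynomial bound for the powers excludes X > 1.
-/
lemma le_one_of_pow_le {X C : ℝ} {M : ℕ}
    (h : ∀ l : ℕ, X ^ l ≤ C * (1 + l : ℝ) ^ M) : X ≤ 1 := by
  by_contra! hX
  have h1 := ((tendsto_pow_const_div_const_pow_of_one_lt M hX).comp
    (tendsto_add_atTop_nat 1)).const_mul (C * X)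
  rw [mul_zero] at h1
  obtain ⟨l, hl⟩ := (h1.eventually (gt_mem_nhds one_pos)).exists
  have h2 := h l
  have hp : 0 < X ^ l := by positivity
  have h3 : C * X * (((l + 1 : ℕ) : ℝ) ^ M / X ^ (l + 1)) = C * (1 + l : ℝ) ^ M / X ^ l := by
    push_cast
    rw [pow_succ, add_comm (l : ℝ)]
    field_simp
  simp only [Function.comp_apply] at hl
  rw [h3, div_lt_one hp] at hl
  linarith

open Nat in
lemma factorial_ge_exp (n : ℕ) : (n : ℝ) ^ n ≤ n ! * Real.exp n := by
  have := Real.pow_div_factorial_le_exp (n : ℝ) n.cast_nonneg n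
  rwa [div_le_iff₀' (by positivity)] at this

open Nat in
-- A weak form of Stirling's formula, with the elementary inequality (n/(n+1))^(n+1) ≤ 1/e in the
-- induction step; polynomial losses are harmless here.
lemma factorial_le_exp {n : ℕ} (hn : 1 ≤ n) :
    (n ! : ℝ) * Real.exp n ≤ Real.exp 1 * n * (n : ℝ) ^ n := by
  induction n, hn using Nat.le_induction with
  | base => simp
  | succ n hn ih =>
    have hn0 : (0 : ℝ) < n := by exact_mod_cast hn
    have key : Real.exp 1 * (n : ℝ) ^ (n + 1) ≤ ((n : ℝ) + 1) ^ (n + 1) := by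
      have h1 : (n : ℝ) / (n + 1) ≤ Real.exp (-(1 / (n + 1))) := by
        have := Real.add_one_le_exp (-(1 / ((n : ℝ) + 1)))
        refine le_trans (le_of_eq ?_) this
        field_simp
        ring
      have h2 : ((n : ℝ) / (n + 1)) ^ (n + 1) ≤ Real.exp (-1) := by
        calc _ ≤ Real.exp (-(1 / ((n : ℝ) + 1))) ^ (n + 1) := by gcongr
          _ = _ := by
            rw [← Real.exp_nat_mul]
            congr 1
            push_cast
            field_simp
      rw [div_pow, div_le_iff₀ (by positivity), Real.exp_neg, inv_mul_eq_div,
        le_div_iff₀ (Real.exp_pos 1)] at h2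
      linarith
    rw [Nat.factorial_succ]
    push_cast
    rw [Real.exp_add]
    calc ((n : ℝ) + 1) * n ! * (Real.exp n * Real.exp 1) =
        ((n : ℝ) + 1) * Real.exp 1 * (n ! * Real.exp n) := by ring
      _ ≤ ((n : ℝ) + 1) * Real.exp 1 * (Real.exp 1 * n * (n : ℝ) ^ n) := by gcongr
      _ = ((n : ℝ) + 1) * Real.exp 1 * (Real.exp 1 * (n : ℝ) ^ (n + 1)) := by ring
      _ ≤ ((n : ℝ) + 1) * Real.exp 1 * ((n : ℝ) + 1) ^ (n + 1) := by gcongr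
      _ = _ := by ring

open Nat in
/-- A polynomial bound along a ray of lattice points gives an entropy inequality. -/
lemma line_bound_ray {ρ σ C : ℝ} {M : ℕ} (hρ : 0 < ρ) (hσ : 0 < σ)
    (h : ∀ i n : ℕ, ((3 * n + 2 * i)! : ℝ) * (ρ ^ (2 * n + i) * σ ^ n) ≤
      C * (1 + n + i : ℝ) ^ M * (4 ^ (n + i) * (i ! * (2 * n + i)! * n !))) {i n : ℕ}
    (hi : 1 ≤ i) (hn : 1 ≤ n) :
    ((3 * n + 2 * i : ℕ) : ℝ) ^ (3 * n + 2 * i) * (ρ ^ (2 * n + i) * σ ^ n) ≤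
      4 ^ (n + i) * ((i : ℝ) ^ i * ((2 * n + i : ℕ) : ℝ) ^ (2 * n + i) * (n : ℝ) ^ n) := by
  set j := 2 * n + i with hj
  set N := 3 * n + 2 * i with hN
  have hj1 : 1 ≤ j := by omega
  have hi0 : (0 : ℝ) < i := by exact_mod_cast hi
  have hn0 : (0 : ℝ) < n := by exact_mod_cast hn
  have hj0 : (0 : ℝ) < j := by exact_mod_cast hj1
  have hC : 0 ≤ C := by
    have := h 0 0
    simp at this
    linarith
  set D := 4 ^ (n + i) * ((i : ℝ) ^ i * (j : ℝ) ^ j * (n : ℝ) ^ n) with hD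
  have hD0 : 0 < D := by positivity
  rw [← div_le_one hD0]
  -- The hypothesis is used at the multiples (li, ln) of the given point. Replacing factorials by
  -- powers, the exponentials and the powers of l cancel because N = i + j + n, and what remains is
  -- the l-th power of the asserted quotient with a polynomial factor.
  refine le_one_of_pow_le (C := C * (Real.exp 1 ^ 3 * (i * j * n)) * (1 + n + i : ℝ) ^ M) (M := M + 3)
    fun l => ?_
  rcases Nat.eq_zero_or_pos l with rfl | hl
  · have := h 0 0
    have h0 := h i n
    have e1 := factorial_ge_exp N
    have h1 : 1 ≤ C := by simpa using this
    have h2 : (1 : ℝ) ≤ Real.exp 1 ^ 3 := one_le_pow₀ (Real.one_le_exp zero_le_one)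
    have h3 : (1 : ℝ) ≤ i * j * n := by exact_mod_cast Nat.mul_pos (Nat.mul_pos hi hj1) hn
    have h4 : (1 : ℝ) ≤ (1 + n + i : ℝ) ^ M := one_le_pow₀ (by linarith)
    simp only [pow_zero, Nat.cast_zero, add_zero, one_pow, mul_one]
    calc (1 : ℝ) = 1 * (1 * 1) * 1 := by ring
      _ ≤ _ := by gcongr
  have hl0 : (0 : ℝ) < l := by exact_mod_cast hl
  have hb := h (l * i) (l * n)
  rw [show 3 * (l * n) + 2 * (l * i) = l * N by rw [hN]; ring,
    show 2 * (l * n) + l * i = l * j by rw [hj]; ring] at hb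
  have e1 := factorial_ge_exp (l * N)
  have e2 := factorial_le_exp (n := l * i) (Nat.mul_pos hl hi)
  have e3 := factorial_le_exp (n := l * j) (Nat.mul_pos hl hj1)
  have e4 := factorial_le_exp (n := l * n) (Nat.mul_pos hl hn)
  have hexp : Real.exp ((l * N : ℕ) : ℝ) = Real.exp ((l * i : ℕ) : ℝ) * Real.exp ((l * j : ℕ) : ℝ) *
      Real.exp ((l * n : ℕ) : ℝ) := by
    rw [← Real.exp_add, ← Real.exp_add]
    congr 1
    rw [hN, hj]
    push_cast
    ring
  have f1 : ((l * N : ℕ) : ℝ) ^ (l * N) = (l : ℝ) ^ (l * N) * ((N : ℝ) ^ N) ^ l := by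
    push_cast; rw [mul_pow, mul_comm l N, pow_mul (N : ℝ)]
  have f2 : ((l * i : ℕ) : ℝ) ^ (l * i) = (l : ℝ) ^ (l * i) * ((i : ℝ) ^ i) ^ l := by
    push_cast; rw [mul_pow, mul_comm l i, pow_mul (i : ℝ)]
  have f3 : ((l * j : ℕ) : ℝ) ^ (l * j) = (l : ℝ) ^ (l * j) * ((j : ℝ) ^ j) ^ l := by
    push_cast; rw [mul_pow, mul_comm l j, pow_mul (j : ℝ)]
  have f4 : ((l * n : ℕ) : ℝ) ^ (l * n) = (l : ℝ) ^ (l * n) * ((n : ℝ) ^ n) ^ l := by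
    push_cast; rw [mul_pow, mul_comm l n, pow_mul (n : ℝ)]
  have f5 : (l : ℝ) ^ (l * N) = (l : ℝ) ^ (l * i) * (l : ℝ) ^ (l * j) * (l : ℝ) ^ (l * n) := by
    rw [← pow_add, ← pow_add]; congr 1; rw [hN, hj]; ring
  have hpoly : (1 + (l * n : ℕ) + (l * i : ℕ) : ℝ) ≤ (1 + n + i) * (1 + l) := by
    push_cast; nlinarith
  have hpow : ((N : ℝ) ^ N * (ρ ^ j * σ ^ n)) ^ l =
      ((N : ℝ) ^ N) ^ l * (ρ ^ (l * j) * σ ^ (l * n)) := by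
    rw [mul_pow, mul_pow, ← pow_mul, ← pow_mul, mul_comm l j, mul_comm l n]; ring
  have hDl : D ^ l = 4 ^ (l * n + l * i) * (((i : ℝ) ^ i) ^ l * ((j : ℝ) ^ j) ^ l *
      ((n : ℝ) ^ n) ^ l) := by
    rw [hD, mul_pow, mul_pow, mul_pow, ← pow_mul, mul_comm _ l, mul_add]
  have hlN : 0 < (l : ℝ) ^ (l * N) := by positivity
  rw [div_pow, div_le_iff₀ (by positivity), hpow]
  refine le_of_mul_le_mul_left ?_ hlN
  calc (l : ℝ) ^ (l * N) * (((N : ℝ) ^ N) ^ l * (ρ ^ (l * j) * σ ^ (l * n))) =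
      ((l * N : ℕ) : ℝ) ^ (l * N) * (ρ ^ (l * j) * σ ^ (l * n)) := by rw [f1]; ring
    _ ≤ ((l * N)! * Real.exp ((l * N : ℕ) : ℝ)) * (ρ ^ (l * j) * σ ^ (l * n)) := by gcongr
    _ = Real.exp ((l * N : ℕ) : ℝ) * ((l * N)! * (ρ ^ (l * j) * σ ^ (l * n))) := by ring
    _ ≤ Real.exp ((l * N : ℕ) : ℝ) * (C * (1 + (l * n : ℕ) + (l * i : ℕ) : ℝ) ^ M *
        (4 ^ (l * n + l * i) * ((l * i)! * (l * j)! * (l * n)!))) := by gcongr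
    _ = C * (1 + (l * n : ℕ) + (l * i : ℕ) : ℝ) ^ M * 4 ^ (l * n + l * i) *
        (((l * i)! * Real.exp ((l * i : ℕ) : ℝ)) * ((l * j)! * Real.exp ((l * j : ℕ) : ℝ)) *
          ((l * n)! * Real.exp ((l * n : ℕ) : ℝ))) := by rw [hexp]; ring
    _ ≤ C * ((1 + n + i) * (1 + l)) ^ M * 4 ^ (l * n + l * i) *
        ((Real.exp 1 * (l * i : ℕ) * ((l * i : ℕ) : ℝ) ^ (l * i)) *
          (Real.exp 1 * (l * j : ℕ) * ((l * j : ℕ) : ℝ) ^ (l * j)) *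
          (Real.exp 1 * (l * n : ℕ) * ((l * n : ℕ) : ℝ) ^ (l * n))) := by gcongr
    _ = (l : ℝ) ^ (l * N) * (C * (Real.exp 1 ^ 3 * (i * j * n)) * (1 + n + i : ℝ) ^ M *
        ((1 + l) ^ M * (l : ℝ) ^ 3) * D ^ l) := by
      rw [f2, f3, f4, f5, hDl, mul_pow (1 + n + i : ℝ)]
      push_cast
      ring
    _ ≤ (l : ℝ) ^ (l * N) * (C * (Real.exp 1 ^ 3 * (i * j * n)) * (1 + n + i : ℝ) ^ M *
        ((1 + l) ^ M * (1 + l : ℝ) ^ 3) * D ^ l) := by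
      gcongr
      linarith
    _ = _ := by rw [pow_add (1 + l : ℝ)]

open Nat in
-- The ray inequalities say that an entropy function Ψ is non-positive at all rational slopes in (0,
-- 1/2), hence by continuity at the critical slope p; evaluated there, the inequality is exactly the
-- bound for ρ.
lemma line_bound {ρ σ C : ℝ} {M : ℕ} (hρ : 0 < ρ) (hσ : 0 < σ)
    (h : ∀ i n : ℕ, ((3 * n + 2 * i)! : ℝ) * (ρ ^ (2 * n + i) * σ ^ n) ≤
      C * (1 + n + i : ℝ) ^ M * (4 ^ (n + i) * (i ! * (2 * n + i)! * n !))) {p : ℝ}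
    (hp : 0 < p) (hp2 : p < 1 / 2) (hcrit : 12 * σ * p ^ 2 + 2 * p = 1) :
    ρ ≤ 4 * p * (1 - p - 4 * σ * p ^ 2) := by
  -- Here x = i/N with N = 3n + 2i; then (2n+i)/N = (2-x)/3 and n/N = (1-2x)/3.
  let Ψ : ℝ → ℝ := fun x => (2 - x) / 3 * Real.log ρ + (1 - 2 * x) / 3 * Real.log σ -
    (x + (1 - 2 * x) / 3) * Real.log 4 - x * Real.log x -
    (2 - x) / 3 * Real.log ((2 - x) / 3) - (1 - 2 * x) / 3 * Real.log ((1 - 2 * x) / 3)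
  have hcont : Continuous Ψ := by
    have h1 : Continuous fun x : ℝ => (2 - x) / 3 * Real.log ((2 - x) / 3) :=
      Real.continuous_mul_log.comp (by fun_prop : Continuous fun x : ℝ => (2 - x) / 3)
    have h2 : Continuous fun x : ℝ => (1 - 2 * x) / 3 * Real.log ((1 - 2 * x) / 3) :=
      Real.continuous_mul_log.comp (by fun_prop : Continuous fun x : ℝ => (1 - 2 * x) / 3)
    have h3 := Real.continuous_mul_log
    exact (((by fun_prop : Continuous fun x : ℝ => (2 - x) / 3 * Real.log ρ +
      (1 - 2 * x) / 3 * Real.log σ - (x + (1 - 2 * x) / 3) * Real.log 4).sub h3).sub h1).sub h2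
  have hrat : ∀ r : ℚ, 0 < (r : ℝ) → (r : ℝ) < 1 / 2 → Ψ r ≤ 0 := by
    intro r hr hr2
    have hr' : 0 < r := by exact_mod_cast hr
    obtain ⟨u, hu⟩ := Int.eq_ofNat_of_zero_le (Rat.num_pos.2 hr').le
    set v := r.den with hv
    have hv0 : (0 : ℝ) < v := by exact_mod_cast r.den_pos
    have hrv : (r : ℝ) = u / v := by
      rw [Rat.cast_def, hu]; simp [hv]
    have hu0 : 1 ≤ u := by
      have := Rat.num_pos.2 hr'
      omega
    have huv : 2 * u < v := by
      rw [hrv, div_lt_iff₀ hv0] at hr2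
      have : (2 * u : ℝ) < v := by linarith
      exact_mod_cast this
    obtain ⟨w, hw⟩ := Nat.exists_eq_add_of_lt huv
    -- The slope u/v is realized by i = 3u and n = v - 2u, for which N = 3v.
    have hray := line_bound_ray hρ hσ h (i := 3 * u) (n := w + 1) (by omega) (by omega)
    have hvw : (v : ℝ) = 2 * u + w + 1 := by exact_mod_cast hw
    have hu0' : (0 : ℝ) < u := by exact_mod_cast hu0
    rw [← Real.log_le_log_iff (by positivity) (by positivity), Real.log_mul (by positivity)
      (by positivity), Real.log_mul (by positivity) (by positivity), Real.log_mul (by positivity)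
      (by positivity), Real.log_mul (by positivity) (by positivity), Real.log_mul (by positivity)
      (by positivity), Real.log_pow, Real.log_pow, Real.log_pow, Real.log_pow, Real.log_pow,
      Real.log_pow, Real.log_pow] at hray
    have n1 : ((3 * (w + 1) + 2 * (3 * u) : ℕ) : ℝ) = 3 * v := by rw [hvw]; push_cast; ring
    have n2 : ((2 * (w + 1) + 3 * u : ℕ) : ℝ) = 2 * v - u := by rw [hvw]; push_cast; ring
    have n3 : ((w + 1 : ℕ) : ℝ) = v - 2 * u := by rw [hvw]; push_cast; ring
    have n4 : ((w + 1 + 3 * u : ℕ) : ℝ) = v + u := by rw [hvw]; push_cast; ring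
    rw [n1, n2, n3, n4] at hray
    push_cast at hray
    have pos2 : (0 : ℝ) < 2 * v - u := by rw [← n2]; positivity
    have pos3 : (0 : ℝ) < v - 2 * u := by rw [← n3]; positivity
    have l1 : Real.log r = Real.log (3 * u) - Real.log (3 * v) := by
      rw [hrv, ← Real.log_div (by positivity) (by positivity), mul_div_mul_left _ _ (by norm_num)]
    have l2 : Real.log ((2 - r) / 3) = Real.log (2 * v - u) - Real.log (3 * v) := by
      rw [hrv, ← Real.log_div pos2.ne' (by positivity)]; congr 1; field_simp
    have l3 : Real.log ((1 - 2 * r) / 3) = Real.log (v - 2 * u) - Real.log (3 * v) := by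
      rw [hrv, ← Real.log_div pos3.ne' (by positivity)]; congr 1; field_simp
    simp only [Ψ]
    rw [l1, l2, l3, hrv]
    refine le_of_mul_le_mul_left ?_ (by positivity : (0 : ℝ) < 3 * v)
    have : 3 * (v : ℝ) * ((2 - u / v) / 3 * Real.log ρ + (1 - 2 * (u / v)) / 3 * Real.log σ -
        (u / v + (1 - 2 * (u / v)) / 3) * Real.log 4 -
        u / v * (Real.log (3 * u) - Real.log (3 * v)) -
        (2 - u / v) / 3 * (Real.log (2 * v - u) - Real.log (3 * v)) -
        (1 - 2 * (u / v)) / 3 * (Real.log (v - 2 * u) - Real.log (3 * v))) =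
      3 * v * Real.log (3 * v) + ((2 * v - u) * Real.log ρ + (v - 2 * u) * Real.log σ) -
      ((v + u) * Real.log 4 + (3 * u * Real.log (3 * u) + (2 * v - u) * Real.log (2 * v - u) +
        (v - 2 * u) * Real.log (v - 2 * u))) := by
      field_simp
      ring
    rw [this]
    linarith
  have hΨ : Ψ p ≤ 0 := by
    by_contra! hneg
    obtain ⟨r, hr1, hr2⟩ := Rat.denseRange_cast.exists_mem_open
      ((isOpen_lt continuous_const hcont).inter isOpen_Ioo) ⟨p, hneg, hp, hp2⟩
    exact absurd (hrat r hr2.1 hr2.2) (not_le.2 hr1)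
  -- The equation for p says n/N = 4σp². With it log σ drops out of Ψ(p), and log ρ, log 4, log p
  -- and log((2-p)/3) all have the coefficient ±(2-p)/3.
  have hT : (1 - 2 * p) / 3 = 4 * σ * p ^ 2 := by linarith
  have hTlog : Real.log ((1 - 2 * p) / 3) = Real.log 4 + Real.log σ + 2 * Real.log p := by
    rw [hT, Real.log_mul (by positivity) (by positivity), Real.log_mul (by positivity)
      (by positivity), Real.log_pow]
    norm_num
  have hQ : 1 - p - 4 * σ * p ^ 2 = (2 - p) / 3 := by rw [← hT]; ring
  have hQ0 : 0 < (2 - p) / 3 := by linarith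
  simp only [Ψ, hTlog] at hΨ
  rw [hQ, ← Real.log_le_log_iff hρ (by positivity), Real.log_mul (by positivity) (by positivity),
    Real.log_mul (by norm_num) (by positivity)]
  refine le_of_mul_le_mul_left ?_ hQ0
  linarith

end

/-! ### The biquadratic polynomials and the region Ω in terms of moduli -/

noncomputable section

/-- As a quadratic in z² the polynomial has one negative and one positive root t, because α and -γ
have opposite signs. So the real roots are -√t < √t, the second one is √t, and the quadratic is
negative on [0, t) and non-negative on the rest of the half-line. -/
lemma isSecondRoot_biquadratic {P : ℝ → ℝ} {α β γ : ℝ} (hα : 0 < α) (hγ : 0 < γ)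
    (hP : ∀ z, P z = α * (z ^ 2) ^ 2 + β * z ^ 2 - γ) :
    ∃ w, IsSecondRoot P w ∧ (∀ w', IsSecondRoot P w' → w' = w) ∧
      ∀ S, 0 ≤ S → (√S < w ↔ α * S ^ 2 + β * S - γ < 0) := by
  set t := (-β + √(β ^ 2 + 4 * α * γ)) / (2 * α) with ht
  have hsq : √(β ^ 2 + 4 * α * γ) ^ 2 = β ^ 2 + 4 * α * γ := Real.sq_sqrt (by positivity)
  have ht0 : 0 < t := by
    refine div_pos ?_ (by positivity)
    have : √(β ^ 2) < √(β ^ 2 + 4 * α * γ) := Real.sqrt_lt_sqrt (by positivity) (by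
      have : 0 < 4 * α * γ := by positivity
      linarith)
    rw [Real.sqrt_sq_eq_abs] at this
    linarith [le_abs_self β]
  have hroot : α * t ^ 2 + β * t - γ = 0 := by
    have h1 : 2 * α * t + β = √(β ^ 2 + 4 * α * γ) := by rw [ht]; field_simp; ring
    rw [← h1] at hsq
    have : 4 * α * (α * t ^ 2 + β * t - γ) = 0 := by linarith
    rcases mul_eq_zero.1 this with h | h
    · linarith
    · exact h
  have hfac : ∀ X, α * X ^ 2 + β * X - γ = (X - t) * (α * X + γ / t) := by
    intro X
    field_simp
    linear_combination X * hroot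
  have hpos : ∀ X, 0 ≤ X → 0 < α * X + γ / t := fun X hX => by positivity
  have hzero : ∀ z, P z = 0 ↔ z ^ 2 = t := by
    intro z
    rw [hP, hfac, mul_eq_zero, or_iff_left (hpos _ (sq_nonneg z)).ne', sub_eq_zero]
  have hz : ∀ z, P z = 0 ↔ z = √t ∨ z = -√t := by
    intro z
    rw [hzero, ← sq_eq_sq_iff_eq_or_eq_neg, Real.sq_sqrt ht0.le]
  have hs := Real.sqrt_pos.2 ht0
  refine ⟨√t, ⟨(hz _).2 (Or.inl rfl), -√t, ⟨by linarith, (hz _).2 (Or.inr rfl)⟩, ?_⟩, ?_, ?_⟩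
  · rintro v ⟨hv, hv'⟩
    rcases (hz v).1 hv' with h | h
    · linarith
    · exact h
  · rintro w' ⟨h1, v, ⟨hv, hv'⟩, -⟩
    rcases (hz w').1 h1 with h | h
    · exact h
    · rcases (hz v).1 hv' with h' | h' <;> linarith
  · intro S hS
    rw [Real.sqrt_lt_sqrt_iff hS, hfac, mul_neg_iff]
    have := hpos S hS
    constructor
    · intro h
      exact Or.inr ⟨by linarith, this⟩
    · rintro (h | h) <;> linarith [h.1, h.2]

/-- The inequalities that describe the region of the new series in terms of the moduli of its
variables. -/
def newCond (R S : ℝ) : Prop :=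
  R < 1 ∧ S < 1 / 16 ∧ 27 * R ^ 2 * S ^ 2 + 2 * (9 * R - 8) * S - (1 - R) < 0 ∧
    27 * R ^ 2 * S ^ 2 + 2 * (9 * R + 8) * S - (R + 1) < 0

lemma mem_newRegion_iff {p : ℂ × ℂ} : p ∈ newRegion ↔ p.1 ≠ 0 ∧ p.2 ≠ 1 ∧
    newCond ‖(1 - p.2) / p.1‖ ‖-p.1‖ := by
  simp only [newRegion, newCond, mem_ofPred_eq]
  refine and_congr_right fun h1 => and_congr_right fun h2 => and_congr_right fun h3 =>
    and_congr_right fun h4 => ?_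
  have hR : 0 < ‖(1 - p.2) / p.1‖ := norm_pos_iff.2 (div_ne_zero (sub_ne_zero.2 h2.symm) h1)
  have hS : 0 ≤ ‖-p.1‖ := norm_nonneg _
  generalize ‖(1 - p.2) / p.1‖ = R at *
  generalize ‖-p.1‖ = S at *
  obtain ⟨w₁, a1, b1, c1⟩ := isSecondRoot_biquadratic (P := fun z => 27 * z ^ 4 * R ^ 2 -
    2 * z ^ 2 * (9 * R + 8) - R - 1) (α := 27 * R ^ 2) (β := -(2 * (9 * R + 8))) (γ := R + 1)
    (by positivity) (by positivity) (fun z => by ring)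
  obtain ⟨w₂, a2, b2, c2⟩ := isSecondRoot_biquadratic (P := fun z => 27 * z ^ 4 * R ^ 2 +
    2 * z ^ 2 * (9 * R - 8) + R - 1) (α := 27 * R ^ 2) (β := 2 * (9 * R - 8)) (γ := 1 - R)
    (by positivity) (by linarith) (fun z => by ring)
  obtain ⟨w₃, a3, b3, c3⟩ := isSecondRoot_biquadratic (P := fun z => 27 * z ^ 4 * R ^ 2 +
    2 * z ^ 2 * (9 * R + 8) - R - 1) (α := 27 * R ^ 2) (β := 2 * (9 * R + 8)) (γ := R + 1)
    (by positivity) (by positivity) (fun z => by ring)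
  constructor
  · rintro ⟨z₁, z₂, z₃, e1, e2, e3, h⟩
    rw [lt_min_iff, lt_min_iff, b2 _ e2, b3 _ e3, c2 S hS, c3 S hS] at h
    exact h.2
  · rintro ⟨e2, e3⟩
    refine ⟨w₁, w₂, w₃, a1, a2, a3, ?_⟩
    rw [lt_min_iff, lt_min_iff, c1 S hS, c2 S hS, c3 S hS]
    -- The inequality of the first polynomial follows from R < 1 and S < 1/16, since 27(RS)² is then
    -- at most 27/256 < 1; so z₁ imposes nothing.
    refine ⟨?_, e2, e3⟩
    have h5 : (R * S) ^ 2 ≤ (1 / 16) ^ 2 := by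
      have : R * S ≤ 1 * (1 / 16) := by gcongr
      gcongr
      linarith
    nlinarith [mul_nonneg hR.le hS]

/-- The critical parameter of the multinomial estimates. -/
lemma exists_crit {σ : ℝ} (hσ : 0 < σ) : ∃ p, 0 < p ∧ p < 1 / 2 ∧ 12 * σ * p ^ 2 + 2 * p = 1 ∧
    ∀ ρ, 0 ≤ ρ → (27 * ρ ^ 2 * σ ^ 2 + 2 * (9 * ρ - 8) * σ - (1 - ρ) < 0 ↔
      ρ < 4 * (p * (1 - p - 4 * σ * p ^ 2))) := by
  set s := √(1 + 12 * σ) with hs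
  have hs2 : s ^ 2 = 1 + 12 * σ := Real.sq_sqrt (by positivity)
  have hs1 : 1 < s := by
    rw [hs, Real.lt_sqrt zero_le_one]; linarith
  set p := 1 / (s + 1) with hp
  have hp0 : 0 < p := by positivity
  have hp2 : p < 1 / 2 := by
    rw [hp]; exact one_div_lt_one_div_of_lt two_pos (by linarith)
  have hσp : σ = (1 - 2 * p) / (12 * p ^ 2) := by
    have : 12 * σ = s ^ 2 - 1 := by linarith
    rw [hp]
    field_simp
    linear_combination this
  have hcrit : 12 * σ * p ^ 2 + 2 * p = 1 := by
    rw [hσp]; field_simp; ring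
  refine ⟨p, hp0, hp2, hcrit, fun ρ hρ => ?_⟩
  have h1 : 4 * (p * (1 - p - 4 * σ * p ^ 2)) = 4 * p * (2 - p) / 3 := by
    linear_combination (-4 * p / 3) * hcrit
  rw [h1]
  have hpos : 0 < 27 * σ ^ 2 * (ρ + 4 * p * (2 - p) / 3) + 18 * σ + 1 := by
    have : 0 < 2 - p := by linarith
    positivity
  -- With σ expressed by p, the quadratic in ρ has the root 4p(2-p)/3, and the other factor is
  -- positive for ρ ≥ 0.
  have h2 : 27 * ρ ^ 2 * σ ^ 2 + 2 * (9 * ρ - 8) * σ - (1 - ρ) =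
      (ρ - 4 * p * (2 - p) / 3) * (27 * σ ^ 2 * (ρ + 4 * p * (2 - p) / 3) + 18 * σ + 1) := by
    rw [hσp]
    field_simp
    ring
  rw [h2, mul_neg_iff]
  constructor
  · rintro (h | h) <;> linarith [h.1, h.2]
  · intro h
    exact Or.inr ⟨by linarith, hpos⟩

end

/-! ### Ω is the region of convergence of the new series -/

noncomputable section
variable {a b c : ℂ}

/-- The substitution (R, S) ↦ (16S, R/16), which interchanges the two outer cones, carries the
second inequality into the third; a single analysis therefore serves both. -/
lemma newCond_iff_three {R S : ℝ} : 27 * (16 * S) ^ 2 * (R / 16) ^ 2 +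
    2 * (9 * (16 * S) - 8) * (R / 16) - (1 - 16 * S) < 0 ↔
    27 * R ^ 2 * S ^ 2 + 2 * (9 * R + 8) * S - (R + 1) < 0 := by
  rw [show 27 * (16 * S) ^ 2 * (R / 16) ^ 2 + 2 * (9 * (16 * S) - 8) * (R / 16) - (1 - 16 * S) =
    27 * R ^ 2 * S ^ 2 + 2 * (9 * R + 8) * S - (R + 1) by ring]

/-- All conditions are strict, so they persist when both moduli are enlarged by a small ε. The
weights are p from `exists_crit`, t = 4σp² with the enlarged σ, and q = 1 - p - t. -/
lemma mem_convSet_newCoef (hg : Generic a b c) {q : ℂ × ℂ} (h1 : q.1 ≠ 0) (h2 : q.2 ≠ 0)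
    (h : newCond ‖q.1‖ ‖q.2‖) : q ∈ convSet (newCoef a b c) := by
  have hR := norm_pos_iff.2 h1
  have hS := norm_pos_iff.2 h2
  obtain ⟨c1, c2, c3, c4⟩ := h
  obtain ⟨p, hp, -, -, hpc⟩ := exists_crit hS
  obtain ⟨p', hp', -, -, hpc'⟩ := exists_crit (σ := ‖q.1‖ / 16) (by positivity)
  have d3 := (hpc _ hR.le).1 c3
  have d4 := (hpc' (16 * ‖q.2‖) (by positivity)).1
    (newCond_iff_three.2 c4)
  set R := ‖q.1‖
  set S := ‖q.2‖
  have ev : ∀ᶠ ε in 𝓝[>] (0 : ℝ), R + ε < 1 ∧ S + ε < 1 / 16 ∧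
      R + ε < 4 * (p * (1 - p - 4 * (S + ε) * p ^ 2)) ∧
      16 * (S + ε) < 4 * (p' * (1 - p' - 4 * ((R + ε) / 16) * p' ^ 2)) := by
    apply nhdsWithin_le_nhds
    refine (Continuous.continuousAt (by fun_prop)).eventually_lt continuousAt_const (by simpa using c1)
      |>.and (((Continuous.continuousAt (by fun_prop)).eventually_lt continuousAt_const
        (by simpa using c2)).and (((Continuous.continuousAt (by fun_prop)).eventually_lt
        (Continuous.continuousAt (by fun_prop)) (by simpa using d3)).and
        ((Continuous.continuousAt (by fun_prop)).eventually_lt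
        (Continuous.continuousAt (by fun_prop)) (by simpa using d4))))
  obtain ⟨ε, ⟨e1, e2, e3, e4⟩, hε⟩ := (ev.and self_mem_nhdsWithin).exists
  have hε0 : 0 < ε := hε
  -- The linear factor in `newMaj_mul_le` is moved into the polynomial loss, so that a constant
  -- bound remains.
  have hPL : PolyLE newMaj (fun k => newMaj k / (2 * (1 + k.1 + k.2))) :=
    ⟨2, two_pos, 1, fun k => by rw [pow_one]; field_simp; rfl⟩
  have q1 : 0 < 1 - p - 4 * (S + ε) * p ^ 2 := by
    by_contra! hneg
    have : p * (1 - p - 4 * (S + ε) * p ^ 2) ≤ 0 := mul_nonpos_of_nonneg_of_nonpos hp.le hneg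
    linarith
  have q2 : 0 < 1 - p' - 4 * ((R + ε) / 16) * p' ^ 2 := by
    by_contra! hneg
    have : p' * (1 - p' - 4 * ((R + ε) / 16) * p' ^ 2) ≤ 0 :=
      mul_nonpos_of_nonneg_of_nonpos hp'.le hneg
    linarith
  refine mem_convSet_of_bound ((polyLE_newCoef hg).1.trans hPL) (A := R + ε) (B := S + ε) (D := 1)
    (fun k => ?_) (lt_add_of_pos_right _ hε0) (lt_add_of_pos_right _ hε0)
  rw [div_mul_eq_mul_div, div_le_one (by positivity)]
  exact newMaj_mul_le (by positivity) (by positivity) e1.le e2.le hp q1.le (by positivity)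
    (by linarith) e3.le le_rfl hp' q2.le (by positivity) (by linarith) e4.le le_rfl k

/-- The points (l, 0) and (0, l) give R < 1 and S < 1/16, and the outer cones give the two quadratic
inequalities. In each cone only one of the two radii is enlarged, A with S and then 16B with R/16:
this yields the strict inequalities. -/
lemma newCond_of_mem_convSet (hg : Generic a b c) {q : ℂ × ℂ} (h1 : q.1 ≠ 0) (h2 : q.2 ≠ 0)
    (h : q ∈ convSet (newCoef a b c)) : newCond ‖q.1‖ ‖q.2‖ := by
  have hR := norm_pos_iff.2 h1
  have hS := norm_pos_iff.2 h2
  obtain ⟨A, B, hA, hB, C, hC, M, hb⟩ := exists_bound_of_mem_convSet (polyLE_newCoef hg).2 h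
  set R := ‖q.1‖
  set S := ‖q.2‖
  have hA0 : 0 < A := hR.trans hA
  have hB0 : 0 < B := hS.trans hB
  have a1 : A ≤ 1 := le_one_of_pow_le (C := C) (M := M) fun l => by
    simpa [newMaj_zero_right] using hb (l, 0)
  have a2 : 16 * B ≤ 1 := le_one_of_pow_le (C := 4 * C) (M := M + 2) fun l => by
    have e1 := hb (0, l)
    have e2 := newMaj_zero_left l
    simp only [Nat.cast_zero, pow_zero, one_mul, add_zero] at e1
    rw [div_le_iff₀ (by positivity)] at e2
    have hl : (0 : ℝ) ≤ l := l.cast_nonneg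
    calc (16 * B) ^ l = 16 ^ l * B ^ l := mul_pow _ _ _
      _ ≤ (newMaj (0, l) * (2 * l + 1) ^ 2) * B ^ l := by gcongr
      _ = (newMaj (0, l) * B ^ l) * (2 * l + 1) ^ 2 := by ring
      _ ≤ (C * (1 + l) ^ M) * (2 * (1 + l)) ^ 2 := by
        gcongr
        linarith
      _ = _ := by ring
  refine ⟨hA.trans_le a1, by linarith, ?_, ?_⟩
  · obtain ⟨p, hp, hp2, hcr, hpc⟩ := exists_crit hS
    rw [hpc R hR.le]
    refine hA.trans_le ((line_bound (C := C * 3 ^ M) (M := M) hA0 hS (fun i n => ?_)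
      hp hp2 hcr).trans (by rw [mul_assoc]))
    have e1 := hb (2 * n + i, n)
    simp only at e1
    rw [newMaj_line_one, div_div, div_mul_eq_mul_div, div_le_iff₀ (by positivity)] at e1
    have e2 := factorial_two_mul_le_four_pow (n + i)
    have e3 : (1 + ((2 * n + i : ℕ) : ℝ) + n) ≤ 3 * (1 + n + i) := by
      push_cast; nlinarith [(n.cast_nonneg : (0 : ℝ) ≤ n), (i.cast_nonneg : (0 : ℝ) ≤ i)]
    have hk : (0 : ℝ) < (n + i).factorial * (n + i).factorial := by positivity
    refine le_of_mul_le_mul_left ?_ hk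
    calc _ ≤ ((n + i).factorial * (n + i).factorial : ℝ) * ((3 * n + 2 * i).factorial *
          (A ^ (2 * n + i) * B ^ n)) := by gcongr
      _ = ((n + i).factorial * (n + i).factorial : ℝ) * (3 * n + 2 * i).factorial *
          (A ^ (2 * n + i) * B ^ n) := by ring
      _ ≤ _ := e1
      _ ≤ C * (3 * (1 + n + i)) ^ M * ((i.factorial * (4 ^ (n + i) * ((n + i).factorial *
          (n + i).factorial))) * ((2 * n + i).factorial * n.factorial)) := by gcongr
      _ = _ := by rw [mul_pow]; ring
  · rw [← newCond_iff_three]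
    obtain ⟨p, hp, hp2, hcr, hpc⟩ := exists_crit (σ := R / 16) (by positivity)
    rw [hpc (16 * S) (by positivity)]
    refine lt_of_lt_of_le (by linarith : 16 * S < 16 * B) ((line_bound (C := C * 3 ^ M * 2)
      (M := M + 1) (by positivity) (by positivity) (fun i m => ?_) hp hp2 hcr).trans
        (by rw [mul_assoc]))
    have e1 := hb (m, 2 * m + i)
    simp only at e1
    rw [newMaj_line_four, div_mul_eq_mul_div, div_mul_eq_mul_div, div_mul_eq_mul_div, div_div,
      div_le_iff₀ (by positivity)] at e1
    have e2 := four_pow_mul_le (m + i)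
    have e3 : (1 + (m : ℝ) + ((2 * m + i : ℕ) : ℝ)) ≤ 3 * (1 + m + i) := by
      push_cast; nlinarith [(m.cast_nonneg : (0 : ℝ) ≤ m), (i.cast_nonneg : (0 : ℝ) ≤ i)]
    have e4 : (2 * ((m + i : ℕ) : ℝ) + 1) ≤ 2 * (1 + m + i) := by push_cast; linarith
    have hk : (0 : ℝ) < (m + i).factorial * (m + i).factorial := by positivity
    have e6 : (16 * B) ^ (2 * m + i) * (R / 16) ^ m =
        (4 : ℝ) ^ (m + i) * 4 ^ (m + i) * (R ^ m * B ^ (2 * m + i)) := by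
      rw [mul_pow, div_pow, ← mul_pow 4, show (4 : ℝ) * 4 = 16 by norm_num]
      field_simp
      ring
    refine le_of_mul_le_mul_left ?_ hk
    calc _ = (4 ^ (m + i) * ((m + i).factorial * (m + i).factorial) : ℝ) *
          ((3 * m + 2 * i).factorial * (R ^ m * B ^ (2 * m + i))) * 4 ^ (m + i) := by
          rw [e6]; ring
      _ ≤ ((2 * (m + i : ℕ) + 1) * (2 * (m + i)).factorial) *
          ((3 * m + 2 * i).factorial * (A ^ m * B ^ (2 * m + i))) * 4 ^ (m + i) := by gcongr
      _ = (2 * (m + i : ℕ) + 1) * ((2 * (m + i)).factorial *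
          (3 * m + 2 * i).factorial * (A ^ m * B ^ (2 * m + i))) * 4 ^ (m + i) := by ring
      _ ≤ (2 * (1 + m + i)) * (C * (1 + (m : ℝ) + ((2 * m + i : ℕ) : ℝ)) ^ M *
          ((i.factorial * (m.factorial * (2 * m + i).factorial)) * ((m + i).factorial *
            (m + i).factorial))) * 4 ^ (m + i) := by
          refine mul_le_mul_of_nonneg_right (mul_le_mul e4 (e1.trans (le_of_eq ?_))
            (by positivity) (by positivity)) (by positivity)
          ring
      _ ≤ (2 * (1 + m + i)) * (C * (3 * (1 + m + i)) ^ M *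
          ((i.factorial * (m.factorial * (2 * m + i).factorial)) * ((m + i).factorial *
            (m + i).factorial))) * 4 ^ (m + i) := by gcongr
      _ = _ := by rw [mul_pow]; ring

lemma mem_newRegion_iff_convSet (hg : Generic a b c) {p : ℂ × ℂ} : p ∈ newRegion ↔
    p.1 ≠ 0 ∧ p.2 ≠ 1 ∧ ((1 - p.2) / p.1, -p.1) ∈ convSet (newCoef a b c) := by
  rw [mem_newRegion_iff]
  refine and_congr_right fun h1 => and_congr_right fun h2 => ?_
  have h3 : (1 - p.2) / p.1 ≠ 0 := div_ne_zero (sub_ne_zero.2 h2.symm) h1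
  exact ⟨fun h => mem_convSet_newCoef hg h3 (neg_ne_zero.2 h1) h,
    fun h => newCond_of_mem_convSet hg h3 (neg_ne_zero.2 h1) h⟩

lemma region_new_eq (hg : Generic a b c) :
    regionOfConvergence (newTerm a b c) ∩ {p | p.1 ≠ 0 ∧ p.2 ≠ 1} = newRegion := by
  ext p
  rw [mem_newRegion_iff_convSet hg]
  constructor
  · rintro ⟨h, h1, h2⟩
    exact ⟨h1, h2, (mem_region_new_iff h1).1 h⟩
  · rintro ⟨h1, h2, h⟩
    exact ⟨(mem_region_new_iff h1).2 h, h1, h2⟩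

/-- With t = 4(R/16)p² and q = 1 - p - t the radii pq/4 and Rpq/4 are admissible in
`firstMaj_mul_le`, the last condition there being an equality. So the third inequality, with R ≤ 1,
already puts Ω into the region of S₁. -/
lemma mem_convSet_firstCoef (hg : Generic a b c) {q : ℂ × ℂ} {R p : ℝ} (hR : 0 < R) (hR1 : R ≤ 1)
    (hp : 0 < p) (h1 : 16 * ‖q.1‖ < 4 * (p * (1 - p - 4 * (R / 16) * p ^ 2)))
    (h2 : ‖q.2‖ ≤ R * ‖q.1‖) : q ∈ convSet (firstCoef a b c) := by
  set t := 4 * (R / 16) * p ^ 2 with ht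
  have ht0 : 0 < t := by positivity
  have hq : 0 < 1 - p - t := by
    by_contra! hneg
    have : p * (1 - p - t) ≤ 0 := mul_nonpos_of_nonneg_of_nonpos hp.le hneg
    linarith [norm_nonneg q.1]
  have h3 : p * (1 - p - t) / 4 ≤ 1 / 16 := by nlinarith [sq_nonneg (p - 1 / 2)]
  have h4 : 0 < p * (1 - p - t) / 4 := by positivity
  refine mem_convSet_of_bound (polyLE_firstCoef hg) (A := p * (1 - p - t) / 4)
    (B := R * (p * (1 - p - t) / 4)) (D := 1)
    (firstMaj_mul_le h4.le (by positivity) h3 ?_ hp hq.le ht0.le (by linarith) (by linarith)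
      (le_of_eq (by rw [ht]; ring))) (by linarith) ?_
  · calc R * (p * (1 - p - t) / 4) ≤ 1 * (1 / 16) := by gcongr
      _ = _ := one_mul _
  · refine h2.trans_lt ?_
    gcongr
    linarith

lemma newRegion_subset_region_first (hg : Generic a b c) :
    newRegion ⊆ regionOfConvergence (firstTerm a b c) := by
  intro p hp
  obtain ⟨h1, h2, h3, -, -, h4⟩ := mem_newRegion_iff.1 hp
  rw [mem_region_first_iff]
  have hR : 0 < ‖(1 - p.2) / p.1‖ := norm_pos_iff.2 (div_ne_zero (sub_ne_zero.2 h2.symm) h1)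
  obtain ⟨p', hp', -, -, hpc⟩ := exists_crit (σ := ‖(1 - p.2) / p.1‖ / 16) (by positivity)
  have d4 := (hpc (16 * ‖-p.1‖) (by positivity)).1 (newCond_iff_three.2 h4)
  refine mem_convSet_firstCoef hg hR h3.le hp' d4 ?_
  rw [norm_div, norm_neg, div_mul_cancel₀ _ (norm_ne_zero_iff.2 h1)]

end

/-! ### Rough inclusions for S₁, S₂ and H₅ -/

noncomputable section
variable {a b c : ℂ}

lemma mem_convSet_firstCoef_of_small (hg : Generic a b c) {q : ℂ × ℂ} (h1 : ‖q.1‖ < 1 / 20)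
    (h2 : ‖q.2‖ < 1 / 20) : q ∈ convSet (firstCoef a b c) :=
  mem_convSet_of_bound (polyLE_firstCoef hg)
    (firstMaj_mul_le (p := 1 / 2) (q := 7 / 16) (t := 1 / 16) (by norm_num) (by norm_num)
      (by norm_num) (by norm_num) (by norm_num) (by norm_num) (by norm_num) (by norm_num)
      (by norm_num) (by norm_num)) h1 h2

lemma mem_convSet_secondCoef_of_small (hg : Generic a b c) {q : ℂ × ℂ} (h1 : ‖q.1‖ < 1 / 64)
    (h2 : ‖q.2‖ < 1 / 64) : q ∈ convSet (secondCoef a b c) := by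
  refine mem_convSet_of_bound (polyLE_secondCoef hg).1 (D := 1) (fun k => ?_) h1 h2
  calc secondMaj k * ((1 / 64) ^ k.1 * (1 / 64) ^ k.2) ≤
        64 ^ (k.1 + k.2) * ((1 / 64) ^ k.1 * (1 / 64) ^ k.2) := by gcongr; exact secondMaj_le k
    _ = 1 := by rw [← pow_add, ← mul_pow]; norm_num

lemma norm_lt_one_of_mem_convSet_secondCoef (hg : Generic a b c) {q : ℂ × ℂ}
    (h : q ∈ convSet (secondCoef a b c)) : ‖q.1‖ < 1 := by
  obtain ⟨A, B, hA, hB, C, hC, M, hb⟩ := exists_bound_of_mem_convSet (polyLE_secondCoef hg).2 h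
  refine hA.trans_le (le_one_of_pow_le (C := C) (M := M) fun l => ?_)
  simpa [secondMaj_zero_right] using hb (l, 0)

lemma mem_convSet_hornCoef (hg : Generic a b c) {y : ℂ} (hy : ‖y‖ < 1) :
    ((0, y) : ℂ × ℂ) ∈ convSet (hornCoef a b c) := by
  obtain ⟨B, hB, hB1⟩ := exists_between hy
  have hB0 : 0 ≤ B := (norm_nonneg _).trans hB.le
  have h1 : 0 < (1 - B) ^ 2 / 4 := by
    have : 0 < 1 - B := by linarith
    positivity
  refine mem_convSet_of_bound (polyLE_hornCoef hg).1 (A := min (1 / 64) ((1 - B) ^ 2 / 4)) (B := B)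
    (hornMaj_mul_le (by positivity) hB0 hB1.le (min_le_left _ _) ?_) ?_ hB
  · linarith [min_le_right (1 / 64 : ℝ) ((1 - B) ^ 2 / 4)]
  · rw [norm_zero]; exact lt_min (by norm_num) h1

/-- Gives |x/(1-y)| < 1 on the region of H₅, which is therefore disjoint from Ω. The rows n = 0 give
4A ≤ 1, which settles the case B < A. If A ≤ B, all terms of (A+B)^N grow at most polynomially:
those with m ≤ N - m by `choose_le_hornMaj`, the others by symmetry. -/
lemma norm_add_norm_lt_one_of_mem_convSet_hornCoef (hg : Generic a b c) {q : ℂ × ℂ}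
    (h : q ∈ convSet (hornCoef a b c)) : ‖q.1‖ + ‖q.2‖ < 1 := by
  obtain ⟨A, B, hA, hB, C, hC, M, hb⟩ := exists_bound_of_mem_convSet (polyLE_hornCoef hg).2 h
  have hA0 : 0 ≤ A := (norm_nonneg _).trans hA.le
  have hB0 : 0 ≤ B := (norm_nonneg _).trans hB.le
  have a1 : 4 * A ≤ 1 := le_one_of_pow_le (C := 2 * C) (M := M + 1) fun l => by
    have e1 := hb (l, 0)
    have e2 := hornMaj_zero_right l
    simp only [Nat.cast_zero, pow_zero, mul_one, add_zero] at e1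
    rw [div_le_iff₀ (by positivity)] at e2
    have hl : (0 : ℝ) ≤ l := l.cast_nonneg
    calc (4 * A) ^ l = 4 ^ l * A ^ l := mul_pow _ _ _
      _ ≤ (hornMaj (l, 0) * (2 * l + 1)) * A ^ l := by gcongr
      _ = (hornMaj (l, 0) * A ^ l) * (2 * l + 1) := by ring
      _ ≤ (C * (1 + l) ^ M) * (2 * (1 + l)) := by
        gcongr
        linarith
      _ = _ := by ring
  rcases lt_or_ge B A with hBA | hAB
  · linarith
  have key : ∀ m j : ℕ, A ^ m * B ^ (m + j) * ((m + (m + j)).choose m : ℝ) ≤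
      C * (1 + (m + (m + j) : ℕ) : ℝ) ^ M := by
    intro m j
    have e1 := hb (m, m + j)
    have e2 := choose_le_hornMaj m j
    calc _ ≤ A ^ m * B ^ (m + j) * hornMaj (m, m + j) := by gcongr
      _ = hornMaj (m, m + j) * (A ^ m * B ^ (m + j)) := by ring
      _ ≤ _ := e1
      _ = _ := by push_cast; ring
  have a2 : A + B ≤ 1 := le_one_of_pow_le (C := C) (M := M + 1) fun N => by
    rw [add_pow]
    refine (Finset.sum_le_card_nsmul _ _ (C * (1 + N : ℝ) ^ M) fun m hm => ?_).trans (le_of_eq ?_)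
    · have hm' : m ≤ N := by simpa [Nat.lt_succ_iff] using hm
      rcases le_total m (N - m) with hc | hc
      · obtain ⟨j, hj⟩ := Nat.exists_eq_add_of_le hc
        have hN : N = m + (m + j) := by omega
        have := key m j
        rwa [← hN, ← hj] at this
      · obtain ⟨j, hj⟩ := Nat.exists_eq_add_of_le hc
        have hN : N = (N - m) + ((N - m) + j) := by omega
        have h3 := key (N - m) j
        rw [← hN, ← hj, Nat.choose_symm hm'] at h3
        refine le_trans ?_ h3
        gcongr ?_ * _
        generalize N - m = m' at hj
        calc A ^ m * B ^ m' = A ^ m' * B ^ m' * A ^ j := by rw [hj]; ring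
          _ ≤ A ^ m' * B ^ m' * B ^ j := by gcongr
          _ = _ := by rw [hj]; ring
    · rw [Finset.card_range, nsmul_eq_mul]; push_cast; ring
  linarith

end

/-! ### The continuation of S₂ and its agreement with S₂ and S₂' -/

noncomputable section
variable {a b c : ℂ}

/-- The continuation of the second series. -/
def secondCont (a b c : ℂ) (p : ℂ × ℂ) : ℂ :=
  (1 - p.2) ^ (c - a - b) * secondConst a b c * psiSum a b c (1 - p.2, p.1 / (1 - p.2))

lemma mem_secondRegion_iff {p : ℂ × ℂ} : p ∈ secondRegion a b c ↔
    1 - p.2 ∈ Complex.slitPlane ∧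
      (-(p.1 / (1 - p.2)), 1 - p.2) ∈ convSet (secondCoef a b c) := by
  constructor
  · rintro ⟨h1, h2⟩
    exact ⟨h2, (mem_region_second_iff (Complex.slitPlane_ne_zero h2)).1 h1⟩
  · rintro ⟨h2, h1⟩
    exact ⟨(mem_region_second_iff (Complex.slitPlane_ne_zero h2)).2 h1, h2⟩

lemma norm_lt_one_of_mem_secondRegion (hg : Generic a b c) {p : ℂ × ℂ}
    (hp : p ∈ secondRegion a b c) : ‖p.1 / (1 - p.2)‖ < 1 := by
  simpa only [norm_neg] using norm_lt_one_of_mem_convSet_secondCoef hg (mem_secondRegion_iff.1 hp).2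

lemma mem_cutPlane_of_norm_lt {z : ℂ} (hz : ‖z‖ < 1) : z ∈ cutPlane :=
  Complex.mem_slitPlane_of_norm_lt_one (z := -z) (by rwa [norm_neg]) |> fun h => by
    rwa [← sub_eq_add_neg] at h

lemma hasSum_psi_of_mem_secondRegion (hg : Generic a b c) {p : ℂ × ℂ}
    (hp : p ∈ secondRegion a b c) :
    HasSum (fun n : ℕ => (1 - p.2) ^ n * psi a b c n (p.1 / (1 - p.2)))
      (∑' k : ℕ × ℕ, secondTerm a b c p k) := by
  have hz := norm_lt_one_of_mem_secondRegion hg hp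
  have hs := summable_of_mem_convSet (mem_secondRegion_iff.1 hp).2
  simp only [← secondTerm_eq] at hs
  have h1 : HasSum (secondTerm a b c p ∘ Equiv.prodComm ℕ ℕ) (∑' k : ℕ × ℕ, secondTerm a b c p k) :=
    (Equiv.prodComm ℕ ℕ).hasSum_iff.2 hs.hasSum
  refine h1.prod_fiberwise fun n => ?_
  refine ((hasSum_psi hg n hz).mul_left ((1 - p.2) ^ n)).congr_fun fun m => ?_
  simp only [Function.comp_apply, Equiv.prodComm_apply, Prod.swap_prod_mk, secondTerm_eq]
  ring

lemma hasSum_secondSeries (hg : Generic a b c) {p : ℂ × ℂ} (hp : p ∈ secondRegion a b c) :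
    HasSum (fun n : ℕ => (1 - p.2) ^ (c - a - b) * secondConst a b c *
          ((1 - p.2) ^ n * poch (c - a) n * poch (c - b) n /
            (n.factorial * poch (c - a - b + 1) n) * inner4F3 a b c n (p.1 / (1 - p.2))))
        (secondSeries a b c p) := by
  refine ((hasSum_psi_of_mem_secondRegion hg hp).mul_left _).congr_fun fun n => ?_
  rw [← sumConst_mul_inner4F3 hg n (norm_lt_one_of_mem_secondRegion hg hp), sumConst,
    poch_natCast, poch_natCast, poch_natCast]
  ring

lemma secondCont_eq_secondSeries (hg : Generic a b c) {p : ℂ × ℂ} (hp : p ∈ secondRegion a b c) :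
    secondCont a b c p = secondSeries a b c p := by
  rw [secondCont, secondSeries, psiSum, (hasSum_psi_of_mem_secondRegion hg hp).tsum_eq]

lemma mem_newRegionCut_iff (hg : Generic a b c) {p : ℂ × ℂ} : p ∈ newRegionCut ↔
    p.1 ≠ 0 ∧ 1 - p.2 ∈ Complex.slitPlane ∧ -(p.1 / (1 - p.2)) ∈ Complex.slitPlane ∧
      ((1 - p.2) / p.1, -p.1) ∈ convSet (newCoef a b c) := by
  have h : p.1 / (p.2 - 1) = -(p.1 / (1 - p.2)) := by rw [← neg_sub, div_neg]
  simp only [newRegionCut, mem_ofPred_eq, mem_newRegion_iff_convSet hg, h]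
  constructor
  · rintro ⟨⟨h1, h2, h3⟩, h4, h5⟩
    exact ⟨h1, h4, h5, h3⟩
  · rintro ⟨h1, h4, h5, h3⟩
    refine ⟨⟨h1, ?_, h3⟩, h4, h5⟩
    rintro h6
    rw [h6, sub_self] at h4
    exact Complex.slitPlane_ne_zero h4 rfl

lemma mem_cutPlane_of_neg_slit {z : ℂ} (hz : -z ∈ Complex.slitPlane) : z ∈ cutPlane := by
  rw [Complex.mem_slitPlane_iff] at hz
  simp only [cutPlane, mem_ofPred_eq, Complex.mem_slitPlane_iff, Complex.sub_re, Complex.one_re,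
    Complex.sub_im, Complex.one_im, Complex.neg_re, Complex.neg_im] at hz ⊢
  rcases hz with h | h
  · left; linarith
  · right; simpa using h

lemma one_lt_norm_of_mem_newRegion {p : ℂ × ℂ} (hp : p ∈ newRegion) :
    1 < ‖p.1 / (1 - p.2)‖ := by
  obtain ⟨h1, h2, h3, -⟩ := mem_newRegion_iff.1 hp
  have h4 : 0 < ‖(1 - p.2) / p.1‖ := norm_pos_iff.2 (div_ne_zero (sub_ne_zero.2 h2.symm) h1)
  rw [← inv_div, norm_inv]
  exact (one_lt_inv₀ h4).2 h3

/-- The absolutely convergent double series S₂' is summed over its first index, which gives the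
expansions at infinity of the coefficient functions. In particular the sum over n converges on all
of Ω*, beyond the reach of `psi_bound`. -/
lemma secondCont_eq_newSeries (hg : Generic a b c) {p : ℂ × ℂ} (hp : p ∈ newRegionCut) :
    secondCont a b c p = newSeries a b c p := by
  have hz := one_lt_norm_of_mem_newRegion hp.1
  obtain ⟨h0, h1, h2, h3⟩ := (mem_newRegionCut_iff hg).1 hp
  have hu := Complex.slitPlane_ne_zero h1
  have hs := summable_of_mem_convSet h3
  simp only [← newTerm_eq] at hs
  have h4 : HasSum (newTerm a b c p ∘ Equiv.prodComm ℕ ℕ) (∑' k : ℕ × ℕ, newTerm a b c p k) :=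
    (Equiv.prodComm ℕ ℕ).hasSum_iff.2 hs.hasSum
  have h5 : HasSum (fun n : ℕ => (1 - p.2) ^ n * psi a b c n (p.1 / (1 - p.2)))
      ((-(p.1 / (1 - p.2))) ^ (c - a - b) * ∑' k : ℕ × ℕ, newTerm a b c p k) := by
    refine (h4.mul_left _).prod_fiberwise fun n => ?_
    refine ((hasSum_psi_at_infinity hg n (mem_cutPlane_of_neg_slit h2) hz).mul_left
      ((1 - p.2) ^ n)).congr_fun fun m => ?_
    simp only [Function.comp_apply, Equiv.prodComm_apply, Prod.swap_prod_mk, newTerm_eq]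
    -- With z = x/(1-y), the variables of the new series are 1/z and -x = (1-y)(-z); the power
    -- (1-y)^n splits off and belongs to the outer sum.
    rw [inv_div, show -p.1 = (1 - p.2) * -(p.1 / (1 - p.2)) by field_simp, mul_pow (1 - p.2)]
    ring
  rw [secondCont, psiSum, newSeries, h5.tsum_eq,
    show p.1 / (p.2 - 1) = -(p.1 / (1 - p.2)) by rw [← neg_sub, div_neg]]
  ring

lemma isOpen_secondRegion : IsOpen (secondRegion a b c) :=
  isOpen_interior.inter (Complex.isOpen_slitPlane.preimage (by fun_prop : Continuous
    fun p : ℂ × ℂ => 1 - p.2))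

lemma isOpen_newRegionCut (hg : Generic a b c) : IsOpen newRegionCut := by
  have h1 : IsOpen newRegion := by
    rw [← region_new_eq hg]
    exact isOpen_interior.inter ((isOpen_ne_fun continuous_fst continuous_const).inter
      (isOpen_ne_fun continuous_snd continuous_const))
  refine isOpen_iff_mem_nhds.2 fun p hp => ?_
  have h2 : p.2 - 1 ≠ 0 := sub_ne_zero.2 (mem_newRegion_iff.1 hp.1).2.1
  have h3 : ContinuousAt (fun q : ℂ × ℂ => q.1 / (q.2 - 1)) p :=
    continuousAt_fst.div (continuousAt_snd.sub continuousAt_const) h2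
  have h4 : ContinuousAt (fun q : ℂ × ℂ => 1 - q.2) p := by fun_prop
  filter_upwards [h1.mem_nhds hp.1, h4 (Complex.isOpen_slitPlane.mem_nhds hp.2.1),
    h3 (Complex.isOpen_slitPlane.mem_nhds hp.2.2)] with q q1 q2 q3
  exact ⟨q1, q2, q3⟩

lemma analyticAt_one_sub_snd (p : ℂ × ℂ) : AnalyticAt ℂ (fun q : ℂ × ℂ => 1 - q.2) p :=
  analyticAt_const.sub analyticAt_snd

lemma analyticAt_ratio {p : ℂ × ℂ} (hp : 1 - p.2 ≠ 0) :
    AnalyticAt ℂ (fun q : ℂ × ℂ => q.1 / (1 - q.2)) p :=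
  analyticAt_fst.div (analyticAt_one_sub_snd p) hp

lemma analyticAt_comp_convSet {co : ℕ × ℕ → ℂ} {f g : ℂ × ℂ → ℂ} {p : ℂ × ℂ}
    (hf : AnalyticAt ℂ f p) (hg : AnalyticAt ℂ g p) (h : (f p, g p) ∈ convSet co) :
    AnalyticAt ℂ (fun p => ∑' k : ℕ × ℕ, co k * (f p ^ k.1 * g p ^ k.2)) p :=
  AnalyticAt.comp₂ (h := fun q : ℂ × ℂ => ∑' k : ℕ × ℕ, co k * (q.1 ^ k.1 * q.2 ^ k.2))
    (f := f) (g := g) (analyticAt_of_mem_convSet h) hf hg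

lemma analyticAt_secondSeries {p : ℂ × ℂ} (hp : p ∈ secondRegion a b c) :
    AnalyticAt ℂ (secondSeries a b c) p := by
  obtain ⟨h1, h2⟩ := mem_secondRegion_iff.1 hp
  have h3 := analyticAt_comp_convSet (f := fun p => -(p.1 / (1 - p.2))) (analyticAt_ratio (Complex.slitPlane_ne_zero h1)).neg
    (analyticAt_one_sub_snd p) h2
  simp only [← secondTerm_eq] at h3
  exact (((analyticAt_one_sub_snd p).cpow analyticAt_const h1).mul analyticAt_const).mul h3

lemma analyticAt_newSum {p : ℂ × ℂ} (h1 : p.1 ≠ 0)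
    (h2 : ((1 - p.2) / p.1, -p.1) ∈ convSet (newCoef a b c)) :
    AnalyticAt ℂ (fun p => ∑' k : ℕ × ℕ, newTerm a b c p k) p := by
  have h3 := analyticAt_comp_convSet (f := fun p => (1 - p.2) / p.1) (g := fun p => -p.1)
    ((analyticAt_one_sub_snd p).div analyticAt_fst h1)
    analyticAt_fst.neg h2
  simpa only [← newTerm_eq] using h3

lemma analyticAt_newSeries (hg : Generic a b c) {p : ℂ × ℂ} (hp : p ∈ newRegionCut) :
    AnalyticAt ℂ (newSeries a b c) p := by
  obtain ⟨h0, h1, h2, h3⟩ := (mem_newRegionCut_iff hg).1 hp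
  have h4 : p.2 - 1 ≠ 0 := sub_ne_zero.2 (mem_newRegion_iff.1 hp.1).2.1
  exact ((((analyticAt_one_sub_snd p).cpow analyticAt_const h1).mul
    ((analyticAt_fst.div (analyticAt_snd.sub analyticAt_const) h4).cpow analyticAt_const
      hp.2.2)).mul analyticAt_const).mul (analyticAt_newSum h0 h3)

lemma analyticAt_firstSeries {p : ℂ × ℂ} (hp : p ∈ regionOfConvergence (firstTerm a b c)) :
    AnalyticAt ℂ (firstSeries a b c) p := by
  have h3 := analyticAt_comp_convSet (f := fun p => -p.1) analyticAt_fst.neg (analyticAt_one_sub_snd p)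
    (mem_region_first_iff.1 hp)
  simp only [← firstTerm_eq] at h3
  exact analyticAt_const.mul h3

lemma analyticAt_hornH5 {p : ℂ × ℂ} (hp : p ∈ convSet (hornCoef a b c)) :
    AnalyticAt ℂ (hornH5 a b c) p := by
  have h3 := analyticAt_of_mem_convSet hp
  simp only [← hornH5Term_eq] at h3
  exact h3

end

/-! ### Tubes around (0, 1) and connectedness -/

noncomputable section
variable {a b c : ℂ}

/-- A function that is positive exactly on the cut plane. -/
def gap (z : ℂ) : ℝ := ‖1 - z‖ + 1 - ‖z‖

lemma continuous_gap : Continuous gap := by unfold gap; fun_prop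

lemma gap_pos {z : ℂ} (hz : z ∈ cutPlane) : 0 < gap z := by
  by_contra! h
  unfold gap at h
  have h1 : ‖z‖ ^ 2 = z.re ^ 2 + z.im ^ 2 := by rw [Complex.sq_norm, Complex.normSq_apply]; ring
  have h2 : ‖1 - z‖ ^ 2 = (1 - z.re) ^ 2 + z.im ^ 2 := by
    rw [Complex.sq_norm, Complex.normSq_apply]; simp; ring
  have h3 : (‖1 - z‖ + 1) ^ 2 ≤ ‖z‖ ^ 2 := by gcongr; linarith
  have h4 := norm_nonneg (1 - z)
  have h5 : ‖1 - z‖ ≤ z.re - 1 := by nlinarith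
  have h6 : ‖1 - z‖ ^ 2 ≤ (z.re - 1) ^ 2 := by gcongr
  have h7 : z.im = 0 := by
    have : z.im ^ 2 ≤ 0 := by nlinarith
    exact pow_eq_zero_iff two_ne_zero |>.1 (le_antisymm this (sq_nonneg _))
  rw [cutPlane, mem_ofPred_eq, Complex.mem_slitPlane_iff] at hz
  simp only [Complex.sub_re, Complex.one_re, Complex.sub_im, Complex.one_im] at hz
  rcases hz with h | h
  · linarith
  · exact h (by linarith)

lemma mem_cutPlane_of_gap_pos {z : ℂ} (h : 0 < gap z) : z ∈ cutPlane := by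
  by_contra hz
  rw [cutPlane, mem_ofPred_eq, Complex.mem_slitPlane_iff] at hz
  simp only [Complex.sub_re, Complex.one_re, Complex.sub_im, Complex.one_im, not_or, not_lt,
    not_not] at hz
  have him : z.im = 0 := by linarith [hz.2]
  obtain ⟨x, rfl⟩ : ∃ x : ℝ, z = x := ⟨z.re, Complex.ext rfl (by simp [him])⟩
  have hx : 1 - x ≤ 0 := by simpa using hz.1
  have h2 : 1 - (x : ℂ) = ((1 - x : ℝ) : ℂ) := by push_cast; rfl
  unfold gap at h
  rw [h2, Complex.norm_real, Complex.norm_real, Real.norm_of_nonpos hx,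
    Real.norm_of_nonneg (by linarith)] at h
  linarith

lemma gap_le_two_mul (z : ℂ) : gap z ≤ 2 * ‖1 - z‖ := by
  have := norm_sub_norm_le (1 : ℂ) z
  rw [norm_one] at this
  unfold gap
  linarith

/-- Contracting z towards 0 only increases the gap, so the tubes may be contracted in x. -/
lemma gap_le_gap_mul (z : ℂ) {σ : ℝ} (h0 : 0 ≤ σ) (h1 : σ ≤ 1) : gap z ≤ gap (σ * z) := by
  have h2 : ‖1 - z‖ ≤ ‖1 - σ * z‖ + (1 - σ) * ‖z‖ := by
    calc ‖1 - z‖ = ‖(1 - σ * z) - ((1 - σ : ℝ) : ℂ) * z‖ := by congr 1; push_cast; ring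
      _ ≤ ‖1 - σ * z‖ + ‖((1 - σ : ℝ) : ℂ) * z‖ := norm_sub_le _ _
      _ = _ := by rw [norm_mul, Complex.norm_real, Real.norm_of_nonneg (by linarith)]
  unfold gap
  rw [norm_mul, Complex.norm_real, Real.norm_of_nonneg h0]
  linarith

/-- A union of tubes. -/
def tubes (C : ℝ) : Set (ℂ × ℂ) :=
  {p | 1 - p.2 ∈ Complex.slitPlane ∧ C * ‖1 - p.2‖ < gap (p.1 / (1 - p.2)) ∧
    C * ‖1 - p.2‖ * (1 + ‖p.1 / (1 - p.2)‖) < 1}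

lemma isOpen_tubes (C : ℝ) : IsOpen (tubes C) := by
  refine isOpen_iff_mem_nhds.2 fun p hp => ?_
  obtain ⟨h1, h2, h3⟩ := hp
  have h4 : ContinuousAt (fun q : ℂ × ℂ => 1 - q.2) p := by fun_prop
  have h5 := (analyticAt_ratio (Complex.slitPlane_ne_zero h1)).continuousAt
  have h6 : ContinuousAt (fun q : ℂ × ℂ => C * ‖1 - q.2‖) p := by fun_prop
  filter_upwards [h4 (Complex.isOpen_slitPlane.mem_nhds h1),
    h6.eventually_lt (continuous_gap.continuousAt.comp h5) h2,
    (h6.mul (continuousAt_const.add h5.norm)).eventually_lt continuousAt_const h3]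
    with q q1 q2 q3
  exact ⟨q1, q2, q3⟩

lemma mem_cutPlane_of_mem_tubes {C : ℝ} (hC : 0 ≤ C) {p : ℂ × ℂ} (hp : p ∈ tubes C) :
    p.1 / (1 - p.2) ∈ cutPlane :=
  mem_cutPlane_of_gap_pos ((by positivity : 0 ≤ C * ‖1 - p.2‖).trans_lt hp.2.1)

/-- On a compact subset of the cut plane both the gap and 1/(1 + ‖z‖) have positive lower bounds. -/
lemma containsTubes_of_tubes_subset {C : ℝ} (hC : 0 < C) {U : Set (ℂ × ℂ)} (h : tubes C ⊆ U) :
    ContainsTubes U := by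
  intro K hK hKc
  have hcont : Continuous fun z : ℂ => min (gap z) (1 / (1 + ‖z‖)) :=
    continuous_gap.min (continuous_const.div (by fun_prop) fun z => by positivity)
  obtain ⟨ε, hε, hε'⟩ := hKc.exists_forall_le' hcont.continuousOn (a := 0)
    fun z hz => lt_min (gap_pos (hK hz)) (by positivity)
  refine ⟨ε / C, by positivity, fun p h1 h2 h3 => h ⟨h1, ?_, ?_⟩⟩
  all_goals
    have h4 := hε' _ h3
    rw [lt_div_iff₀ hC, mul_comm] at h2
    have h5 := h2.trans_le h4
    rw [lt_min_iff] at h5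
  · exact h5.1
  · rw [← lt_div_iff₀ (by positivity)]; exact h5.2

lemma tubes_subset_region_first (hg : Generic a b c) {C : ℝ} (hC : 20 ≤ C) :
    tubes C ⊆ regionOfConvergence (firstTerm a b c) := by
  intro p ⟨h1, h2, h3⟩
  have hu : 0 < ‖1 - p.2‖ := norm_pos_iff.2 (Complex.slitPlane_ne_zero h1)
  rw [mem_region_first_iff]
  have h4 : 20 * ‖1 - p.2‖ * (1 + ‖p.1 / (1 - p.2)‖) < 1 := lt_of_le_of_lt (by gcongr) h3
  have h5 : ‖p.1‖ = ‖1 - p.2‖ * ‖p.1 / (1 - p.2)‖ := by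
    rw [norm_div, mul_div_cancel₀ _ hu.ne']
  have h6 := norm_nonneg (p.1 / (1 - p.2))
  have h7 := mul_nonneg hu.le h6
  refine mem_convSet_firstCoef_of_small hg ?_ ?_
  · simp only [norm_neg]; rw [h5]; nlinarith
  · simp only; nlinarith

/-- The two inequalities that define the tubes imply those under which the sum over n is analytic,
because gap z ≤ 2‖1-z‖ and ‖1-z‖ ≤ 1 + ‖z‖. The factor 20 also places the tubes inside the region of
S₁. -/
lemma exists_analyticAt_secondCont (hg : Generic a b c) : ∃ C ≥ 20, ∀ p ∈ tubes C,
    AnalyticAt ℂ (secondCont a b c) p := by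
  obtain ⟨C, hC, h⟩ := exists_analyticAt_psiSum hg
  refine ⟨20 * C, by linarith, fun p hp => ?_⟩
  have hz := mem_cutPlane_of_mem_tubes (by linarith) hp
  obtain ⟨h1, h2, h3⟩ := hp
  have hu : 0 < ‖1 - p.2‖ := norm_pos_iff.2 (Complex.slitPlane_ne_zero h1)
  set z := p.1 / (1 - p.2) with hzdef
  have h4 := gap_le_two_mul z
  have h5 : 0 ≤ C * ‖1 - p.2‖ := by positivity
  have h6 := norm_sub_le (1 : ℂ) z
  rw [norm_one] at h6
  have h7 := h (1 - p.2) z hz (by nlinarith) (by nlinarith [norm_nonneg z])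
  have h8 : AnalyticAt ℂ (fun q : ℂ × ℂ => psiSum a b c (1 - q.2, q.1 / (1 - q.2))) p :=
    AnalyticAt.comp₂ (h := psiSum a b c) (f := fun q : ℂ × ℂ => 1 - q.2)
      (g := fun q : ℂ × ℂ => q.1 / (1 - q.2)) h7 (analyticAt_one_sub_snd p)
      (analyticAt_ratio (Complex.slitPlane_ne_zero h1))
  exact (((analyticAt_one_sub_snd p).cpow analyticAt_const h1).mul analyticAt_const).mul h8

/-- The point of the same line through `(0, 1)`, at `τ` times the distance. -/
def scalePt (τ : ℝ) (p : ℂ × ℂ) : ℂ × ℂ := (τ * p.1, 1 - τ * (1 - p.2))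

lemma scalePt_one (p : ℂ × ℂ) : scalePt 1 p = p := by
  ext <;> simp [scalePt]

lemma one_sub_scalePt (τ : ℝ) (p : ℂ × ℂ) : 1 - (scalePt τ p).2 = τ * (1 - p.2) := by
  simp [scalePt]

lemma ratio_scalePt {τ : ℝ} (hτ : 0 < τ) (p : ℂ × ℂ) :
    (scalePt τ p).1 / (1 - (scalePt τ p).2) = p.1 / (1 - p.2) := by
  rw [one_sub_scalePt, scalePt]
  exact mul_div_mul_left _ _ (by exact_mod_cast hτ.ne')

lemma smul_mem_slitPlane {τ : ℝ} (hτ : 0 < τ) {u : ℂ} (hu : u ∈ Complex.slitPlane) :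
    (τ : ℂ) * u ∈ Complex.slitPlane := by
  rw [Complex.mem_slitPlane_iff] at hu ⊢
  simp only [Complex.re_ofReal_mul, Complex.im_ofReal_mul]
  rcases hu with h | h
  · exact Or.inl (by positivity)
  · exact Or.inr (mul_ne_zero hτ.ne' h)

lemma scalePt_mem_tubes {C : ℝ} {p : ℂ × ℂ} (h1 : 1 - p.2 ∈ Complex.slitPlane) {τ : ℝ}
    (hτ : 0 < τ) (h2 : C * (τ * ‖1 - p.2‖) < gap (p.1 / (1 - p.2)))
    (h3 : C * (τ * ‖1 - p.2‖) * (1 + ‖p.1 / (1 - p.2)‖) < 1) : scalePt τ p ∈ tubes C := by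
  have hn : ‖(τ : ℂ) * (1 - p.2)‖ = τ * ‖1 - p.2‖ := by
    rw [norm_mul, Complex.norm_real, Real.norm_of_nonneg hτ.le]
  refine ⟨?_, ?_, ?_⟩
  · rw [one_sub_scalePt]; exact smul_mem_slitPlane hτ h1
  · rw [ratio_scalePt hτ, one_sub_scalePt, hn]; exact h2
  · rw [ratio_scalePt hτ, one_sub_scalePt, hn]; exact h3

lemma joinedIn_of_path {S : Set (ℂ × ℂ)} {f : ℝ → ℂ × ℂ} (hf : Continuous f)
    (h : ∀ s ∈ Icc (0 : ℝ) 1, f s ∈ S) : JoinedIn S (f 0) (f 1) :=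
  JoinedIn.ofLine hf.continuousOn rfl rfl (by rintro _ ⟨s, hs, rfl⟩; exact h s hs)

lemma continuous_scalePt (p : ℂ × ℂ) : Continuous fun τ : ℝ => scalePt τ p := by
  unfold scalePt; fun_prop

/-- First x is contracted to 0 with y fixed, then 1 - y moves along a segment to the positive number
1/(2C); the slit plane is star-shaped about it. -/
lemma joinedIn_tubes {C : ℝ} (hC : 1 ≤ C) {p : ℂ × ℂ} (hp : p ∈ tubes C) :
    JoinedIn (tubes C) p (0, 1 - ((1 / (2 * C) : ℝ) : ℂ)) := by
  obtain ⟨h1, h2, h3⟩ := hp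
  have hu0 := Complex.slitPlane_ne_zero h1
  have hC0 : 0 < C := by linarith
  have hgap0 : gap 0 = 2 := by unfold gap; norm_num
  have hpos : 0 ≤ C * ‖1 - p.2‖ := by positivity
  have hz0 := norm_nonneg (p.1 / (1 - p.2))
  have step1 : JoinedIn (tubes C) p (0, p.2) := by
    have := joinedIn_of_path (S := tubes C) (f := fun s : ℝ => (((1 - s : ℝ) : ℂ) * p.1, p.2))
      (by fun_prop) (fun s hs => by
        refine ⟨h1, ?_, ?_⟩
        · simp only
          rw [mul_div_assoc]
          exact h2.trans_le (gap_le_gap_mul _ (by linarith [hs.2]) (by linarith [hs.1]))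
        · simp only
          rw [mul_div_assoc, norm_mul, Complex.norm_real,
            Real.norm_of_nonneg (by linarith [hs.2] : 0 ≤ 1 - s)]
          refine lt_of_le_of_lt ?_ h3
          gcongr
          nlinarith [hs.1])
    simpa using this
  have hCu : C * ‖1 - p.2‖ < 1 := by nlinarith
  have step2 : JoinedIn (tubes C) (0, p.2) (0, 1 - ((1 / (2 * C) : ℝ) : ℂ)) := by
    have := joinedIn_of_path (S := tubes C) (f := fun s : ℝ => ((0 : ℂ),
      1 - (((1 - s : ℝ) : ℂ) * (1 - p.2) + ((s * (1 / (2 * C)) : ℝ) : ℂ))))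
      (by fun_prop) (fun s hs => by
        have hb : C * ‖((1 - s : ℝ) : ℂ) * (1 - p.2) + ((s * (1 / (2 * C)) : ℝ) : ℂ)‖ < 1 := by
          calc _ ≤ C * ((1 - s) * ‖1 - p.2‖ + s * (1 / (2 * C))) := by
                gcongr
                refine (norm_add_le _ _).trans (le_of_eq ?_)
                rw [norm_mul, Complex.norm_real, Complex.norm_real,
                  Real.norm_of_nonneg (by linarith [hs.2]),
                  Real.norm_of_nonneg (mul_nonneg hs.1 (by positivity))]
            _ = (1 - s) * (C * ‖1 - p.2‖) + s * (1 / 2) := by field_simp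
            _ < 1 := by
              rcases eq_or_lt_of_le hs.2 with h | h
              · rw [h]; norm_num
              · nlinarith [hs.1]
        refine ⟨?_, ?_, ?_⟩
        · simp only [sub_sub_cancel]
          rw [Complex.mem_slitPlane_iff] at h1 ⊢
          simp only [Complex.add_re, Complex.add_im, Complex.re_ofReal_mul, Complex.im_ofReal_mul,
            Complex.ofReal_re, Complex.ofReal_im, add_zero]
          have hsp : 0 ≤ s * (1 / (2 * C)) := mul_nonneg hs.1 (by positivity)
          rcases eq_or_lt_of_le hs.2 with h | h
          · left
            rw [h]; simp; positivity
          · rcases h1 with h1 | h1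
            · left
              have : 0 < (1 - s) * (1 - p.2).re := mul_pos (by linarith) h1
              linarith
            · right
              exact mul_ne_zero (by linarith) h1
        · simp only [sub_sub_cancel, zero_div, hgap0]
          linarith
        · simp only [sub_sub_cancel, zero_div, norm_zero, add_zero, mul_one]
          exact hb)
    simpa using this
  exact step1.trans step2

/-- Scaling towards (0, 1) keeps x/(1-y) fixed and makes 1 - y small, so every point of A flows
inside A into the tubes, which are path connected. -/
lemma isConnected_union_tubes {A : Set (ℂ × ℂ)} {C : ℝ} (hC : 1 ≤ C)
    (hA : ∀ p ∈ A, 1 - p.2 ∈ Complex.slitPlane ∧ p.1 / (1 - p.2) ∈ cutPlane)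
    (hs : ∀ p ∈ A, ∀ τ : ℝ, 0 < τ → τ ≤ 1 → scalePt τ p ∈ A) : IsConnected (A ∪ tubes C) := by
  have hbase : ((0, 1 - ((1 / (2 * C) : ℝ) : ℂ)) : ℂ × ℂ) ∈ tubes C := by
    have hC0 : 0 < C := by linarith
    have hn : C * ‖((1 / (2 * C) : ℝ) : ℂ)‖ = 1 / 2 := by
      rw [Complex.norm_real, Real.norm_of_nonneg (by positivity)]; field_simp
    have hgap0 : gap 0 = 2 := by unfold gap; norm_num
    refine ⟨?_, ?_, ?_⟩
    · simp only [sub_sub_cancel]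
      exact Complex.ofReal_mem_slitPlane.2 (by positivity)
    · simp only [sub_sub_cancel, zero_div, hgap0]; rw [hn]; norm_num
    · simp only [sub_sub_cancel, zero_div, norm_zero]; rw [hn]; norm_num
  refine IsPathConnected.isConnected ⟨_, Or.inr hbase, fun {p} hp => ?_⟩
  refine JoinedIn.symm ?_
  rcases hp with hp | hp
  · obtain ⟨h1, h2⟩ := hA p hp
    have hg := gap_pos h2
    have hC0 : 0 < C := by linarith
    obtain ⟨τ, hτ, hτ1, h3, h4⟩ : ∃ τ : ℝ, 0 < τ ∧ τ ≤ 1 ∧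
        C * (τ * ‖1 - p.2‖) < gap (p.1 / (1 - p.2)) ∧
        C * (τ * ‖1 - p.2‖) * (1 + ‖p.1 / (1 - p.2)‖) < 1 := by
      have ev : ∀ᶠ τ in 𝓝[>] (0 : ℝ), τ < 1 ∧ C * (τ * ‖1 - p.2‖) < gap (p.1 / (1 - p.2)) ∧
          C * (τ * ‖1 - p.2‖) * (1 + ‖p.1 / (1 - p.2)‖) < 1 := by
        apply nhdsWithin_le_nhds
        exact (continuousAt_id.eventually_lt continuousAt_const (by simp)).and
          (((Continuous.continuousAt (by fun_prop)).eventually_lt continuousAt_const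
            (by simpa using hg)).and ((Continuous.continuousAt (by fun_prop)).eventually_lt
              continuousAt_const (by simp)))
      obtain ⟨τ, ⟨e1, e2, e3⟩, e4⟩ := (ev.and self_mem_nhdsWithin).exists
      exact ⟨τ, e4, e1.le, e2, e3⟩
    have j1 : JoinedIn (A ∪ tubes C) p (scalePt τ p) := by
      have := joinedIn_of_path (S := A ∪ tubes C) (f := fun s => scalePt (1 - s * (1 - τ)) p)
        ((continuous_scalePt p).comp (by fun_prop)) (fun s hs' => Or.inl (hs p hp _
          (by nlinarith [hs'.1, hs'.2]) (by nlinarith [hs'.1, hs'.2])))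
      simpa [scalePt_one] using this
    exact j1.trans ((joinedIn_tubes hC (scalePt_mem_tubes h1 hτ h3 h4)).mono subset_union_right)
  · exact (joinedIn_tubes hC hp).mono subset_union_right

end

/-! ### Row-wise application of Gauss's connection formula -/

noncomputable section
variable {a b c : ℂ}

lemma hasSum_hornH5Term_row (hg : Generic a b c) {p : ℂ × ℂ} (hy : ‖p.2‖ < 1) (m : ℕ) :
    HasSum (fun n => hornH5Term a b c p (m, n))
      (asc a (2 * m) * poch b (-m) * p.1 ^ m / m.factorial * gauss (a + 2 * m) (b - m) c p.2) := by
  refine (((polyBdd_gcoef (a + 2 * m) (b - m) hg.c_ne).hasSum hy).mul_left _).congr_fun fun n => ?_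
  have h1 : poch a (2 * (m : ℤ) + n) = asc a (2 * m) * asc (a + 2 * m) n := by
    rw [show (2 * (m : ℤ) + n) = ((2 * m + n : ℕ) : ℤ) by push_cast; rfl, poch_natCast, asc_add]
    push_cast; rfl
  have h2 : poch b (n - m) = poch b (-m) * asc (b - m) n := by
    rw [poch_add_asc hg.b_int _ (-m) n (by ring)]; push_cast; rw [← sub_eq_add_neg]
  simp only [hornH5Term, gcoef, h1, h2, poch_natCast, div_eq_mul_inv, mul_inv]
  ring

lemma hasSum_firstTerm_row (hg : Generic a b c) {p : ℂ × ℂ} (hy : ‖1 - p.2‖ < 1) (m : ℕ) :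
    HasSum (fun n => firstTerm a b c p (m, n))
      (asc (a - c + 1) (2 * m) * asc a (2 * m) * poch b (-m) * (-p.1) ^ m /
        (asc (c - b) m * asc (a + b - c + 1) m * m.factorial) *
        gauss (a + 2 * m) (b - m) (a + b - c + 1 + m) (1 - p.2)) := by
  have hC : NotInt (a + b - c + 1 + m) := hg.abc_int.of_eq_add (1 + m) (by push_cast; ring)
  refine (((polyBdd_gcoef (a + 2 * m) (b - m) hC.ne_neg).hasSum hy).mul_left _).congr_fun
    fun n => ?_
  have h1 : poch a (2 * (m : ℤ) + n) = asc a (2 * m) * asc (a + 2 * m) n := by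
    rw [show (2 * (m : ℤ) + n) = ((2 * m + n : ℕ) : ℤ) by push_cast; rfl, poch_natCast, asc_add]
    push_cast; rfl
  have h2 : poch b (n - m) = poch b (-m) * asc (b - m) n := by
    rw [poch_add_asc hg.b_int _ (-m) n (by ring)]; push_cast; rw [← sub_eq_add_neg]
  have h3 : poch (a - c + 1) (2 * (m : ℤ)) = asc (a - c + 1) (2 * m) := by
    rw [← poch_natCast]; push_cast; rfl
  have h4 : poch (a + b - c + 1) ((m : ℤ) + n) =
      asc (a + b - c + 1) m * asc (a + b - c + 1 + m) n := by
    rw [← asc_add, ← poch_natCast]; push_cast; rfl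
  simp only [firstTerm, gcoef, h1, h2, h3, h4, poch_natCast, div_eq_mul_inv, mul_inv]
  ring

lemma hasSum_secondTerm_row (hg : Generic a b c) {p : ℂ × ℂ} (hy : ‖1 - p.2‖ < 1) (m : ℕ) :
    HasSum (fun n => secondTerm a b c p (m, n))
      ((-(p.1 / (1 - p.2))) ^ m / (poch (c - a - b + 1) (-m) * m.factorial) *
        gauss (c - a - 2 * m) (c - b + m) (c - a - b + 1 - m) (1 - p.2)) := by
  have h0 : NotInt (c - a - b + 1) := hg.abc_int.of_eq_sub 1 (by push_cast; ring)
  have hC : NotInt (c - a - b + 1 - m) := h0.of_eq_add (-m) (by push_cast; ring)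
  refine (((polyBdd_gcoef (c - a - 2 * m) (c - b + m) hC.ne_neg).hasSum hy).mul_left _).congr_fun
    fun n => ?_
  have h1 : poch (c - a) (n - 2 * m) = poch (c - a) (-(2 * m : ℕ)) * asc (c - a - 2 * m) n := by
    rw [poch_add_asc hg.ca_int _ (-(2 * m : ℕ)) n (by push_cast; ring)]; push_cast
    rw [← sub_eq_add_neg]
  have h2 : poch (c - a - b + 1) (n - m) =
      poch (c - a - b + 1) (-m) * asc (c - a - b + 1 - m) n := by
    rw [poch_add_asc h0 _ (-m) n (by ring)]; push_cast; rw [← sub_eq_add_neg]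
  have h3 : poch (a - c + 1) (2 * (m : ℤ)) = asc (a - c + 1) (2 * m) := by
    rw [← poch_natCast]; push_cast; rfl
  have h4 : poch (c - b) ((m : ℤ) + n) = asc (c - b) m * asc (c - b + m) n := by
    rw [← asc_add, ← poch_natCast]; push_cast; rfl
  have h5 : asc (a - c + 1) (2 * m) * poch (c - a) (-(2 * m : ℕ)) = 1 := by
    have := poch_reflect (hg.ca_int.of_eq_sub 1 (v := a - c + 1) (by push_cast; ring))
      ((2 * m : ℕ) : ℤ)
    rw [show 1 - (a - c + 1) = c - a by ring, poch_natCast, zpow_natCast, pow_mul] at this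
    rw [mul_comm, this]; norm_num
  have h6 := asc_ne_zero hg.cb_ne m
  have h7 := poch_ne_zero h0 (-m)
  have h8 := asc_ne_zero hC.ne_neg n
  have h9 : (m.factorial : ℂ) ≠ 0 := by exact_mod_cast m.factorial_ne_zero
  have h10 : (n.factorial : ℂ) ≠ 0 := by exact_mod_cast n.factorial_ne_zero
  simp only [secondTerm, gcoef, h1, h2, h3, h4, poch_natCast]
  rw [← mul_assoc (asc (a - c + 1) (2 * m)), h5]
  field_simp

/-- Gauss's formula with the parameters a+2m, b-m and c. The difference C-A-B drops by m, so the
singular solution carries (1-y)^(c-a-b-m); together with x^m this produces (x/(1-y))^m. The Gamma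
factors reduce to Pochhammer symbols by shifts and reflection. -/
lemma row_connection (hg : Generic a b c) {p : ℂ × ℂ} (hy : ‖p.2‖ < 1) (hy' : ‖1 - p.2‖ < 1)
    (hu : 1 - p.2 ≠ 0) (m : ℕ) :
    asc a (2 * m) * poch b (-m) * p.1 ^ m / m.factorial * gauss (a + 2 * m) (b - m) c p.2 =
      Complex.Gamma c * Complex.Gamma (c - a - b) /
          (Complex.Gamma (c - a) * Complex.Gamma (c - b)) *
        (asc (a - c + 1) (2 * m) * asc a (2 * m) * poch b (-m) * (-p.1) ^ m /
          (asc (c - b) m * asc (a + b - c + 1) m * m.factorial) *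
          gauss (a + 2 * m) (b - m) (a + b - c + 1 + m) (1 - p.2)) +
      (1 - p.2) ^ (c - a - b) * secondConst a b c *
        ((-(p.1 / (1 - p.2))) ^ m / (poch (c - a - b + 1) (-m) * m.factorial) *
        gauss (c - a - 2 * m) (c - b + m) (c - a - b + 1 - m) (1 - p.2)) := by
  have hs : NotInt (c - a - b) := hg.abc_int.of_eq_sub 0 (by push_cast; ring)
  have hs1 : NotInt (a + b - c + 1) := hg.abc_int.of_eq_add 1 (by push_cast; ring)
  have h0 : NotInt (c - a - b + 1) := hg.abc_int.of_eq_sub 1 (by push_cast; ring)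
  have hA : ∀ k : ℕ, a + 2 * m ≠ -(k : ℂ) := fun k h => hg.a_ne (k + 2 * m) (by
    push_cast; linear_combination h)
  have hB : NotInt (b - m) := hg.b_int.of_eq_add (-m) (by push_cast; ring)
  have hCB : ∀ k : ℕ, c - (b - m) ≠ -(k : ℂ) := fun k h => hg.cb_ne (k + m) (by
    push_cast; linear_combination h)
  have hCA : NotInt (c - (a + 2 * m)) := hg.ca_int.of_eq_add (-(2 * m)) (by push_cast; ring)
  have hconn := gauss_connection hg.c_ne
    (hs.of_eq_add (-m) (v := c - (a + 2 * m) - (b - m)) (by push_cast; ring)) hA hB.ne_neg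
    hCA.ne_neg hCB hy hy'
  have e1 : Complex.Gamma (c - a - b - m) = poch (c - a - b) (-m) * Complex.Gamma (c - a - b) := by
    rw [poch_mul_Gamma hs]; push_cast; rw [← sub_eq_add_neg]
  have e2 : Complex.Gamma (c - a - 2 * m) = poch (c - a) (-(2 * m : ℕ)) * Complex.Gamma (c - a) := by
    rw [poch_mul_Gamma hg.ca_int]; push_cast; rw [← sub_eq_add_neg]
  have e3 : Complex.Gamma (c - b + m) = asc (c - b) m * Complex.Gamma (c - b) :=
    (asc_mul_Gamma hg.cb_ne m).symm
  have e4 : Complex.Gamma (a + b - c + m) = asc (a + b - c) m * Complex.Gamma (a + b - c) :=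
    (asc_mul_Gamma hg.abc_int.ne_neg m).symm
  have e5 : Complex.Gamma (a + 2 * m) = asc a (2 * m) * Complex.Gamma a := by
    rw [asc_mul_Gamma hg.a_ne]; push_cast; rfl
  have e6 : Complex.Gamma (b - m) = poch b (-m) * Complex.Gamma b := by
    rw [poch_mul_Gamma hg.b_int]; push_cast; rw [← sub_eq_add_neg]
  have r1 : poch (c - a - b) (-m) * asc (a + b - c + 1) m = (-1) ^ m := by
    have := poch_reflect hs1 (m : ℤ)
    rwa [show 1 - (a + b - c + 1) = c - a - b by ring, poch_natCast, zpow_natCast] at this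
  have r2 : poch (c - a - b + 1) (-m) * asc (a + b - c) m = (-1) ^ m := by
    have := poch_reflect hg.abc_int (m : ℤ)
    rwa [show 1 - (a + b - c) = c - a - b + 1 by ring, poch_natCast, zpow_natCast] at this
  have r3 : poch (c - a) (-(2 * m : ℕ)) * asc (a - c + 1) (2 * m) = 1 := by
    have := poch_reflect (hg.ca_int.of_eq_sub 1 (v := a - c + 1) (by push_cast; ring))
      ((2 * m : ℕ) : ℤ)
    rw [show 1 - (a - c + 1) = c - a by ring, poch_natCast, zpow_natCast, pow_mul] at this
    rw [this]; norm_num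
  have r4 : (1 - p.2) ^ (c - a - b - m) = (1 - p.2) ^ (c - a - b) / (1 - p.2) ^ m := by
    rw [Complex.cpow_sub _ _ hu, Complex.cpow_natCast]
  rw [show c - (a + 2 * m) - (b - m) = c - a - b - m by ring,
    show c - (a + 2 * m) = c - a - 2 * m by ring, show c - (b - m) = c - b + m by ring,
    show a + 2 * m + (b - m) + 1 - c = a + b - c + 1 + m by ring,
    show a + 2 * m + (b - m) - c = a + b - c + m by ring,
    show c - a - b - m + 1 = c - a - b + 1 - m by ring, e1, e2, e3, e4, e5, e6, r4] at hconn
  rw [hconn, secondConst]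
  have n1 := asc_ne_zero hg.cb_ne m
  have n2 := asc_ne_zero hs1.ne_neg m
  have n3 := poch_ne_zero h0 (-m)
  have n4 := poch_ne_zero hg.ca_int (-(2 * m : ℕ))
  have n5 := asc_ne_zero hg.a_ne (2 * m)
  have n6 := poch_ne_zero hg.b_int (-m)
  have g1 := Complex.Gamma_ne_zero hg.ca_int.ne_neg
  have g2 := Complex.Gamma_ne_zero hg.cb_ne
  have g3 := Complex.Gamma_ne_zero hg.a_ne
  have g4 := Complex.Gamma_ne_zero hg.b_int.ne_neg
  have n9 : (m.factorial : ℂ) ≠ 0 := by exact_mod_cast m.factorial_ne_zero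
  rw [neg_pow p.1, ← r1, ← div_neg, div_pow, neg_pow (1 - p.2), ← r2,
    eq_inv_of_mul_eq_one_right r3]
  have n7 : asc (a + b - c) m ≠ 0 := asc_ne_zero hg.abc_int.ne_neg m
  have n8 : (1 - p.2) ^ m ≠ 0 := pow_ne_zero _ hu
  have r5 : ((-1 : ℂ) ^ m) * (-1) ^ m = 1 := by rw [← mul_pow]; norm_num
  have r6 : (poch (c - a - b + 1) (-m) * asc (a + b - c) m) ^ 2 = 1 := by rw [r2, sq, r5]
  rw [mul_add]
  congr 1
  · field_simp
  · field_simp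
    linear_combination (p.1 ^ m * Complex.Gamma c * Complex.Gamma (a + b - c) *
      (1 - p.2) ^ (c - a - b) *
      gauss (c - a - 2 * m) (c - b + m) (c - a - b + 1 - m) (1 - p.2)) * r6

lemma hornH5_eq (hg : Generic a b c) {p : ℂ × ℂ} (h0 : p ∈ convSet (hornCoef a b c))
    (h1 : p ∈ regionOfConvergence (firstTerm a b c)) (h2 : p ∈ secondRegion a b c)
    (hy : ‖p.2‖ < 1) (hy' : ‖1 - p.2‖ < 1) :
    hornH5 a b c p = firstSeries a b c p + secondSeries a b c p := by
  have s0 := summable_of_mem_convSet h0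
  have s1 := summable_of_mem_convSet (mem_region_first_iff.1 h1)
  have s2 := summable_of_mem_convSet (mem_secondRegion_iff.1 h2).2
  simp only [← hornH5Term_eq] at s0
  simp only [← firstTerm_eq] at s1
  simp only [← secondTerm_eq] at s2
  have t0 := s0.hasSum.prod_fiberwise (hasSum_hornH5Term_row hg hy)
  have t1 := s1.hasSum.prod_fiberwise (hasSum_firstTerm_row hg hy')
  have t2 := s2.hasSum.prod_fiberwise (hasSum_secondTerm_row hg hy')
  have hu := Complex.slitPlane_ne_zero h2.2
  exact t0.unique (((t1.mul_left _).add (t2.mul_left _)).congr_fun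
    (row_connection hg hy hy' hu))

end

/-! ### The continuation of H₅ -/

noncomputable section
variable {a b c : ℂ}

lemma norm_one_sub_scalePt_le {τ : ℝ} (hτ : 0 < τ) (hτ1 : τ ≤ 1) (p : ℂ × ℂ) :
    ‖1 - (scalePt τ p).2‖ ≤ ‖1 - p.2‖ := by
  rw [one_sub_scalePt, norm_mul, Complex.norm_real, Real.norm_of_nonneg hτ.le]
  exact mul_le_of_le_one_left (norm_nonneg _) hτ1

lemma norm_fst_scalePt_le {τ : ℝ} (hτ : 0 < τ) (hτ1 : τ ≤ 1) (p : ℂ × ℂ) :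
    ‖(scalePt τ p).1‖ ≤ ‖p.1‖ := by
  rw [scalePt, norm_mul, Complex.norm_real, Real.norm_of_nonneg hτ.le]
  exact mul_le_of_le_one_left (norm_nonneg _) hτ1

lemma scalePt_mem_secondRegion {p : ℂ × ℂ} (hp : p ∈ secondRegion a b c) {τ : ℝ} (hτ : 0 < τ)
    (hτ1 : τ ≤ 1) : scalePt τ p ∈ secondRegion a b c := by
  obtain ⟨h1, h2⟩ := mem_secondRegion_iff.1 hp
  refine mem_secondRegion_iff.2 ⟨?_, convSet_mono h2 ?_ (norm_one_sub_scalePt_le hτ hτ1 p)⟩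
  · rw [one_sub_scalePt]; exact smul_mem_slitPlane hτ h1
  · simp only [ratio_scalePt hτ p, le_refl]

lemma scalePt_mem_region_first {p : ℂ × ℂ} (hp : p ∈ regionOfConvergence (firstTerm a b c)) {τ : ℝ}
    (hτ : 0 < τ) (hτ1 : τ ≤ 1) : scalePt τ p ∈ regionOfConvergence (firstTerm a b c) := by
  rw [mem_region_first_iff] at hp ⊢
  refine convSet_mono hp ?_ (norm_one_sub_scalePt_le hτ hτ1 p)
  simpa only [norm_neg] using norm_fst_scalePt_le hτ hτ1 p

lemma scalePt_mem_newRegionCut (hg : Generic a b c) {p : ℂ × ℂ} (hp : p ∈ newRegionCut) {τ : ℝ}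
    (hτ : 0 < τ) (hτ1 : τ ≤ 1) : scalePt τ p ∈ newRegionCut := by
  obtain ⟨h0, h1, h2, h3⟩ := (mem_newRegionCut_iff hg).1 hp
  refine (mem_newRegionCut_iff hg).2 ⟨?_, ?_, ?_, convSet_mono h3 ?_ ?_⟩
  · exact mul_ne_zero (by exact_mod_cast hτ.ne') h0
  · rw [one_sub_scalePt]; exact smul_mem_slitPlane hτ h1
  · rwa [ratio_scalePt hτ]
  · simp only [← inv_div (scalePt τ p).1, ratio_scalePt hτ p, inv_div, le_refl]
  · simpa only [norm_neg] using norm_fst_scalePt_le hτ hτ1 p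

lemma continuation_region_properties (hg : Generic a b c) {p : ℂ × ℂ}
    (hp : p ∈ secondRegion a b c ∪ newRegionCut) :
    1 - p.2 ∈ Complex.slitPlane ∧ p.1 / (1 - p.2) ∈ cutPlane := by
  rcases hp with hp | hp
  · exact ⟨hp.2, mem_cutPlane_of_norm_lt (norm_lt_one_of_mem_secondRegion hg hp)⟩
  · obtain ⟨h0, h1, h2, h3⟩ := (mem_newRegionCut_iff hg).1 hp
    exact ⟨h1, mem_cutPlane_of_neg_slit h2⟩

lemma analyticAt_secondCont_of_mem (hg : Generic a b c) {p : ℂ × ℂ}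
    (hp : p ∈ secondRegion a b c ∪ newRegionCut) : AnalyticAt ℂ (secondCont a b c) p := by
  rcases hp with hp | hp
  · refine (analyticAt_secondSeries hp).congr ?_
    filter_upwards [isOpen_secondRegion.mem_nhds hp] with q hq
    exact (secondCont_eq_secondSeries hg hq).symm
  · refine (analyticAt_newSeries hg hp).congr ?_
    filter_upwards [(isOpen_newRegionCut hg).mem_nhds hp] with q hq
    exact (secondCont_eq_newSeries hg hq).symm

lemma exists_continuation_secondSeries (hg : Generic a b c) :
    ∃ (W : Set (ℂ × ℂ)) (G : ℂ × ℂ → ℂ),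
      IsOpen W ∧ IsConnected W ∧ AnalyticOnNhd ℂ G W ∧ ContainsTubes W ∧
      secondRegion a b c ⊆ W ∧ EqOn G (secondSeries a b c) (secondRegion a b c) ∧
      newRegionCut ⊆ W ∧ EqOn G (newSeries a b c) newRegionCut := by
  obtain ⟨C, hC, hG⟩ := exists_analyticAt_secondCont hg
  refine ⟨(secondRegion a b c ∪ newRegionCut) ∪ tubes C, secondCont a b c,
    (isOpen_secondRegion.union (isOpen_newRegionCut hg)).union (isOpen_tubes C),
    isConnected_union_tubes (by linarith) (fun p hp => continuation_region_properties hg hp)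
      (fun p hp τ h0 h1 => hp.imp (scalePt_mem_secondRegion · h0 h1)
        (scalePt_mem_newRegionCut hg · h0 h1)),
    fun p hp => hp.elim (analyticAt_secondCont_of_mem hg) (hG p),
    containsTubes_of_tubes_subset (by linarith) subset_union_right,
    subset_union_left.trans subset_union_left, fun p hp => secondCont_eq_secondSeries hg hp,
    subset_union_right.trans subset_union_left, fun p hp => secondCont_eq_newSeries hg hp⟩

/-- The part of the domain of the continuation of `H₅` that is near `(0, 1)`. -/
def outerRegion (a b c : ℂ) (C : ℝ) : Set (ℂ × ℂ) :=
  (secondRegion a b c ∪ newRegionCut) ∩ regionOfConvergence (firstTerm a b c) ∪ tubes C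

lemma isOpen_region_first : IsOpen (regionOfConvergence (firstTerm a b c)) := isOpen_interior

lemma isOpen_outerRegion (hg : Generic a b c) (C : ℝ) : IsOpen (outerRegion a b c C) :=
  ((isOpen_secondRegion.union (isOpen_newRegionCut hg)).inter isOpen_region_first).union
    (isOpen_tubes C)

lemma outerRegion_subset_region_first (hg : Generic a b c) {C : ℝ} (hC : 20 ≤ C) :
    outerRegion a b c C ⊆ regionOfConvergence (firstTerm a b c) :=
  union_subset inter_subset_right (tubes_subset_region_first hg hC)

lemma isConnected_outerRegion (hg : Generic a b c) {C : ℝ} (hC : 1 ≤ C) :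
    IsConnected (outerRegion a b c C) :=
  isConnected_union_tubes hC (fun _ hp => continuation_region_properties hg hp.1)
    (fun _ hp _ h0 h1 => ⟨hp.1.imp (scalePt_mem_secondRegion · h0 h1)
        (scalePt_mem_newRegionCut hg · h0 h1), scalePt_mem_region_first hp.2 h0 h1⟩)

lemma ratio_norm_lt_one_of_mem_convSet_hornCoef (hg : Generic a b c) {p : ℂ × ℂ}
    (hp : p ∈ convSet (hornCoef a b c)) : ‖p.1 / (1 - p.2)‖ < 1 := by
  have h := norm_add_norm_lt_one_of_mem_convSet_hornCoef hg hp
  have h1 := norm_sub_norm_le (1 : ℂ) p.2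
  rw [norm_one] at h1
  rw [norm_div, div_lt_one (by linarith [norm_nonneg p.1])]
  linarith

/-- Shrinking the first variable stays in the common region of the two representations. -/
lemma shrink_mem (hg : Generic a b c) {C : ℝ} {p : ℂ × ℂ} (hC : 0 ≤ C)
    (hp : p ∈ convSet (hornCoef a b c) ∩ outerRegion a b c C) {σ : ℝ} (h0 : 0 ≤ σ) (h1 : σ ≤ 1) :
    ((σ * p.1, p.2) : ℂ × ℂ) ∈ convSet (hornCoef a b c) ∩ outerRegion a b c C := by
  obtain ⟨hp1, hp2⟩ := hp
  have hle : ‖(σ : ℂ) * p.1‖ ≤ ‖p.1‖ := by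
    rw [norm_mul, Complex.norm_real, Real.norm_of_nonneg h0]
    exact mul_le_of_le_one_left (norm_nonneg _) h1
  have hz : ‖(σ : ℂ) * p.1 / (1 - p.2)‖ ≤ ‖p.1 / (1 - p.2)‖ := by
    rw [norm_div, norm_div]; gcongr
  refine ⟨convSet_mono hp1 hle le_rfl, ?_⟩
  rcases hp2 with ⟨h2 | h2, h3⟩ | ⟨h2, h3, h4⟩
  · refine Or.inl ⟨Or.inl (mem_secondRegion_iff.2 ⟨h2.2, ?_⟩), ?_⟩
    · exact convSet_mono (mem_secondRegion_iff.1 h2).2 (by simpa only [norm_neg] using hz) le_rfl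
    · rw [mem_region_first_iff] at h3 ⊢
      exact convSet_mono h3 (by simpa only [norm_neg] using hle) le_rfl
  -- This case is empty: x/(1-y) has modulus less than 1 on the region of H₅ and greater than 1 on
  -- Ω.
  · exact absurd (ratio_norm_lt_one_of_mem_convSet_hornCoef hg hp1)
      (one_lt_norm_of_mem_newRegion h2.1).le.not_gt
  · refine Or.inr ⟨h2, ?_, lt_of_le_of_lt ?_ h4⟩
    · refine h3.trans_le ?_
      simp only [mul_div_assoc]
      exact gap_le_gap_mul _ h0 h1
    · simp only; gcongr

/-- On the axis x = 0 the region of H₅ contains the whole disc |y| < 1, which is convex and has 1 on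
its boundary, so one may move from y towards 1. -/
lemma axis_mem {p : ℂ × ℂ} (hg : Generic a b c) {C : ℝ} (hC : 0 ≤ C)
    (hp : p ∈ convSet (hornCoef a b c) ∩ outerRegion a b c C) {τ : ℝ} (h0 : 0 < τ) (h1 : τ ≤ 1) :
    ((0, 1 - τ * (1 - p.2)) : ℂ × ℂ) ∈ convSet (hornCoef a b c) ∩ outerRegion a b c C := by
  have hp' := shrink_mem hg hC hp (σ := 0) le_rfl zero_le_one
  simp only [Complex.ofReal_zero, zero_mul] at hp'
  have hy := norm_add_norm_lt_one_of_mem_convSet_hornCoef hg hp'.1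
  rw [norm_zero, zero_add] at hy
  have he : scalePt τ (0, p.2) = (0, 1 - τ * (1 - p.2)) := by simp [scalePt]
  refine ⟨mem_convSet_hornCoef hg ?_, ?_⟩
  · calc ‖1 - τ * (1 - p.2)‖ = ‖((1 - τ : ℝ) : ℂ) + (τ : ℂ) * p.2‖ := by
          congr 1; push_cast; ring
      _ ≤ (1 - τ) + τ * ‖p.2‖ := by
          refine (norm_add_le _ _).trans (le_of_eq ?_)
          rw [norm_mul, Complex.norm_real, Complex.norm_real, Real.norm_of_nonneg h0.le,
            Real.norm_of_nonneg (by linarith)]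
      _ < 1 := by simp only at hy; nlinarith
  · rw [← he]
    rcases hp'.2 with ⟨h2, h3⟩ | ⟨h2, h3, h4⟩
    · exact Or.inl ⟨h2.imp (scalePt_mem_secondRegion · h0 h1)
        (scalePt_mem_newRegionCut hg · h0 h1), scalePt_mem_region_first h3 h0 h1⟩
    · have h5 : τ * ‖1 - p.2‖ ≤ ‖1 - p.2‖ := mul_le_of_le_one_left (norm_nonneg _) h1
      exact Or.inr (scalePt_mem_tubes h2 h0 (lt_of_le_of_lt (by gcongr) h3)
        (lt_of_le_of_lt (by gcongr) h4))

/-- On the common region the two representations agree. -/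
lemma hornH5_eq_of_mem (hg : Generic a b c) {C : ℝ} (hC : 20 ≤ C)
    (hG : ∀ p ∈ tubes C, AnalyticAt ℂ (secondCont a b c) p) {p : ℂ × ℂ}
    (hp : p ∈ convSet (hornCoef a b c) ∩ outerRegion a b c C) :
    hornH5 a b c p = firstSeries a b c p + secondCont a b c p := by
  set S := convSet (hornCoef a b c) ∩ outerRegion a b c C with hS
  have hSo : IsOpen S := (isOpen_convSet _).inter (isOpen_outerRegion hg C)
  have hC0 : 0 ≤ C := by linarith
  have hF : AnalyticOnNhd ℂ (hornH5 a b c) S := fun q hq => analyticAt_hornH5 hq.1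
  have hK : AnalyticOnNhd ℂ (fun q => firstSeries a b c q + secondCont a b c q) S := fun q hq =>
    (analyticAt_firstSeries (outerRegion_subset_region_first hg hC hq.2)).add
      (hq.2.elim (fun h => analyticAt_secondCont_of_mem hg h.1) (hG q))
  have hu0 : 1 - p.2 ≠ 0 := by
    have h := norm_add_norm_lt_one_of_mem_convSet_hornCoef hg hp.1
    rintro h'
    rw [← sub_eq_zero.1 h', norm_one] at h
    linarith [norm_nonneg p.1]
  have hun : 0 < ‖1 - p.2‖ := norm_pos_iff.2 hu0
  obtain ⟨τ, hτ, hτ1, hτ2⟩ : ∃ τ : ℝ, 0 < τ ∧ τ ≤ 1 ∧ τ * ‖1 - p.2‖ < 1 / 64 := by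
    refine ⟨min 1 (1 / (128 * ‖1 - p.2‖)), by positivity, min_le_left _ _, ?_⟩
    calc _ ≤ 1 / (128 * ‖1 - p.2‖) * ‖1 - p.2‖ := by gcongr; exact min_le_right _ _
      _ = 1 / 128 := by field_simp
      _ < _ := by norm_num
  -- Every point gets its own base point on the axis x = 0, so close to (0, 1) that S₂ converges
  -- near it, together with a path to it inside the common region. The common region itself need not
  -- be shown connected.
  set e : ℂ × ℂ := (0, 1 - τ * (1 - p.2)) with he
  have heS : e ∈ S := axis_mem hg hC0 hp hτ hτ1
  have hj : JoinedIn S p e := by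
    have j1 := joinedIn_of_path (S := S) (f := fun s : ℝ => (((1 - s : ℝ) : ℂ) * p.1, p.2))
      (by fun_prop) (fun s hs => shrink_mem hg hC0 hp (by linarith [hs.2]) (by linarith [hs.1]))
    have j2 := joinedIn_of_path (S := S)
      (f := fun s : ℝ => ((0 : ℂ), 1 - ((1 - s * (1 - τ) : ℝ) : ℂ) * (1 - p.2)))
      (by fun_prop) (fun s hs => axis_mem hg hC0 hp (by nlinarith [hs.1, hs.2])
        (by nlinarith [hs.1, hs.2]))
    simp only [sub_zero, Complex.ofReal_one, one_mul, sub_self, Complex.ofReal_zero, zero_mul,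
      sub_sub_cancel, Prod.mk.eta] at j1 j2
    exact j1.trans j2
  have hne : ‖1 - e.2‖ < 1 / 64 := by
    rw [he]
    simp only [sub_sub_cancel]
    rwa [norm_mul, Complex.norm_real, Real.norm_of_nonneg hτ.le]
  have hslit : 1 - e.2 ∈ Complex.slitPlane := by
    rcases heS.2 with h | h
    · exact (continuation_region_properties hg h.1).1
    · exact h.1
  have he2 : e ∈ secondRegion a b c := by
    refine mem_secondRegion_iff.2 ⟨hslit, mem_convSet_secondCoef_of_small hg ?_ hne⟩
    rw [he]; simp
  have hey : ‖e.2‖ < 1 := by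
    simpa [he] using norm_add_norm_lt_one_of_mem_convSet_hornCoef hg heS.1
  have hloc : hornH5 a b c =ᶠ[𝓝 e] fun q => firstSeries a b c q + secondCont a b c q := by
    have c1 : ContinuousAt (fun q : ℂ × ℂ => ‖q.2‖) e := by fun_prop
    have c2 : ContinuousAt (fun q : ℂ × ℂ => ‖1 - q.2‖) e := by fun_prop
    filter_upwards [hSo.mem_nhds heS, isOpen_secondRegion.mem_nhds he2,
      c1.eventually (gt_mem_nhds hey), c2.eventually (gt_mem_nhds (hne.trans (by norm_num : (1 / 64 : ℝ) < 1)))]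
      with q q1 q2 q3 q4
    rw [hornH5_eq hg q1.1 (outerRegion_subset_region_first hg hC q1.2) q2 q3 q4,
      secondCont_eq_secondSeries hg q2]
  obtain ⟨γ, hγ⟩ := hj
  have hpre : IsPreconnected (range γ) := isPreconnected_range γ.continuous
  have hsub : range γ ⊆ S := by rintro _ ⟨t, rfl⟩; exact hγ t
  -- Identity theorem on the image of the path, a preconnected set on which both sides are analytic.
  exact (hF.mono hsub).eqOn_of_preconnected_of_eventuallyEq (hK.mono hsub) hpre
    ⟨1, γ.target⟩ hloc ⟨0, γ.source⟩

open Classical in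
/-- The continuation of `H₅`. -/
def hornCont (a b c : ℂ) (p : ℂ × ℂ) : ℂ :=
  if p ∈ convSet (hornCoef a b c) then hornH5 a b c p else firstSeries a b c p + secondCont a b c p

lemma hornCont_eq_hornH5 {p : ℂ × ℂ} (hp : p ∈ convSet (hornCoef a b c)) :
    hornCont a b c p = hornH5 a b c p := if_pos hp

lemma hornCont_eq_of_mem_outer (hg : Generic a b c) {C : ℝ} (hC : 20 ≤ C)
    (hG : ∀ p ∈ tubes C, AnalyticAt ℂ (secondCont a b c) p) {p : ℂ × ℂ}
    (hp : p ∈ outerRegion a b c C) :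
    hornCont a b c p = firstSeries a b c p + secondCont a b c p := by
  by_cases h : p ∈ convSet (hornCoef a b c)
  · rw [hornCont_eq_hornH5 h, hornH5_eq_of_mem hg hC hG ⟨h, hp⟩]
  · exact if_neg h

/-- The region of H₅ is star-shaped about 0, the outer part is connected, and they share the point
(0, 1 - 1/(2C)). -/
lemma isConnected_convSet_union (hg : Generic a b c) {C : ℝ} (hC : 20 ≤ C) :
    IsConnected (convSet (hornCoef a b c) ∪ outerRegion a b c C) := by
  have h0 : IsConnected (convSet (hornCoef a b c)) := by
    refine IsPathConnected.isConnected ⟨0, ?_, fun {p} hp => ?_⟩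
    · exact mem_convSet_hornCoef hg (y := 0) (by simp)
    · have := joinedIn_of_path (S := convSet (hornCoef a b c)) (f := fun s : ℝ => (s : ℂ) • p)
        (by fun_prop) (fun s hs => convSet_mono hp ?_ ?_)
      · simpa using this
      all_goals
        simp only [Prod.smul_fst, Prod.smul_snd, norm_smul, Complex.norm_real,
          Real.norm_of_nonneg hs.1]
        exact mul_le_of_le_one_left (norm_nonneg _) hs.2
  refine IsConnected.union ?_ h0 (isConnected_outerRegion hg (by linarith))
  have hC0 : 0 < C := by linarith
  have hn : ‖((1 / (2 * C) : ℝ) : ℂ)‖ = 1 / (2 * C) := by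
    rw [Complex.norm_real, Real.norm_of_nonneg (by positivity)]
  have hsm : 1 / (2 * C) < 1 := by rw [div_lt_one (by positivity)]; linarith
  refine ⟨(0, 1 - ((1 / (2 * C) : ℝ) : ℂ)), mem_convSet_hornCoef hg ?_, Or.inr ⟨?_, ?_, ?_⟩⟩
  · rw [show (1 : ℂ) - ((1 / (2 * C) : ℝ) : ℂ) = ((1 - 1 / (2 * C) : ℝ) : ℂ) by push_cast; rfl,
      Complex.norm_real, Real.norm_of_nonneg (by linarith)]
    have : 0 < 1 / (2 * C) := by positivity
    linarith
  · simp only [sub_sub_cancel]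
    exact Complex.ofReal_mem_slitPlane.2 (by positivity)
  · simp only [sub_sub_cancel, zero_div, hn]
    have : C * (1 / (2 * C)) = 1 / 2 := by field_simp
    rw [this]; unfold gap; norm_num
  · simp only [sub_sub_cancel, zero_div, hn, norm_zero]
    have : C * (1 / (2 * C)) = 1 / 2 := by field_simp
    rw [this]; norm_num

lemma exists_analyticOnNhd_hornCont (hg : Generic a b c) : ∃ C ≥ 20,
    AnalyticOnNhd ℂ (hornCont a b c) (convSet (hornCoef a b c) ∪ outerRegion a b c C) ∧
    ∀ p ∈ outerRegion a b c C,
      hornCont a b c p = firstSeries a b c p + secondCont a b c p := by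
  obtain ⟨C, hC, hG⟩ := exists_analyticAt_secondCont hg
  have key := fun p hp => hornCont_eq_of_mem_outer hg hC hG (p := p) hp
  refine ⟨C, hC, fun p hp => ?_, key⟩
  rcases hp with hp | hp
  · refine (analyticAt_hornH5 hp).congr ?_
    filter_upwards [(isOpen_convSet _).mem_nhds hp] with q hq
    exact (hornCont_eq_hornH5 hq).symm
  · refine ((analyticAt_firstSeries (outerRegion_subset_region_first hg hC hp)).add
      (hp.elim (fun h => analyticAt_secondCont_of_mem hg h.1) (hG p))).congr ?_
    filter_upwards [(isOpen_outerRegion hg C).mem_nhds hp] with q hq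
    exact (key q hq).symm

lemma newRegionCut_subset_outerRegion (hg : Generic a b c) (C : ℝ) :
    newRegionCut ⊆ outerRegion a b c C :=
  fun _ hp => Or.inl ⟨Or.inr hp, newRegion_subset_region_first hg hp.1⟩

lemma exists_continuation_hornH5 (hg : Generic a b c) :
    ∃ (U : Set (ℂ × ℂ)) (F : ℂ × ℂ → ℂ),
      IsOpen U ∧ IsConnected U ∧ AnalyticOnNhd ℂ F U ∧ ContainsTubes U ∧
      (0, 0) ∈ regionOfConvergence (hornH5Term a b c) ∧
      regionOfConvergence (hornH5Term a b c) ⊆ U ∧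
      EqOn F (hornH5 a b c) (regionOfConvergence (hornH5Term a b c)) ∧
      firstContinuationRegion a b c ⊆ U ∧
      EqOn F (fun p => firstSeries a b c p + secondSeries a b c p)
        (firstContinuationRegion a b c) ∧
      newRegionCut ⊆ U ∧
      EqOn F (fun p => firstSeries a b c p + newSeries a b c p) newRegionCut := by
  obtain ⟨C, hC, hF, hV⟩ := exists_analyticOnNhd_hornCont hg
  have h1 : firstContinuationRegion a b c ⊆ outerRegion a b c C :=
    fun p hp => Or.inl ⟨Or.inl hp.2, hp.1⟩
  have h2 := newRegionCut_subset_outerRegion hg C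
  rw [regionOfConvergence_hornH5Term]
  refine ⟨_, hornCont a b c, (isOpen_convSet _).union (isOpen_outerRegion hg C),
    isConnected_convSet_union hg hC, hF, containsTubes_of_tubes_subset (by linarith)
      (subset_union_right.trans subset_union_right), mem_convSet_hornCoef hg (by simp),
    subset_union_left, fun p hp => hornCont_eq_hornH5 hp, h1.trans subset_union_right,
    fun p hp => ?_, h2.trans subset_union_right, fun p hp => ?_⟩
  · rw [hV p (h1 hp), secondCont_eq_secondSeries hg hp.2]
  · rw [hV p (h2 hp), secondCont_eq_newSeries hg hp]

end

/-! ### Other determinations of the powers; position of Ω near (0, 1) -/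

noncomputable section
variable {a b c : ℂ}

lemma ContinuesTo.congr {p q : ℂ × ℂ} {g g' h h' : ℂ × ℂ → ℂ} (H : ContinuesTo p q g h)
    (hg : g =ᶠ[𝓝 p] g') (hh : h =ᶠ[𝓝 q] h') : ContinuesTo p q g' h' := by
  obtain ⟨γ, f, h0, h1, h2⟩ := H
  exact ⟨γ, f, h0.trans hg, h1.trans hh, h2⟩

lemma continuesTo_of_analyticOnNhd {U : Set (ℂ × ℂ)} {F : ℂ × ℂ → ℂ} (hU : IsOpen U)
    (hUc : IsConnected U) (hF : AnalyticOnNhd ℂ F U) {p q : ℂ × ℂ} (hp : p ∈ U) (hq : q ∈ U) :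
    ContinuesTo p q F F := by
  obtain ⟨γ, hγ⟩ := (hU.isConnected_iff_isPathConnected.1 hUc).joinedIn p hp q hq
  exact ⟨γ, fun _ => F, .rfl, .rfl, fun t => hF _ (hγ t), fun t => .of_forall fun s => .rfl⟩

/-- The two families are run at double speed, with the parameters clamped to the unit interval.
Local compatibility needs thought only at time 1/2, where the germs `f₁ 1` and `f₂ 0` agree near q.
-/
lemma ContinuesTo.trans {p q r : ℂ × ℂ} {g h k : ℂ × ℂ → ℂ} (H₁ : ContinuesTo p q g h)
    (H₂ : ContinuesTo q r h k) : ContinuesTo p r g k := by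
  obtain ⟨γ₁, f₁, a0, a1, a2, a3⟩ := H₁
  obtain ⟨γ₂, f₂, b0, b1, b2, b3⟩ := H₂
  set φ₁ : unitInterval → unitInterval := fun t => projIcc 0 1 zero_le_one (2 * (t : ℝ)) with hφ₁
  set φ₂ : unitInterval → unitInterval := fun t => projIcc 0 1 zero_le_one (2 * (t : ℝ) - 1)
    with hφ₂
  have c₁ : Continuous φ₁ := continuous_projIcc.comp (by fun_prop)
  have c₂ : Continuous φ₂ := continuous_projIcc.comp (by fun_prop)
  have e₁ : ∀ t : unitInterval, (t : ℝ) ≤ 1 / 2 → (γ₁.trans γ₂) t = γ₁ (φ₁ t) := fun t ht => by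
    rw [Path.trans_apply, dif_pos ht, hφ₁]
    simp only
    rw [projIcc_of_mem]
  have e₂ : ∀ t : unitInterval, 1 / 2 ≤ (t : ℝ) → (γ₁.trans γ₂) t = γ₂ (φ₂ t) := fun t ht => by
    rcases eq_or_lt_of_le ht with h' | h'
    · have h3 : φ₁ t = 1 := by
        rw [hφ₁]; simp only; rw [← h']; norm_num
      have h4 : φ₂ t = 0 := by
        rw [hφ₂]; simp only; rw [← h']; norm_num
      rw [e₁ t h'.ge, h3, h4, γ₁.target, γ₂.source]
    · rw [Path.trans_apply, dif_neg h'.not_ge, hφ₂]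
      simp only
      rw [projIcc_of_mem]
  have n₁ : ∀ t, ∀ᶠ s in 𝓝 t, f₁ (φ₁ s) =ᶠ[𝓝 (γ₁ (φ₁ s))] f₁ (φ₁ t) := fun t =>
    c₁.continuousAt.eventually (a3 (φ₁ t))
  have n₂ : ∀ t, ∀ᶠ s in 𝓝 t, f₂ (φ₂ s) =ᶠ[𝓝 (γ₂ (φ₂ s))] f₂ (φ₂ t) := fun t =>
    c₂.continuousAt.eventually (b3 (φ₂ t))
  have cc : Continuous fun t : unitInterval => (t : ℝ) := continuous_subtype_val
  refine ⟨γ₁.trans γ₂, fun t => if (t : ℝ) ≤ 1 / 2 then f₁ (φ₁ t) else f₂ (φ₂ t), ?_, ?_,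
    fun t => ?_, fun t => ?_⟩
  · have : φ₁ 0 = 0 := by rw [hφ₁]; simp
    simpa [this] using a0
  · have : φ₂ 1 = 1 := by
      rw [hφ₂]; simp only [Icc.coe_one]; norm_num
    have h2 : ¬ (((1 : unitInterval) : ℝ) ≤ 1 / 2) := by norm_num
    simp only [if_neg h2, this]
    exact b1
  · simp only
    split_ifs with h'
    · rw [e₁ t h']; exact a2 _
    · rw [e₂ t (not_le.1 h').le]; exact b2 _
  · rcases lt_trichotomy (t : ℝ) (1 / 2) with ht | ht | ht
    · filter_upwards [n₁ t, cc.continuousAt.eventually (gt_mem_nhds ht)] with s s1 s2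
      simp only [if_pos ht.le, if_pos s2.le, e₁ s s2.le]
      exact s1
    · have h3 : φ₁ t = 1 := by
        rw [hφ₁]; simp only; rw [ht]; norm_num
      have h4 : φ₂ t = 0 := by
        rw [hφ₂]; simp only; rw [ht]; norm_num
      have h5 : (γ₁.trans γ₂) t = q := by rw [e₁ t ht.le, h3, γ₁.target]
      have h6 : f₂ 0 =ᶠ[𝓝 ((γ₁.trans γ₂) t)] f₁ 1 := by rw [h5]; exact b0.trans a1.symm
      have h7 := (γ₁.trans γ₂).continuous.continuousAt.eventually
        (eventually_eventually_nhds.2 h6)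
      filter_upwards [n₁ t, n₂ t, h7] with s s1 s2 s3
      simp only [if_pos ht.le]
      split_ifs with h'
      · rw [e₁ s h']; exact s1
      · have h8 := e₂ s (not_le.1 h').le
        rw [h3]
        rw [h4, ← h8] at s2
        exact s2.trans s3
    · filter_upwards [n₂ t, cc.continuousAt.eventually (lt_mem_nhds ht)] with s s1 s2
      simp only [if_neg ht.not_ge, if_neg s2.not_ge, e₂ s s2.le]
      exact s1

/-- The logarithm of `v` that is equal to `l` where `v = exp l`. -/
def logNear (l : ℂ) (v : ℂ × ℂ → ℂ) (q : ℂ × ℂ) : ℂ := l + Complex.log (v q / Complex.exp l)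

lemma exp_mem_slitPlane_of_abs_im_lt {w : ℂ} (hw : |w.im| < Real.pi) :
    Complex.exp w ∈ Complex.slitPlane := by
  rw [Complex.mem_slitPlane_iff_arg]
  obtain ⟨h1, h2⟩ := abs_lt.1 hw
  refine ⟨?_, Complex.exp_ne_zero w⟩
  rw [← Complex.log_im, Complex.log_exp h1 h2.le]
  exact h2.ne

lemma logNear_eventuallyEq {l : ℂ} {v g : ℂ × ℂ → ℂ} {q : ℂ × ℂ} (hg : ContinuousAt g q)
    (h : ∀ᶠ z in 𝓝 q, Complex.exp (g z) = v z) (hq : |(g q - l).im| < Real.pi) :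
    logNear l v =ᶠ[𝓝 q] g := by
  have h1 : ContinuousAt (fun z => |(g z - l).im|) q :=
    (Complex.continuous_im.continuousAt.comp (hg.sub continuousAt_const)).abs
  filter_upwards [h, h1.eventually (gt_mem_nhds hq)] with z z1 z2
  obtain ⟨h3, h4⟩ := abs_lt.1 z2
  rw [logNear, ← z1, ← Complex.exp_sub, Complex.log_exp h3 h4.le]
  ring

section
variable {l m : ℂ} {v : ℂ × ℂ → ℂ} {q : ℂ × ℂ}

lemma logNear_apply (h : v q = Complex.exp m) (hm : |(m - l).im| < Real.pi) :
    logNear l v q = m := by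
  obtain ⟨h3, h4⟩ := abs_lt.1 hm
  rw [logNear, h, ← Complex.exp_sub, Complex.log_exp h3 h4.le]
  ring

lemma analyticAt_logNear (hv : AnalyticAt ℂ v q) (h : v q = Complex.exp m)
    (hm : |(m - l).im| < Real.pi) : AnalyticAt ℂ (logNear l v) q := by
  refine analyticAt_const.add ((hv.div analyticAt_const (Complex.exp_ne_zero l)).clog ?_)
  change v q / Complex.exp l ∈ _
  rw [h, ← Complex.exp_sub]
  exact exp_mem_slitPlane_of_abs_im_lt hm

lemma exp_logNear (hv : v q ≠ 0) : Complex.exp (logNear l v q) = v q := by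
  rw [logNear, Complex.exp_add, Complex.exp_log (div_ne_zero hv (Complex.exp_ne_zero l)),
    mul_div_cancel₀ _ (Complex.exp_ne_zero l)]

lemma logNear_eventuallyEq_logNear (hv : AnalyticAt ℂ v q) (h : v q = Complex.exp m)
    (hm : |(m - l).im| < Real.pi) : logNear m v =ᶠ[𝓝 q] logNear l v := by
  refine logNear_eventuallyEq (analyticAt_logNear hv h hm).continuousAt ?_ ?_
  · have : v q ≠ 0 := h ▸ Complex.exp_ne_zero m
    filter_upwards [hv.continuousAt.eventually_ne this] with z hz using exp_logNear hz
  · rw [logNear_apply h hm]; simp [Real.pi_pos]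

end

/-- The number with the same real part as `l` and `t` times its imaginary part. -/
def turn (t : ℝ) (l : ℂ) : ℂ := (l.re : ℂ) + t * l.im * Complex.I

lemma turn_one (l : ℂ) : turn 1 l = l := by simp [turn]

lemma turn_zero (l : ℂ) : turn 0 l = l.re := by simp [turn]

lemma norm_exp_turn (t : ℝ) (l : ℂ) : ‖Complex.exp (turn t l)‖ = ‖Complex.exp l‖ := by
  simp [Complex.norm_exp, turn]

lemma continuous_turn (l : ℂ) : Continuous fun t => turn t l := by unfold turn; fun_prop

/-- The point at which `1 - y` and `x / (y - 1)` have the logarithms `l₁` and `l₂`. -/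
def pointOfLogs (l₁ l₂ : ℂ) : ℂ × ℂ :=
  (-(Complex.exp l₁ * Complex.exp l₂), 1 - Complex.exp l₁)

section
variable (l₁ l₂ : ℂ)

lemma one_sub_pointOfLogs : 1 - (pointOfLogs l₁ l₂).2 = Complex.exp l₁ := by simp [pointOfLogs]

lemma ratio_pointOfLogs :
    (pointOfLogs l₁ l₂).1 / ((pointOfLogs l₁ l₂).2 - 1) = Complex.exp l₂ := by
  rw [← neg_sub, one_sub_pointOfLogs, pointOfLogs, neg_div_neg_eq,
    mul_div_cancel_left₀ _ (Complex.exp_ne_zero l₁)]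

end

lemma pointOfLogs_eq {p : ℂ × ℂ} {l₁ l₂ : ℂ} (h₁ : Complex.exp l₁ = 1 - p.2)
    (h₂ : Complex.exp l₂ = p.1 / (p.2 - 1)) : pointOfLogs l₁ l₂ = p := by
  have h : 1 - p.2 ≠ 0 := h₁ ▸ Complex.exp_ne_zero l₁
  have h' : p.2 - 1 ≠ 0 := by rwa [← neg_sub, neg_ne_zero]
  rw [pointOfLogs, h₁, h₂]
  ext
  · simp only; field_simp; ring
  · simp

/-- Changing the imaginary parts of the logarithms changes neither modulus that enters the
description of Ω. -/
lemma pointOfLogs_turn_mem (hg : Generic a b c) {l₁ l₂ : ℂ} (hp : pointOfLogs l₁ l₂ ∈ newRegion)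
    (t : ℝ) : pointOfLogs (turn t l₁) (turn t l₂) ∈ newRegion := by
  obtain ⟨h1, h2, h3⟩ := (mem_newRegion_iff_convSet hg).1 hp
  refine (mem_newRegion_iff_convSet hg).2 ⟨?_, ?_, convSet_mono h3 (le_of_eq ?_) (le_of_eq ?_)⟩
  · simp [pointOfLogs, Complex.exp_ne_zero]
  · simp [pointOfLogs, Complex.exp_ne_zero]
  · simp [pointOfLogs, norm_exp_turn]
  · simp [pointOfLogs, norm_exp_turn]

lemma newSeriesBranch_congr {q : ℂ × ℂ} {l₁ l₂ m₁ m₂ : ℂ × ℂ → ℂ} (h₁ : l₁ q = m₁ q)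
    (h₂ : l₂ q = m₂ q) : newSeriesBranch a b c l₁ l₂ q = newSeriesBranch a b c m₁ m₂ q := by
  rw [newSeriesBranch, newSeriesBranch, h₁, h₂]

lemma analyticAt_newSeriesBranch (hg : Generic a b c) {q : ℂ × ℂ} (hq : q ∈ newRegion)
    {l₁ l₂ : ℂ × ℂ → ℂ} (h₁ : AnalyticAt ℂ l₁ q) (h₂ : AnalyticAt ℂ l₂ q) :
    AnalyticAt ℂ (newSeriesBranch a b c l₁ l₂) q := by
  obtain ⟨h0, -, h3⟩ := (mem_newRegion_iff_convSet hg).1 hq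
  exact (((analyticAt_const.mul h₁).cexp.mul (analyticAt_const.mul h₂).cexp).mul
    analyticAt_const).mul (analyticAt_newSum h0 h3)

lemma analyticAt_ratio' {p : ℂ × ℂ} (hp : p.2 ≠ 1) :
    AnalyticAt ℂ (fun q : ℂ × ℂ => q.1 / (q.2 - 1)) p :=
  analyticAt_fst.div (analyticAt_snd.sub analyticAt_const) (sub_ne_zero.2 hp)

lemma eventually_abs_im_turn_sub_lt (l : ℂ) (t : unitInterval) :
    ∀ᶠ s : unitInterval in 𝓝 t, |(turn s l - turn t l).im| < Real.pi := by
  have h : Continuous fun s : unitInterval => |(turn s l - turn t l).im| :=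
    (Complex.continuous_im.comp (((continuous_turn l).comp continuous_subtype_val).sub
      continuous_const)).abs
  exact h.continuousAt.eventually (gt_mem_nhds (by simp [Real.pi_pos]))

/-- The imaginary parts of both logarithms are multiplied by t. At t = 1 this is the given branch at
p, and at t = 0 both 1-y and x/(y-1) are positive, so the powers are principal. In between the
branch is followed by `logNear`, which is analytic as long as the imaginary part varies by less than
π. -/
lemma continuesTo_of_logs (hg : Generic a b c) {p : ℂ × ℂ} (hp : p ∈ newRegion)
    {l₁ l₂ : ℂ × ℂ → ℂ} (h₁ : AnalyticAt ℂ l₁ p) (h₂ : AnalyticAt ℂ l₂ p)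
    (hl : ∀ᶠ q in 𝓝 p, Complex.exp (l₁ q) = 1 - q.2 ∧ Complex.exp (l₂ q) = q.1 / (q.2 - 1)) :
    ∃ p₀ ∈ newRegionCut, ContinuesTo p₀ p (fun q => firstSeries a b c q + newSeries a b c q)
      (fun q => firstSeries a b c q + newSeriesBranch a b c l₁ l₂ q) := by
  have hp' : pointOfLogs (l₁ p) (l₂ p) = p := pointOfLogs_eq hl.self_of_nhds.1 hl.self_of_nhds.2
  set P : ℝ → ℂ × ℂ := fun t => pointOfLogs (turn t (l₁ p)) (turn t (l₂ p)) with hP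
  have hPmem : ∀ t, P t ∈ newRegion := pointOfLogs_turn_mem hg (hp'.symm ▸ hp)
  have hPc : Continuous P := by
    have := continuous_turn (l₁ p)
    have := continuous_turn (l₂ p)
    simp only [hP, pointOfLogs]
    fun_prop
  have hP1 : P 1 = p := by simp only [hP, turn_one, hp']
  have w₁ : ∀ t, 1 - (P t).2 = Complex.exp (turn t (l₁ p)) := fun t => one_sub_pointOfLogs _ _
  have w₂ : ∀ t, (P t).1 / ((P t).2 - 1) = Complex.exp (turn t (l₂ p)) := fun t =>
    ratio_pointOfLogs _ _
  have v₁ : ∀ t, AnalyticAt ℂ (fun q : ℂ × ℂ => 1 - q.2) (P t) := fun t => analyticAt_one_sub_snd _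
  have v₂ : ∀ t, AnalyticAt ℂ (fun q : ℂ × ℂ => q.1 / (q.2 - 1)) (P t) := fun t =>
    analyticAt_ratio' (mem_newRegion_iff.1 (hPmem t)).2.1
  have h0 : P 0 ∈ newRegionCut := by
    refine ⟨hPmem 0, ?_, ?_⟩
    · rw [w₁, turn_zero]; exact exp_mem_slitPlane_of_abs_im_lt (by simp [Real.pi_pos])
    · rw [w₂, turn_zero]; exact exp_mem_slitPlane_of_abs_im_lt (by simp [Real.pi_pos])
  refine ⟨P 0, h0, ⟨⟨⟨fun t : unitInterval => P t, hPc.comp continuous_subtype_val⟩, by simp, ?_⟩,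
    fun t q => firstSeries a b c q + newSeriesBranch a b c
      (logNear (turn t (l₁ p)) fun q => 1 - q.2)
      (logNear (turn t (l₂ p)) fun q => q.1 / (q.2 - 1)) q, ?_, ?_, fun t => ?_, fun t => ?_⟩⟩
  · simp [hP1]
  · have hz : ∀ l : ℂ, Complex.log (Complex.exp (turn 0 l)) = turn 0 l := fun l => by
      rw [Complex.log_exp] <;> simp [turn_zero, Real.pi_pos, Real.pi_pos.le]
    have e₁ := logNear_eventuallyEq (l := turn 0 (l₁ p)) (v := fun q => 1 - q.2)
      (g := fun q => Complex.log (1 - q.2)) (q := P 0) ((v₁ 0).clog h0.2.1).continuousAt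
      (by
        filter_upwards [(v₁ 0).continuousAt.eventually_ne (Complex.slitPlane_ne_zero h0.2.1)]
          with z hz using Complex.exp_log hz)
      (by rw [w₁, hz]; simp [Real.pi_pos])
    have e₂ := logNear_eventuallyEq (l := turn 0 (l₂ p)) (v := fun q => q.1 / (q.2 - 1))
      (g := fun q => Complex.log (q.1 / (q.2 - 1))) (q := P 0) ((v₂ 0).clog h0.2.2).continuousAt
      (by
        filter_upwards [(v₂ 0).continuousAt.eventually_ne (Complex.slitPlane_ne_zero h0.2.2)]
          with z hz using Complex.exp_log hz)
      (by rw [w₂, hz]; simp [Real.pi_pos])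
    filter_upwards [e₁, e₂, (v₁ 0).continuousAt.eventually_ne (Complex.slitPlane_ne_zero h0.2.1),
      (v₂ 0).continuousAt.eventually_ne (Complex.slitPlane_ne_zero h0.2.2)] with q q1 q2 q3 q4
    simp only [Icc.coe_zero]
    rw [newSeriesBranch, newSeries, q1, q2, Complex.cpow_def_of_ne_zero q3,
      Complex.cpow_def_of_ne_zero q4, mul_comm (c - a - b), mul_comm (c - a - b)]
  · have e₁ := logNear_eventuallyEq (l := l₁ p) (v := fun q => 1 - q.2) h₁.continuousAt
      (hl.mono fun _ h => h.1) (by simp [Real.pi_pos])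
    have e₂ := logNear_eventuallyEq (l := l₂ p) (v := fun q => q.1 / (q.2 - 1)) h₂.continuousAt
      (hl.mono fun _ h => h.2) (by simp [Real.pi_pos])
    filter_upwards [e₁, e₂] with q q1 q2
    simp only [Icc.coe_one, turn_one]
    rw [newSeriesBranch_congr q1 q2]
  · exact (analyticAt_firstSeries (newRegion_subset_region_first hg (hPmem t))).add
      (analyticAt_newSeriesBranch hg (hPmem t)
        (analyticAt_logNear (v₁ t) (w₁ t) (by simp [Real.pi_pos]))
        (analyticAt_logNear (v₂ t) (w₂ t) (by simp [Real.pi_pos])))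
  · filter_upwards [eventually_abs_im_turn_sub_lt (l₁ p) t, eventually_abs_im_turn_sub_lt (l₂ p) t]
      with s s1 s2
    filter_upwards [logNear_eventuallyEq_logNear (v₁ s) (w₁ s) s1,
      logNear_eventuallyEq_logNear (v₂ s) (w₂ s) s2] with q q1 q2
    rw [newSeriesBranch_congr q1 q2]

lemma continuesTo_newSeriesBranch (hg : Generic a b c) {p : ℂ × ℂ} (hp : p ∈ newRegion)
    {l₁ l₂ : ℂ × ℂ → ℂ} (h₁ : AnalyticAt ℂ l₁ p) (h₂ : AnalyticAt ℂ l₂ p)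
    (hl : ∀ᶠ q in 𝓝 p, Complex.exp (l₁ q) = 1 - q.2 ∧ Complex.exp (l₂ q) = q.1 / (q.2 - 1)) :
    ContinuesTo (0, 0) p (hornH5 a b c)
      (fun q => firstSeries a b c q + newSeriesBranch a b c l₁ l₂ q) := by
  obtain ⟨p₀, hp₀, H⟩ := continuesTo_of_logs hg hp h₁ h₂ hl
  obtain ⟨U, F, hU, hUc, hF, -, z1, z2, z3, -, -, z4, z5⟩ := exists_continuation_hornH5 hg
  refine ((continuesTo_of_analyticOnNhd hU hUc hF (z2 z1) (z4 hp₀)).congr ?_ ?_).trans H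
  · exact z3.eventuallyEq_of_mem (isOpen_interior.mem_nhds z1)
  · exact z5.eventuallyEq_of_mem ((isOpen_newRegionCut hg).mem_nhds hp₀)

lemma mem_closure_newRegionCut : ((0, 1) : ℂ × ℂ) ∈ closure newRegionCut := by
  rw [Metric.mem_closure_iff]
  intro ε hε
  obtain ⟨δ, hδ, hδε, hδ1⟩ : ∃ δ : ℝ, 0 < δ ∧ 2 * δ < ε ∧ δ ≤ 1 / 64 :=
    ⟨min (ε / 3) (1 / 64), by positivity, by linarith [min_le_left (ε / 3) (1 / 64)],
      min_le_right _ _⟩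
  have hδ' : (δ : ℂ) ≠ 0 := by exact_mod_cast hδ.ne'
  have e : (1 : ℂ) - (1 - δ) = δ := by ring
  -- Here (1-y)/x = -1/2 and x/(y-1) = 2, so R = 1/2 is fixed while S = 2δ is as small as desired.
  refine ⟨(-2 * δ, 1 - δ), ⟨mem_newRegion_iff.2 ⟨by simpa using hδ', by simpa using hδ', ?_⟩,
    ?_, ?_⟩, ?_⟩
  · have h1 : ‖(1 - (1 - (δ : ℂ))) / (-2 * δ)‖ = 1 / 2 := by
      rw [e, norm_div, norm_mul, mul_comm, div_mul_cancel_left₀ (norm_ne_zero_iff.2 hδ')]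
      norm_num
    have h2 : ‖-(-2 * (δ : ℂ))‖ = 2 * δ := by
      simp [Real.norm_of_nonneg hδ.le]
    simp only [h1, h2]
    refine ⟨by norm_num, by linarith, ?_, ?_⟩ <;> nlinarith
  · simp only [e]; exact Complex.ofReal_mem_slitPlane.2 hδ
  · have : (-2 * (δ : ℂ)) / (1 - δ - 1) = ((2 : ℝ) : ℂ) := by
      rw [show (1 : ℂ) - δ - 1 = -δ by ring]; field_simp; push_cast; rfl
    simp only [this]
    exact Complex.ofReal_mem_slitPlane.2 (by norm_num)
  · rw [Prod.dist_eq, max_lt_iff, dist_eq_norm, dist_eq_norm]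
    constructor
    · simpa [abs_of_pos hδ] using hδε
    · simp only [e, Complex.norm_real, Real.norm_of_nonneg hδ.le]; linarith

lemma disjoint_newRegion (hg : Generic a b c) :
    Disjoint newRegion (firstContinuationRegion a b c) :=
  disjoint_left.2 fun _ h1 h2 =>
    (one_lt_norm_of_mem_newRegion h1).not_gt (norm_lt_one_of_mem_secondRegion hg h2.2)

end

/-! ### The theorem -/

theorem mainTheorem5 (a b c : ℂ)
    (ha : ∀ k : ℕ, a ≠ -(k : ℂ)) (hb : ∀ k : ℤ, b ≠ (k : ℂ)) (hc : ∀ k : ℕ, c ≠ -(k : ℂ))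
    (hca : ∀ k : ℤ, c - a ≠ (k : ℂ)) (hcb : ∀ k : ℕ, c - b ≠ -(k : ℂ))
    (habc : ∀ k : ℤ, a + b - c ≠ (k : ℂ)) (habc₁ : ∀ k : ℤ, a + 2 * b - c ≠ (k : ℂ))
    (habc₂ : ∀ k : ℤ, a + 2 * b - 2 * c ≠ (k : ℂ)) :
    -- summation of the second series over `m`
    (∀ p ∈ secondRegion a b c,
      HasSum (fun n : ℕ => (1 - p.2) ^ (c - a - b) * secondConst a b c *
          ((1 - p.2) ^ n * poch (c - a) n * poch (c - b) n /
            (n.factorial * poch (c - a - b + 1) n) * inner4F3 a b c n (p.1 / (1 - p.2))))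
        (secondSeries a b c p)) ∧
    -- continuation of each `₄F₃` to infinity, with one term only
    (∀ n : ℕ, ∃ g : ℂ → ℂ, AnalyticOnNhd ℂ g cutPlane ∧
      (∀ z : ℂ, ‖z‖ < 1 → g z = inner4F3 a b c n z) ∧
      (∀ z ∈ cutPlane, 1 < ‖z‖ → g z = inner4F3AtInfinity a b c n z)) ∧
    -- continuation of the second series
    (∃ (W : Set (ℂ × ℂ)) (G : ℂ × ℂ → ℂ),
      IsOpen W ∧ IsConnected W ∧ AnalyticOnNhd ℂ G W ∧ ContainsTubes W ∧
      secondRegion a b c ⊆ W ∧ EqOn G (secondSeries a b c) (secondRegion a b c) ∧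
      newRegionCut ⊆ W ∧ EqOn G (newSeries a b c) newRegionCut) ∧
    -- the region of convergence of the new representation
    regionOfConvergence (newTerm a b c) ∩ {p | p.1 ≠ 0 ∧ p.2 ≠ 1} = newRegion ∧
    newRegion ⊆ regionOfConvergence (firstTerm a b c) ∧
    -- the new representation of `H₅`, with principal powers
    (∃ (U : Set (ℂ × ℂ)) (F : ℂ × ℂ → ℂ),
      IsOpen U ∧ IsConnected U ∧ AnalyticOnNhd ℂ F U ∧ ContainsTubes U ∧
      (0, 0) ∈ regionOfConvergence (hornH5Term a b c) ∧
      regionOfConvergence (hornH5Term a b c) ⊆ U ∧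
      EqOn F (hornH5 a b c) (regionOfConvergence (hornH5Term a b c)) ∧
      firstContinuationRegion a b c ⊆ U ∧
      EqOn F (fun p => firstSeries a b c p + secondSeries a b c p)
        (firstContinuationRegion a b c) ∧
      newRegionCut ⊆ U ∧
      EqOn F (fun p => firstSeries a b c p + newSeries a b c p) newRegionCut) ∧
    -- the same on the whole region, for every determination of the two powers
    (∀ p ∈ newRegion, ∀ l₁ l₂ : ℂ × ℂ → ℂ, AnalyticAt ℂ l₁ p → AnalyticAt ℂ l₂ p →
      (∀ᶠ q in 𝓝 p, Complex.exp (l₁ q) = 1 - q.2 ∧ Complex.exp (l₂ q) = q.1 / (q.2 - 1)) →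
      ContinuesTo (0, 0) p (hornH5 a b c)
        (fun q => firstSeries a b c q + newSeriesBranch a b c l₁ l₂ q)) ∧
    -- the new region covers points arbitrarily close to `(0, 1)` that were not covered before
    ((0, 1) : ℂ × ℂ) ∈ closure newRegionCut ∧
    Disjoint newRegion (firstContinuationRegion a b c) := by
  have hg : Generic a b c := ⟨ha, hc, hcb, hb, hca, habc, habc₁, habc₂⟩
  exact ⟨fun p hp => hasSum_secondSeries hg hp, exists_continuation_inner4F3 hg,
    exists_continuation_secondSeries hg, region_new_eq hg, newRegion_subset_region_first hg,
    exists_continuation_hornH5 hg, fun p hp l₁ l₂ => continuesTo_newSeriesBranch hg hp,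
    mem_closure_newRegionCut, disjoint_newRegion hg⟩
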